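/- **Setting.** Let $\Sigma$ be a real-analytic two-dimensional manifold (Hausdorff, second countable, without boundary). Let $\mathcal E=(\epsilon_\sigma,\epsilon_k,\epsilon_{\sigma'},\epsilon_\phi,\epsilon_p,\epsilon_{\phi'})$ be positive constants, and let $\mathcal A=(\tilde\sigma^{ab},\tilde\phi,\tilde\lambda,\tilde v,\tilde w)$ be analytic data on $\Sigma$: the inverse $\tilde\sigma^{ab}$ of an analytic Riemannian metric $\tilde\sigma_{ab}$, and four analytic real functions. Assume that $$\tilde v(x)>\epsilon_k>\max\{\epsilon_\sigma,\epsilon_{\sigma'},\epsilon_p\}\ \text{ for all } x\in\Sigma,\qquad \epsilon_p>\max\{\epsilon_\phi,\epsilon_{\phi'}\}.$$ The unknowns are time-dependent tensor fields $U=(\delta\sigma^{ab},\delta\phi,\delta k_a^b,\delta p,\delta\sigma^{ab}_{[c]},\delta\phi_{[c]})$ on $\Sigma$. Write $$\sigma^{ab}=\tilde\sigma^{ab}+e^{-\epsilon_\sigma t}\delta\sigma^{ab},\quad \sigma^{ab}_{[c]}=e^{-\epsilon_{\sigma'}t}\delta\sigma^{ab}_{[c]},\quad \lambda=\tilde\lambda-\tilde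 v t,\quad \phi_{[c]}=\partial_c\tilde\phi-t\,\partial_c\tilde w+e^{-\epsilon_{\phi'}t}\delta\phi_{[c]},$$ and let $\sigma_{ab}$ be the inverse of $\sigma^{ab}$. It is required that $\sigma^{ab}$ be symmetric and positive definite, that $\delta\sigma^{ab}_{[c]}$ be symmetric in $a,b$, and that $\sigma^{am}\delta k_m^b$ be symmetric in $a,b$. Let $\tilde\nabla$ be the Levi-Civita derivative of $\tilde\sigma_{ab}$, with Christoffel symbols $\tilde\Gamma$. Let $\Gamma^c_{ab}(\sigma)$ and $R(\sigma)$ be the Christoffel symbols and the scalar curvature of $\sigma_{ab}$, computed relative to $\tilde\sigma_{ab}$ and with $\tilde\nabla_c\sigma^{ab}$ replaced by $\sigma^{ab}_{[c]}$ and $\tilde\nabla_d\tilde\nabla_c\sigma^{ab}$ by $\tilde\nabla_d\sigma^{ab}_{[c]}$. That is, with $$D_a\sigma_{bd}=-\sigma_{bm}\sigma_{dn}\sigma^{mn}_{[a]},\qquad C^c_{ab}=\tfrac12\sigma^{cd}(D_a\sigma_{bd}+D_b\sigma_{ad}-D_d\sigma_{ab}),$$ put $\Gamma^c_{ab}(\sigma)=\tilde\Gamma^c_{ab}+C^c_{ab}$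 and $$R(\sigma)=\sigma^{ab}\big(\tilde R_{ab}+\tilde\nabla_cC^c_{ab}-\tilde\nabla_bC^c_{ac}+C^c_{cd}C^d_{ab}-C^c_{bd}C^d_{ac}\big),$$ where $\tilde R_{ab}$ is the Ricci curvature of $\tilde\sigma_{ab}$ and the derivatives of $C$ are expanded by the product rule with the same replacements. Put also $$\Gamma^c_{ab}(\gamma)=\Gamma^c_{ab}(\sigma)+\tfrac12(\delta^c_b\partial_a\lambda+\delta^c_a\partial_b\lambda-\sigma^{cd}\sigma_{ab}\partial_d\lambda),\qquad \Delta_\sigma\lambda=\sigma^{ab}(\partial_a\partial_b\lambda-\Gamma^d_{ab}(\sigma)\partial_d\lambda).$$ The system for $U$ is $$\partial_t\delta\sigma^{ab}-\epsilon_\sigma\delta\sigma^{ab}=2e^{(\epsilon_\sigma-\epsilon_k)t}\sigma^{am}\delta k_m^b,$$ $$\partial_t\delta\sigma^{ab}_{[c]}-\epsilon_{\sigma'}\delta\sigma^{ab}_{[c]}=2e^{(\epsilon_{\sigma'}-\epsilon_k)t}\,\tilde\nabla_c(\sigma^{bm}\delta k_m^a),$$ $$\partial_t\delta k_a^b-\epsilon_k\delta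 k_a^b-\tfrac12\tilde v\,\delta_a^b\,\delta k_m^m=e^{-\epsilon_kt}\delta k_m^m\,\delta k_a^b+e^{(\epsilon_k-\tilde v)t}F_a^b,$$ $$\partial_t\delta p-\epsilon_p\delta p=-e^{(\epsilon_p-\epsilon_k)t}\tilde w\,\delta k_m^m+e^{-\epsilon_kt}\delta p\,\delta k_m^m+e^{(\epsilon_p-\tilde v)t}F,$$ $$\partial_t\delta\phi-\epsilon_\phi\delta\phi=e^{(\epsilon_\phi-\epsilon_p)t}\delta p,\qquad \partial_t\delta\phi_{[c]}-\epsilon_{\phi'}\delta\phi_{[c]}=e^{(\epsilon_{\phi'}-\epsilon_p)t}\partial_c\delta p,$$ where $$F_a^b=e^{\tilde\lambda}\Big[\tfrac12\delta_a^b\big(R(\sigma)-\Delta_\sigma\lambda\big)-\sigma^{bm}\big(\partial_m\lambda\,\partial_a\lambda+\partial_m\partial_a\lambda-\Gamma^d_{am}(\gamma)\partial_d\lambda\big)-2\sigma^{bm}\phi_{[m]}\phi_{[a]}\Big],$$ $$F=e^{\tilde\lambda}\sigma^{ab}\big(\partial_a\phi_{[b]}-\Gamma^c_{ab}(\sigma)\phi_{[c]}+\phi_{[b]}\partial_a\lambda\big).$$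 For a continuous $T:\Sigma\to\mathbb R$, an analytic solution for $t>T$ is a $U$ satisfying these requirements and equations on $\{(t,x):t>T(x)\}$ whose components in every chart of the given analytic atlas are real-analytic functions of $(t,x)$ there. Say that $U(t)$ is *bounded for large $t$* (respectively *tends to $0$*) *in the analytic sense* if around every point of every such chart there is a complex polydisc, independent of $t$, to which the components of $U(t)$ extend holomorphically in the space variables for all large $t$, with a bound independent of $t$ (respectively with the extensions tending to $0$ uniformly on the polydisc as $t\to\infty$). **Proposition 1.** There are a continuous $T:\Sigma\to\mathbb R$, which is constant if $\Sigma$ is compact, and an analytic solution $U$ for $t>T$ which is bounded for large $t$ in the analytic sense. It is unique: if $T'$ is continuous and $U'$ is any analytic solution for $t>T'$ which is bounded for large $t$ in the analytic sense, then $U'(t,x)=U(t,x)$ whenever $t>T(x)$ and $t>T'(x)$. Moreover $U(t)\to0$ as $t\to\infty$ in the analytic sense; in particular $U$ and all its spatial derivatives tend to $0$ locally uniformly. -/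

import Mathlib

open scoped Manifold ContDiff

noncomputable section

namespace AVTD

/-- The model space of the surface. Latin indices take values in `Fin 2`. -/
abbrev Plane := EuclideanSpace ℝ (Fin 2)

/-! ### Local differential geometry in the coordinate domain -/

/-- The partial derivative `∂_a f` at `y`. -/
def pd (a : Fin 2) (f : Plane → ℝ) (y : Plane) : ℝ :=
  fderiv ℝ f y (EuclideanSpace.single a 1)

/-- Christoffel symbols `Γ^c_{ab}` of the metric with components `g_{ab}`. -/
def christoffel (g : Plane → Matrix (Fin 2) (Fin 2) ℝ) (c a b : Fin 2) (y : Plane) : ℝ :=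
  ∑ d, (1 / 2) * (g y)⁻¹ c d *
    (pd a (fun z => g z b d) y + pd b (fun z => g z a d) y - pd d (fun z => g z a b) y)

/-- Ricci curvature `R_{ab}` of the metric with components `g_{ab}`. -/
def ricci (g : Plane → Matrix (Fin 2) (Fin 2) ℝ) (a b : Fin 2) (y : Plane) : ℝ :=
  ∑ c, pd c (christoffel g c a b) y - ∑ c, pd b (christoffel g c a c) y
    + ∑ c, ∑ d, christoffel g c c d y * christoffel g d a b y
    - ∑ c, ∑ d, christoffel g c b d y * christoffel g d a c y

/-- The Levi-Civita derivative `∇_c S^{ab}` with respect to `g`. -/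
def covUp (g : Plane → Matrix (Fin 2) (Fin 2) ℝ) (S : Plane → Fin 2 → Fin 2 → ℝ)
    (c a b : Fin 2) (y : Plane) : ℝ :=
  pd c (fun z => S z a b) y + ∑ d, christoffel g a c d y * S y d b
    + ∑ d, christoffel g b c d y * S y a d

/-- The Levi-Civita derivative `∇_d P_c^{ab}` with respect to `g`; the components `P_c^{ab}` are
written `P y c a b`. -/
def covMixed (g : Plane → Matrix (Fin 2) (Fin 2) ℝ) (P : Plane → Fin 2 → Fin 2 → Fin 2 → ℝ)
    (d c a b : Fin 2) (y : Plane) : ℝ :=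
  pd d (fun z => P z c a b) y - ∑ m, christoffel g m d c y * P y m a b
    + ∑ m, christoffel g a d m y * P y c m b + ∑ m, christoffel g b d m y * P y c a m

/-! ### Geometry of `σ` relative to a background metric, in first-order variables

`S` stands for the inverse metric `σ^{ab}`, `P c a b` for the variable `σ^{ab}_{[c]}` (in place of
the background derivative of `σ^{ab}`), and `Q d c a b` for the background derivative of
`σ^{ab}_{[c]}` in the direction `d`. Indices of `σ` are lowered with the matrix inverse of `S`. -/

/-- The background derivative of `σ_{bd}` in the direction `a`, expressed through `P`. -/
def dLow (S : Matrix (Fin 2) (Fin 2) ℝ) (P : Fin 2 → Fin 2 → Fin 2 → ℝ) (a b d : Fin 2) : ℝ :=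
  -∑ m, ∑ n, S⁻¹ b m * S⁻¹ d n * P a m n

/-- The second background derivative (outer direction `g`, inner direction `a`) of `σ_{bd}`,
expressed through `P` and `Q`. -/
def ddLow (S : Matrix (Fin 2) (Fin 2) ℝ) (P : Fin 2 → Fin 2 → Fin 2 → ℝ)
    (Q : Fin 2 → Fin 2 → Fin 2 → Fin 2 → ℝ) (g a b d : Fin 2) : ℝ :=
  -∑ m, ∑ n, (dLow S P g b m * S⁻¹ d n * P a m n + S⁻¹ b m * dLow S P g d n * P a m n
    + S⁻¹ b m * S⁻¹ d n * Q g a m n)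

/-- The difference tensor `C^c_{ab}`: the Christoffel symbols of `σ` minus those of the background,
expressed through `P`. -/
def diffC (S : Matrix (Fin 2) (Fin 2) ℝ) (P : Fin 2 → Fin 2 → Fin 2 → ℝ) (c a b : Fin 2) : ℝ :=
  ∑ d, (1 / 2) * S c d * (dLow S P a b d + dLow S P b a d - dLow S P d a b)

/-- The background derivative of `C^c_{ab}` in the direction `g`, expressed through `P`, `Q`. -/
def dDiffC (S : Matrix (Fin 2) (Fin 2) ℝ) (P : Fin 2 → Fin 2 → Fin 2 → ℝ)
    (Q : Fin 2 → Fin 2 → Fin 2 → Fin 2 → ℝ) (g c a b : Fin 2) : ℝ :=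
  ∑ d, ((1 / 2) * P g c d * (dLow S P a b d + dLow S P b a d - dLow S P d a b)
    + (1 / 2) * S c d * (ddLow S P Q g a b d + ddLow S P Q g b a d - ddLow S P Q g d a b))

/-- The scalar curvature `R(σ)`; `Rb` is the Ricci curvature of the background. -/
def scalarCurv (Rb : Fin 2 → Fin 2 → ℝ) (S : Matrix (Fin 2) (Fin 2) ℝ)
    (P : Fin 2 → Fin 2 → Fin 2 → ℝ) (Q : Fin 2 → Fin 2 → Fin 2 → Fin 2 → ℝ) : ℝ :=
  ∑ a, ∑ b, S a b * (Rb a b + ∑ c, dDiffC S P Q c c a b - ∑ c, dDiffC S P Q b c a c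
    + ∑ c, ∑ d, diffC S P c c d * diffC S P d a b
    - ∑ c, ∑ d, diffC S P c b d * diffC S P d a c)

/-! ### Exponents, asymptotic data and remainder fields -/

/-- The exponents `ε_σ, ε_k, ε_{σ'}, ε_φ, ε_p, ε_{φ'}`. -/
structure Exponents where
  sig : ℝ
  k : ℝ
  sigc : ℝ
  phi : ℝ
  p : ℝ
  phic : ℝ

/-- All the exponents are positive. -/
def Exponents.Positive (ε : Exponents) : Prop :=
  0 < ε.sig ∧ 0 < ε.k ∧ 0 < ε.sigc ∧ 0 < ε.phi ∧ 0 < ε.p ∧ 0 < ε.phic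

section Surface

variable (M : Type*) [TopologicalSpace M] [ChartedSpace Plane M] [IsManifold 𝓘(ℝ, Plane) ω M]

/-- Analytic asymptotic data on the surface `M`: a Riemannian metric (`σ̃_{ab}`, with inverse
`σ̃^{ab}`) and four functions `φ̃, λ̃, ṽ, w̃`, all of them analytic. -/
structure AsymptoticData where
  metric : Bundle.ContMDiffRiemannianMetric 𝓘(ℝ, Plane) ω Plane
    (fun x : M => TangentSpace 𝓘(ℝ, Plane) x)
  phi : M → ℝ
  lam : M → ℝ
  v : M → ℝ
  w : M → ℝ
  phi_analytic : ContMDiff 𝓘(ℝ, Plane) 𝓘(ℝ, ℝ) ω phi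
  lam_analytic : ContMDiff 𝓘(ℝ, Plane) 𝓘(ℝ, ℝ) ω lam
  v_analytic : ContMDiff 𝓘(ℝ, Plane) 𝓘(ℝ, ℝ) ω v
  w_analytic : ContMDiff 𝓘(ℝ, Plane) 𝓘(ℝ, ℝ) ω w

variable {M}

/-- The tangent space at `x`. -/
abbrev Tan (x : M) : Type := TangentSpace 𝓘(ℝ, Plane) x

/-- Contravariant tensors of rank two at `x`, as bilinear forms on the cotangent space. -/
abbrev Contra2 (x : M) : Type :=
  Module.Dual ℝ (Tan x) →ₗ[ℝ] Module.Dual ℝ (Tan x) →ₗ[ℝ] ℝ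

variable (M) in
/-- The time-dependent remainder fields
`U = (δσ^{ab}, δφ, δk_a^b, δp, δσ^{ab}_{[c]}, δφ_{[c]})` on `M`. The field `δk_a^b` is an
endomorphism of each tangent space, `δσ^{ab}_{[c]}` is linear in a tangent vector (index `c`). -/
structure Fields where
  sig : ℝ → (x : M) → Contra2 x
  phi : ℝ → M → ℝ
  k : ℝ → (x : M) → (Tan x →ₗ[ℝ] Tan x)
  p : ℝ → M → ℝ
  sigc : ℝ → (x : M) → (Tan x →ₗ[ℝ] Contra2 x)
  phic : ℝ → (x : M) → Module.Dual ℝ (Tan x)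

/-- Labels of the components of `U` in a coordinate basis. -/
inductive Idx
  /-- `δσ^{ab}` -/
  | sig (a b : Fin 2)
  /-- `δφ` -/
  | phi
  /-- `δk_a^b` -/
  | k (a b : Fin 2)
  /-- `δp` -/
  | p
  /-- `δσ^{ab}_{[c]}` -/
  | sigc (c a b : Fin 2)
  /-- `δφ_{[c]}` -/
  | phic (c : Fin 2)

/-- The coordinate vector `∂_a` of the chart `e`, at the point with coordinates `y`. -/
def frame (e : OpenPartialHomeomorph M Plane) (y : Plane) (a : Fin 2) : Tan (e.symm y) :=
  mfderiv 𝓘(ℝ, Plane) 𝓘(ℝ, Plane) e.symm y (EuclideanSpace.single a (1 : ℝ) : Plane)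

/-- The coordinate covector `dx^a` of the chart `e`, at the point with coordinates `y`. -/
def coframe (e : OpenPartialHomeomorph M Plane) (y : Plane) (a : Fin 2) :
    Module.Dual ℝ (Tan (e.symm y)) :=
  (EuclideanSpace.proj a : Plane →L[ℝ] ℝ).toLinearMap ∘ₗ
    (mfderiv 𝓘(ℝ, Plane) 𝓘(ℝ, Plane) e (e.symm y)).toLinearMap

/-- The components of `U` at time `t` in the chart `e`, at the point with coordinates `y`. -/
def Fields.comp (U : Fields M) (e : OpenPartialHomeomorph M Plane) (t : ℝ) (y : Plane) :
    Idx → ℝ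
  | .sig a b => U.sig t (e.symm y) (coframe e y a) (coframe e y b)
  | .phi => U.phi t (e.symm y)
  | .k a b => coframe e y b (U.k t (e.symm y) (frame e y a))
  | .p => U.p t (e.symm y)
  | .sigc c a b => U.sigc t (e.symm y) (frame e y c) (coframe e y a) (coframe e y b)
  | .phic c => U.phic t (e.symm y) (frame e y c)

/-- `∂_t` of a component of `U`, at fixed position. -/
def Fields.dt (U : Fields M) (e : OpenPartialHomeomorph M Plane) (t : ℝ) (y : Plane)
    (i : Idx) : ℝ :=
  deriv (fun s => U.comp e s y i) t

/-- `∂_c` of a component of `U`, at fixed time. -/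
def Fields.dx (U : Fields M) (e : OpenPartialHomeomorph M Plane) (t : ℝ) (y : Plane)
    (c : Fin 2) (i : Idx) : ℝ :=
  pd c (fun z => U.comp e t z i) y

/-- The trace `δk^m_m`. -/
def Fields.trk (U : Fields M) (e : OpenPartialHomeomorph M Plane) (t : ℝ) (y : Plane) : ℝ :=
  ∑ m, U.comp e t y (.k m m)

section Background

variable (A : AsymptoticData M) (e : OpenPartialHomeomorph M Plane)

/-- The components `σ̃_{ab}`. -/
def AsymptoticData.sigLow (y : Plane) : Matrix (Fin 2) (Fin 2) ℝ :=
  Matrix.of fun a b => A.metric.inner (e.symm y) (frame e y a) (frame e y b)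

/-- The components `σ̃^{ab}`. -/
def AsymptoticData.sigUp (y : Plane) : Matrix (Fin 2) (Fin 2) ℝ := (A.sigLow e y)⁻¹

/-- The gauge choice `λ = λ̃ - ṽ t`, in coordinates. -/
def AsymptoticData.lamAt (t : ℝ) (y : Plane) : ℝ := A.lam (e.symm y) - A.v (e.symm y) * t

/-- `φ̃ - w̃ t`, in coordinates. -/
def AsymptoticData.phiAt (t : ℝ) (y : Plane) : ℝ := A.phi (e.symm y) - A.w (e.symm y) * t

end Background

section Expansions

variable (A : AsymptoticData M) (ε : Exponents) (U : Fields M)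
  (e : OpenPartialHomeomorph M Plane) (t : ℝ)

/-- `σ^{ab} = σ̃^{ab} + e^{-ε_σ t} δσ^{ab}`. -/
def sigma (y : Plane) : Matrix (Fin 2) (Fin 2) ℝ :=
  Matrix.of fun a b => A.sigUp e y a b + Real.exp (-ε.sig * t) * U.comp e t y (.sig a b)

/-- `σ^{ab}_{[c]} = e^{-ε_{σ'} t} δσ^{ab}_{[c]}`. -/
def sigmaC (y : Plane) (c a b : Fin 2) : ℝ :=
  Real.exp (-ε.sigc * t) * U.comp e t y (.sigc c a b)

/-- The derivative `∇̃_d σ^{ab}_{[c]}`. -/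
def dSigmaC (y : Plane) (d c a b : Fin 2) : ℝ :=
  covMixed (A.sigLow e) (sigmaC ε U e t) d c a b y

/-- `φ_{[c]} = ∂_c φ̃ - t ∂_c w̃ + e^{-ε_{φ'} t} δφ_{[c]}`. -/
def phiC (c : Fin 2) (y : Plane) : ℝ :=
  pd c (A.phiAt e t) y + Real.exp (-ε.phic * t) * U.comp e t y (.phic c)

/-- The product `σ^{am} δk_m^b`. -/
def sigK (y : Plane) (a b : Fin 2) : ℝ :=
  ∑ m, sigma A ε U e t y a m * U.comp e t y (.k m b)

/-- The Christoffel symbols `Γ^c_{ab}(σ)`. -/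
def gammaSigma (y : Plane) (c a b : Fin 2) : ℝ :=
  christoffel (A.sigLow e) c a b y + diffC (sigma A ε U e t y) (sigmaC ε U e t y) c a b

/-- The Christoffel symbols of `γ = e^λ σ`:
`Γ^c_{ab}(σ) + ½ (δ^c_b ∂_a λ + δ^c_a ∂_b λ - σ^{cd} σ_{ab} ∂_d λ)`. -/
def gammaGamma (y : Plane) (c a b : Fin 2) : ℝ :=
  gammaSigma A ε U e t y c a b
    + (1 / 2) * ((1 : Matrix (Fin 2) (Fin 2) ℝ) c b * pd a (A.lamAt e t) y
      + (1 : Matrix (Fin 2) (Fin 2) ℝ) c a * pd b (A.lamAt e t) y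
      - ∑ d, sigma A ε U e t y c d * (sigma A ε U e t y)⁻¹ a b * pd d (A.lamAt e t) y)

/-- The scalar curvature `R(σ)`. -/
def curvSigma (y : Plane) : ℝ :=
  scalarCurv (fun a b => ricci (A.sigLow e) a b y) (sigma A ε U e t y) (sigmaC ε U e t y)
    (dSigmaC A ε U e t y)

/-- The Laplacian `Δ_σ λ = σ^{ab} (∂_a ∂_b λ - Γ^d_{ab}(σ) ∂_d λ)`. -/
def laplaceLam (y : Plane) : ℝ :=
  ∑ a, ∑ b, sigma A ε U e t y a b * (pd a (pd b (A.lamAt e t)) y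
    - ∑ d, gammaSigma A ε U e t y d a b * pd d (A.lamAt e t) y)

/-- `N R_a^b = ½ δ_a^b (R(σ) - Δ_σ λ)`, with the curvature of `γ` on the left. -/
def ricciTerm (y : Plane) (a b : Fin 2) : ℝ :=
  (1 / 2) * (1 : Matrix (Fin 2) (Fin 2) ℝ) a b * (curvSigma A ε U e t y - laplaceLam A ε U e t y)

/-- `∇^b ∂_a N = σ^{bm} (∂_m λ ∂_a λ + ∂_m ∂_a λ - Γ^d_{am}(γ) ∂_d λ)` for `N = e^λ`. -/
def hessTerm (y : Plane) (a b : Fin 2) : ℝ :=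
  ∑ m, sigma A ε U e t y b m * (pd m (A.lamAt e t) y * pd a (A.lamAt e t) y
    + pd m (pd a (A.lamAt e t)) y - ∑ d, gammaGamma A ε U e t y d a m * pd d (A.lamAt e t) y)

/-- `2 N γ^{bm} φ_{[m]} φ_{[a]} = 2 σ^{bm} φ_{[m]} φ_{[a]}`. -/
def phiTerm (y : Plane) (a b : Fin 2) : ℝ :=
  2 * ∑ m, sigma A ε U e t y b m * phiC A ε U e t m y * phiC A ε U e t a y

/-- The source `F_a^b` of the equation for `δk_a^b`. -/
def sourceK (y : Plane) (a b : Fin 2) : ℝ :=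
  Real.exp (A.lam (e.symm y)) *
    (ricciTerm A ε U e t y a b - hessTerm A ε U e t y a b - phiTerm A ε U e t y a b)

/-- The source `F` of the equation for `δp`:
`e^{λ̃} (σ^{ab} (∂_a φ_{[b]} - Γ^c_{ab}(σ) φ_{[c]}) + σ^{ab} φ_{[b]} ∂_a λ)`. -/
def sourceP (y : Plane) : ℝ :=
  Real.exp (A.lam (e.symm y)) * ∑ a, ∑ b, sigma A ε U e t y a b *
    (pd a (phiC A ε U e t b) y - ∑ c, gammaSigma A ε U e t y c a b * phiC A ε U e t c y
      + phiC A ε U e t b y * pd a (A.lamAt e t) y)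

/-- The first-order system for the remainder fields, in the chart `e`, at time `t` and at the point
with coordinates `y`. -/
structure SystemAt (y : Plane) : Prop where
  sig : ∀ a b, U.dt e t y (.sig a b) - ε.sig * U.comp e t y (.sig a b)
    = 2 * Real.exp ((ε.sig - ε.k) * t) * sigK A ε U e t y a b
  sigc : ∀ c a b, U.dt e t y (.sigc c a b) - ε.sigc * U.comp e t y (.sigc c a b)
    = 2 * Real.exp ((ε.sigc - ε.k) * t) * covUp (A.sigLow e) (sigK A ε U e t) c b a y
  k : ∀ a b, U.dt e t y (.k a b) - ε.k * U.comp e t y (.k a b)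
      - (1 / 2) * A.v (e.symm y) * (1 : Matrix (Fin 2) (Fin 2) ℝ) a b * U.trk e t y
    = Real.exp (-ε.k * t) * U.trk e t y * U.comp e t y (.k a b)
      + Real.exp ((ε.k - A.v (e.symm y)) * t) * sourceK A ε U e t y a b
  p : U.dt e t y .p - ε.p * U.comp e t y .p
    = -Real.exp ((ε.p - ε.k) * t) * A.w (e.symm y) * U.trk e t y
      + Real.exp (-ε.k * t) * U.comp e t y .p * U.trk e t y
      + Real.exp ((ε.p - A.v (e.symm y)) * t) * sourceP A ε U e t y
  phi : U.dt e t y .phi - ε.phi * U.comp e t y .phi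
    = Real.exp ((ε.phi - ε.p) * t) * U.comp e t y .p
  phic : ∀ c, U.dt e t y (.phic c) - ε.phic * U.comp e t y (.phic c)
    = Real.exp ((ε.phic - ε.p) * t) * U.dx e t y c .p

/-- The fields have the type required by their meaning: `σ^{ab}` is an inverse Riemannian metric
(symmetric and positive definite), `σ^{ab}_{[c]}` is symmetric in `a, b`, and `k^{ab}` is
symmetric; as `σ^{am} k_m^b` differs from a positive multiple of `σ^{am} δk_m^b` by a multiple of
`σ^{ab}`, the last condition says that `σ^{am} δk_m^b` is symmetric. -/
structure AdmissibleAt (y : Plane) : Prop where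
  posDef : (sigma A ε U e t y).PosDef
  symm_sigc : ∀ c a b, U.comp e t y (.sigc c a b) = U.comp e t y (.sigc c b a)
  symm_k : ∀ a b, sigK A ε U e t y a b = sigK A ε U e t y b a

end Expansions

/-- `U` is an analytic solution (jointly in time and space) of the system on the region
`{(t, x) : t > T x}`. -/
structure IsSolution (A : AsymptoticData M) (ε : Exponents) (T : M → ℝ) (U : Fields M) :
    Prop where
  analytic : ∀ e ∈ atlas Plane M, ∀ i : Idx,
    AnalyticOnNhd ℝ (fun q : ℝ × Plane => U.comp e q.1 q.2 i)
      {q | q.2 ∈ e.target ∧ T (e.symm q.2) < q.1}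
  admissible : ∀ e ∈ atlas Plane M, ∀ y ∈ e.target, ∀ t, T (e.symm y) < t →
    AdmissibleAt A ε U e t y
  system : ∀ e ∈ atlas Plane M, ∀ y ∈ e.target, ∀ t, T (e.symm y) < t → SystemAt A ε U e t y

/-- The inclusion of real coordinates into complex coordinates. -/
def toC (y : Plane) : Fin 2 → ℂ := fun a => (y a : ℂ)

/-- `V` is a holomorphic extension in the space variables of the components of `U` in the chart
`e`, at all times `t > t₀`, to the complex polydisc of radius `r` about `y₀`. -/
def IsHolExtension (U : Fields M) (e : OpenPartialHomeomorph M Plane) (y₀ : Plane) (r t₀ : ℝ)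
    (V : ℝ → (Fin 2 → ℂ) → Idx → ℂ) : Prop :=
  ∀ t, t₀ < t → ∀ i,
    DifferentiableOn ℂ (fun z => V t z i) (Metric.ball (toC y₀) r) ∧
    ∀ y ∈ e.target, toC y ∈ Metric.ball (toC y₀) r → V t (toC y) i = (U.comp e t y i : ℂ)

/-- `U(t)` is bounded for large `t` in the sense of analytic functions: near every point its
components extend, for all large `t`, to a common complex neighborhood, with a common bound. -/
def BoundedAnalytic (U : Fields M) : Prop :=
  ∀ e ∈ atlas Plane M, ∀ y₀ ∈ e.target, ∃ (r t₀ C : ℝ) (V : ℝ → (Fin 2 → ℂ) → Idx → ℂ),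
    0 < r ∧ IsHolExtension U e y₀ r t₀ V ∧
    ∀ t, t₀ < t → ∀ i, ∀ z ∈ Metric.ball (toC y₀) r, ‖V t z i‖ ≤ C

/-- `U(t) → 0` as `t → ∞` in the sense of analytic functions: near every point its components
extend, for all large `t`, to a common complex neighborhood, on which they tend to zero uniformly.
In particular they and all their spatial derivatives tend to zero locally uniformly. -/
def TendsToZero (U : Fields M) : Prop :=
  ∀ e ∈ atlas Plane M, ∀ y₀ ∈ e.target, ∃ (r t₀ : ℝ) (V : ℝ → (Fin 2 → ℂ) → Idx → ℂ),
    0 < r ∧ IsHolExtension U e y₀ r t₀ V ∧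
    ∀ i, TendstoUniformlyOn (fun t z => V t z i) (fun _ => 0) Filter.atTop
      (Metric.ball (toC y₀) r)

/-- The fields `U` and `U'` coincide at time `t` and at the point `x`. -/
def Fields.AgreeAt (U U' : Fields M) (t : ℝ) (x : M) : Prop :=
  U.sig t x = U'.sig t x ∧ U.phi t x = U'.phi t x ∧ U.k t x = U'.k t x ∧ U.p t x = U'.p t x ∧
    U.sigc t x = U'.sigc t x ∧ U.phic t x = U'.phic t x

end Surface

end AVTD

end

/-!
The system is of Fuchsian type at `t = ∞`, and its bounded solutions are the fixed points of an
integral operator.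

*Fuchsian form.* In a chart the symmetry conditions leave the components `reduce U` independent,
with `δk` given by its trace, the difference of its diagonal entries and `δk_0^1`; the entry
`δk_1^0` is a rational function `kDep` of these, and its equation follows from the others
(`kDep_equation`). In these variables the system reads `∂_t u_i = μ_i u_i + f_i(t, z, u, ∂_z u)`,
where `μ_i` is one of the positive constants `ε_•`, or `ε_k + ṽ` for the trace. The inequalities
between the exponents make every term of `f` decay exponentially: the factors
`e^{(ε_• - ε_k) t}`, `e^{(ε_• - ε_p) t}` and `e^{(ε_• - ṽ) t}` absorb the polynomial growth of
`∂λ` and `∂φ` in `t`. Since `f` is affine in `∂_z u`, after extending the background to complex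
`z` one has `|f| ≤ L e^{-δ Re t} (1 + |∂_z u|)` (`exists_isFuchsian`).

*Existence.* A solution of `u(t) = -∫₀^∞ e^{-μ s} f(t + s, z, u, ∂_z u) ds` solves the equation. To
compensate the loss of a derivative, `u(τ)` is considered on a ball about `z₀` whose radius `R - c
e^{-δ τ}` grows with `τ`, and `∂_z u` may grow like `gap^{-1/2}` at its boundary, `gap` being the
distance to it. A Cauchy estimate bounds the derivative of the integrand by a multiple of `e^{-δ τ}
gap^{-3/2}` at the time `τ = t + s`, whose integral is at most a multiple of `gap^{-1/2} / (c δ)` at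
time `t` (`norm_integral_le_of_gap`). Hence the operator is a contraction for large `c`
(`IsFuchsian.exists_fixedPoint`); for large `t` the balls have positive radius. The fixed point is
holomorphic in `t` and `z`, tends to zero, and is real at real points.

*Uniqueness.* As `Re μ > 0`, a bounded solution satisfies the integral equation
(`eq_integral_of_hasDerivAt`), and the same estimate for the difference of two solutions shows
that they agree for large `t` (`IsFuchsian.eq_of_isBoundedSolution`), hence by analyticity in `t`
for all `t` (`IsSolOn.comp_eq`). A solution which is bounded in the analytic sense solves the
equation at real points only; `IsFuchsian.isBoundedSolution_of_real` transfers the integrated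
equation to complex points, by the identity theorem on complex lines.

*Globalization.* The equations and constraints are tensorial (`SystemAt.transit`,
`AdmissibleAt.transit`), so a solution found in one chart near a point is one in every chart
(`IsLocalSol`). By uniqueness local solutions agree where they overlap. They are glued for `t > T`,
where the continuous function `T` is at each point above the starting time of some local solution
near that point (`exists_startingTime`, a partition of unity argument).
-/

set_option linter.unusedSectionVars false

namespace AVTD

open Filter Topology Metric Set MeasureTheory

/-! ### Holomorphic functions of several complex variables -/

section SeveralVariables

universe u

variable {E F : Type u} [NormedAddCommGroup E] [NormedSpace ℂ E] [NormedAddCommGroup F]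
  [NormedSpace ℂ F]

theorem norm_fderiv_le_of_bounded_ball {f : E → F} {c : E} {r B : ℝ} (hr : 0 < r)
    (hd : DifferentiableOn ℂ f (ball c r)) (hB : ∀ x ∈ ball c r, ‖f x‖ ≤ B) :
    ‖fderiv ℂ f c‖ ≤ 2 * B / r := by
  refine Complex.norm_fderiv_le_div_of_mapsTo_ball hd (fun x hx => ?_) hr
  rw [mem_closedBall, dist_eq_norm]
  have h1 := hB x hx
  have h2 := hB c (mem_ball_self hr)
  linarith [norm_sub_le (f x) (f c)]

theorem differentiableAt_of_tendstoUniformlyOn [CompleteSpace F] {f : ℕ → E → F} {g : E → F}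
    {x : E} {r : ℝ} (hr : 0 < r) (hf : ∀ n, DifferentiableOn ℂ (f n) (ball x r))
    (hfg : TendstoUniformlyOn f g atTop (ball x r)) :
    DifferentiableAt ℂ g x ∧
      Tendsto (fun n => fderiv ℂ (f n) x) atTop (𝓝 (fderiv ℂ g x)) := by
  have hsub : ∀ y ∈ ball x (r / 2), ball y (r / 2) ⊆ ball x r := fun y hy =>
    ball_subset_ball' (by rw [mem_ball] at hy; linarith)
  have hC : UniformCauchySeqOn (fun n => fderiv ℂ (f n)) atTop (ball x (r / 2)) := by
    rw [Metric.uniformCauchySeqOn_iff]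
    intro ε hε
    obtain ⟨N, hN⟩ := (Metric.uniformCauchySeqOn_iff.1 hfg.uniformCauchySeqOn) (ε * r / 8)
      (by positivity)
    refine ⟨N, fun m hm n hn y hy => ?_⟩
    have hdm := (hf m).mono (hsub y hy)
    have hdn := (hf n).mono (hsub y hy)
    have hy2 : ball y (r / 2) ∈ 𝓝 y := ball_mem_nhds _ (by positivity)
    have h1 := norm_fderiv_le_of_bounded_ball (f := f m - f n) (B := ε * r / 8)
      (by positivity : 0 < r / 2) (hdm.sub hdn) (fun z hz => by
        have := (hN m hm n hn z (hsub y hy hz)).le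
        rwa [dist_eq_norm] at this)
    rw [dist_eq_norm, ← fderiv_sub (hdm.differentiableAt hy2) (hdn.differentiableAt hy2)]
    refine h1.trans_lt ?_
    have : 2 * (ε * r / 8) / (r / 2) = ε / 2 := by field_simp; norm_num
    rw [this]; linarith
  have hx : x ∈ ball x (r / 2) := mem_ball_self (by positivity)
  have hlim : ∀ y ∈ ball x (r / 2), ∃ L, Tendsto (fun n => fderiv ℂ (f n) y) atTop (𝓝 L) :=
    fun y hy => cauchySeq_tendsto_of_complete (hC.cauchySeq hy)
  choose! g' hg' using hlim
  have hU := hC.tendstoUniformlyOn_of_tendsto hg'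
  have hder := hasFDerivAt_of_tendstoUniformlyOn (x := x) isOpen_ball hU
    (fun n y hy => ((hf n).differentiableAt
      (Filter.mem_of_superset (ball_mem_nhds y (by positivity : 0 < r / 2))
        (hsub y hy))).hasFDerivAt)
    (fun y hy => hfg.tendsto_at (ball_subset_ball (by linarith) hy)) hx
  exact ⟨hder.differentiableAt, by rw [hder.fderiv]; exact hg' x hx⟩

theorem exists_bounded_ball {E F : Type*} [NormedAddCommGroup E] [NormedAddCommGroup F]
    {f : E → F} {Ω : Set E} (hΩ : IsOpen Ω) (hd : ContinuousOn f Ω)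
    {x : E} (hx : x ∈ Ω) : ∃ r > 0, ball x r ⊆ Ω ∧ ∃ B, ∀ y ∈ ball x r, ‖f y‖ ≤ B := by
  have h1 : ∀ᶠ y in 𝓝 x, ‖f y‖ < ‖f x‖ + 1 :=
    (hd.continuousAt (hΩ.mem_nhds hx)).norm.eventually_lt continuousAt_const (by linarith)
  obtain ⟨r, hr, hr'⟩ := Metric.mem_nhds_iff.1 (Filter.inter_mem (hΩ.mem_nhds hx) h1)
  exact ⟨r, hr, fun y hy => (hr' hy).1, ‖f x‖ + 1, fun y hy => (hr' hy).2.le⟩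

variable [FiniteDimensional ℂ E]

theorem clm_eq_sum_coord {𝕜 V W : Type*} [NontriviallyNormedField 𝕜] [CompleteSpace 𝕜]
    [NormedAddCommGroup V] [NormedSpace 𝕜 V] [FiniteDimensional 𝕜 V] [NormedAddCommGroup W]
    [NormedSpace 𝕜 W] (L : V →L[𝕜] W) :
    L = ∑ i, ContinuousLinearMap.smulRightL 𝕜 V W
      (LinearMap.toContinuousLinearMap ((Module.finBasis 𝕜 V).coord i))
      (L (Module.finBasis 𝕜 V i)) := by
  ext v
  have h := congrArg L ((Module.finBasis 𝕜 V).sum_repr v).symm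
  rw [map_sum] at h
  simpa [map_smul] using h

/-- A parameter integral of holomorphic functions, locally dominated, is holomorphic. -/
theorem differentiableOn_integral_of_dominated [CompleteSpace F] {α : Type*}
    [MeasurableSpace α] {μ : Measure α} {h : α → E → F} {Ω : Set E} (hΩ : IsOpen Ω)
    (hd : ∀ᵐ s ∂μ, DifferentiableOn ℂ (h s) Ω)
    (hm : ∀ x ∈ Ω, AEStronglyMeasurable (fun s => h s x) μ)
    (hb : ∀ x ∈ Ω, ∃ r > 0, ∃ g : α → ℝ, Integrable g μ ∧
      ∀ᵐ s ∂μ, ∀ y ∈ ball x r, ‖h s y‖ ≤ g s) :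
    DifferentiableOn ℂ (fun x => ∫ s, h s x ∂μ) Ω := by
  intro x hx
  obtain ⟨r₀, hr₀, g, hg, hgb⟩ := hb x hx
  obtain ⟨r₁, hr₁, hr₁Ω⟩ := Metric.isOpen_iff.1 hΩ x hx
  set r := min r₀ r₁ with hr
  have hrpos : 0 < r := lt_min hr₀ hr₁
  have hrΩ : ball x r ⊆ Ω := (ball_subset_ball (min_le_right _ _)).trans hr₁Ω
  have hsub : ∀ y ∈ ball x (r / 2), ball y (r / 2) ⊆ ball x r := fun y hy =>
    ball_subset_ball' (by rw [mem_ball] at hy; linarith)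
  have hx2 : x ∈ ball x (r / 2) := mem_ball_self (by positivity)
  refine (hasFDerivAt_integral_of_dominated_of_fderiv_le (𝕜 := ℂ) (μ := μ)
    (F := fun x s => h s x) (F' := fun x s => fderiv ℂ (h s) x) (x₀ := x)
    (bound := fun s => 2 * g s / (r / 2)) (s := ball x (r / 2))
    (ball_mem_nhds _ (by positivity)) ?_ ?_ ?_ ?_ ?_ ?_).differentiableAt.differentiableWithinAt
  · filter_upwards [hΩ.mem_nhds hx] with y hy using hm y hy
  · refine hg.mono' (hm x hx) ?_
    filter_upwards [hgb] with s hs using hs x (mem_ball_self hr₀)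
  · have : (fun s => fderiv ℂ (h s) x) = fun s => ∑ i, ContinuousLinearMap.smulRightL ℂ E F
        (LinearMap.toContinuousLinearMap ((Module.finBasis ℂ E).coord i))
        (fderiv ℂ (h s) x (Module.finBasis ℂ E i)) := by
      ext1 s; exact clm_eq_sum_coord _
    rw [this]
    refine Finset.aestronglyMeasurable_fun_sum _ fun i _ => ?_
    refine (ContinuousLinearMap.continuous _).comp_aestronglyMeasurable ?_
    set v := Module.finBasis ℂ E i
    have hlim : Tendsto (fun n : ℕ => ((n : ℂ) + 1)⁻¹) atTop (𝓝[≠] 0) := by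
      rw [tendsto_nhdsWithin_iff]
      constructor
      · have := (tendsto_inv_atTop_nhds_zero_nat (𝕜 := ℂ)).comp (tendsto_add_atTop_nat 1)
        refine this.congr fun n => by simp
      · exact Eventually.of_forall fun n => by
          have : (n : ℂ) + 1 ≠ 0 := by exact_mod_cast Nat.succ_ne_zero n
          simpa using this
    have hev : ∀ᶠ n : ℕ in atTop, x + ((n : ℂ) + 1)⁻¹ • v ∈ Ω := by
      have hc : Tendsto (fun n : ℕ => x + ((n : ℂ) + 1)⁻¹ • v) atTop (𝓝 (x + (0 : ℂ) • v)) :=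
        ((hlim.mono_right nhdsWithin_le_nhds).smul_const v).const_add x
      rw [zero_smul, add_zero] at hc
      exact hc.eventually (hΩ.mem_nhds hx)
    obtain ⟨N, hN⟩ := hev.exists_forall_of_atTop
    refine aestronglyMeasurable_of_tendsto_ae atTop
      (f := fun n s => ((((n + N : ℕ) : ℂ) + 1)⁻¹)⁻¹ •
        (h s (x + (((n + N : ℕ) : ℂ) + 1)⁻¹ • v) - h s x)) (fun n => ?_) ?_
    · exact ((hm _ (hN _ (by lia))).sub (hm x hx)).const_smul _
    · filter_upwards [hd] with s hs
      have h1 := ((hs.differentiableAt (hΩ.mem_nhds hx)).hasFDerivAt).hasLineDerivAt v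
      have h2 := h1.tendsto_slope_zero
      exact (h2.comp hlim).comp (tendsto_add_atTop_nat N)
  · filter_upwards [hd, hgb] with s hs hs2 y hy
    exact norm_fderiv_le_of_bounded_ball (by positivity) (hs.mono ((hsub y hy).trans hrΩ))
      (fun z hz => hs2 z (ball_subset_ball (min_le_left _ _) (hsub y hy hz)))
  · exact (hg.const_mul 2).div_const _
  · filter_upwards [hd] with s hs y hy
    exact (hs.differentiableAt (hΩ.mem_nhds (hrΩ (hsub y hy
      (mem_ball_self (by positivity)))))).hasFDerivAt

/-- By the Cauchy formula on complex lines, directional derivatives are parameter integrals. -/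
theorem differentiableOn_fderiv_apply [CompleteSpace F] {f : E → F} {Ω : Set E}
    (hΩ : IsOpen Ω) (hd : DifferentiableOn ℂ f Ω) (v : E) :
    DifferentiableOn ℂ (fun x => fderiv ℂ f x v) Ω := by
  intro x hx
  obtain ⟨r, hr, hrΩ, B, hB⟩ := exists_bounded_ball hΩ hd.continuousOn hx
  obtain ⟨ρ, hρ, hρv⟩ := exists_pos_mul_lt (half_pos hr) (2 * ‖v‖)
  have hin : ∀ y ∈ ball x (r / 2), ∀ l ∈ ball (0 : ℂ) (2 * ρ), y + l • v ∈ ball x r := by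
    intro y hy l hl
    rw [mem_ball, dist_eq_norm] at *
    rw [sub_zero] at hl
    calc ‖y + l • v - x‖ = ‖(y - x) + l • v‖ := by congr 1; abel
      _ ≤ ‖y - x‖ + ‖l‖ * ‖v‖ := (norm_add_le _ _).trans_eq (by rw [norm_smul])
      _ < r := by nlinarith [norm_nonneg v]
  have hcirc : ∀ θ, circleMap 0 ρ θ ∈ ball (0 : ℂ) (2 * ρ) := fun θ => by
    rw [mem_ball_zero_iff, norm_circleMap_zero, abs_of_pos hρ]; linarith
  have hdr := hd.mono hrΩ
  set G : ℝ → E → F := fun θ y => deriv (circleMap 0 ρ) θ •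
    ((circleMap 0 ρ θ - 0) ^ 2)⁻¹ • f (y + circleMap 0 ρ θ • v)
  have hG : DifferentiableOn ℂ (fun y => ∫ θ in Ioc 0 (2 * Real.pi), G θ y) (ball x (r / 2)) := by
    refine differentiableOn_integral_of_dominated isOpen_ball (Eventually.of_forall fun θ => ?_)
      (fun y hy => ?_) fun y hy => ?_
    · exact ((hdr.comp (by fun_prop) fun y hy => hin y hy _ (hcirc θ)).const_smul _).const_smul _
    · refine Continuous.aestronglyMeasurable ?_
      have h1 : Continuous fun θ => f (y + circleMap 0 ρ θ • v) :=
        hdr.continuousOn.comp_continuous (by fun_prop) fun θ => hin y hy _ (hcirc θ)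
      simp only [G, deriv_circleMap]
      refine Continuous.smul (by fun_prop) (Continuous.smul ?_ h1)
      exact Continuous.inv₀ (by fun_prop) fun θ => by simp [hρ.ne']
    · obtain ⟨s, hs, hsub⟩ := Metric.isOpen_iff.1 isOpen_ball y hy
      refine ⟨s, hs, fun _ => ρ * ((ρ ^ 2)⁻¹ * B), integrable_const _,
        Eventually.of_forall fun θ z hz => ?_⟩
      have h1 := hB _ (hin z (hsub hz) _ (hcirc θ))
      simp only [G, deriv_circleMap, norm_smul, norm_mul, norm_inv, norm_pow, sub_zero,
        norm_circleMap_zero, abs_of_pos hρ, Complex.norm_I, mul_one]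
      gcongr
  have hx2 : x ∈ ball x (r / 2) := mem_ball_self (half_pos hr)
  refine (((hG.differentiableAt (isOpen_ball.mem_nhds hx2)).const_smul
    (2 * Real.pi * Complex.I : ℂ)⁻¹).congr_of_eventuallyEq ?_).differentiableWithinAt
  filter_upwards [isOpen_ball.mem_nhds hx2] with y hy
  have h1 := Complex.two_pi_I_inv_smul_circleIntegral_sub_sq_inv_smul_of_differentiable
    (f := fun l : ℂ => f (y + l • v)) isOpen_ball (closedBall_subset_ball (by linarith))
    (hdr.comp (by fun_prop) (hin y hy)) (mem_ball_self hρ)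
  have h0 : HasDerivAt (fun l : ℂ => y + l • v) v 0 := by
    simpa using ((hasDerivAt_id (0 : ℂ)).smul_const v).const_add y
  have h2 : HasFDerivAt f (fderiv ℂ f y) (y + (0 : ℂ) • v) := by
    rw [zero_smul, add_zero]
    exact (hdr.differentiableAt (isOpen_ball.mem_nhds
      (ball_subset_ball (half_le_self hr.le) hy))).hasFDerivAt
  have h3 : HasDerivAt (fun l : ℂ => f (y + l • v)) (fderiv ℂ f y v) 0 := h2.comp_hasDerivAt 0 h0
  rw [h3.deriv, circleIntegral, intervalIntegral.integral_of_le Real.two_pi_pos.le] at h1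
  exact h1.symm

theorem differentiableOn_fderiv [CompleteSpace F] {f : E → F} {Ω : Set E}
    (hΩ : IsOpen Ω) (hd : DifferentiableOn ℂ f Ω) : DifferentiableOn ℂ (fderiv ℂ f) Ω := by
  have : fderiv ℂ f = fun x => ∑ i, ContinuousLinearMap.smulRightL ℂ E F
      (LinearMap.toContinuousLinearMap ((Module.finBasis ℂ E).coord i))
      (fderiv ℂ f x (Module.finBasis ℂ E i)) := by
    ext1 x; exact clm_eq_sum_coord _
  rw [this]
  refine DifferentiableOn.fun_sum fun i _ => ?_
  exact (ContinuousLinearMap.differentiable _).comp_differentiableOn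
    (differentiableOn_fderiv_apply hΩ hd _)

theorem contDiffOn_of_differentiableOn {Ω : Set E} (hΩ : IsOpen Ω) (n : ℕ) :
    ∀ {F : Type u} [NormedAddCommGroup F] [NormedSpace ℂ F] [CompleteSpace F] {f : E → F},
    DifferentiableOn ℂ f Ω → ContDiffOn ℂ n f Ω := by
  induction n with
  | zero => intro F _ _ _ f hd; simpa using hd.continuousOn
  | succ n ih =>
    intro F _ _ _ f hd
    have : ((n + 1 : ℕ) : WithTop ℕ∞) = (n : WithTop ℕ∞) + 1 := by push_cast; rfl
    rw [this, contDiffOn_succ_iff_fderiv_of_isOpen hΩ]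
    exact ⟨hd, by simp, ih (differentiableOn_fderiv hΩ hd)⟩

theorem norm_iteratedFDeriv_le [CompleteSpace F] {f : E → F} {c : E} {r B : ℝ} (hr : 0 < r)
    (hd : DifferentiableOn ℂ f (ball c r)) (hB : ∀ x ∈ ball c r, ‖f x‖ ≤ B) (n : ℕ) :
    ‖iteratedFDeriv ℂ n f c‖ ≤ B * (2 * n / r) ^ n := by
  rcases Nat.eq_zero_or_pos n with rfl | hn
  · simpa using hB c (mem_ball_self hr)
  have hn' : (0 : ℝ) < n := by exact_mod_cast hn
  have key : ∀ k : ℕ, ∀ x ∈ ball c (r - k * (r / n)),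
      ‖iteratedFDeriv ℂ k f x‖ ≤ B * (2 * n / r) ^ k := by
    intro k
    induction k with
    | zero => intro x hx; simpa using hB x (by simpa using hx)
    | succ k ih =>
      intro x hx
      have hrn : 0 < r / n := by positivity
      have hsub : ball x (r / n) ⊆ ball c (r - k * (r / n)) := by
        refine ball_subset_ball' ?_
        rw [mem_ball] at hx
        push_cast at hx; nlinarith
      have hsub2 : ball c (r - k * (r / n)) ⊆ ball c r :=
        ball_subset_ball (by have : 0 ≤ k * (r / n) := by positivity
                             linarith)
      have hdk : DifferentiableOn ℂ (iteratedFDeriv ℂ k f) (ball x (r / n)) := by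
        intro y hy
        have := (contDiffOn_of_differentiableOn isOpen_ball (k + 1) hd).contDiffAt
          (isOpen_ball.mem_nhds (hsub2 (hsub hy)))
        exact (this.differentiableAt_iteratedFDeriv
          (by exact_mod_cast Nat.lt_succ_self k)).differentiableWithinAt
      have := norm_fderiv_le_of_bounded_ball hrn hdk (fun y hy => ih y (hsub hy))
      rw [norm_fderiv_iteratedFDeriv] at this
      refine this.trans (le_of_eq ?_)
      rw [pow_succ]; field_simp
  have := key (n - 1)
  have h0 : (c : E) ∈ ball c (r - (n - 1 : ℕ) * (r / n)) := by
    rw [mem_ball, dist_self, Nat.cast_sub hn]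
    have : r = n * (r / n) := by field_simp
    push_cast
    have : 0 < r / n := by positivity
    nlinarith
  obtain ⟨m, rfl⟩ : ∃ m, n = m + 1 := ⟨n - 1, by lia⟩
  simp only [Nat.add_sub_cancel] at this h0
  have hdk : DifferentiableOn ℂ (iteratedFDeriv ℂ m f) (ball c (r / (m + 1 : ℕ))) := by
    intro y hy
    have hy2 : y ∈ ball c r := ball_subset_ball (by
      rw [div_le_iff₀ hn']; push_cast; nlinarith [(Nat.cast_nonneg m : (0 : ℝ) ≤ m)]) hy
    have := (contDiffOn_of_differentiableOn isOpen_ball (m + 1) hd).contDiffAt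
      (isOpen_ball.mem_nhds hy2)
    exact (this.differentiableAt_iteratedFDeriv
      (by exact_mod_cast Nat.lt_succ_self m)).differentiableWithinAt
  have hfin := norm_fderiv_le_of_bounded_ball (by positivity) hdk (fun y hy => key m y (by
    convert hy using 2
    push_cast; field_simp; ring))
  rw [norm_fderiv_iteratedFDeriv] at hfin
  refine hfin.trans (le_of_eq ?_)
  rw [pow_succ]; field_simp

theorem iteratedDeriv_line_eq [CompleteSpace F] {f : E → F} {c v : E} {r ρ : ℝ}
    (hd : DifferentiableOn ℂ f (ball c r)) (hv : ρ * ‖v‖ ≤ r) (hv0 : v ≠ 0) (n : ℕ) :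
    ∀ z ∈ ball (0 : ℂ) ρ, iteratedDeriv n (fun s : ℂ => f (c + s • v)) z =
      iteratedFDeriv ℂ n f (c + z • v) (fun _ => v) := by
  have hmem : ∀ z ∈ ball (0 : ℂ) ρ, c + z • v ∈ ball c r := by
    intro z hz
    rw [mem_ball, dist_zero_right] at hz
    rw [mem_ball, dist_eq_norm, add_sub_cancel_left, norm_smul]
    exact lt_of_lt_of_le (by have := norm_pos_iff.2 hv0; gcongr) hv
  induction n with
  | zero => intro z hz; simp
  | succ n ih =>
    intro z hz
    rw [iteratedDeriv_succ]
    have he : iteratedDeriv n (fun s : ℂ => f (c + s • v)) =ᶠ[𝓝 z]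
        fun z => iteratedFDeriv ℂ n f (c + z • v) (fun _ => v) := by
      filter_upwards [isOpen_ball.mem_nhds hz] with w hw using ih w hw
    rw [he.deriv_eq]
    have h1 : DifferentiableAt ℂ (iteratedFDeriv ℂ n f) (c + z • v) :=
      ((contDiffOn_of_differentiableOn isOpen_ball (n + 1) hd).contDiffAt
        (isOpen_ball.mem_nhds (hmem z hz))).differentiableAt_iteratedFDeriv
          (by exact_mod_cast Nat.lt_succ_self n)
    have h2 : HasDerivAt (fun s : ℂ => c + s • v) v z := by
      simpa using ((hasDerivAt_id z).smul_const v).const_add c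
    have h3 := h1.hasFDerivAt.comp_hasDerivAt z h2
    have h4 := ((ContinuousMultilinearMap.apply ℂ (fun _ : Fin n => E) F
      (fun _ => v)).hasFDerivAt).comp_hasDerivAt z h3
    rw [iteratedFDeriv_succ_apply_left]
    exact h4.deriv

/-- Holomorphic functions on an open subset of a finite-dimensional complex space are analytic:
along each line the Taylor series converges, and iterating the Cauchy estimate for the first
derivative on shrinking balls bounds the homogeneous terms. -/
theorem analyticOnNhd_of_differentiableOn [CompleteSpace F] {f : E → F} {Ω : Set E}
    (hΩ : IsOpen Ω) (hd : DifferentiableOn ℂ f Ω) : AnalyticOnNhd ℂ f Ω := by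
  intro x hx
  obtain ⟨r, hr, hrΩ, B, hB⟩ := exists_bounded_ball hΩ hd.continuousOn hx
  have hB0 : 0 ≤ B := (norm_nonneg _).trans (hB x (mem_ball_self hr))
  have hdr := hd.mono hrΩ
  set p : FormalMultilinearSeries ℂ E F := fun n => (n.factorial : ℂ)⁻¹ • iteratedFDeriv ℂ n f x
  set ρ : NNReal := ⟨r / (2 * Real.exp 1), by positivity⟩
  have hρ : (ρ : ℝ) = r / (2 * Real.exp 1) := rfl
  have hρr : (ρ : ℝ) < r := by
    rw [hρ, div_lt_iff₀ (by positivity)]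
    nlinarith [Real.add_one_le_exp (1 : ℝ)]
  refine ⟨p, ρ, ⟨?_, ?_, ?_⟩⟩
  · refine p.le_radius_of_bound B fun n => ?_
    have h1 := norm_iteratedFDeriv_le hr hdr hB n
    have h2 := Real.pow_div_factorial_le_exp (n : ℝ) (Nat.cast_nonneg n) n
    have h3 : Real.exp n = Real.exp 1 ^ n := by rw [← Real.exp_nat_mul]; simp
    have hf : (0 : ℝ) < n.factorial := by exact_mod_cast n.factorial_pos
    simp only [p]
    rw [norm_smul, norm_inv, Complex.norm_natCast, hρ]
    calc (n.factorial : ℝ)⁻¹ * ‖iteratedFDeriv ℂ n f x‖ * (r / (2 * Real.exp 1)) ^ n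
        ≤ (n.factorial : ℝ)⁻¹ * (B * (2 * n / r) ^ n) * (r / (2 * Real.exp 1)) ^ n := by gcongr
      _ = B * ((n : ℝ) ^ n / n.factorial) / Real.exp 1 ^ n := by
        simp only [div_pow, mul_pow]; field_simp
      _ ≤ B * Real.exp n / Real.exp 1 ^ n := by gcongr
      _ = B := by rw [h3]; field_simp
  · have : (0 : NNReal) < ρ := by
      rw [← NNReal.coe_pos, hρ]; positivity
    exact_mod_cast this
  · intro y hy
    have hy' : ‖y‖ < ρ := by
      have : edist y 0 < ρ := hy
      rw [edist_zero_right] at this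
      exact_mod_cast this
    by_cases hy0 : y = 0
    · subst hy0
      have h0 := (hasFPowerSeriesOnBall_const (𝕜 := ℂ) (E := E) (c := f x) (e := x)).hasSum
        (y := 0) (by simp)
      simp only [add_zero] at h0 ⊢
      convert hasSum_single (f := fun n => (p n) fun _ => (0 : E)) 0 ?_ using 1
      · simp [p]
      · intro n hn
        exact (p n).map_coord_zero (i := ⟨0, Nat.pos_of_ne_zero hn⟩) rfl
    · have hy1 : 0 < ‖y‖ := norm_pos_iff.2 hy0
      have hmem : ∀ z ∈ ball (0 : ℂ) (r / ‖y‖), x + z • y ∈ ball x r := by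
        intro z hz
        rw [mem_ball, dist_zero_right, lt_div_iff₀ hy1] at hz
        rwa [mem_ball, dist_eq_norm, add_sub_cancel_left, norm_smul]
      have hg : DifferentiableOn ℂ (fun s : ℂ => f (x + s • y)) (ball 0 (r / ‖y‖)) :=
        hdr.comp ((differentiable_id.smul_const y).const_add x).differentiableOn hmem
      have h1 : (1 : ℂ) ∈ ball (0 : ℂ) (r / ‖y‖) := by
        rw [mem_ball, dist_zero_right, norm_one, one_lt_div hy1]; linarith
      have h2 := Complex.hasSum_taylorSeries_on_ball hg h1
      simp only [sub_zero, one_pow, one_smul] at h2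
      convert h2 using 1
      ext n
      rw [iteratedDeriv_line_eq (ρ := r / ‖y‖) hdr (by rw [div_mul_cancel₀ _ hy1.ne']) hy0 n 0
        (mem_ball_self (by positivity))]
      simp [p]

end SeveralVariables

/-! ### Cauchy estimates on balls that grow with time -/

section GapIntegrals

variable {A c δ τ : ℝ}

theorem hasDerivAt_gap (s : ℝ) :
    HasDerivAt (fun s => A - c * Real.exp (-δ * (τ + s))) (c * δ * Real.exp (-δ * (τ + s))) s := by
  have h1 : HasDerivAt (fun s : ℝ => -δ * (τ + s)) (-δ) s := by
    simpa using ((hasDerivAt_id s).const_add τ).const_mul (-δ)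
  exact ((h1.exp.const_mul c).const_sub A).congr_deriv (by ring)

theorem gap_le_gap_add (hc : 0 < c) (hδ : 0 < δ) {s : ℝ}
    (hs : 0 ≤ s) : A - c * Real.exp (-δ * τ) ≤ A - c * Real.exp (-δ * (τ + s)) := by
  have : Real.exp (-δ * (τ + s)) ≤ Real.exp (-δ * τ) := Real.exp_le_exp.2 (by nlinarith)
  nlinarith

theorem tendsto_gap (hδ : 0 < δ) :
    Tendsto (fun s => A - c * Real.exp (-δ * (τ + s))) atTop (𝓝 A) := by
  have h1 : Tendsto (fun s : ℝ => -δ * (τ + s)) atTop atBot :=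
    (tendsto_atTop_add_const_left atTop τ tendsto_id).const_mul_atTop_of_neg (by linarith)
  simpa using ((Real.tendsto_exp_atBot.comp h1).const_mul c).const_sub A

theorem integral_exp_div_sqrt_gap (hc : 0 < c) (hδ : 0 < δ)
    (h0 : 0 < A - c * Real.exp (-δ * τ)) (hA : A ≤ 1) :
    IntegrableOn (fun s => Real.exp (-δ * (τ + s)) / √(A - c * Real.exp (-δ * (τ + s)))) (Ioi 0) ∧
    ∫ s in Ioi 0, Real.exp (-δ * (τ + s)) / √(A - c * Real.exp (-δ * (τ + s))) ≤ 2 / (c * δ) := by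
  have hder : ∀ s ∈ Ici (0 : ℝ), HasDerivAt
      (fun s => 2 / (c * δ) * √(A - c * Real.exp (-δ * (τ + s))))
      (Real.exp (-δ * (τ + s)) / √(A - c * Real.exp (-δ * (τ + s)))) s := by
    intro s hs
    have hp : 0 < A - c * Real.exp (-δ * (τ + s)) := h0.trans_le (gap_le_gap_add hc hδ hs)
    refine (((hasDerivAt_gap s).sqrt hp.ne').const_mul (2 / (c * δ))).congr_deriv ?_
    field_simp
  have hlim : Tendsto (fun s => 2 / (c * δ) * √(A - c * Real.exp (-δ * (τ + s)))) atTop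
      (𝓝 (2 / (c * δ) * √A)) :=
    ((Real.continuous_sqrt.tendsto A).comp (tendsto_gap hδ)).const_mul _
  have hcont := (hder 0 self_mem_Ici).continuousAt.continuousWithinAt (s := Ici 0)
  have hpos : ∀ s ∈ Ioi (0 : ℝ),
      0 ≤ Real.exp (-δ * (τ + s)) / √(A - c * Real.exp (-δ * (τ + s))) :=
    fun s _ => by positivity
  refine ⟨integrableOn_Ioi_deriv_of_nonneg hcont (fun s hs => hder s (mem_Ici.2 (le_of_lt hs))) hpos hlim, ?_⟩
  rw [integral_Ioi_of_hasDerivAt_of_nonneg hcont (fun s hs => hder s (mem_Ici.2 (le_of_lt hs))) hpos hlim]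
  have h1 : √A ≤ 1 := Real.sqrt_le_one.2 hA
  have h2 : 0 ≤ 2 / (c * δ) := by positivity
  have h3 : 0 ≤ 2 / (c * δ) * √(A - c * Real.exp (-δ * (τ + 0))) := by positivity
  nlinarith

theorem integral_exp_div_sqrt_gap_cube (hc : 0 < c) (hδ : 0 < δ)
    (h0 : 0 < A - c * Real.exp (-δ * τ)) :
    IntegrableOn (fun s => Real.exp (-δ * (τ + s)) / √(A - c * Real.exp (-δ * (τ + s))) ^ 3)
      (Ioi 0) ∧
    ∫ s in Ioi 0, Real.exp (-δ * (τ + s)) / √(A - c * Real.exp (-δ * (τ + s))) ^ 3 ≤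
      2 / (c * δ) / √(A - c * Real.exp (-δ * τ)) := by
  have hder : ∀ s ∈ Ici (0 : ℝ), HasDerivAt
      (fun s => -(2 / (c * δ)) * (√(A - c * Real.exp (-δ * (τ + s))))⁻¹)
      (Real.exp (-δ * (τ + s)) / √(A - c * Real.exp (-δ * (τ + s))) ^ 3) s := by
    intro s hs
    have hp : 0 < A - c * Real.exp (-δ * (τ + s)) := h0.trans_le (gap_le_gap_add hc hδ hs)
    have hsq : 0 < √(A - c * Real.exp (-δ * (τ + s))) := Real.sqrt_pos.2 hp
    refine ((((hasDerivAt_gap s).sqrt hp.ne').inv hsq.ne').const_mul (-(2 / (c * δ)))).congr_deriv ?_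
    field_simp
  have hA : 0 < A := by have := Real.exp_pos (-δ * τ); nlinarith
  have hlim : Tendsto (fun s => -(2 / (c * δ)) * (√(A - c * Real.exp (-δ * (τ + s))))⁻¹) atTop
      (𝓝 (-(2 / (c * δ)) * (√A)⁻¹)) :=
    (((Real.continuous_sqrt.tendsto A).comp (tendsto_gap hδ)).inv₀
      (Real.sqrt_pos.2 hA).ne').const_mul _
  have hcont := (hder 0 self_mem_Ici).continuousAt.continuousWithinAt (s := Ici 0)
  have hpos : ∀ s ∈ Ioi (0 : ℝ),
      0 ≤ Real.exp (-δ * (τ + s)) / √(A - c * Real.exp (-δ * (τ + s))) ^ 3 :=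
    fun s _ => by positivity
  refine ⟨integrableOn_Ioi_deriv_of_nonneg hcont (fun s hs => hder s (mem_Ici.2 (le_of_lt hs))) hpos hlim, ?_⟩
  rw [integral_Ioi_of_hasDerivAt_of_nonneg hcont (fun s hs => hder s (mem_Ici.2 (le_of_lt hs))) hpos hlim]
  have h3 : 0 ≤ 2 / (c * δ) * (√A)⁻¹ := by positivity
  simp only [add_zero]
  have e : 2 / (c * δ) / √(A - c * Real.exp (-δ * τ)) =
    2 / (c * δ) * (√(A - c * Real.exp (-δ * τ)))⁻¹ := by rw [div_eq_mul_inv]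
  rw [e]; linarith

end GapIntegrals

section IntegralEstimate

variable {Z X : Type} [NormedAddCommGroup Z]

/-- The distance of `z` to the boundary of the ball about `z₀` of radius `R - c e^{-δ τ}`, on which
the unknown at time `τ` is considered. The radius grows with `τ`, so that the derivative of the
unknown at the later times `τ + s`, over which one integrates, is controlled at time `τ`. -/
noncomputable def gap (R c δ : ℝ) (z₀ : Z) (τ : ℝ) (z : Z) : ℝ := R - c * Real.exp (-δ * τ) - ‖z - z₀‖

theorem gap_eq (R c δ : ℝ) (z₀ : Z) (τ : ℝ) (z : Z) :
    gap R c δ z₀ τ z = (R - ‖z - z₀‖) - c * Real.exp (-δ * τ) := by unfold gap; ring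

theorem gap_mono {R c δ : ℝ} (hc : 0 < c) (hδ : 0 < δ) (z₀ z : Z) {τ s : ℝ} (hs : 0 ≤ s) :
    gap R c δ z₀ τ z ≤ gap R c δ z₀ (τ + s) z := by
  have : Real.exp (-δ * (τ + s)) ≤ Real.exp (-δ * τ) := Real.exp_le_exp.2 (by nlinarith)
  unfold gap; nlinarith

theorem gap_sub_le {R c δ : ℝ} {z₀ : Z} {τ : ℝ} (z z' : Z) :
    gap R c δ z₀ τ z - ‖z' - z‖ ≤ gap R c δ z₀ τ z' := by
  have : ‖z' - z₀‖ ≤ ‖z' - z‖ + ‖z - z₀‖ := norm_sub_le_norm_sub_add_norm_sub _ _ _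
  unfold gap; linarith

theorem continuous_gap (R c δ : ℝ) (z₀ : Z) :
    Continuous (fun p : ℝ × Z => gap R c δ z₀ p.1 p.2) := by unfold gap; fun_prop

theorem gap_le_one {R c δ : ℝ} {z₀ : Z} (hc : 0 < c) (hR : R ≤ 1) (τ : ℝ) (z : Z) :
    gap R c δ z₀ τ z ≤ 1 := by
  have := Real.exp_pos (-δ * τ)
  unfold gap; nlinarith [norm_nonneg (z - z₀)]

theorem mem_ball_of_gap_pos {R c δ τ : ℝ} {z₀ : Z} (hc : 0 < c) {z : Z}
    (h : 0 < gap R c δ z₀ τ z) : z ∈ ball z₀ R := by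
  have := Real.exp_pos (-δ * τ)
  rw [mem_ball, dist_eq_norm]
  unfold gap at h; nlinarith

theorem isOpen_gap_pos (R c δ : ℝ) (z₀ : Z) (τ : ℝ) : IsOpen {z | 0 < gap R c δ z₀ τ z} :=
  isOpen_lt continuous_const ((continuous_gap R c δ z₀).comp (Continuous.prodMk_right τ))

variable [NormedSpace ℂ Z] [NormedAddCommGroup X] [NormedSpace ℂ X]

/-- Integrating from `τ` to `∞` a family of holomorphic functions of size
`e^{-δ (τ + s)} / √gap` gains a factor `1 / c`, both for the integral and, after the loss of
a full power of the gap through the Cauchy estimate, for `√gap` times its derivative. -/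
theorem norm_integral_le_of_gap {R c δ B τ : ℝ} {z₀ : Z} (hc : 0 < c) (hδ : 0 < δ) (hR : R ≤ 1)
    (hB : 0 ≤ B) {F : ℝ → Z → X}
    (hd : ∀ s, 0 < s → DifferentiableOn ℂ (F s) {z | 0 < gap R c δ z₀ (τ + s) z})
    (hm : ∀ z, 0 < gap R c δ z₀ τ z →
      AEStronglyMeasurable (fun s => F s z) (volume.restrict (Ioi 0)))
    (hb : ∀ s, 0 < s → ∀ z, 0 < gap R c δ z₀ (τ + s) z →
      ‖F s z‖ ≤ B * (Real.exp (-δ * (τ + s)) / √(gap R c δ z₀ (τ + s) z)))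
    {z : Z} (hz : 0 < gap R c δ z₀ τ z) :
    IntegrableOn (fun s => F s z) (Ioi 0) ∧ ‖∫ s in Ioi 0, F s z‖ ≤ 2 * B / (c * δ) ∧
    ‖fderiv ℂ (fun z => ∫ s in Ioi 0, F s z) z‖ ≤ 12 * B / (c * δ) / √(gap R c δ z₀ τ z) := by
  have hA : ∀ z : Z, R - ‖z - z₀‖ ≤ 1 := fun z => by linarith [norm_nonneg (z - z₀)]
  have hpos : ∀ z : Z, 0 < gap R c δ z₀ τ z → ∀ s, 0 ≤ s → 0 < gap R c δ z₀ (τ + s) z :=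
    fun z hz s hs => hz.trans_le (gap_mono hc hδ _ _ hs)
  have hint : ∀ z : Z, 0 < gap R c δ z₀ τ z → IntegrableOn (fun s => F s z) (Ioi 0) ∧
      ‖∫ s in Ioi 0, F s z‖ ≤ 2 * B / (c * δ) := by
    intro z hz
    have h0 := hz; rw [gap_eq] at h0
    obtain ⟨h1, h2⟩ := integral_exp_div_sqrt_gap hc hδ h0 (hA z)
    have hae : ∀ᵐ s ∂(volume.restrict (Ioi (0:ℝ))), ‖F s z‖ ≤
        B * (Real.exp (-δ * (τ + s)) / √(R - ‖z - z₀‖ - c * Real.exp (-δ * (τ + s)))) := by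
      filter_upwards [ae_restrict_mem measurableSet_Ioi] with s hs
      have := hb s hs z (hpos z hz s (le_of_lt hs))
      rwa [gap_eq] at this
    refine ⟨(h1.const_mul B).mono' (hm z hz) hae, ?_⟩
    refine (norm_integral_le_of_norm_le (h1.const_mul B) hae).trans ?_
    rw [integral_const_mul]
    calc _ ≤ B * (2 / (c * δ)) := by gcongr
      _ = _ := by ring
  refine ⟨(hint z hz).1, (hint z hz).2, ?_⟩
  refine norm_fderiv_le_of_lip' ℂ (by positivity) ?_
  have hnear : ∀ᶠ z' in 𝓝 z, ‖z' - z‖ < gap R c δ z₀ τ z / 2 := by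
    have : Tendsto (fun z' => ‖z' - z‖) (𝓝 z) (𝓝 0) := by
      have h := ((continuous_id.sub (continuous_const (y := z))).norm).tendsto z
      simpa using h
    exact this.eventually (gt_mem_nhds (by positivity))
  filter_upwards [hnear] with z' hz'
  have hz'pos : 0 < gap R c δ z₀ τ z' := by
    have := gap_sub_le (R := R) (c := c) (δ := δ) (z₀ := z₀) (τ := τ) z z'; linarith
  rw [← integral_sub (hint z' hz'pos).1 (hint z hz).1]
  have h0 := hz; rw [gap_eq] at h0
  obtain ⟨h1, h2⟩ := integral_exp_div_sqrt_gap_cube hc hδ h0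
  have hae : ∀ᵐ s ∂(volume.restrict (Ioi (0:ℝ))), ‖F s z' - F s z‖ ≤
      6 * B * ‖z' - z‖ *
        (Real.exp (-δ * (τ + s)) / √(R - ‖z - z₀‖ - c * Real.exp (-δ * (τ + s))) ^ 3) := by
    filter_upwards [ae_restrict_mem measurableSet_Ioi] with s hs
    have hs0 : 0 < s := hs
    rw [← gap_eq]
    set d := gap R c δ z₀ (τ + s) z with hd'
    have hdp : 0 < d := hpos z hz s hs0.le
    have hle : gap R c δ z₀ τ z ≤ d := gap_mono hc hδ _ _ hs0.le
    have hsub : ∀ y ∈ ball z (d / 2), d / 2 < gap R c δ z₀ (τ + s) y := by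
      intro y hy
      rw [mem_ball, dist_eq_norm] at hy
      have := gap_sub_le (R := R) (c := c) (δ := δ) (z₀ := z₀) (τ := τ + s) z y
      linarith
    have hdiff : DifferentiableOn ℂ (F s) (ball z (d / 2)) :=
      (hd s hs0).mono fun y hy => (half_pos hdp).trans (hsub y hy)
    have hbd : ∀ y ∈ ball z (d / 2), ‖F s y‖ ≤ B * (Real.exp (-δ * (τ + s)) / √(d / 2)) := by
      intro y hy
      have h3 := hsub y hy
      refine (hb s hs0 y (by linarith)).trans ?_
      gcongr
    have hmaps : MapsTo (F s) (ball z (d / 2))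
        (closedBall (F s z) (2 * (B * (Real.exp (-δ * (τ + s)) / √(d / 2))))) := by
      intro y hy
      rw [mem_closedBall, dist_eq_norm]
      linarith [norm_sub_le (F s y) (F s z), hbd y hy, hbd z (mem_ball_self (by positivity))]
    have hz'm : z' ∈ ball z (d / 2) := by
      rw [mem_ball, dist_eq_norm]; linarith
    have h4 := Complex.dist_le_div_mul_dist_of_mapsTo_ball hdiff hmaps hz'm
    rw [dist_eq_norm, dist_eq_norm] at h4
    refine h4.trans ?_
    have hsd : √d ^ 2 = d := Real.sq_sqrt hdp.le
    have hsdp : 0 < √d := Real.sqrt_pos.2 hdp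
    have h5 : √(d / 2) = √d / √2 := Real.sqrt_div hdp.le 2
    have h6 : √2 ≤ 3 / 2 := by rw [Real.sqrt_le_left (by norm_num)]; norm_num
    have h7 : 2 * (B * (Real.exp (-δ * (τ + s)) / √(d / 2))) / (d / 2) =
        (4 * √2) * B * (Real.exp (-δ * (τ + s)) / √d ^ 3) := by
      rw [h5, show √d ^ 3 = √d * d by rw [pow_succ, hsd]; ring]
      field_simp; ring
    rw [h7]
    have h8 : 4 * √2 ≤ 6 := by linarith
    calc 4 * √2 * B * (Real.exp (-δ * (τ + s)) / √d ^ 3) * ‖z' - z‖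
        ≤ 6 * B * (Real.exp (-δ * (τ + s)) / √d ^ 3) * ‖z' - z‖ := by gcongr
      _ = _ := by ring
  refine (norm_integral_le_of_norm_le (h1.const_mul _) hae).trans ?_
  rw [integral_const_mul]
  calc _ ≤ 6 * B * ‖z' - z‖ * (2 / (c * δ) / √(R - ‖z - z₀‖ - c * Real.exp (-δ * τ))) := by gcongr
    _ = _ := by rw [gap_eq]; ring

end IntegralEstimate

/-! ### Fuchsian equations and the integral kernel -/

section Fuchsian

variable {Z : Type} [NormedAddCommGroup Z] [NormedSpace ℂ Z] {ι : Type} [Fintype ι]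

/-- Complex times with real part above `t₁`, near the real axis. -/
def strip (t₁ : ℝ) : Set ℂ := {t | t₁ < t.re ∧ |t.im| < 1}

theorem isOpen_strip (t₁ : ℝ) : IsOpen (strip t₁) :=
  (isOpen_lt continuous_const Complex.continuous_re).inter
    (isOpen_lt Complex.continuous_im.abs continuous_const)

theorem ofReal_mem_strip {t₁ t : ℝ} (h : t₁ < t) : (t : ℂ) ∈ strip t₁ := by
  simp [strip, h]

theorem add_mem_strip {t₁ : ℝ} {t : ℂ} (h : t ∈ strip t₁) {s : ℝ} (hs : 0 ≤ s) :
    t + s ∈ strip t₁ := by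
  obtain ⟨h1, h2⟩ := h
  refine ⟨?_, by simpa using h2⟩
  simp only [Complex.add_re, Complex.ofReal_re]; linarith

/-- The equation `∂_t u_i = μ_i(z) u_i + f_i(t, z, u, ∂_z u)` is of Fuchsian type at `t = ∞`: all
`μ_i` have positive real part, and `f` is holomorphic, of at most linear growth in `∂_z u`, and
decays exponentially in `t`. -/
structure IsFuchsian (μ : Z → ι → ℂ) (f : ℂ → Z → (ι → ℂ) → (Z →L[ℂ] (ι → ℂ)) → ι → ℂ)
    (z₀ : Z) (R t₁ K δ L : ℝ) : Prop where
  R_pos : 0 < R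
  R_le : R ≤ 1
  K_pos : 0 < K
  δ_pos : 0 < δ
  L_nonneg : 0 ≤ L
  mu_diff : DifferentiableOn ℂ μ (ball z₀ R)
  mu_pos : ∀ z ∈ ball z₀ R, ∀ i, 0 < (μ z i).re
  diff : DifferentiableOn ℂ (fun q : ℂ × Z × (ι → ℂ) × (Z →L[ℂ] (ι → ℂ)) =>
    f q.1 q.2.1 q.2.2.1 q.2.2.2) (strip t₁ ×ˢ ball z₀ R ×ˢ ball 0 K ×ˢ univ)
  bound : ∀ t ∈ strip t₁, ∀ z ∈ ball z₀ R, ∀ u, ‖u‖ < K → ∀ w,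
    ‖f t z u w‖ ≤ L * Real.exp (-δ * t.re) * (1 + ‖w‖)

variable {μ : Z → ι → ℂ} {f : ℂ → Z → (ι → ℂ) → (Z →L[ℂ] (ι → ℂ)) → ι → ℂ}
  {z₀ : Z} {R t₁ K δ L : ℝ}

/-- The Lipschitz estimate comes from the bound alone, by the Schwarz lemma on the complex line
through the two points. -/
theorem IsFuchsian.lipschitz (h : IsFuchsian μ f z₀ R t₁ K δ L) {t : ℂ} (ht : t ∈ strip t₁)
    {z : Z} (hz : z ∈ ball z₀ R) {u u' : ι → ℂ} (hu : ‖u‖ ≤ K / 2) (hu' : ‖u'‖ ≤ K / 2)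
    (w w' : Z →L[ℂ] (ι → ℂ)) :
    ‖f t z u' w' - f t z u w‖ ≤
      4 * L * Real.exp (-δ * t.re) * (2 / K * (1 + ‖w‖) * ‖u' - u‖ + ‖w' - w‖) := by
  have hK := h.K_pos
  have hL := h.L_nonneg
  set M := L * Real.exp (-δ * t.re) with hM
  have hM0 : 0 ≤ M := by positivity
  set s := 2 / K * ‖u' - u‖ + ‖w' - w‖ / (1 + ‖w‖) with hs
  have hw1 : 0 < 1 + ‖w‖ := by positivity
  have hs0 : 0 ≤ s := by positivity
  have hmain : ‖f t z u' w' - f t z u w‖ ≤ 4 * M * (1 + ‖w‖) * s := by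
    rcases le_or_gt 1 s with h1 | h1
    · have b1 := h.bound t ht z hz u (by linarith) w
      have b2 := h.bound t ht z hz u' (by linarith) w'
      have hw' : ‖w'‖ ≤ ‖w‖ + ‖w' - w‖ := by
        calc ‖w'‖ = ‖w + (w' - w)‖ := by congr 1; abel
          _ ≤ _ := norm_add_le _ _
      have hd : ‖w' - w‖ ≤ s * (1 + ‖w‖) := by
        have : 0 ≤ 2 / K * ‖u' - u‖ := by positivity
        rw [← div_le_iff₀ hw1]; linarith
      have e1 : ‖f t z u' w' - f t z u w‖ ≤ M * (1 + ‖w'‖) + M * (1 + ‖w‖) :=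
        (norm_sub_le _ _).trans (add_le_add b2 b1)
      have e2 : (1 + ‖w'‖) + (1 + ‖w‖) ≤ 4 * (1 + ‖w‖) * s := by nlinarith
      calc _ ≤ M * ((1 + ‖w'‖) + (1 + ‖w‖)) := by linarith
        _ ≤ M * (4 * (1 + ‖w‖) * s) := by gcongr
        _ = _ := by ring
    · rcases hs0.eq_or_lt with h0 | h0
      · have e1 : 0 ≤ 2 / K * ‖u' - u‖ := by positivity
        have e2 : 0 ≤ ‖w' - w‖ / (1 + ‖w‖) := by positivity
        have e3 : 2 / K * ‖u' - u‖ = 0 := by linarith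
        have e4 : ‖w' - w‖ / (1 + ‖w‖) = 0 := by linarith
        have e5 : u' = u := by
          rcases mul_eq_zero.1 e3 with h | h
          · have : 0 < 2 / K := by positivity
            linarith
          · exact sub_eq_zero.1 (norm_eq_zero.1 h)
        have e6 : w' = w := by
          rcases div_eq_zero_iff.1 e4 with h | h
          · exact sub_eq_zero.1 (norm_eq_zero.1 h)
          · linarith
        rw [e5, e6]; simp [← h0]
      · set φ : ℂ → ι → ℂ := fun l => f t z (u + l • (u' - u)) (w + l • (w' - w)) with hφ
        have hin : ∀ l ∈ ball (0 : ℂ) (1 / s), ‖u + l • (u' - u)‖ < K ∧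
            ‖w + l • (w' - w)‖ ≤ 1 + 2 * ‖w‖ := by
          intro l hl
          rw [mem_ball, dist_zero_right, lt_div_iff₀ h0] at hl
          have a1 : ‖l‖ * (2 / K * ‖u' - u‖) ≤ ‖l‖ * s := by
            gcongr; have : 0 ≤ ‖w' - w‖ / (1 + ‖w‖) := by positivity
            linarith
          have a2 : ‖l‖ * (‖w' - w‖ / (1 + ‖w‖)) ≤ ‖l‖ * s := by
            gcongr; have : 0 ≤ 2 / K * ‖u' - u‖ := by positivity
            linarith
          constructor
          · have a3 : ‖l‖ * ‖u' - u‖ < K / 2 := by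
              have : ‖l‖ * (2 / K * ‖u' - u‖) = (‖l‖ * ‖u' - u‖) / (K / 2) := by field_simp
              rw [this] at a1
              have := lt_of_le_of_lt a1 hl
              rwa [div_lt_one (by positivity)] at this
            have := norm_add_le u (l • (u' - u))
            rw [norm_smul] at this; linarith
          · have a3 : ‖l‖ * ‖w' - w‖ ≤ 1 + ‖w‖ := by
              have : ‖l‖ * (‖w' - w‖ / (1 + ‖w‖)) = (‖l‖ * ‖w' - w‖) / (1 + ‖w‖) := by
                field_simp
              rw [this] at a2
              have := a2.trans hl.le
              rwa [div_le_one hw1] at this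
            have := norm_add_le w (l • (w' - w))
            rw [norm_smul] at this; linarith
        have hd : DifferentiableOn ℂ φ (ball 0 (1 / s)) := by
          refine h.diff.comp (f := fun l : ℂ => (t, z, u + l • (u' - u), w + l • (w' - w)))
            (by fun_prop) ?_
          intro l hl
          exact ⟨ht, hz, by simpa using (hin l hl).1, mem_univ _⟩
        have hbd : ∀ l ∈ ball (0 : ℂ) (1 / s), ‖φ l‖ ≤ 2 * M * (1 + ‖w‖) := by
          intro l hl
          refine (h.bound t ht z hz _ (hin l hl).1 _).trans ?_
          have := (hin l hl).2
          calc M * (1 + ‖w + l • (w' - w)‖) ≤ M * (1 + (1 + 2 * ‖w‖)) := by gcongr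
            _ = _ := by ring
        have h00 : (0 : ℂ) ∈ ball (0 : ℂ) (1 / s) := mem_ball_self (by positivity)
        have hmaps : MapsTo φ (ball 0 (1 / s)) (closedBall (φ 0) (4 * M * (1 + ‖w‖))) := by
          intro l hl
          rw [mem_closedBall, dist_eq_norm]
          linarith [norm_sub_le (φ l) (φ 0), hbd l hl, hbd 0 h00]
        have h11 : (1 : ℂ) ∈ ball (0 : ℂ) (1 / s) := by
          rw [mem_ball, dist_zero_right, norm_one, one_lt_div h0]; exact h1
        have := Complex.dist_le_div_mul_dist_of_mapsTo_ball hd hmaps h11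
        rw [dist_zero_right, norm_one, dist_eq_norm] at this
        have e1 : φ 1 = f t z u' w' := by simp [hφ]
        have e2 : φ 0 = f t z u w := by
          show f t z (u + (0 : ℂ) • (u' - u)) (w + (0 : ℂ) • (w' - w)) = _
          have e3 : (0 : ℂ) • (w' - w) = 0 := zero_smul ℂ (w' - w)
          rw [e3, zero_smul, add_zero, add_zero]
        rw [e1, e2] at this
        refine this.trans (le_of_eq ?_)
        field_simp
  refine hmain.trans (le_of_eq ?_)
  rw [hs, hM]; field_simp

/-- The integrand of the integral equation
`u_i(t, z) = -∫_0^∞ e^{-μ_i(z) s} f_i(t + s, z, u(t + s), ∂_z u(t + s)) ds`, where `U s` stands for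
`u(t + s)`. -/
noncomputable def kernel (μ : Z → ι → ℂ) (f : ℂ → Z → (ι → ℂ) → (Z →L[ℂ] (ι → ℂ)) → ι → ℂ) (t : ℂ)
    (U : ℝ → Z → ι → ℂ) (s : ℝ) (z : Z) : ι → ℂ :=
  fun i => Complex.exp (-(μ z i) * s) * f (t + s) z (U s z) (fderiv ℂ (U s) z) i

theorem norm_exp_mul_le {a : ℂ} (ha : 0 < a.re) {s : ℝ} (hs : 0 ≤ s) :
    ‖Complex.exp (-a * s)‖ ≤ 1 := by
  rw [Complex.norm_exp]
  have : (-a * (s : ℂ)).re = -(a.re * s) := by simp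
  rw [this]
  exact Real.exp_le_one_iff.2 (by nlinarith)

/-- `U s`, for `s > 0`, is holomorphic and bounded, with a derivative that is controlled by the
inverse square root of the gap at time `τ + s`. -/
structure IsSlice (R c δ : ℝ) (z₀ : Z) (τ κ κ' : ℝ) (U : ℝ → Z → ι → ℂ) : Prop where
  diff : ∀ s, 0 < s → DifferentiableOn ℂ (U s) {z | 0 < gap R c δ z₀ (τ + s) z}
  bound : ∀ s, 0 < s → ∀ z, 0 < gap R c δ z₀ (τ + s) z → ‖U s z‖ ≤ κ
  fderiv_bound : ∀ s, 0 < s → ∀ z, 0 < gap R c δ z₀ (τ + s) z →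
    ‖fderiv ℂ (U s) z‖ ≤ κ' / √(gap R c δ z₀ (τ + s) z)

variable {c κ' : ℝ}

theorem IsFuchsian.differentiableOn_kernel [FiniteDimensional ℂ Z]
    (h : IsFuchsian μ f z₀ R t₁ K δ L) (hc : 0 < c)
    {t : ℂ} (ht : t ∈ strip t₁) {U : ℝ → Z → ι → ℂ}
    (hU : IsSlice R c δ z₀ t.re (K / 2) κ' U) {s : ℝ} (hs : 0 < s) :
    DifferentiableOn ℂ (kernel μ f t U s) {z | 0 < gap R c δ z₀ (t.re + s) z} := by
  have hO := isOpen_gap_pos R c δ z₀ (t.re + s)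
  have h1 := differentiableOn_fderiv hO (hU.diff s hs)
  have h2 : DifferentiableOn ℂ (fun z => f (t + s) z (U s z) (fderiv ℂ (U s) z))
      {z | 0 < gap R c δ z₀ (t.re + s) z} := by
    refine h.diff.comp (f := fun z => (t + s, z, U s z, fderiv ℂ (U s) z))
      ((differentiableOn_const _).prodMk (differentiableOn_id.prodMk ((hU.diff s hs).prodMk h1))) ?_
    intro z hz
    refine ⟨add_mem_strip ht hs.le, mem_ball_of_gap_pos hc hz, ?_, mem_univ _⟩
    have := hU.bound s hs z hz
    have := h.K_pos
    simp only [mem_ball, dist_zero_right]; linarith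
  have h3 : DifferentiableOn ℂ μ {z | 0 < gap R c δ z₀ (t.re + s) z} :=
    h.mu_diff.mono fun z hz => mem_ball_of_gap_pos hc hz
  rw [differentiableOn_pi] at h2 h3 ⊢
  intro i
  exact (((h3 i).neg.mul_const _).cexp).mul (h2 i)

theorem IsFuchsian.norm_kernel_le (h : IsFuchsian μ f z₀ R t₁ K δ L) (hc : 0 < c)
    {t : ℂ} (ht : t ∈ strip t₁) {U : ℝ → Z → ι → ℂ}
    (hU : IsSlice R c δ z₀ t.re (K / 2) κ' U) {s : ℝ} (hs : 0 < s) {z : Z}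
    (hz : 0 < gap R c δ z₀ (t.re + s) z) :
    ‖kernel μ f t U s z‖ ≤ L * (1 + κ') *
      (Real.exp (-δ * (t.re + s)) / √(gap R c δ z₀ (t.re + s) z)) := by
  have hzb := mem_ball_of_gap_pos hc hz
  have hKp := h.K_pos
  have hLn := h.L_nonneg
  have h1 : ‖kernel μ f t U s z‖ ≤ ‖f (t + s) z (U s z) (fderiv ℂ (U s) z)‖ := by
    refine (pi_norm_le_iff_of_nonneg (norm_nonneg _)).2 fun i => ?_
    unfold kernel
    rw [norm_mul]
    calc _ ≤ 1 * ‖f (t + s) z (U s z) (fderiv ℂ (U s) z)‖ :=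
          mul_le_mul (norm_exp_mul_le (h.mu_pos z hzb i) hs.le) (norm_le_pi_norm _ i)
            (norm_nonneg _) zero_le_one
      _ = _ := one_mul _
  refine h1.trans ((h.bound _ (add_mem_strip ht hs.le) z hzb _
    (by have := hU.bound s hs z hz; linarith) _).trans ?_)
  have hg := Real.sqrt_pos.2 hz
  have hg1 : √(gap R c δ z₀ (t.re + s) z) ≤ 1 := Real.sqrt_le_one.2 (gap_le_one hc h.R_le _ _)
  have h2 := hU.fderiv_bound s hs z hz
  have h3 : 1 ≤ 1 / √(gap R c δ z₀ (t.re + s) z) := by rw [le_div_iff₀ hg]; linarith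
  have h4 : 1 + ‖fderiv ℂ (U s) z‖ ≤ (1 + κ') / √(gap R c δ z₀ (t.re + s) z) := by
    rw [add_div]; linarith
  simp only [Complex.add_re, Complex.ofReal_re]
  calc _ ≤ L * Real.exp (-δ * (t.re + s)) * ((1 + κ') / √(gap R c δ z₀ (t.re + s) z)) := by gcongr
    _ = _ := by ring

theorem IsFuchsian.norm_kernel_sub_le (h : IsFuchsian μ f z₀ R t₁ K δ L) (hc : 0 < c)
    {t : ℂ} (ht : t ∈ strip t₁) {U V : ℝ → Z → ι → ℂ} (hκ' : 0 ≤ κ')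
    (hU : IsSlice R c δ z₀ t.re (K / 2) κ' U) (hV : IsSlice R c δ z₀ t.re (K / 2) κ' V)
    {N : ℝ} (hN : ∀ s, 0 < s → ∀ z, 0 < gap R c δ z₀ (t.re + s) z → ‖U s z - V s z‖ ≤ N ∧
      ‖fderiv ℂ (U s) z - fderiv ℂ (V s) z‖ ≤ N / √(gap R c δ z₀ (t.re + s) z))
    {s : ℝ} (hs : 0 < s) {z : Z} (hz : 0 < gap R c δ z₀ (t.re + s) z) :
    ‖kernel μ f t U s z - kernel μ f t V s z‖ ≤ 4 * L * (2 / K * (1 + κ') + 1) * N *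
      (Real.exp (-δ * (t.re + s)) / √(gap R c δ z₀ (t.re + s) z)) := by
  have hzb := mem_ball_of_gap_pos hc hz
  have hKp := h.K_pos
  have hLn := h.L_nonneg
  have h1 : ‖kernel μ f t U s z - kernel μ f t V s z‖ ≤
      ‖f (t + s) z (U s z) (fderiv ℂ (U s) z) - f (t + s) z (V s z) (fderiv ℂ (V s) z)‖ := by
    refine (pi_norm_le_iff_of_nonneg (norm_nonneg _)).2 fun i => ?_
    simp only [kernel, Pi.sub_apply]
    rw [← mul_sub, norm_mul]
    calc _ ≤ 1 * ‖f (t + s) z (U s z) (fderiv ℂ (U s) z) -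
          f (t + s) z (V s z) (fderiv ℂ (V s) z)‖ :=
          mul_le_mul (norm_exp_mul_le (h.mu_pos z hzb i) hs.le)
            (norm_le_pi_norm (f (t + s) z (U s z) (fderiv ℂ (U s) z) -
              f (t + s) z (V s z) (fderiv ℂ (V s) z)) i)
            (norm_nonneg _) zero_le_one
      _ = _ := one_mul _
  refine h1.trans ((h.lipschitz (add_mem_strip ht hs.le) hzb (hV.bound s hs z hz)
    (hU.bound s hs z hz) _ _).trans ?_)
  have hg := Real.sqrt_pos.2 hz
  have hg1 : √(gap R c δ z₀ (t.re + s) z) ≤ 1 := Real.sqrt_le_one.2 (gap_le_one hc h.R_le _ _)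
  have h2 := hV.fderiv_bound s hs z hz
  have h3 : 1 ≤ 1 / √(gap R c δ z₀ (t.re + s) z) := by rw [le_div_iff₀ hg]; linarith
  have h4 : 1 + ‖fderiv ℂ (V s) z‖ ≤ (1 + κ') / √(gap R c δ z₀ (t.re + s) z) := by
    rw [add_div]; linarith
  obtain ⟨h5, h6⟩ := hN s hs z hz
  simp only [Complex.add_re, Complex.ofReal_re]
  calc _ ≤ 4 * L * Real.exp (-δ * (t.re + s)) * (2 / K * ((1 + κ') /
          √(gap R c δ z₀ (t.re + s) z)) * N + N / √(gap R c δ z₀ (t.re + s) z)) := by gcongr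
    _ = _ := by ring

/-- One step of the contraction argument, at a fixed time `t`. -/
theorem IsFuchsian.integral_kernel_sub_le [FiniteDimensional ℂ Z]
    (h : IsFuchsian μ f z₀ R t₁ K δ L) (hc : 0 < c)
    {t : ℂ} (ht : t ∈ strip t₁) {U V : ℝ → Z → ι → ℂ} (hκ' : 0 ≤ κ')
    (hc2 : 12 * (4 * L * (2 / K * (1 + κ') + 1)) / (c * δ) ≤ 1 / 2)
    (hU : IsSlice R c δ z₀ t.re (K / 2) κ' U) (hV : IsSlice R c δ z₀ t.re (K / 2) κ' V)
    (hUm : ∀ z, 0 < gap R c δ z₀ t.re z →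
      AEStronglyMeasurable (fun s => kernel μ f t U s z) (volume.restrict (Ioi 0)))
    (hVm : ∀ z, 0 < gap R c δ z₀ t.re z →
      AEStronglyMeasurable (fun s => kernel μ f t V s z) (volume.restrict (Ioi 0)))
    {N : ℝ} (hN0 : 0 ≤ N)
    (hN : ∀ s, 0 < s → ∀ z, 0 < gap R c δ z₀ (t.re + s) z → ‖U s z - V s z‖ ≤ N ∧
      ‖fderiv ℂ (U s) z - fderiv ℂ (V s) z‖ ≤ N / √(gap R c δ z₀ (t.re + s) z))
    {z : Z} (hz : 0 < gap R c δ z₀ t.re z) :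
    ‖(∫ s in Ioi 0, kernel μ f t U s z) - ∫ s in Ioi 0, kernel μ f t V s z‖ ≤ N / 2 ∧
    ‖fderiv ℂ (fun z => (∫ s in Ioi 0, kernel μ f t U s z) - ∫ s in Ioi 0, kernel μ f t V s z) z‖
      ≤ N / 2 / √(gap R c δ z₀ t.re z) := by
  have hδ := h.δ_pos
  have hLn := h.L_nonneg
  have hKp := h.K_pos
  have hiU : ∀ z, 0 < gap R c δ z₀ t.re z → IntegrableOn (fun s => kernel μ f t U s z) (Ioi 0) :=
    fun z hz => (norm_integral_le_of_gap hc hδ h.R_le (by positivity)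
      (fun s hs => h.differentiableOn_kernel hc ht hU hs) hUm
      (fun s hs z hz => h.norm_kernel_le hc ht hU hs hz) hz).1
  have hiV : ∀ z, 0 < gap R c δ z₀ t.re z → IntegrableOn (fun s => kernel μ f t V s z) (Ioi 0) :=
    fun z hz => (norm_integral_le_of_gap hc hδ h.R_le (by positivity)
      (fun s hs => h.differentiableOn_kernel hc ht hV hs) hVm
      (fun s hs z hz => h.norm_kernel_le hc ht hV hs hz) hz).1
  obtain ⟨-, h2, h3⟩ := norm_integral_le_of_gap (B := 4 * L * (2 / K * (1 + κ') + 1) * N)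
    (F := fun s z => kernel μ f t U s z - kernel μ f t V s z) hc hδ h.R_le (by positivity)
    (fun s hs => (h.differentiableOn_kernel hc ht hU hs).sub
      (h.differentiableOn_kernel hc ht hV hs)) (fun z hz => (hUm z hz).sub (hVm z hz))
    (fun s hs z hz => h.norm_kernel_sub_le hc ht hκ' hU hV hN hs hz) hz
  have he : (fun z => (∫ s in Ioi 0, kernel μ f t U s z) - ∫ s in Ioi 0, kernel μ f t V s z)
      =ᶠ[𝓝 z] fun z => ∫ s in Ioi 0, (kernel μ f t U s z - kernel μ f t V s z) := by
    filter_upwards [(isOpen_gap_pos R c δ z₀ t.re).mem_nhds hz] with y hy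
    rw [integral_sub (hiU y hy) (hiV y hy)]
  rw [he.fderiv_eq, ← integral_sub (hiU z hz) (hiV z hz)]
  have hcd : 0 < c * δ := by positivity
  have hC : 12 * (4 * L * (2 / K * (1 + κ') + 1) * N) / (c * δ) ≤ N / 2 := by
    calc _ = 12 * (4 * L * (2 / K * (1 + κ') + 1)) / (c * δ) * N := by ring
      _ ≤ 1 / 2 * N := by gcongr
      _ = _ := by ring
  refine ⟨h2.trans (le_trans ?_ hC), h3.trans (by gcongr)⟩
  gcongr; norm_num

end Fuchsian

/-! ### The integral operator -/

section Picard

variable {Z : Type} [NormedAddCommGroup Z] [NormedSpace ℂ Z] {ι : Type} [Fintype ι]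
  {μ : Z → ι → ℂ} {f : ℂ → Z → (ι → ℂ) → (Z →L[ℂ] (ι → ℂ)) → ι → ℂ}
  {z₀ : Z} {R t₁ K δ L c : ℝ}

/-- `μ` and `f` take real values at real arguments; `Zr` is the space of real positions. -/
structure IsRealSystem (Zr : Submodule ℝ Z) (μ : Z → ι → ℂ)
    (f : ℂ → Z → (ι → ℂ) → (Z →L[ℂ] (ι → ℂ)) → ι → ℂ) (t₁ R : ℝ) (z₀ : Z) : Prop where
  mu : ∀ z ∈ Zr, z ∈ ball z₀ R → ∀ i, (μ z i).im = 0
  rhs : ∀ t : ℝ, t₁ < t → ∀ z ∈ Zr, z ∈ ball z₀ R → ∀ u : ι → ℂ, (∀ i, (u i).im = 0) →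
    ∀ w : Z →L[ℂ] (ι → ℂ), (∀ v ∈ Zr, ∀ i, (w v i).im = 0) → ∀ i, (f t z u w i).im = 0

theorem im_fderiv_eq_zero {Zr : Submodule ℝ Z} {g : Z → ι → ℂ} {z : Z}
    (hg : DifferentiableAt ℂ g z) (hz : z ∈ Zr)
    (hr : ∀ᶠ y in 𝓝 z, y ∈ Zr → ∀ i, (g y i).im = 0) {v : Z} (hv : v ∈ Zr) (i : ι) :
    (fderiv ℂ g z v i).im = 0 := by
  have h1 : HasDerivAt (fun s : ℝ => z + ((s : ℂ) • v)) v 0 := by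
    have : HasDerivAt (fun s : ℝ => (s : ℂ)) 1 0 := Complex.ofRealCLM.hasDerivAt
    simpa using (this.smul_const v).const_add z
  have h0 : z + (((0 : ℝ) : ℂ) • v) = z := by simp
  have h2 : HasDerivAt (fun s : ℝ => g (z + ((s : ℂ) • v))) (fderiv ℂ g z v) 0 := by
    have h3 : HasFDerivAt g (fderiv ℂ g z) (z + (((0 : ℝ) : ℂ) • v)) := by
      rw [h0]; exact hg.hasFDerivAt
    exact (h3.restrictScalars ℝ).comp_hasDerivAt (0 : ℝ) h1
  have h4 : HasDerivAt (fun s : ℝ => (g (z + ((s : ℂ) • v)) i).im) ((fderiv ℂ g z v i).im) 0 :=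
    Complex.imCLM.hasFDerivAt.comp_hasDerivAt (0 : ℝ) (hasDerivAt_pi.1 h2 i)
  have hc : Tendsto (fun s : ℝ => z + ((s : ℂ) • v)) (𝓝 0) (𝓝 z) := by
    have := h1.continuousAt.tendsto; rwa [h0] at this
  have h5 : (fun s : ℝ => (g (z + ((s : ℂ) • v)) i).im) =ᶠ[𝓝 0] fun _ => 0 := by
    filter_upwards [hc.eventually hr] with s hs
    refine hs (Zr.add_mem hz ?_) i
    rw [Complex.coe_smul]
    exact Zr.smul_mem s hv
  exact h4.unique ((hasDerivAt_const (0 : ℝ) (0 : ℝ)).congr_of_eventuallyEq h5)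

/-- The region in space-time on which the unknown is constructed. -/
def region (R c δ : ℝ) (z₀ : Z) (t₂ : ℝ) : Set (ℂ × Z) :=
  {p | p.1 ∈ strip t₂ ∧ 0 < gap R c δ z₀ p.1.re p.2}

theorem isOpen_region (R c δ : ℝ) (z₀ : Z) (t₂ : ℝ) : IsOpen (region R c δ z₀ t₂) := by
  have h2 : IsOpen {p : ℂ × Z | 0 < gap R c δ z₀ p.1.re p.2} :=
    isOpen_lt continuous_const ((continuous_gap R c δ z₀).comp
      ((Complex.continuous_re.comp continuous_fst).prodMk continuous_snd))
  exact ((isOpen_strip t₂).preimage continuous_fst).inter h2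

theorem add_mem_region (hc : 0 < c) (hδ : 0 < δ) {t₂ : ℝ} {p : ℂ × Z}
    (hp : p ∈ region R c δ z₀ t₂) {s : ℝ} (hs : 0 ≤ s) :
    (p.1 + s, p.2) ∈ region R c δ z₀ t₂ := by
  refine ⟨add_mem_strip hp.1 hs, ?_⟩
  simp only [Complex.add_re, Complex.ofReal_re]
  exact hp.2.trans_le (gap_mono hc hδ _ _ hs)

/-- The derivative in the space variables. -/
noncomputable def dz (u : ℂ × Z → ι → ℂ) (p : ℂ × Z) : Z →L[ℂ] (ι → ℂ) :=
  fderiv ℂ (fun z => u (p.1, z)) p.2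

theorem dz_eq {u : ℂ × Z → ι → ℂ} {p : ℂ × Z} (h : DifferentiableAt ℂ u p) :
    dz u p = (fderiv ℂ u p).comp (ContinuousLinearMap.inr ℂ ℂ Z) := by
  have h1 : HasFDerivAt (fun z => ((p.1, z) : ℂ × Z)) (ContinuousLinearMap.inr ℂ ℂ Z) p.2 :=
    hasFDerivAt_prodMk_right p.1 p.2
  have h2 : HasFDerivAt u (fderiv ℂ u p) ((p.1, p.2) : ℂ × Z) := h.hasFDerivAt
  exact (h2.comp p.2 h1).fderiv

theorem differentiableOn_dz [FiniteDimensional ℂ Z] {u : ℂ × Z → ι → ℂ} {Ω : Set (ℂ × Z)}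
    (hΩ : IsOpen Ω) (h : DifferentiableOn ℂ u Ω) : DifferentiableOn ℂ (dz u) Ω := by
  have h1 := differentiableOn_fderiv hΩ h
  have h2 : DifferentiableOn ℂ
      (fun p => (fderiv ℂ u p).comp (ContinuousLinearMap.inr ℂ ℂ Z)) Ω := by
    exact ((ContinuousLinearMap.compL ℂ Z (ℂ × Z) (ι → ℂ)).flip
      (ContinuousLinearMap.inr ℂ ℂ Z)).differentiable.comp_differentiableOn h1
  exact h2.congr fun p hp => dz_eq (h.differentiableAt (hΩ.mem_nhds hp))

/-- The complete metric space of the contraction argument. -/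
structure IsAdmissible (Zr : Submodule ℝ Z) (R c δ : ℝ) (z₀ : Z) (t₂ κ : ℝ)
    (u : ℂ × Z → ι → ℂ) : Prop where
  diff : DifferentiableOn ℂ u (region R c δ z₀ t₂)
  bound : ∀ p ∈ region R c δ z₀ t₂, ‖u p‖ ≤ κ
  dz_bound : ∀ p ∈ region R c δ z₀ t₂, ‖dz u p‖ ≤ κ / √(gap R c δ z₀ p.1.re p.2)
  real : ∀ t : ℝ, ∀ z ∈ Zr, ((t : ℂ), z) ∈ region R c δ z₀ t₂ → ∀ i, (u (t, z) i).im = 0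

variable {Zr : Submodule ℝ Z} {t₂ κ : ℝ}

theorem IsAdmissible.isSlice {u : ℂ × Z → ι → ℂ}
    (hu : IsAdmissible Zr R c δ z₀ t₂ κ u) {t : ℂ} (ht : t ∈ strip t₂) :
    IsSlice R c δ z₀ t.re κ κ (fun s z => u (t + s, z)) := by
  have hmem : ∀ s : ℝ, 0 < s → ∀ z, 0 < gap R c δ z₀ (t.re + s) z →
      (t + s, z) ∈ region R c δ z₀ t₂ := fun s hs z hz =>
    ⟨add_mem_strip ht hs.le, by simpa using hz⟩
  refine ⟨fun s hs => ?_, fun s hs z hz => hu.bound _ (hmem s hs z hz), fun s hs z hz => ?_⟩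
  · exact hu.diff.comp (f := fun z => (t + (s : ℂ), z)) (by fun_prop) (fun z hz => hmem s hs z hz)
  · simpa [dz] using hu.dz_bound _ (hmem s hs z hz)

/-- The right-hand side of the integral equation. -/
noncomputable def integralMap (μ : Z → ι → ℂ)
    (f : ℂ → Z → (ι → ℂ) → (Z →L[ℂ] (ι → ℂ)) → ι → ℂ) (u : ℂ × Z → ι → ℂ) (p : ℂ × Z) : ι → ℂ :=
  -∫ s in Ioi (0 : ℝ), kernel μ f p.1 (fun s z => u (p.1 + s, z)) s p.2

theorem kernel_apply (u : ℂ × Z → ι → ℂ) (p : ℂ × Z) (s : ℝ) :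
    kernel μ f p.1 (fun s z => u (p.1 + s, z)) s p.2 = fun i =>
      Complex.exp (-(μ p.2 i) * s) * f (p.1 + s) p.2 (u (p.1 + s, p.2)) (dz u (p.1 + s, p.2)) i :=
  rfl

variable [FiniteDimensional ℂ Z]

theorem IsFuchsian.differentiableOn_rhs (h : IsFuchsian μ f z₀ R t₁ K δ L) (hc : 0 < c)
    (ht : t₁ ≤ t₂) {u : ℂ × Z → ι → ℂ} (hu : IsAdmissible Zr R c δ z₀ t₂ (K / 2) u) :
    DifferentiableOn ℂ (fun p : ℂ × Z => f p.1 p.2 (u p) (dz u p)) (region R c δ z₀ t₂) := by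
  refine h.diff.comp (f := fun p : ℂ × Z => (p.1, p.2, u p, dz u p))
    (differentiableOn_fst.prodMk (differentiableOn_snd.prodMk (hu.diff.prodMk
      (differentiableOn_dz (isOpen_region R c δ z₀ t₂) hu.diff)))) ?_
  intro p hp
  refine ⟨⟨lt_of_le_of_lt ht hp.1.1, hp.1.2⟩, mem_ball_of_gap_pos hc hp.2, ?_, mem_univ _⟩
  have h1 := hu.bound p hp
  have h2 := h.K_pos
  simp only [mem_ball, dist_zero_right]; linarith

theorem IsFuchsian.aestronglyMeasurable_kernel (h : IsFuchsian μ f z₀ R t₁ K δ L) (hc : 0 < c)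
    (ht : t₁ ≤ t₂) {u : ℂ × Z → ι → ℂ} (hu : IsAdmissible Zr R c δ z₀ t₂ (K / 2) u)
    {p : ℂ × Z} (hp : p ∈ region R c δ z₀ t₂) :
    AEStronglyMeasurable (fun s => kernel μ f p.1 (fun s z => u (p.1 + s, z)) s p.2)
      (volume.restrict (Ioi 0)) := by
  refine ContinuousOn.aestronglyMeasurable ?_ measurableSet_Ioi
  simp only [kernel_apply]
  have h1 : ContinuousOn (fun s : ℝ => f (p.1 + s) p.2 (u (p.1 + s, p.2)) (dz u (p.1 + s, p.2)))
      (Ioi 0) :=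
    (h.differentiableOn_rhs hc ht hu).continuousOn.comp (f := fun s : ℝ => (p.1 + (s : ℂ), p.2))
      (by fun_prop) (fun s hs => add_mem_region hc h.δ_pos hp (le_of_lt hs))
  rw [continuousOn_pi] at h1 ⊢
  intro i
  refine ContinuousOn.mul (by fun_prop) (h1 i)

theorem IsFuchsian.integralMap_isAdmissible (h : IsFuchsian μ f z₀ R t₁ K δ L)
    (hr : IsRealSystem Zr μ f t₁ R z₀) (hc : 0 < c)
    (hc1 : 12 * (L * (1 + K / 2)) / (c * δ) ≤ K / 2)
    (ht : t₁ ≤ t₂) {u : ℂ × Z → ι → ℂ} (hu : IsAdmissible Zr R c δ z₀ t₂ (K / 2) u) :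
    IsAdmissible Zr R c δ z₀ t₂ (K / 2) (integralMap μ f u) := by
  have hδ := h.δ_pos
  have hLn := h.L_nonneg
  have hKp := h.K_pos
  have hO := isOpen_region R c δ z₀ t₂
  have hst : ∀ p ∈ region R c δ z₀ t₂, p.1 ∈ strip t₁ :=
    fun p hp => ⟨lt_of_le_of_lt ht hp.1.1, hp.1.2⟩
  have hbd : ∀ p ∈ region R c δ z₀ t₂, ∀ s : ℝ, 0 < s →
      ‖kernel μ f p.1 (fun s z => u (p.1 + s, z)) s p.2‖ ≤
      L * (1 + K / 2) * (Real.exp (-δ * (p.1.re + s)) / √(gap R c δ z₀ (p.1.re + s) p.2)) :=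
    fun p hp s hs => h.norm_kernel_le hc (hst p hp) (hu.isSlice hp.1) hs
      (hp.2.trans_le (gap_mono hc hδ _ _ hs.le))
  have hkey : ∀ p ∈ region R c δ z₀ t₂, _ := fun p hp =>
    norm_integral_le_of_gap (B := L * (1 + K / 2)) (τ := p.1.re)
      (F := kernel μ f p.1 (fun s z => u (p.1 + s, z))) hc hδ h.R_le (by positivity)
      (fun s hs => h.differentiableOn_kernel hc (hst p hp) (hu.isSlice hp.1) hs)
      (fun z hz => h.aestronglyMeasurable_kernel hc ht hu (p := (p.1, z)) ⟨hp.1, hz⟩)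
      (fun s hs z hz => h.norm_kernel_le hc (hst p hp) (hu.isSlice hp.1) hs hz)
      hp.2
  refine ⟨?_, fun p hp => ?_, fun p hp => ?_, fun t z hz hp i => ?_⟩
  · refine DifferentiableOn.neg (differentiableOn_integral_of_dominated hO ?_ ?_ ?_)
    · filter_upwards [ae_restrict_mem measurableSet_Ioi] with s hs
      have hs0 : (0 : ℝ) < s := hs
      simp only [kernel_apply]
      have h1 : DifferentiableOn ℂ (fun p : ℂ × Z => f (p.1 + s) p.2 (u (p.1 + s, p.2))
          (dz u (p.1 + s, p.2))) (region R c δ z₀ t₂) :=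
        (h.differentiableOn_rhs hc ht hu).comp (f := fun p : ℂ × Z => (p.1 + (s : ℂ), p.2))
          (by fun_prop) (fun p hp => add_mem_region hc hδ hp hs0.le)
      have h2 : DifferentiableOn ℂ (fun p : ℂ × Z => μ p.2) (region R c δ z₀ t₂) :=
        h.mu_diff.comp (f := fun p : ℂ × Z => p.2) (by fun_prop)
          (fun p hp => mem_ball_of_gap_pos hc hp.2)
      rw [differentiableOn_pi] at h1 h2 ⊢
      intro i
      exact (((h2 i).neg.mul_const _).cexp).mul (h1 i)
    · exact fun p hp => h.aestronglyMeasurable_kernel hc ht hu hp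
    -- A dominating function near `p`: the gap increases with `s`.
    · intro p hp
      have hcont : ContinuousAt (fun p : ℂ × Z => L * (1 + K / 2) *
          (Real.exp (-δ * p.1.re) / √(gap R c δ z₀ p.1.re p.2))) p := by
        refine ContinuousAt.mul continuousAt_const (ContinuousAt.div ?_ ?_
          (Real.sqrt_pos.2 hp.2).ne')
        · have : Continuous fun p : ℂ × Z => Real.exp (-δ * p.1.re) :=
            Real.continuous_exp.comp
              (continuous_const.mul (Complex.continuous_re.comp continuous_fst))
          exact this.continuousAt
        · exact (Real.continuous_sqrt.comp ((continuous_gap R c δ z₀).comp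
            ((Complex.continuous_re.comp continuous_fst).prodMk continuous_snd))).continuousAt
      set M := L * (1 + K / 2) * (Real.exp (-δ * p.1.re) / √(gap R c δ z₀ p.1.re p.2)) + 1
      have hev := hcont.eventually_lt (continuousAt_const (y := M)) (by simp [M])
      obtain ⟨r, hrp, hrs⟩ := Metric.mem_nhds_iff.1 (Filter.inter_mem (hO.mem_nhds hp) hev)
      refine ⟨r, hrp, fun s => M * Real.exp (-δ * s), ?_, ?_⟩
      · exact (exp_neg_integrableOn_Ioi 0 hδ).const_mul M
      · filter_upwards [ae_restrict_mem measurableSet_Ioi] with s hs q hq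
        have hs0 : (0 : ℝ) < s := hs
        obtain ⟨hq1, hq2⟩ := hrs hq
        refine (hbd q hq1 s hs0).trans ?_
        have hg := gap_mono (R := R) hc hδ z₀ q.2 (τ := q.1.re) hs0.le
        have hgp : 0 < gap R c δ z₀ q.1.re q.2 := hq1.2
        calc L * (1 + K / 2) * (Real.exp (-δ * (q.1.re + s)) / √(gap R c δ z₀ (q.1.re + s) q.2))
            ≤ L * (1 + K / 2) * (Real.exp (-δ * (q.1.re + s)) / √(gap R c δ z₀ q.1.re q.2)) := by
              gcongr
          _ = (L * (1 + K / 2) * (Real.exp (-δ * q.1.re) / √(gap R c δ z₀ q.1.re q.2))) *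
              Real.exp (-δ * s) := by rw [show -δ * (q.1.re + s) = -δ * q.1.re + -δ * s by ring, Real.exp_add]; ring
          _ ≤ M * Real.exp (-δ * s) := by gcongr; exact le_of_lt hq2
  · unfold integralMap
    rw [norm_neg]
    refine (hkey p hp).2.1.trans (le_trans ?_ hc1)
    gcongr; norm_num
  · have : dz (integralMap μ f u) p = -fderiv ℂ (fun z => ∫ s in Ioi (0 : ℝ),
        kernel μ f p.1 (fun s z => u (p.1 + s, z)) s z) p.2 := by
      rw [← fderiv_neg]; rfl
    rw [this, norm_neg]
    refine (hkey p hp).2.2.trans ?_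
    gcongr
  · set A : (ι → ℂ) →L[ℝ] ℝ :=
      Complex.imCLM.comp ((ContinuousLinearMap.proj (R := ℂ) i).restrictScalars ℝ)
    have hA : ∀ x : ι → ℂ, A x = (x i).im := fun x => rfl
    have h1 := A.integral_comp_comm (hkey _ hp).1
    have h2 : (integralMap μ f u (t, z) i).im = -A (∫ s in Ioi (0 : ℝ),
        kernel μ f t (fun s z => u (t + s, z)) s z) := by
      rw [hA]; simp [integralMap]
    rw [h2, ← h1, neg_eq_zero]
    refine setIntegral_eq_zero_of_forall_eq_zero fun s hs => ?_
    have hs0 : (0 : ℝ) < s := hs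
    -- At real points the integrand is real.
    have hp' := add_mem_region hc hδ hp hs0.le
    have hzb : z ∈ ball z₀ R := mem_ball_of_gap_pos hc hp.2
    have hcast : ((t : ℂ) + s) = ((t + s : ℝ) : ℂ) := by push_cast; rfl
    have hdd : DifferentiableAt ℂ (fun z => u ((t : ℂ) + s, z)) z := by
      have h3 := hu.diff.differentiableAt (hO.mem_nhds hp')
      exact h3.comp z (by fun_prop : DifferentiableAt ℂ (fun z => ((t : ℂ) + (s : ℂ), z)) z)
    have hf : (f (t + s) z (u (t + s, z)) (dz u (t + s, z)) i).im = 0 := by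
      rw [hcast] at hp' ⊢
      refine hr.rhs _ ?_ z hz hzb _ (hu.real _ z hz hp') _ (fun v hv j => ?_) i
      · have := (hst _ hp').1; simpa using this
      · rw [← hcast]
        refine im_fderiv_eq_zero hdd hz ?_ hv j
        have hop : {y | ((((t + s : ℝ) : ℂ)), y) ∈ region R c δ z₀ t₂} ∈ 𝓝 z :=
          (hO.preimage (Continuous.prodMk_right _)).mem_nhds hp'
        filter_upwards [hop] with y hy hyr k
        have h4 := hu.real (t + s) y hyr hy k
        rw [← hcast] at h4
        exact h4
    have hmu : (Complex.exp (-(μ z i) * s)).im = 0 := by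
      have : -(μ z i) * s = (((-(μ z i).re * s : ℝ)) : ℂ) := by
        apply Complex.ext <;> simp [hr.mu z hz hzb i]
      rw [this, ← Complex.ofReal_exp, Complex.ofReal_im]
    rw [hA]
    show (Complex.exp (-(μ z i) * s) * f (t + s) z (u (t + s, z)) (dz u (t + s, z)) i).im = 0
    rw [Complex.mul_im, hf, hmu]; simp

end Picard

/-! ### The fixed point solves the equation -/

section FixedPoint

variable {Z : Type} [NormedAddCommGroup Z] [NormedSpace ℂ Z] {ι : Type} [Fintype ι]
  {μ : Z → ι → ℂ} {f : ℂ → Z → (ι → ℂ) → (Z →L[ℂ] (ι → ℂ)) → ι → ℂ}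
  {z₀ : Z} {R t₁ K δ L c : ℝ} {Zr : Submodule ℝ Z} {t₂ κ : ℝ} [FiniteDimensional ℂ Z]

theorem IsFuchsian.integralMap_sub_le (h : IsFuchsian μ f z₀ R t₁ K δ L)
    (hr : IsRealSystem Zr μ f t₁ R z₀) (hc : 0 < c)
    (hc1 : 12 * (L * (1 + K / 2)) / (c * δ) ≤ K / 2)
    (hc2 : 12 * (4 * L * (2 / K * (1 + K / 2) + 1)) / (c * δ) ≤ 1 / 2)
    (ht : t₁ ≤ t₂) {u v : ℂ × Z → ι → ℂ} (hu : IsAdmissible Zr R c δ z₀ t₂ (K / 2) u)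
    (hv : IsAdmissible Zr R c δ z₀ t₂ (K / 2) v) {N : ℝ} (hN0 : 0 ≤ N)
    (hN : ∀ p ∈ region R c δ z₀ t₂, ‖u p - v p‖ ≤ N ∧
      ‖dz u p - dz v p‖ ≤ N / √(gap R c δ z₀ p.1.re p.2)) :
    ∀ p ∈ region R c δ z₀ t₂, ‖integralMap μ f u p - integralMap μ f v p‖ ≤ N / 2 ∧
      ‖dz (integralMap μ f u) p - dz (integralMap μ f v) p‖ ≤
        N / 2 / √(gap R c δ z₀ p.1.re p.2) := by
  intro p hp
  have hO := isOpen_region R c δ z₀ t₂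
  have hst : p.1 ∈ strip t₁ := ⟨lt_of_le_of_lt ht hp.1.1, hp.1.2⟩
  have hKp := h.K_pos
  obtain ⟨h1, h2⟩ := h.integral_kernel_sub_le (N := N) hc hst (κ' := K / 2) (by positivity) hc2
    (hu.isSlice hp.1) (hv.isSlice hp.1)
    (fun z hz => h.aestronglyMeasurable_kernel hc ht hu (p := (p.1, z)) ⟨hp.1, hz⟩)
    (fun z hz => h.aestronglyMeasurable_kernel hc ht hv (p := (p.1, z)) ⟨hp.1, hz⟩)
    hN0 (fun s hs z hz => by
      have := hN (p.1 + s, z) ⟨add_mem_strip hp.1 hs.le, by simpa using hz⟩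
      simpa [dz] using this) hp.2
  have hd : ∀ w, IsAdmissible Zr R c δ z₀ t₂ (K / 2) w →
      DifferentiableAt ℂ (fun z => integralMap μ f w (p.1, z)) p.2 := fun w hw => by
    have h3 := (h.integralMap_isAdmissible hr hc hc1 ht hw).diff.differentiableAt (hO.mem_nhds hp)
    exact DifferentiableAt.comp (g := integralMap μ f w) (f := fun z => (p.1, z)) p.2 h3
      (by fun_prop)
  constructor
  · unfold integralMap
    rwa [neg_sub_neg, norm_sub_rev]
  · unfold dz
    rw [← fderiv_fun_sub (hd u hu) (hd v hv)]
    have : (fun z => integralMap μ f u (p.1, z) - integralMap μ f v (p.1, z)) =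
      fun z => -((∫ s in Ioi (0 : ℝ), kernel μ f p.1 (fun s z => u (p.1 + s, z)) s z) -
        ∫ s in Ioi (0 : ℝ), kernel μ f p.1 (fun s z => v (p.1 + s, z)) s z) := by
      ext1 z; unfold integralMap; abel
    rw [this, fderiv_fun_neg, norm_neg]
    exact h2

theorem isAdmissible_zero (hκ : 0 ≤ κ) :
    IsAdmissible Zr R c δ z₀ t₂ κ (fun _ => (0 : ι → ℂ)) := by
  refine ⟨differentiableOn_const _, fun p _ => by simpa using hκ, fun p hp => ?_, by simp⟩
  have : dz (fun _ => (0 : ι → ℂ)) p = 0 := by unfold dz; exact fderiv_const_apply _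
  rw [this, norm_zero]; positivity

/-- The Picard iterates from `0` converge geometrically. The two conditions on `c` make the operator
preserve the admissible functions, and contract. -/
theorem IsFuchsian.exists_fixedPoint (h : IsFuchsian μ f z₀ R t₁ K δ L)
    (hr : IsRealSystem Zr μ f t₁ R z₀) (hc : 0 < c)
    (hc1 : 12 * (L * (1 + K / 2)) / (c * δ) ≤ K / 2)
    (hc2 : 12 * (4 * L * (2 / K * (1 + K / 2) + 1)) / (c * δ) ≤ 1 / 2) (ht : t₁ ≤ t₂) :
    ∃ u : ℂ × Z → ι → ℂ, IsAdmissible Zr R c δ z₀ t₂ (K / 2) u ∧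
      ∀ p ∈ region R c δ z₀ t₂, u p = integralMap μ f u p := by
  have hKp := h.K_pos
  set U : ℕ → ℂ × Z → ι → ℂ := fun n => (integralMap μ f)^[n] (fun _ => 0) with hU
  have hU1 : ∀ n, U (n + 1) = integralMap μ f (U n) := fun n => Function.iterate_succ_apply' _ _ _
  have hO := isOpen_region R c δ z₀ t₂
  have hadm : ∀ n, IsAdmissible Zr R c δ z₀ t₂ (K / 2) (U n) := by
    intro n
    induction n with
    | zero => exact isAdmissible_zero (by positivity)
    | succ n ih => rw [hU1]; exact h.integralMap_isAdmissible hr hc hc1 ht ih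
  have hstep : ∀ n, ∀ p ∈ region R c δ z₀ t₂, ‖U (n + 1) p - U n p‖ ≤ K / 2 ^ n ∧
      ‖dz (U (n + 1)) p - dz (U n) p‖ ≤ K / 2 ^ n / √(gap R c δ z₀ p.1.re p.2) := by
    intro n
    induction n with
    | zero =>
      intro p hp
      have a1 := (hadm 1).bound p hp
      have a2 := (hadm 0).bound p hp
      have a3 := (hadm 1).dz_bound p hp
      have a4 := (hadm 0).dz_bound p hp
      refine ⟨(norm_sub_le _ _).trans (by simp only [zero_add, pow_zero]; linarith),
        (norm_sub_le _ _).trans ((add_le_add a3 a4).trans (le_of_eq ?_))⟩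
      simp only [pow_zero]; ring
    | succ n ih =>
      intro p hp
      have := h.integralMap_sub_le hr hc hc1 hc2 ht (hadm (n + 1)) (hadm n) (by positivity) ih p hp
      rw [← hU1, ← hU1] at this
      have e : K / 2 ^ (n + 1) = K / 2 ^ n / 2 := by rw [pow_succ]; field_simp
      rwa [e]
  have hdist : ∀ p ∈ region R c δ z₀ t₂, ∀ n, dist (U n p) (U (n + 1) p) ≤ 2 * K / 2 / 2 ^ n := by
    intro p hp n
    rw [dist_comm, dist_eq_norm]
    exact ((hstep n p hp).1).trans (le_of_eq (by ring))
  have hddist : ∀ p ∈ region R c δ z₀ t₂, ∀ n, dist (dz (U n) p) (dz (U (n + 1)) p) ≤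
      2 * K / √(gap R c δ z₀ p.1.re p.2) / 2 / 2 ^ n := by
    intro p hp n
    rw [dist_comm, dist_eq_norm]
    exact ((hstep n p hp).2).trans (le_of_eq (by ring))
  have hlim : ∀ p ∈ region R c δ z₀ t₂, ∃ x, Tendsto (fun n => U n p) atTop (𝓝 x) := fun p hp =>
    cauchySeq_tendsto_of_complete (cauchySeq_of_le_geometric_two (hdist p hp))
  choose! u hu using hlim
  have hclose : ∀ n, ∀ p ∈ region R c δ z₀ t₂, dist (U n p) (u p) ≤ 2 * K / 2 ^ n := fun n p hp =>
    dist_le_of_le_geometric_two_of_tendsto (hdist p hp) (hu p hp) n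
  have htend : Tendsto (fun n : ℕ => 2 * K / 2 ^ n) atTop (𝓝 0) :=
    tendsto_const_nhds.div_atTop (tendsto_pow_atTop_atTop_of_one_lt one_lt_two)
  have hunif : TendstoUniformlyOn U u atTop (region R c δ z₀ t₂) := by
    rw [Metric.tendstoUniformlyOn_iff]
    intro ε hε
    filter_upwards [htend.eventually (gt_mem_nhds hε)] with n hn p hp
    rw [dist_comm]
    exact (hclose n p hp).trans_lt hn
  have hder : ∀ p ∈ region R c δ z₀ t₂, DifferentiableAt ℂ u p ∧
      Tendsto (fun n => fderiv ℂ (U n) p) atTop (𝓝 (fderiv ℂ u p)) := by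
    intro p hp
    obtain ⟨r, hr, hrs⟩ := Metric.isOpen_iff.1 hO p hp
    exact differentiableAt_of_tendstoUniformlyOn hr (fun n => (hadm n).diff.mono hrs)
      (hunif.mono hrs)
  have hdz : ∀ p ∈ region R c δ z₀ t₂, Tendsto (fun n => dz (U n) p) atTop (𝓝 (dz u p)) := by
    intro p hp
    rw [dz_eq (hder p hp).1]
    have e : ∀ n, dz (U n) p = (fderiv ℂ (U n) p).comp (ContinuousLinearMap.inr ℂ ℂ Z) :=
      fun n => dz_eq ((hadm n).diff.differentiableAt (hO.mem_nhds hp))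
    simp only [e]
    exact (((ContinuousLinearMap.compL ℂ Z (ℂ × Z) (ι → ℂ)).flip
      (ContinuousLinearMap.inr ℂ ℂ Z)).continuous.tendsto _).comp (hder p hp).2
  have hu_adm : IsAdmissible Zr R c δ z₀ t₂ (K / 2) u := by
    refine ⟨fun p hp => (hder p hp).1.differentiableWithinAt, fun p hp => ?_, fun p hp => ?_,
      fun t z hz hp i => ?_⟩
    · exact le_of_tendsto (hu p hp).norm (Eventually.of_forall fun n => (hadm n).bound p hp)
    · exact le_of_tendsto (hdz p hp).norm (Eventually.of_forall fun n => (hadm n).dz_bound p hp)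
    · have h1 : Tendsto (fun n => (U n (t, z) i).im) atTop (𝓝 (u (t, z) i).im) :=
        (Complex.continuous_im.tendsto _).comp ((tendsto_pi_nhds.1 (hu _ hp)) i)
      refine tendsto_nhds_unique h1 ?_
      simp only [(hadm _).real t z hz hp i]
      exact tendsto_const_nhds
  refine ⟨u, hu_adm, fun p hp => ?_⟩
  have hΦ : Tendsto (fun n => U (n + 1) p) atTop (𝓝 (integralMap μ f u p)) := by
    rw [tendsto_iff_dist_tendsto_zero]
    refine squeeze_zero (fun _ => dist_nonneg) (fun n => ?_) (by simpa using htend.div_const 2)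
    rw [hU1, dist_eq_norm]
    refine (h.integralMap_sub_le hr hc hc1 hc2 ht (hadm n) hu_adm (N := 2 * K / 2 ^ n)
      (by positivity) (fun q hq => ⟨?_, ?_⟩) p hp).1
    · rw [← dist_eq_norm]; exact hclose n q hq
    · rw [← dist_eq_norm]
      refine (dist_le_of_le_geometric_two_of_tendsto (hddist q hq) (hdz q hq) n).trans
        (le_of_eq (by ring))
  exact tendsto_nhds_unique ((tendsto_add_atTop_iff_nat 1).2 (hu p hp)) hΦ

/-- A function given by the integral formula satisfies the differential equation. -/
theorem hasDerivAt_of_integral_eq {m : ℂ} {g v : ℝ → ℂ} {T : ℝ}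
    (hg : ContinuousOn g (Ioi T))
    (hint : ∀ t, T < t → IntegrableOn (fun s : ℝ => Complex.exp (-m * s) * g (t + s)) (Ioi 0))
    (hv : ∀ t, T < t → v t = -∫ s in Ioi (0 : ℝ), Complex.exp (-m * s) * g (t + s))
    {t : ℝ} (ht : T < t) : HasDerivAt v (m * v t + g t) t := by
  set G : ℝ → ℂ := fun s => Complex.exp (-m * s) * g s with hG
  have hshift : ∀ a, T < a → (fun s : ℝ => G (a + s)) =
      fun s : ℝ => Complex.exp (-m * a) * (Complex.exp (-m * s) * g (a + s)) := by
    intro a _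
    ext s
    simp only [hG]
    rw [← mul_assoc, ← Complex.exp_add]; push_cast; ring_nf
  have hpre : ∀ a : ℝ, (fun s : ℝ => a + s) ⁻¹' (Ioi a) = Ioi 0 := by intro a; ext s; simp
  have hemb : ∀ a : ℝ, MeasurableEmbedding (fun s : ℝ => a + s) := fun a =>
    (Homeomorph.addLeft a).measurableEmbedding
  have hInt : ∀ a, T < a → IntegrableOn G (Ioi a) ∧
      ∫ s in Ioi a, G s = Complex.exp (-m * a) * -v a := by
    intro a ha
    have hmp := measurePreserving_add_left (volume : Measure ℝ) a
    constructor
    · rw [← hmp.integrableOn_comp_preimage (hemb a), hpre]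
      show IntegrableOn (fun s : ℝ => G (a + s)) (Ioi 0)
      rw [hshift a ha]; exact (hint a ha).const_mul _
    · rw [← hmp.setIntegral_preimage_emb (hemb a) G (Ioi a), hpre, hshift a ha, integral_const_mul,
        hv a ha, neg_neg]
  have hcont : ContinuousOn G (Ioi T) := by
    refine ContinuousOn.mul (by fun_prop) hg
  set a := (T + t) / 2 with ha
  have ha1 : T < a := by rw [ha]; linarith
  have ha2 : a < t := by rw [ha]; linarith
  have hder : HasDerivAt (fun b => ∫ s in a..b, G s) (G t) t := by
    refine intervalIntegral.integral_hasDerivAt_right ?_ ?_ (hcont.continuousAt (Ioi_mem_nhds ht))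
    · refine ContinuousOn.intervalIntegrable (hcont.mono ?_)
      rw [uIcc_of_le ha2.le]
      exact fun s hs => ha1.trans_le hs.1
    · exact hcont.stronglyMeasurableAtFilter isOpen_Ioi t ht
  have hev : v =ᶠ[𝓝 t] fun b => Complex.exp (m * b) * ((∫ s in a..b, G s) -
      ∫ s in Ioi a, G s) := by
    filter_upwards [Ioi_mem_nhds ha2] with b hb
    have hab : a < b := hb
    have h1 := intervalIntegral.integral_Ioi_sub_Ioi (hInt a ha1).1 hab.le
    have h2 : (∫ s in a..b, G s) - ∫ s in Ioi a, G s = Complex.exp (-m * b) * v b := by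
      have h3 := (hInt b (ha1.trans hab)).2
      rw [h3] at h1
      rw [← h1]; ring
    rw [h2, ← mul_assoc, ← Complex.exp_add]; simp
  have hexp : HasDerivAt (fun b : ℝ => Complex.exp (m * b)) (Complex.exp (m * t) * m) t := by
    have h1 : HasDerivAt (fun b : ℝ => m * (b : ℂ)) m t := by
      simpa using (Complex.ofRealCLM.hasDerivAt (x := t)).const_mul m
    exact h1.cexp
  have hfin := (hexp.mul (hder.sub_const (∫ s in Ioi a, G s))).congr_of_eventuallyEq hev
  refine hfin.congr_deriv ?_
  rw [hev.self_of_nhds]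
  simp only [hG]
  have : Complex.exp (m * t) * (Complex.exp (-m * t) * g t) = g t := by
    rw [← mul_assoc, ← Complex.exp_add]; simp
  rw [this]; ring

/-- Existence for equations of Fuchsian type. -/
theorem IsFuchsian.exists_solution (h : IsFuchsian μ f z₀ R t₁ K δ L)
    (hr : IsRealSystem Zr μ f t₁ R z₀) :
    ∃ (T r C : ℝ) (u : ℂ × Z → ι → ℂ), t₁ ≤ T ∧ 0 < r ∧ r ≤ R ∧
      DifferentiableOn ℂ u (strip T ×ˢ ball z₀ r) ∧
      (∀ t ∈ strip T, ∀ z ∈ ball z₀ r, ‖u (t, z)‖ ≤ K / 2 ∧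
        ‖u (t, z)‖ ≤ C * Real.exp (-δ * t.re)) ∧
      (∀ t : ℝ, T < t → ∀ z ∈ ball z₀ r, ∀ i, HasDerivAt (fun s : ℝ => u (s, z) i)
        (μ z i * u (t, z) i + f t z (u (t, z)) (fderiv ℂ (fun z => u (t, z)) z) i) t) ∧
      ∀ t : ℝ, T < t → ∀ z ∈ ball z₀ r, z ∈ Zr → ∀ i, (u (t, z) i).im = 0 := by
  have hKp := h.K_pos
  have hδ := h.δ_pos
  have hLn := h.L_nonneg
  have hRp := h.R_pos
  obtain ⟨c, hc, hc1, hc2⟩ : ∃ c : ℝ, 0 < c ∧ 12 * (L * (1 + K / 2)) / (c * δ) ≤ K / 2 ∧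
      12 * (4 * L * (2 / K * (1 + K / 2) + 1)) / (c * δ) ≤ 1 / 2 := by
    set A := 12 * (L * (1 + K / 2)) with hA
    set B := 12 * (4 * L * (2 / K * (1 + K / 2) + 1)) with hB
    have hA0 : 0 ≤ A := by positivity
    have hB0 : 0 ≤ B := by positivity
    refine ⟨(1 + 2 * A / K + 2 * B) / δ, by positivity, ?_, ?_⟩
    · rw [div_mul_cancel₀ _ hδ.ne', div_le_iff₀ (by positivity)]
      have : K / 2 * (1 + 2 * A / K + 2 * B) = K / 2 + A + K * B := by field_simp
      rw [this]; have : 0 ≤ K * B := by positivity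
      linarith
    · rw [div_mul_cancel₀ _ hδ.ne', div_le_iff₀ (by positivity)]
      have : 0 ≤ 2 * A / K := by positivity
      linarith
  obtain ⟨T, hT1, hT2⟩ : ∃ T : ℝ, t₁ ≤ T ∧ c * Real.exp (-δ * T) ≤ R / 4 := by
    have h1 : Tendsto (fun T : ℝ => c * Real.exp (-δ * T)) atTop (𝓝 0) := by
      have h2 : Tendsto (fun s : ℝ => -δ * s) atTop atBot :=
        tendsto_id.const_mul_atTop_of_neg (by linarith)
      simpa using (Real.tendsto_exp_atBot.comp h2).const_mul c
    obtain ⟨T, hT⟩ := ((h1.eventually (gt_mem_nhds (by positivity : 0 < R / 4))).and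
      (eventually_ge_atTop t₁)).exists
    exact ⟨T, hT.2, hT.1.le⟩
  obtain ⟨u, hu, hfix⟩ := h.exists_fixedPoint hr hc hc1 hc2 hT1
  have hgap : ∀ τ, T < τ → ∀ z ∈ ball z₀ (R / 4), R / 2 ≤ gap R c δ z₀ τ z := by
    intro τ hτ z hz
    rw [mem_ball, dist_eq_norm] at hz
    have : Real.exp (-δ * τ) ≤ Real.exp (-δ * T) := Real.exp_le_exp.2 (by nlinarith)
    unfold gap; nlinarith
  have hmem : strip T ×ˢ ball z₀ (R / 4) ⊆ region R c δ z₀ T := fun p hp =>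
    ⟨hp.1, by have := hgap p.1.re hp.1.1 p.2 hp.2; linarith⟩
  set I := ∫ s in Ioi (0 : ℝ), Real.exp (-δ * s) with hI
  have hkint : ∀ p ∈ region R c δ z₀ T, IntegrableOn
      (fun s => kernel μ f p.1 (fun s z => u (p.1 + s, z)) s p.2) (Ioi 0) := fun p hp =>
    (norm_integral_le_of_gap (B := L * (1 + K / 2)) (τ := p.1.re)
      (F := kernel μ f p.1 (fun s z => u (p.1 + s, z))) hc hδ h.R_le (by positivity)
      (fun s hs => h.differentiableOn_kernel hc ⟨hT1.trans_lt hp.1.1, hp.1.2⟩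
        (hu.isSlice hp.1) hs)
      (fun z hz => h.aestronglyMeasurable_kernel hc hT1 hu (p := (p.1, z)) ⟨hp.1, hz⟩)
      (fun s hs z hz => h.norm_kernel_le hc ⟨hT1.trans_lt hp.1.1, hp.1.2⟩
        (hu.isSlice hp.1) hs hz) hp.2).1
  refine ⟨T, R / 4, L * (1 + K / 2) / √(R / 2) * I, u, hT1, by positivity, by linarith,
    hu.diff.mono hmem, fun t ht z hz => ⟨hu.bound _ (hmem ⟨ht, hz⟩), ?_⟩, fun t ht z hz i => ?_,
    fun t ht z hz hzr i => hu.real t z hzr (hmem ⟨ofReal_mem_strip ht, hz⟩) i⟩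
  · have hp := hmem (a := (t, z)) ⟨ht, hz⟩
    rw [hfix _ hp]
    unfold integralMap
    rw [norm_neg]
    refine (norm_integral_le_of_norm_le (g := fun s => L * (1 + K / 2) / √(R / 2) *
      Real.exp (-δ * t.re) * Real.exp (-δ * s)) ((exp_neg_integrableOn_Ioi 0 hδ).const_mul _)
      ?_).trans (le_of_eq ?_)
    · filter_upwards [ae_restrict_mem measurableSet_Ioi] with s hs
      have hs0 : (0 : ℝ) < s := hs
      have hg := hgap (t.re + s) (by linarith [ht.1]) z hz
      refine (h.norm_kernel_le hc ⟨hT1.trans_lt ht.1, ht.2⟩ (hu.isSlice ht) hs0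
        (by linarith)).trans ?_
      rw [show -δ * (t.re + s) = -δ * t.re + -δ * s by ring, Real.exp_add]
      calc _ ≤ L * (1 + K / 2) * (Real.exp (-δ * t.re) * Real.exp (-δ * s) / √(R / 2)) := by gcongr
        _ = _ := by ring
    · rw [integral_const_mul]; ring
  · have hreg : ∀ a : ℝ, T < a → ((a : ℂ), z) ∈ region R c δ z₀ T := fun a ha =>
      hmem ⟨ofReal_mem_strip ha, hz⟩
    refine hasDerivAt_of_integral_eq (T := T) (m := μ z i) (v := fun s : ℝ => u (s, z) i)
      (g := fun s : ℝ => f s z (u (s, z)) (dz u (s, z)) i) ?_ ?_ ?_ ht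
    · have h1 : ContinuousOn (fun s : ℝ => f s z (u (s, z)) (dz u (s, z))) (Ioi T) :=
        (h.differentiableOn_rhs hc hT1 hu).continuousOn.comp (f := fun s : ℝ => ((s : ℂ), z))
          (by fun_prop) (fun s hs => hreg s hs)
      exact continuousOn_pi.1 h1 i
    · intro a ha
      have h1 := (ContinuousLinearMap.proj (R := ℂ) i : (ι → ℂ) →L[ℂ] ℂ).integrable_comp
        (hkint _ (hreg a ha))
      refine h1.congr (Eventually.of_forall fun s => ?_)
      simp only [Complex.ofReal_add]
      rfl
    · intro a ha
      have h1 := (ContinuousLinearMap.proj (R := ℂ) i : (ι → ℂ) →L[ℂ] ℂ).integral_comp_comm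
        (hkint _ (hreg a ha))
      have h2 := congrFun (hfix _ (hreg a ha)) i
      simp only [integralMap, Pi.neg_apply] at h2
      rw [h2]
      simp only [ContinuousLinearMap.proj_apply] at h1
      rw [← h1]
      simp only [Complex.ofReal_add]
      rfl

end FixedPoint

/-! ### Uniqueness of bounded solutions -/

section Uniqueness

/-- A bounded solution satisfies the integral equation. -/
theorem eq_integral_of_hasDerivAt {m : ℂ} (hm : 0 < m.re) {g v : ℝ → ℂ} {t C δ : ℝ} (hδ : 0 < δ)
    {B : ℝ} (hB : ∀ s, t ≤ s → ‖v s‖ ≤ B) (hg : ∀ s, t ≤ s → ‖g s‖ ≤ C * Real.exp (-δ * s))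
    (hv : ∀ s, t ≤ s → HasDerivAt v (m * v s + g s) s) :
    AEStronglyMeasurable (fun s : ℝ => Complex.exp (-m * s) * g (t + s))
      (volume.restrict (Ioi 0)) ∧
    v t = -∫ s in Ioi (0 : ℝ), Complex.exp (-m * s) * g (t + s) := by
  set w : ℝ → ℂ := fun s => Complex.exp (-m * s) * v (t + s) with hw
  have hexp : ∀ s : ℝ, HasDerivAt (fun b : ℝ => Complex.exp (-m * b))
      (Complex.exp (-m * s) * -m) s := by
    intro s
    have h1 : HasDerivAt (fun b : ℝ => -m * (b : ℂ)) (-m) s := by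
      simpa using (Complex.ofRealCLM.hasDerivAt (x := s)).const_mul (-m)
    exact h1.cexp
  have hder : ∀ s ∈ Ici (0 : ℝ), HasDerivAt w (Complex.exp (-m * s) * g (t + s)) s := by
    intro s hs
    have h1 : HasDerivAt (fun s => v (t + s)) (m * v (t + s) + g (t + s)) s :=
      (hv (t + s) (by linarith [mem_Ici.1 hs])).comp_const_add t s
    refine ((hexp s).mul h1).congr_deriv ?_
    ring
  have hmeas : AEStronglyMeasurable (fun s : ℝ => Complex.exp (-m * s) * g (t + s))
      (volume.restrict (Ioi 0)) := by
    refine (measurable_deriv w).aestronglyMeasurable.congr ?_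
    filter_upwards [ae_restrict_mem measurableSet_Ioi] with s hs
    exact (hder s (mem_Ici.2 (le_of_lt hs))).deriv
  have hle : ∀ s : ℝ, ‖Complex.exp (-m * s)‖ = Real.exp (-m.re * s) := by
    intro s
    rw [Complex.norm_exp]; simp
  have hint : IntegrableOn (fun s : ℝ => Complex.exp (-m * s) * g (t + s)) (Ioi 0) := by
    refine ((exp_neg_integrableOn_Ioi 0 hδ).const_mul (C * Real.exp (-δ * t))).mono' hmeas ?_
    filter_upwards [ae_restrict_mem measurableSet_Ioi] with s hs
    have hs0 : (0 : ℝ) < s := hs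
    rw [norm_mul]
    have h2 := hg (t + s) (by linarith)
    calc _ ≤ 1 * (C * Real.exp (-δ * (t + s))) :=
          mul_le_mul (norm_exp_mul_le hm hs0.le) h2 (norm_nonneg _) zero_le_one
      _ = _ := by rw [show -δ * (t + s) = -δ * t + -δ * s by ring, Real.exp_add]; ring
  have hlim : Tendsto w atTop (𝓝 0) := by
    have h1 : Tendsto (fun s : ℝ => Real.exp (-m.re * s) * B) atTop (𝓝 0) := by
      have h2 : Tendsto (fun s : ℝ => -m.re * s) atTop atBot :=
        tendsto_id.const_mul_atTop_of_neg (by linarith)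
      simpa using (Real.tendsto_exp_atBot.comp h2).mul_const B
    refine squeeze_zero_norm' ?_ h1
    filter_upwards [eventually_ge_atTop 0] with s hs
    simp only [hw]
    rw [norm_mul, hle]
    gcongr
    exact hB _ (by linarith)
  refine ⟨hmeas, ?_⟩
  rw [integral_Ioi_of_hasDerivAt_of_tendsto
    (hder 0 self_mem_Ici).continuousAt.continuousWithinAt
    (fun s hs => hder s (mem_Ici.2 (le_of_lt hs))) hint hlim]
  simp [hw]

variable {Z : Type} [NormedAddCommGroup Z] [NormedSpace ℂ Z] {ι : Type} [Fintype ι]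
  {μ : Z → ι → ℂ} {f : ℂ → Z → (ι → ℂ) → (Z →L[ℂ] (ι → ℂ)) → ι → ℂ}
  {z₀ : Z} {R t₁ K δ L : ℝ} [FiniteDimensional ℂ Z]

/-- `U t`, for real `t > T`, is holomorphic in the position, bounded by `κ`, and solves the
equation. -/
structure IsBoundedSolution (μ : Z → ι → ℂ)
    (f : ℂ → Z → (ι → ℂ) → (Z →L[ℂ] (ι → ℂ)) → ι → ℂ) (z₀ : Z) (r T κ : ℝ)
    (U : ℝ → Z → ι → ℂ) : Prop where
  diff : ∀ t, T < t → DifferentiableOn ℂ (U t) (ball z₀ r)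
  bound : ∀ t, T < t → ∀ z ∈ ball z₀ r, ‖U t z‖ ≤ κ
  ode : ∀ t, T < t → ∀ z ∈ ball z₀ r, ∀ i, HasDerivAt (fun s => U s z i)
    (μ z i * U t z i + f t z (U t z) (fderiv ℂ (U t) z) i) t

theorem IsFuchsian.mono (h : IsFuchsian μ f z₀ R t₁ K δ L) {r : ℝ} (hr : 0 < r) (hrR : r ≤ R) :
    IsFuchsian μ f z₀ r t₁ K δ L := by
  have hb : ball z₀ r ⊆ ball z₀ R := ball_subset_ball hrR
  refine ⟨hr, hrR.trans h.R_le, h.K_pos, h.δ_pos, h.L_nonneg, h.mu_diff.mono hb,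
    fun z hz => h.mu_pos z (hb hz), h.diff.mono ?_, fun t ht z hz => h.bound t ht z (hb hz)⟩
  exact prod_mono le_rfl (prod_mono hb le_rfl)

theorem IsBoundedSolution.norm_fderiv_le {r T κ : ℝ} (hr : 0 < r) {U : ℝ → Z → ι → ℂ}
    (hU : IsBoundedSolution μ f z₀ r T κ U) {t : ℝ} (ht : T < t) {z : Z}
    (hz : z ∈ ball z₀ (r / 2)) : ‖fderiv ℂ (U t) z‖ ≤ 4 * κ / r := by
  have hsub : ball z (r / 2) ⊆ ball z₀ r :=
    ball_subset_ball' (by rw [mem_ball] at hz; linarith)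
  refine (norm_fderiv_le_of_bounded_ball (by positivity : 0 < r / 2) ((hU.diff t ht).mono hsub)
    (fun y hy => hU.bound t ht y (hsub hy))).trans (le_of_eq ?_)
  field_simp; ring

theorem IsBoundedSolution.kernel_eq (h : IsFuchsian μ f z₀ R t₁ K δ L) {r T κ : ℝ} (hr : 0 < r)
    (hrR : r ≤ R) (hT : t₁ ≤ T) (hκ : κ < K) {U : ℝ → Z → ι → ℂ}
    (hU : IsBoundedSolution μ f z₀ r T κ U) {t : ℝ} (ht : T < t) {z : Z}
    (hz : z ∈ ball z₀ (r / 2)) :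
    AEStronglyMeasurable (fun s => kernel μ f t (fun s z => U (t + s) z) s z)
      (volume.restrict (Ioi 0)) ∧
    ∀ i, U t z i = -∫ s in Ioi (0 : ℝ), kernel μ f t (fun s z => U (t + s) z) s z i := by
  have hzr : z ∈ ball z₀ r := ball_subset_ball (by linarith) hz
  have hzR : z ∈ ball z₀ R := ball_subset_ball hrR hzr
  have hLn := h.L_nonneg
  have key : ∀ i, _ := fun i => eq_integral_of_hasDerivAt (h.mu_pos z hzR i)
    (g := fun s => f s z (U s z) (fderiv ℂ (U s) z) i) (v := fun s => U s z i) (t := t)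
    (C := L * (1 + 4 * κ / r)) (B := κ) h.δ_pos
    (fun s hs => (norm_le_pi_norm _ i).trans (hU.bound s (ht.trans_le hs) z hzr))
    (fun s hs => by
      refine (norm_le_pi_norm _ i).trans ((h.bound s
        (ofReal_mem_strip (hT.trans_lt (ht.trans_le hs))) z hzR _
        ((hU.bound s (ht.trans_le hs) z hzr).trans_lt hκ) _).trans ?_)
      have := hU.norm_fderiv_le hr (ht.trans_le hs) hz
      simp only [Complex.ofReal_re]
      calc _ ≤ L * Real.exp (-δ * s) * (1 + 4 * κ / r) := by gcongr
        _ = _ := by ring)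
    (fun s hs => hU.ode s (ht.trans_le hs) z hzr i)
  refine ⟨?_, fun i => ?_⟩
  · refine AEMeasurable.aestronglyMeasurable (aemeasurable_pi_iff.2 fun i => ?_)
    have := (key i).1.aemeasurable
    simp only [Complex.ofReal_add] at this
    exact this
  · have := (key i).2
    simp only [Complex.ofReal_add] at this
    exact this

/-- Uniqueness for equations of Fuchsian type, among bounded solutions: the difference of two
solutions is halved by each application of the integral equation. -/
theorem IsFuchsian.eq_of_isBoundedSolution (h : IsFuchsian μ f z₀ R t₁ K δ L) {r T : ℝ}
    (hr : 0 < r) (hrR : r ≤ R) (hT : t₁ ≤ T) {U V : ℝ → Z → ι → ℂ}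
    (hU : IsBoundedSolution μ f z₀ r T (K / 2) U) (hV : IsBoundedSolution μ f z₀ r T (K / 2) V) :
    ∃ T' r', 0 < r' ∧ ∀ t, T' < t → ∀ z ∈ ball z₀ r', U t z = V t z := by
  have hKp := h.K_pos
  have hδ := h.δ_pos
  have hLn := h.L_nonneg
  have hK2 : K / 2 < K := by linarith
  set ρ := r / 2 with hρ
  have hρp : 0 < ρ := by positivity
  have h' := h.mono hρp (by linarith : ρ ≤ R)
  set κ' := 4 * (K / 2) / r with hκ'
  have hκ'0 : 0 ≤ κ' := by positivity
  obtain ⟨c, hc, hc2⟩ : ∃ c : ℝ, 0 < c ∧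
      12 * (4 * L * (2 / K * (1 + κ') + 1)) / (c * δ) ≤ 1 / 2 := by
    set B := 12 * (4 * L * (2 / K * (1 + κ') + 1)) with hB
    have hB0 : 0 ≤ B := by positivity
    refine ⟨(1 + 2 * B) / δ, by positivity, ?_⟩
    rw [div_mul_cancel₀ _ hδ.ne', div_le_iff₀ (by positivity)]
    linarith
  obtain ⟨T₂, hT1, hT2⟩ : ∃ T₂ : ℝ, T ≤ T₂ ∧ c * Real.exp (-δ * T₂) ≤ ρ / 4 := by
    have h1 : Tendsto (fun T : ℝ => c * Real.exp (-δ * T)) atTop (𝓝 0) := by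
      have h2 : Tendsto (fun s : ℝ => -δ * s) atTop atBot :=
        tendsto_id.const_mul_atTop_of_neg (by linarith)
      simpa using (Real.tendsto_exp_atBot.comp h2).const_mul c
    obtain ⟨T₂, hT⟩ := ((h1.eventually (gt_mem_nhds (by positivity : 0 < ρ / 4))).and
      (eventually_ge_atTop T)).exists
    exact ⟨T₂, hT.2, hT.1.le⟩
  have hinv : ∀ τ z, 0 < gap ρ c δ z₀ τ z → 1 ≤ 1 / √(gap ρ c δ z₀ τ z) := by
    intro τ z hz
    rw [le_div_iff₀ (Real.sqrt_pos.2 hz), one_mul]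
    exact Real.sqrt_le_one.2 (gap_le_one hc h'.R_le _ _)
  have hslice : ∀ W, IsBoundedSolution μ f z₀ r T (K / 2) W → ∀ t : ℝ, T₂ < t →
      IsSlice ρ c δ z₀ (t : ℂ).re (K / 2) κ' (fun s z => W (t + s) z) := by
    intro W hW t ht
    have hm : ∀ τ z, 0 < gap ρ c δ z₀ τ z → z ∈ ball z₀ r := fun τ z hz =>
      ball_subset_ball (by linarith) (mem_ball_of_gap_pos hc hz)
    refine ⟨fun s hs => (hW.diff _ (by linarith)).mono fun z hz => hm _ z hz,
      fun s hs z hz => hW.bound _ (by linarith) z (hm _ z hz), fun s hs z hz => ?_⟩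
    refine (hW.norm_fderiv_le hr (by linarith) (mem_ball_of_gap_pos hc hz)).trans ?_
    have := hinv _ _ hz
    calc κ' = κ' * 1 := (mul_one _).symm
      _ ≤ κ' * (1 / √(gap ρ c δ z₀ ((t : ℂ).re + s) z)) := by gcongr
      _ = _ := by ring
  have hmeas : ∀ W, IsBoundedSolution μ f z₀ r T (K / 2) W → ∀ t : ℝ, T₂ < t → ∀ z,
      0 < gap ρ c δ z₀ (t : ℂ).re z → AEStronglyMeasurable
        (fun s => kernel μ f t (fun s z => W (t + s) z) s z) (volume.restrict (Ioi 0)) :=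
    fun W hW t ht z hz => (hW.kernel_eq h hr hrR hT hK2 (hT1.trans_lt ht)
      (mem_ball_of_gap_pos hc hz)).1
  have hfix : ∀ W, IsBoundedSolution μ f z₀ r T (K / 2) W → ∀ t : ℝ, T₂ < t → ∀ z,
      0 < gap ρ c δ z₀ t z →
      W t z = -∫ s in Ioi (0 : ℝ), kernel μ f t (fun s z => W (t + s) z) s z := by
    intro W hW t ht z hz
    have hst : (t : ℂ) ∈ strip t₁ := ofReal_mem_strip (by linarith)
    have hint := (norm_integral_le_of_gap (B := L * (1 + κ')) (τ := (t : ℂ).re)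
      (F := kernel μ f t (fun s z => W (t + s) z)) hc hδ h'.R_le (by positivity)
      (fun s hs => h'.differentiableOn_kernel hc hst (hslice W hW t ht) hs)
      (fun z hz => hmeas W hW t ht z hz)
      (fun s hs z hz => h'.norm_kernel_le hc hst (hslice W hW t ht) hs hz)
      (z := z) hz).1
    ext i
    rw [(hW.kernel_eq h hr hrR hT hK2 (hT1.trans_lt ht) (mem_ball_of_gap_pos hc hz)).2 i]
    have h1 := (ContinuousLinearMap.proj (R := ℂ) i : (ι → ℂ) →L[ℂ] ℂ).integral_comp_comm hint
    simp only [ContinuousLinearMap.proj_apply] at h1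
    rw [h1, Pi.neg_apply]
  set N₀ := K + 2 * κ' with hN₀
  have hN₀p : 0 ≤ N₀ := by positivity
  have hiter : ∀ n : ℕ, ∀ t : ℝ, T₂ < t → ∀ z, 0 < gap ρ c δ z₀ t z →
      ‖U t z - V t z‖ ≤ N₀ / 2 ^ n ∧
      ‖fderiv ℂ (U t) z - fderiv ℂ (V t) z‖ ≤ N₀ / 2 ^ n / √(gap ρ c δ z₀ t z) := by
    intro n
    induction n with
    | zero =>
      intro t ht z hz
      have hzρ : z ∈ ball z₀ ρ := mem_ball_of_gap_pos hc hz
      have hzr : z ∈ ball z₀ r := ball_subset_ball (by linarith) hzρ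
      have b1 := hU.bound t (by linarith) z hzr
      have b2 := hV.bound t (by linarith) z hzr
      have b3 := hU.norm_fderiv_le hr (by linarith : T < t) hzρ
      have b4 := hV.norm_fderiv_le hr (by linarith : T < t) hzρ
      have b5 := hinv _ _ hz
      refine ⟨(norm_sub_le _ _).trans ?_, (norm_sub_le _ _).trans ?_⟩
      · simp only [pow_zero, div_one]; linarith
      · simp only [pow_zero, div_one]
        calc _ ≤ N₀ * 1 := by linarith
          _ ≤ N₀ * (1 / √(gap ρ c δ z₀ t z)) := by gcongr
          _ = _ := by ring
    | succ n ih =>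
      intro t ht z hz
      have hst : (t : ℂ) ∈ strip t₁ := ofReal_mem_strip (by linarith)
      obtain ⟨h1, h2⟩ := h'.integral_kernel_sub_le (N := N₀ / 2 ^ n) hc hst hκ'0 hc2
        (hslice U hU t ht) (hslice V hV t ht) (hmeas U hU t ht) (hmeas V hV t ht) (by positivity)
        (fun s hs z hz => ih (t + s) (by linarith) z hz) (z := z) hz
      have e : N₀ / 2 ^ (n + 1) = N₀ / 2 ^ n / 2 := by rw [pow_succ]; field_simp
      rw [e]
      constructor
      · rw [hfix U hU t ht z hz, hfix V hV t ht z hz, neg_sub_neg, norm_sub_rev]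
        exact h1
      · have hzb : ball z₀ r ∈ 𝓝 z := isOpen_ball.mem_nhds
          (ball_subset_ball (by linarith) (mem_ball_of_gap_pos hc hz))
        rw [← fderiv_sub ((hU.diff t (by linarith)).differentiableAt hzb)
          ((hV.diff t (by linarith)).differentiableAt hzb)]
        have he : (U t - V t) =ᶠ[𝓝 z] fun z =>
            -((∫ s in Ioi (0 : ℝ), kernel μ f t (fun s z => U (t + s) z) s z) -
              ∫ s in Ioi (0 : ℝ), kernel μ f t (fun s z => V (t + s) z) s z) := by
          filter_upwards [(isOpen_gap_pos ρ c δ z₀ t).mem_nhds hz] with y hy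
          rw [Pi.sub_apply, hfix U hU t ht y hy, hfix V hV t ht y hy]; abel
        rw [he.fderiv_eq, fderiv_fun_neg, norm_neg]
        exact h2
  refine ⟨T₂, ρ / 4, by positivity, fun t ht z hz => ?_⟩
  have hg : 0 < gap ρ c δ z₀ t z := by
    rw [mem_ball, dist_eq_norm] at hz
    have : Real.exp (-δ * t) ≤ Real.exp (-δ * T₂) := Real.exp_le_exp.2 (by nlinarith)
    unfold gap; nlinarith
  have hlim : Tendsto (fun n : ℕ => N₀ / 2 ^ n) atTop (𝓝 0) :=
    tendsto_const_nhds.div_atTop (tendsto_pow_atTop_atTop_of_one_lt one_lt_two)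
  have := ge_of_tendsto' hlim fun n => (hiter n t ht z hg).1
  exact sub_eq_zero.1 (norm_le_zero_iff.1 this)

end Uniqueness

/-! ### From real to complex points -/

section RealPoints

/-- The inclusion of the real plane in its complexification, as a linear map. -/
noncomputable def toCL : Plane →L[ℝ] (Fin 2 → ℂ) :=
  ContinuousLinearMap.pi fun a => Complex.ofRealCLM.comp (EuclideanSpace.proj a)

theorem toC_add (y y' : Plane) : toC (y + y') = toC y + toC y' := map_add toCL y y'

theorem toC_smul (a : ℝ) (y : Plane) : toC (a • y) = (a : ℂ) • toC y := by
  ext i; simp [toC]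

theorem continuous_toC : Continuous toC := toCL.continuous

theorem analyticAt_toC (y : Plane) : AnalyticAt ℝ toC y := toCL.analyticAt y

/-- The real part of a point of the complexified plane. -/
noncomputable def rePart (z : Fin 2 → ℂ) : Plane := WithLp.toLp 2 fun a => (z a).re

/-- The imaginary part of a point of the complexified plane. -/
noncomputable def imPart (z : Fin 2 → ℂ) : Plane := WithLp.toLp 2 fun a => (z a).im

theorem toC_rePart_add (z : Fin 2 → ℂ) : toC (rePart z) + Complex.I • toC (imPart z) = z := by
  ext a; simp [toC, rePart, imPart, mul_comm Complex.I, Complex.re_add_im]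

theorem norm_toC_rePart_sub_le (z : Fin 2 → ℂ) (y : Plane) :
    ‖toC (rePart z) - toC y‖ ≤ ‖z - toC y‖ := by
  refine (pi_norm_le_iff_of_nonneg (norm_nonneg _)).2 fun a => ?_
  refine le_trans ?_ (norm_le_pi_norm (z - toC y) a)
  have : (toC (rePart z) - toC y) a = (((z - toC y) a).re : ℂ) := by simp [toC, rePart]
  rw [this, Complex.norm_real]
  exact Complex.abs_re_le_norm _

theorem norm_toC_imPart_le (z : Fin 2 → ℂ) (y : Plane) : ‖toC (imPart z)‖ ≤ ‖z - toC y‖ := by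
  refine (pi_norm_le_iff_of_nonneg (norm_nonneg _)).2 fun a => ?_
  refine le_trans ?_ (norm_le_pi_norm (z - toC y) a)
  have : (toC (imPart z)) a = (((z - toC y) a).im : ℂ) := by simp [toC, imPart]
  rw [this, Complex.norm_real]
  exact Complex.abs_im_le_norm _

theorem line_mem_ball {y₀ : Plane} {r : ℝ} {z : Fin 2 → ℂ} (hz : z ∈ ball (toC y₀) (r / 4))
    {l : ℂ} (hl : l ∈ ball (0 : ℂ) 2) :
    toC (rePart z) + l • toC (imPart z) ∈ ball (toC y₀) r := by
  rw [mem_ball, dist_eq_norm] at hz ⊢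
  rw [mem_ball, dist_zero_right] at hl
  have h1 := norm_toC_rePart_sub_le z y₀
  have h2 := norm_toC_imPart_le z y₀
  calc ‖toC (rePart z) + l • toC (imPart z) - toC y₀‖
      = ‖(toC (rePart z) - toC y₀) + l • toC (imPart z)‖ := by congr 1; abel
    _ ≤ ‖toC (rePart z) - toC y₀‖ + ‖l‖ * ‖toC (imPart z)‖ := by
      rw [← norm_smul]; exact norm_add_le _ _
    _ ≤ ‖z - toC y₀‖ + 2 * ‖z - toC y₀‖ := by gcongr
    _ < r := by linarith [norm_nonneg (z - toC y₀)]

theorem line_real (z : Fin 2 → ℂ) (x : ℝ) :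
    toC (rePart z) + (x : ℂ) • toC (imPart z) = toC (rePart z + x • imPart z) := by
  rw [toC_add, toC_smul]

/-- A holomorphic function that vanishes at the real points vanishes. -/
theorem eq_zero_of_real {H : (Fin 2 → ℂ) → ℂ} {y₀ : Plane} {r : ℝ}
    (hd : DifferentiableOn ℂ H (ball (toC y₀) r))
    (h0 : ∀ y, toC y ∈ ball (toC y₀) r → H (toC y) = 0) {z : Fin 2 → ℂ}
    (hz : z ∈ ball (toC y₀) (r / 4)) : H z = 0 := by
  set φ : ℂ → ℂ := fun l => H (toC (rePart z) + l • toC (imPart z)) with hφ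
  have hφd : DifferentiableOn ℂ φ (ball 0 2) :=
    hd.comp (by fun_prop) fun l hl => line_mem_ball hz hl
  have han := hφd.analyticOnNhd isOpen_ball
  have hfr : ∃ᶠ l in 𝓝[≠] (0 : ℂ), φ l = 0 := by
    have hlim : Tendsto (fun n : ℕ => (((1 / ((n : ℝ) + 1) : ℝ)) : ℂ)) atTop (𝓝[≠] 0) := by
      rw [tendsto_nhdsWithin_iff]
      constructor
      · have := (Complex.continuous_ofReal.tendsto 0).comp
          (tendsto_one_div_add_atTop_nhds_zero_nat (𝕜 := ℝ))
        rw [Complex.ofReal_zero] at this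
        exact this
      · refine Eventually.of_forall fun n => ?_
        have : (1 / ((n : ℝ) + 1)) ≠ 0 := by positivity
        show (((1 / ((n : ℝ) + 1) : ℝ)) : ℂ) ≠ 0
        exact Complex.ofReal_ne_zero.2 this
    refine hlim.frequently (Eventually.frequently ?_)
    filter_upwards [(hlim.mono_right nhdsWithin_le_nhds).eventually
      (ball_mem_nhds (0 : ℂ) two_pos)] with n hn
    have h1 := line_mem_ball hz hn
    simp only [hφ]
    rw [line_real] at h1 ⊢
    exact h0 _ h1
  have := han.eqOn_zero_of_preconnected_of_frequently_eq_zero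
    (convex_ball (0 : ℂ) 2).isPreconnected (mem_ball_self two_pos) hfr
    (show Complex.I ∈ ball (0 : ℂ) 2 by simp)
  simpa [hφ, toC_rePart_add] using this

/-- A family of bounded holomorphic functions whose restrictions to the real points are jointly
analytic in time and position depends continuously on time: on a suitable complex line, the Taylor
coefficients are derivatives along the real line, hence continuous in time. -/
theorem continuousOn_of_real_analytic {G : ℝ → (Fin 2 → ℂ) → ℂ} {g : ℝ × Plane → ℂ} {y₀ : Plane}
    {r T C : ℝ} (hd : ∀ t, T < t → DifferentiableOn ℂ (G t) (ball (toC y₀) r))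
    (hb : ∀ t, T < t → ∀ z ∈ ball (toC y₀) r, ‖G t z‖ ≤ C)
    (hg : AnalyticOnNhd ℝ g {q | T < q.1 ∧ toC q.2 ∈ ball (toC y₀) r})
    (hGg : ∀ t, T < t → ∀ y, toC y ∈ ball (toC y₀) r → G t (toC y) = g (t, y))
    {z : Fin 2 → ℂ} (hz : z ∈ ball (toC y₀) (r / 4)) :
    ContinuousOn (fun t => G t z) (Ioi T) := by
  set φ : ℝ → ℂ → ℂ := fun s l => G s (toC (rePart z) + l • toC (imPart z)) with hφ
  set D : ℕ → ℝ × ℝ → ℂ := fun k => Nat.rec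
    (fun q => g (q.1, rePart z + q.2 • imPart z)) (fun _ D q => fderiv ℝ D q (0, 1)) k with hD
  have hD0 : D 0 = fun q => g (q.1, rePart z + q.2 • imPart z) := rfl
  have hDs : ∀ k, D (k + 1) = fun q => fderiv ℝ (D k) q (0, 1) := fun k => rfl
  set S : Set (ℝ × ℝ) := {q | T < q.1 ∧ |q.2| < 2} with hS
  have hball : ∀ x : ℝ, |x| < 2 → (x : ℂ) ∈ ball (0 : ℂ) 2 := by
    intro x hx; simpa using hx
  have hDan : ∀ k, AnalyticOnNhd ℝ (D k) S := by
    intro k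
    induction k with
    | zero =>
      rw [hD0]
      intro q hq
      refine (hg (q.1, rePart z + q.2 • imPart z) ⟨hq.1, ?_⟩).comp
        (f := fun q : ℝ × ℝ => (q.1, rePart z + q.2 • imPart z))
        (analyticAt_fst.prod (analyticAt_const.add (analyticAt_snd.smul analyticAt_const)))
      have := line_mem_ball hz (hball _ hq.2)
      rwa [line_real] at this
    | succ k ih =>
      rw [hDs]
      exact fun q hq => (ContinuousLinearMap.apply ℝ ℂ ((0 : ℝ), (1 : ℝ))).analyticAt _ |>.comp (ih.fderiv q hq)
  have hφd : ∀ s, T < s → DifferentiableOn ℂ (φ s) (ball 0 2) := fun s hs =>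
    (hd s hs).comp (by fun_prop) fun l hl => line_mem_ball hz hl
  have hrel : ∀ k, ∀ s, T < s → ∀ x : ℝ, |x| < 2 → iteratedDeriv k (φ s) x = D k (s, x) := by
    intro k
    induction k with
    | zero =>
      intro s hs x hx
      rw [iteratedDeriv_zero, hD0]
      have := line_mem_ball hz (hball _ hx)
      simp only [hφ]
      rw [line_real] at this ⊢
      exact hGg s hs _ this
    | succ k ih =>
      intro s hs x hx
      have h1 : HasDerivAt (iteratedDeriv k (φ s)) (iteratedDeriv (k + 1) (φ s) x) (x : ℂ) := by
        rw [iteratedDeriv_succ]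
        refine DifferentiableAt.hasDerivAt ?_
        have := ((hφd s hs).contDiffOn (n := k + 1) isOpen_ball).contDiffAt
          (isOpen_ball.mem_nhds (hball x hx))
        rw [iteratedDeriv_eq_equiv_comp]
        have h3 := this.differentiableAt_iteratedFDeriv
          (show ((k : ℕ) : WithTop ℕ∞) < k + 1 by exact_mod_cast Nat.lt_succ_self k)
        exact (LinearIsometryEquiv.differentiableAt _).comp _ h3
      have h2 := h1.comp_ofReal
      have h3 : HasDerivAt (fun y : ℝ => D k (s, y)) (D (k + 1) (s, x)) x := by
        rw [hDs]
        have h4 := (hDan k (s, x) ⟨hs, hx⟩).differentiableAt.hasFDerivAt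
        have h5 : HasDerivAt (fun y : ℝ => (s, y)) ((0 : ℝ), (1 : ℝ)) x :=
          (hasDerivAt_const x s).prodMk (hasDerivAt_id x)
        exact h4.comp_hasDerivAt x h5
      have hev : (fun y : ℝ => iteratedDeriv k (φ s) y) =ᶠ[𝓝 x] fun y => D k (s, y) := by
        have : {y : ℝ | |y| < 2} ∈ 𝓝 x := (isOpen_lt continuous_abs continuous_const).mem_nhds hx
        filter_upwards [this] with y hy using ih s hs y hy
      exact h2.unique (h3.congr_of_eventuallyEq hev)
  have hser : ∀ s ∈ Ioi T, G s z = ∑' k : ℕ, ((k.factorial : ℂ)⁻¹ • (Complex.I ^ k • D k (s, 0))) := by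
    intro s hs
    have h1 := Complex.hasSum_taylorSeries_on_ball (hφd s hs)
      (show Complex.I ∈ ball (0 : ℂ) 2 by simp)
    have h2 : φ s Complex.I = G s z := by simp only [hφ, toC_rePart_add]
    rw [h2] at h1
    rw [← h1.tsum_eq]
    congr 1
    ext k
    have := hrel k s hs 0 (by simp)
    rw [Complex.ofReal_zero] at this
    rw [this, sub_zero]
  refine ContinuousOn.congr ?_ hser
  refine continuousOn_tsum (u := fun k : ℕ => C * (2 / 3) ^ k) (fun k => ?_)
    ((summable_geometric_of_lt_one (by norm_num) (by norm_num)).mul_left C) (fun k s hs => ?_)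
  · have h : ContinuousOn (fun s : ℝ => D k (s, 0)) (Ioi T) :=
      ContinuousOn.comp (hDan k).continuousOn (f := fun s : ℝ => (s, (0 : ℝ)))
        (by fun_prop) (fun s hs => ⟨hs, by simp⟩)
    exact ((h.const_smul (Complex.I ^ k)).const_smul (k.factorial : ℂ)⁻¹ :)
  · have h1 := hrel k s hs 0 (by simp)
    rw [Complex.ofReal_zero] at h1
    rw [← h1, norm_smul, norm_smul, norm_pow, Complex.norm_I, one_pow, one_mul, norm_inv,
      Complex.norm_natCast]
    have h2 := Complex.norm_iteratedDeriv_le_of_forall_mem_sphere_norm_le (n := k) (c := (0 : ℂ))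
      (R := 3 / 2) (C := C) (f := φ s) (by norm_num)
      (((hφd s hs).mono (by
        rw [closure_ball _ (by norm_num)]
        exact closedBall_subset_ball (by norm_num))).diffContOnCl)
      (fun l hl => hb s hs _ (line_mem_ball hz (by
        rw [mem_sphere] at hl; rw [mem_ball, hl]; norm_num)))
    have hf : (0 : ℝ) < k.factorial := by exact_mod_cast k.factorial_pos
    calc (k.factorial : ℝ)⁻¹ * ‖iteratedDeriv k (φ s) 0‖
        ≤ (k.factorial : ℝ)⁻¹ * (k.factorial * C / (3 / 2) ^ k) := by gcongr
      _ = C * (2 / 3) ^ k := by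
        have : ((2 : ℝ) / 3) ^ k = 1 / (3 / 2) ^ k := by
          rw [one_div, ← inv_pow]; norm_num
        rw [this]; field_simp

/-- A differential equation that holds at the real points holds at nearby complex points, for a
bounded family of holomorphic extensions of a jointly real-analytic function. -/
theorem IsFuchsian.isBoundedSolution_of_real {ι : Type} [Fintype ι]
    {μ : (Fin 2 → ℂ) → ι → ℂ} {f : ℂ → (Fin 2 → ℂ) → (ι → ℂ) → ((Fin 2 → ℂ) →L[ℂ] (ι → ℂ)) → ι → ℂ}
    {y₀ : Plane} {R t₁ K δ L : ℝ} (h : IsFuchsian μ f (toC y₀) R t₁ K δ L) {r T : ℝ}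
    (hr : 0 < r) (hrR : r ≤ R) (hT : t₁ ≤ T) {V : ℝ → (Fin 2 → ℂ) → ι → ℂ}
    {g : ℝ × Plane → ι → ℂ} (hd : ∀ t, T < t → DifferentiableOn ℂ (V t) (ball (toC y₀) r))
    (hb : ∀ t, T < t → ∀ z ∈ ball (toC y₀) r, ‖V t z‖ ≤ K / 2)
    (hg : AnalyticOnNhd ℝ g {q | T < q.1 ∧ toC q.2 ∈ ball (toC y₀) r})
    (hVg : ∀ t, T < t → ∀ y, toC y ∈ ball (toC y₀) r → V t (toC y) = g (t, y))
    (hode : ∀ t, T < t → ∀ y, toC y ∈ ball (toC y₀) r → ∀ i,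
      HasDerivAt (fun s => V s (toC y) i) (μ (toC y) i * V t (toC y) i
        + f t (toC y) (V t (toC y)) (fderiv ℂ (V t) (toC y)) i) t) :
    IsBoundedSolution μ f (toC y₀) (r / 32) T (K / 2) V := by
  have hsub : ∀ {a b : ℝ}, a ≤ b → ball (toC y₀) a ⊆ ball (toC y₀) b := fun h => ball_subset_ball h
  refine ⟨fun t ht => (hd t ht).mono (hsub (by linarith)),
    fun t ht z hz => hb t ht z (hsub (by linarith) hz), fun t₀ ht₀ z hz i => ?_⟩
  have hK := h.K_pos
  set G : ℝ → (Fin 2 → ℂ) → ℂ := fun t z => f t z (V t z) (fderiv ℂ (V t) z) i with hG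
  have hstrip : ∀ t, T < t → (t : ℂ) ∈ strip t₁ := fun t ht => ofReal_mem_strip (hT.trans_lt ht)
  have hGd : ∀ t, T < t → DifferentiableOn ℂ (G t) (ball (toC y₀) r) := by
    intro t ht
    have h1 := (hd t ht)
    have h2 := differentiableOn_fderiv isOpen_ball h1
    have h3 := h.diff.comp (f := fun z => ((t : ℂ), z, V t z, fderiv ℂ (V t) z))
      ((differentiableOn_const _).prodMk (differentiableOn_id.prodMk (h1.prodMk h2)))
      (fun z hz => ⟨hstrip t ht, hsub hrR hz,
        by rw [mem_ball_zero_iff]; linarith [hb t ht z hz], mem_univ _⟩)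
    exact fun z hz => differentiableWithinAt_pi.1 (h3 z hz) i
  have hVd : ∀ t, T < t → DifferentiableOn ℂ (fun z => V t z i) (ball (toC y₀) r) :=
    fun t ht z hz => differentiableWithinAt_pi.1 (hd t ht z hz) i
  have hVb : ∀ t, T < t → ∀ z ∈ ball (toC y₀) r, ‖V t z i‖ ≤ K / 2 :=
    fun t ht z hz => (norm_le_pi_norm _ i).trans (hb t ht z hz)
  set C := L * Real.exp (-δ * T) * (1 + 2 * (K / 2) / (r / 2)) with hC
  have hGb : ∀ t, T < t → ∀ z ∈ ball (toC y₀) (r / 2), ‖G t z‖ ≤ C := by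
    intro t ht z hz
    have hz' : ball z (r / 2) ⊆ ball (toC y₀) r :=
      ball_subset_ball' (by rw [mem_ball] at hz; linarith)
    have h1 := norm_fderiv_le_of_bounded_ball (half_pos hr) ((hd t ht).mono hz')
      fun x hx => hb t ht x (hz' hx)
    have hzr := hz' (mem_ball_self (half_pos hr))
    have h2 := h.bound t (hstrip t ht) z (hsub hrR hzr) (V t z) (by linarith [hb t ht z hzr])
      (fderiv ℂ (V t) z)
    refine (norm_le_pi_norm _ i).trans (h2.trans ?_)
    have := h.L_nonneg
    have := h.δ_pos
    have hexp : Real.exp (-δ * t) ≤ Real.exp (-δ * T) := Real.exp_le_exp.2 (by nlinarith)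
    rw [Complex.ofReal_re, hC]
    gcongr
  have hgi : AnalyticOnNhd ℝ (fun q => g q i) {q | T < q.1 ∧ toC q.2 ∈ ball (toC y₀) r} :=
    fun q hq => ((ContinuousLinearMap.proj (R := ℝ) (φ := fun _ : ι => ℂ) i).analyticAt _).comp
      (hg q hq)
  have hVgi : ∀ t, T < t → ∀ y, toC y ∈ ball (toC y₀) r → V t (toC y) i = g (t, y) i :=
    fun t ht y hy => by rw [hVg t ht y hy]
  -- the right-hand side is analytic at the real points, because the time derivative is
  have hμan : AnalyticOnNhd ℝ (fun q : ℝ × Plane => μ (toC q.2) i)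
      {q | T < q.1 ∧ toC q.2 ∈ ball (toC y₀) r} := by
    intro q hq
    have h1 : DifferentiableOn ℂ (fun z => μ z i) (ball (toC y₀) R) := fun z hz =>
      differentiableWithinAt_pi.1 (h.mu_diff z hz) i
    have h2 := (analyticOnNhd_of_differentiableOn isOpen_ball h1 (toC q.2)
      (hsub hrR hq.2)).restrictScalars (𝕜 := ℝ)
    exact h2.comp (f := fun q : ℝ × Plane => toC q.2) ((analyticAt_toC q.2).comp analyticAt_snd)
  have hGan : AnalyticOnNhd ℝ (fun q : ℝ × Plane => fderiv ℝ (fun q => g q i) q (1, 0)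
      - μ (toC q.2) i * g q i) {q | T < q.1 ∧ toC q.2 ∈ ball (toC y₀) (r / 2)} := by
    intro q hq
    have hq' : q ∈ {q : ℝ × Plane | T < q.1 ∧ toC q.2 ∈ ball (toC y₀) r} :=
      ⟨hq.1, hsub (by linarith) hq.2⟩
    exact (((ContinuousLinearMap.apply ℝ ℂ ((1 : ℝ), (0 : Plane))).analyticAt _).comp
      (hgi.fderiv q hq')).sub ((hμan q hq').mul (hgi q hq'))
  have hGg : ∀ t, T < t → ∀ y, toC y ∈ ball (toC y₀) (r / 2) →
      G t (toC y) = (fun q : ℝ × Plane => fderiv ℝ (fun q => g q i) q (1, 0)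
        - μ (toC q.2) i * g q i) (t, y) := by
    intro t ht y hy
    have hy' := hsub (show r / 2 ≤ r by linarith) hy
    have h1 := (hgi (t, y) ⟨ht, hy'⟩).differentiableAt.hasFDerivAt.comp_hasDerivAt
      (f := fun s : ℝ => (s, y)) t ((hasDerivAt_id t).prodMk (hasDerivAt_const t y))
    have h2 : HasDerivAt (fun s => V s (toC y) i)
        (fderiv ℝ (fun q => g q i) (t, y) (1, 0)) t := by
      refine h1.congr_of_eventuallyEq ?_
      filter_upwards [lt_mem_nhds ht] with s hs using hVgi s hs y hy'
    have h3 := h2.unique (hode t ht y hy' i)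
    simp only [hG]
    rw [h3, ← hVgi t ht y hy']
    ring
  have hcV : ∀ z ∈ ball (toC y₀) (r / 8), ContinuousOn (fun t => V t z i) (Ioi T) := fun z hz =>
    continuousOn_of_real_analytic hVd hVb hgi hVgi (hsub (by linarith) hz)
  have hcG : ∀ z ∈ ball (toC y₀) (r / 8), ContinuousOn (fun t => G t z) (Ioi T) := fun z hz =>
    continuousOn_of_real_analytic (fun t ht => (hGd t ht).mono (hsub (by linarith))) hGb hGan hGg
      (hsub (by linarith) hz)
  set H : ℝ → (Fin 2 → ℂ) → ℂ := fun t z => μ z i * V t z i + G t z with hH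
  have hcH : ∀ z ∈ ball (toC y₀) (r / 8), ContinuousOn (fun t => H t z) (Ioi T) := fun z hz =>
    (continuousOn_const.mul (hcV z hz)).add (hcG z hz)
  have hμd : DifferentiableOn ℂ (fun z => μ z i) (ball (toC y₀) (r / 8)) := fun z hz =>
    differentiableWithinAt_pi.1 ((h.mu_diff z (hsub (by linarith) hz)).mono
      (hsub (by linarith))) i
  have hIoc : ∀ a b, T < a → T < b → DifferentiableOn ℂ (fun z => ∫ s in Ioc a b, H s z)
      (ball (toC y₀) (r / 8)) := by
    intro a b ha hb'
    have hIs : Ioc a b ⊆ Ioi T := fun s hs => ha.trans hs.1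
    refine differentiableOn_integral_of_dominated isOpen_ball ?_ (fun z hz => ?_) (fun z hz => ?_)
    · filter_upwards [ae_restrict_mem measurableSet_Ioc] with s hs
      exact (hμd.mul ((hVd s (hIs hs)).mono (hsub (by linarith)))).add
        ((hGd s (hIs hs)).mono (hsub (by linarith)))
    · exact ((hcH z hz).mono hIs).aestronglyMeasurable measurableSet_Ioc
    · obtain ⟨ρ, hρ, hρs, B, hB⟩ := exists_bounded_ball isOpen_ball hμd.continuousOn hz
      refine ⟨ρ, hρ, fun _ => B * (K / 2) + C, integrable_const _, ?_⟩
      filter_upwards [ae_restrict_mem measurableSet_Ioc] with s hs y hy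
      have hy8 := hρs hy
      refine (norm_add_le _ _).trans (add_le_add ?_ (hGb s (hIs hs) y (hsub (by linarith) hy8)))
      rw [norm_mul]
      exact mul_le_mul (hB y hy) (hVb s (hIs hs) y (hsub (by linarith) hy8)) (norm_nonneg _)
        ((norm_nonneg _).trans (hB y hy))
  have hint : ∀ a b, T < a → T < b → ∀ z ∈ ball (toC y₀) (r / 8),
      IntervalIntegrable (fun s => H s z) volume a b := fun a b ha hb' z hz =>
    ((hcH z hz).mono fun s hs => (lt_min ha hb').trans_le hs.1).intervalIntegrable
  have hmain : ∀ t, T < t → V t z i - V t₀ z i - ∫ s in t₀..t, H s z = 0 := by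
    intro t ht
    refine eq_zero_of_real (H := fun z => V t z i - V t₀ z i - ∫ s in t₀..t, H s z) (r := r / 8)
      (y₀ := y₀) ?_ ?_ (hsub (by linarith) hz)
    · refine (((hVd t ht).mono (hsub (by linarith))).sub
        ((hVd t₀ ht₀).mono (hsub (by linarith)))).sub ?_
      exact (hIoc t₀ t ht₀ ht).sub (hIoc t t₀ ht ht₀)
    · intro y hy
      have : ∫ s in t₀..t, H s (toC y) = V t (toC y) i - V t₀ (toC y) i := by
        refine intervalIntegral.integral_eq_sub_of_hasDerivAt (f := fun s => V s (toC y) i)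
          (fun s hs => ?_)
          (hint t₀ t ht₀ ht _ hy)
        exact hode s ((lt_min ht₀ ht).trans_le hs.1) y (hsub (by linarith) hy) i
      simp only [this, sub_self]
  have hz8 : z ∈ ball (toC y₀) (r / 8) := hsub (by linarith) hz
  have hFTC : HasDerivAt (fun t => ∫ s in t₀..t, H s z) (H t₀ z) t₀ :=
    intervalIntegral.integral_hasDerivAt_right (hint t₀ t₀ ht₀ ht₀ z hz8)
      ((hcH z hz8).stronglyMeasurableAtFilter isOpen_Ioi t₀ ht₀)
      ((hcH z hz8).continuousAt (Ioi_mem_nhds ht₀))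
  refine (hFTC.const_add (V t₀ z i)).congr_of_eventuallyEq ?_
  filter_upwards [lt_mem_nhds ht₀] with t ht
  have := hmain t ht
  linear_combination this

end RealPoints

/-! ### Complexification of real-analytic functions -/

section Complexification

/-- The complexification of a real power series on the plane. -/
noncomputable def complexSeries (p : FormalMultilinearSeries ℝ Plane ℝ) :
    FormalMultilinearSeries ℂ (Fin 2 → ℂ) ℂ := fun n =>
  ∑ σ : Fin n → Fin 2, ((p n fun j => EuclideanSpace.single (σ j) 1 : ℝ) : ℂ) •
    (ContinuousMultilinearMap.mkPiAlgebra ℂ (Fin n) ℂ).compContinuousLinearMap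
      fun j => ContinuousLinearMap.proj (R := ℂ) (φ := fun _ : Fin 2 => ℂ) (σ j)

theorem norm_complexSeries_le (p : FormalMultilinearSeries ℝ Plane ℝ) (n : ℕ) :
    ‖complexSeries p n‖ ≤ 2 ^ n * ‖p n‖ := by
  have h : ∀ σ : Fin n → Fin 2, ‖((p n fun j => EuclideanSpace.single (σ j) 1 : ℝ) : ℂ) •
    (ContinuousMultilinearMap.mkPiAlgebra ℂ (Fin n) ℂ).compContinuousLinearMap
      fun j => ContinuousLinearMap.proj (R := ℂ) (φ := fun _ : Fin 2 => ℂ) (σ j)‖ ≤ ‖p n‖ := by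
    intro σ
    rw [norm_smul, Complex.norm_real]
    have h1 : ‖p n fun j => EuclideanSpace.single (σ j) 1‖ ≤ ‖p n‖ := by
      refine ((p n).le_opNorm _).trans ?_
      simp
    have h2 : ‖(ContinuousMultilinearMap.mkPiAlgebra ℂ (Fin n) ℂ).compContinuousLinearMap
      fun j => ContinuousLinearMap.proj (R := ℂ) (φ := fun _ : Fin 2 => ℂ) (σ j)‖ ≤ 1 := by
      refine ContinuousMultilinearMap.opNorm_le_bound zero_le_one fun m => ?_
      simp only [ContinuousMultilinearMap.compContinuousLinearMap_apply,
        ContinuousMultilinearMap.mkPiAlgebra_apply, ContinuousLinearMap.proj_apply, norm_prod,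
        one_mul]
      exact Finset.prod_le_prod (fun _ _ => norm_nonneg _) fun j _ => norm_le_pi_norm _ _
    exact (mul_le_mul h1 h2 (norm_nonneg _) (norm_nonneg _)).trans (mul_one _).le
  refine (norm_sum_le _ _).trans ((Finset.sum_le_sum fun σ _ => h σ).trans ?_)
  simp

theorem complexSeries_toC (p : FormalMultilinearSeries ℝ Plane ℝ) (n : ℕ) (y : Plane) :
    complexSeries p n (fun _ => toC y) = ((p n fun _ => y : ℝ) : ℂ) := by
  have hy : y = ∑ a, y a • EuclideanSpace.single a (1 : ℝ) := by
    ext i; fin_cases i <;> simp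
  have h : (p n fun _ => y) = ∑ σ : Fin n → Fin 2, (∏ j, y (σ j)) *
      p n fun j => EuclideanSpace.single (σ j) (1 : ℝ) := by
    conv_lhs => rw [hy]
    rw [(p n).map_sum]
    refine Finset.sum_congr rfl fun σ _ => ?_
    rw [(p n).map_smul_univ, smul_eq_mul]
  rw [h]
  simp [complexSeries, toC, mul_comm]

/-- A real-analytic function on the plane extends holomorphically near every point. -/
theorem exists_hol_extension {f : Plane → ℝ} {y₀ : Plane} (hf : AnalyticAt ℝ f y₀) :
    ∃ r > 0, ∃ F : (Fin 2 → ℂ) → ℂ, DifferentiableOn ℂ F (ball (toC y₀) r) ∧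
      ∀ y, toC y ∈ ball (toC y₀) r → F (toC y) = f y := by
  obtain ⟨p, ρ, hp⟩ := hf
  obtain ⟨s, hs0, hsρ⟩ := ENNReal.lt_iff_exists_nnreal_btwn.1 hp.r_pos
  have hs : (0 : ℝ) < s := by exact_mod_cast hs0
  obtain ⟨C, hC, hCp⟩ := p.norm_mul_pow_le_of_lt_radius (hsρ.trans_le hp.r_le)
  have hrad : ((s / 2 : NNReal) : ENNReal) ≤ (complexSeries p).radius := by
    refine (complexSeries p).le_radius_of_bound C fun n => ?_
    calc ‖complexSeries p n‖ * ((s / 2 : NNReal) : ℝ) ^ n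
        ≤ (2 ^ n * ‖p n‖) * ((s / 2 : NNReal) : ℝ) ^ n := by
          gcongr; exact norm_complexSeries_le p n
      _ = ‖p n‖ * (s : ℝ) ^ n := by
          push_cast
          rw [div_pow]; field_simp
      _ ≤ C := hCp n
  have hpos : 0 < (complexSeries p).radius :=
    lt_of_lt_of_le (by rw [ENNReal.coe_pos, ← NNReal.coe_pos]; push_cast; positivity) hrad
  have hq := (complexSeries p).hasFPowerSeriesOnBall hpos
  have hmem : ∀ z : Fin 2 → ℂ, ‖z‖ < s / 2 → z ∈ Metric.eball (0 : Fin 2 → ℂ)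
      (complexSeries p).radius := by
    intro z hz
    rw [Metric.mem_eball, edist_zero_right]
    refine lt_of_lt_of_le ?_ hrad
    rw [← ofReal_norm, ENNReal.ofReal_lt_coe_iff (norm_nonneg _)]
    push_cast; exact hz
  refine ⟨s / 2, by positivity, fun z => (complexSeries p).sum (z - toC y₀), ?_, ?_⟩
  · refine hq.differentiableOn.comp (f := fun z => z - toC y₀) (by fun_prop) fun z hz => ?_
    exact hmem _ (by rwa [mem_ball, dist_eq_norm] at hz)
  · intro y hy
    rw [mem_ball, dist_eq_norm] at hy
    have hsub : toC y - toC y₀ = toC (y - y₀) := (map_sub toCL y y₀).symm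
    have h1 := hq.hasSum (hmem _ hy)
    rw [zero_add] at h1
    have hy' : ‖y - y₀‖ < s := by
      have h2 : ∀ a, ‖(y - y₀) a‖ ≤ ‖toC (y - y₀)‖ := by
        intro a
        rw [← Complex.norm_real]
        exact norm_le_pi_norm (toC (y - y₀)) a
      rw [hsub] at hy
      have h3 : ‖y - y₀‖ ^ 2 ≤ (2 * ‖toC (y - y₀)‖) ^ 2 := by
        rw [EuclideanSpace.norm_sq_eq, Fin.sum_univ_two]
        nlinarith [h2 0, h2 1, norm_nonneg ((y - y₀) 0), norm_nonneg ((y - y₀) 1),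
          pow_le_pow_left₀ (norm_nonneg _) (h2 0) 2, pow_le_pow_left₀ (norm_nonneg _) (h2 1) 2]
      have h4 := abs_le_of_sq_le_sq h3 (by positivity)
      rw [abs_of_nonneg (norm_nonneg _)] at h4
      linarith
    have h2 := hp.hasSum (y := y - y₀) (by
      rw [Metric.mem_eball, edist_zero_right]
      refine lt_trans ?_ hsρ
      rw [← ofReal_norm, ENNReal.ofReal_lt_coe_iff (norm_nonneg _)]
      exact hy')
    rw [add_sub_cancel] at h2
    have h3 := Complex.hasSum_ofReal.2 h2
    refine h1.unique ?_
    rw [hsub]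
    simpa only [complexSeries_toC] using h3

theorem exists_pos_forall_le {ι : Type*} [Finite ι] {r : ι → ℝ} (hr : ∀ i, 0 < r i) :
    ∃ s > 0, ∀ i, s ≤ r i := by
  have h : ∀ᶠ s in 𝓝[>] (0 : ℝ), ∀ i, s ≤ r i := eventually_all.2 fun i =>
    nhdsWithin_le_nhds (eventually_le_nhds (hr i))
  obtain ⟨s, h1, h2⟩ := (h.and self_mem_nhdsWithin).exists
  exact ⟨s, h2, h1⟩

theorem exists_hol_extension_family {β : Type*} [Finite β] {f : β → Plane → ℝ} {y₀ : Plane}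
    (hf : ∀ i, AnalyticAt ℝ (f i) y₀) :
    ∃ r > 0, ∃ F : β → (Fin 2 → ℂ) → ℂ, (∀ i, DifferentiableOn ℂ (F i) (ball (toC y₀) r)) ∧
      ∀ i y, toC y ∈ ball (toC y₀) r → F i (toC y) = f i y := by
  choose r hr F hF hFf using fun i => exists_hol_extension (hf i)
  obtain ⟨s, hs, hsr⟩ := exists_pos_forall_le hr
  exact ⟨s, hs, F, fun i => (hF i).mono (ball_subset_ball (hsr i)),
    fun i y hy => hFf i y (ball_subset_ball (hsr i) hy)⟩

end Complexification

/-! ### The system as an algebraic expression in jets -/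

section Generic

variable {𝕜 : Type} [Field 𝕜]

/-- The inverse of a two by two matrix, written out. -/
def inv2 (S : Fin 2 → Fin 2 → 𝕜) (a b : Fin 2) : 𝕜 :=
  (S 0 0 * S 1 1 - S 0 1 * S 1 0)⁻¹ * !![S 1 1, -S 0 1; -S 1 0, S 0 0] a b

/-- The expression `dLow` over a field, with the inverse `B` of `S` as a separate argument. -/
def dLowG (B : Fin 2 → Fin 2 → 𝕜) (P : Fin 2 → Fin 2 → Fin 2 → 𝕜) (a b d : Fin 2) : 𝕜 :=
  -∑ m, ∑ n, B b m * B d n * P a m n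

/-- The expression `ddLow` over a field. -/
def ddLowG (B : Fin 2 → Fin 2 → 𝕜) (P : Fin 2 → Fin 2 → Fin 2 → 𝕜)
    (Q : Fin 2 → Fin 2 → Fin 2 → Fin 2 → 𝕜) (g a b d : Fin 2) : 𝕜 :=
  -∑ m, ∑ n, (dLowG B P g b m * B d n * P a m n + B b m * dLowG B P g d n * P a m n
    + B b m * B d n * Q g a m n)

/-- The expression `diffC` over a field. -/
def diffCG (S B : Fin 2 → Fin 2 → 𝕜) (P : Fin 2 → Fin 2 → Fin 2 → 𝕜) (c a b : Fin 2) : 𝕜 :=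
  ∑ d, (1 / 2) * S c d * (dLowG B P a b d + dLowG B P b a d - dLowG B P d a b)

/-- The expression `dDiffC` over a field. -/
def dDiffCG (S B : Fin 2 → Fin 2 → 𝕜) (P : Fin 2 → Fin 2 → Fin 2 → 𝕜)
    (Q : Fin 2 → Fin 2 → Fin 2 → Fin 2 → 𝕜) (g c a b : Fin 2) : 𝕜 :=
  ∑ d, ((1 / 2) * P g c d * (dLowG B P a b d + dLowG B P b a d - dLowG B P d a b)
    + (1 / 2) * S c d * (ddLowG B P Q g a b d + ddLowG B P Q g b a d - ddLowG B P Q g d a b))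

/-- The expression `scalarCurv` over a field. -/
def scalarCurvG (Rb : Fin 2 → Fin 2 → 𝕜) (S B : Fin 2 → Fin 2 → 𝕜)
    (P : Fin 2 → Fin 2 → Fin 2 → 𝕜) (Q : Fin 2 → Fin 2 → Fin 2 → Fin 2 → 𝕜) : 𝕜 :=
  ∑ a, ∑ b, S a b * (Rb a b + ∑ c, dDiffCG S B P Q c c a b - ∑ c, dDiffCG S B P Q b c a c
    + ∑ c, ∑ d, diffCG S B P c c d * diffCG S B P d a b
    - ∑ c, ∑ d, diffCG S B P c b d * diffCG S B P d a c)

end Generic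

/-- Labels of the background quantities at a point: `σ̃^{ab}` and its partial derivatives, the
Christoffel symbols and the Ricci curvature of `σ̃`, the first and second partial derivatives of
`φ̃, λ̃, ṽ, w̃`, and `e^{λ̃}, ṽ, w̃`. -/
inductive BIdx
  | sU (a b : Fin 2)
  | dsU (c a b : Fin 2)
  | gam (c a b : Fin 2)
  | ric (a b : Fin 2)
  | dphi (a : Fin 2)
  | ddphi (a b : Fin 2)
  | dlam (a : Fin 2)
  | ddlam (a b : Fin 2)
  | dv (a : Fin 2)
  | ddv (a b : Fin 2)
  | dw (a : Fin 2)
  | ddw (a b : Fin 2)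
  | elam
  | v
  | w
  deriving Fintype

/-- Labels of the exponential factors in the system: `e^{-ε_σ t}`, `e^{-ε_{σ'} t}`,
`e^{-ε_{φ'} t}`, `e^{-ε_k t}`, `e^{(ε_σ - ε_k) t}`, `e^{(ε_{σ'} - ε_k) t}`, `e^{(ε_k - ṽ) t}`,
`e^{(ε_p - ε_k) t}`, `e^{(ε_p - ṽ) t}`, `e^{(ε_φ - ε_p) t}`, `e^{(ε_{φ'} - ε_p) t}`. -/
inductive EIdx
  | s | sc | phc | k | sk | sck | kv | pk | pv | phip | phicp

instance : Finite EIdx := by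
  refine Finite.of_surjective
    (![.s, .sc, .phc, .k, .sk, .sck, .kv, .pk, .pv, .phip, .phicp] : Fin 11 → EIdx) fun i => ?_
  cases i
  exacts [⟨0, rfl⟩, ⟨1, rfl⟩, ⟨2, rfl⟩, ⟨3, rfl⟩, ⟨4, rfl⟩, ⟨5, rfl⟩, ⟨6, rfl⟩, ⟨7, rfl⟩, ⟨8, rfl⟩,
    ⟨9, rfl⟩, ⟨10, rfl⟩]

section Jets

variable {𝕜 : Type} [Field 𝕜] (b : BIdx → 𝕜) (x : EIdx → 𝕜) (t : 𝕜) (u : Idx → 𝕜)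
  (w : Fin 2 → Idx → 𝕜)

/-- `σ^{ac}` from the values `u` of the unknowns. -/
def sigmaJ (a c : Fin 2) : 𝕜 := b (.sU a c) + x .s * u (.sig a c)

/-- `∂_d σ^{ac}` from the derivatives `w` of the unknowns. -/
def dsigmaJ (d a c : Fin 2) : 𝕜 := b (.dsU d a c) + x .s * w d (.sig a c)

/-- `σ^{ad}_{[c]}`. -/
def sigmaCJ (c a d : Fin 2) : 𝕜 := x .sc * u (.sigc c a d)

/-- `∇̃_d σ^{ae}_{[c]}`. -/
def dSigmaCJ (d c a e : Fin 2) : 𝕜 :=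
  x .sc * w d (.sigc c a e) - ∑ m, b (.gam m d c) * sigmaCJ x u m a e
    + ∑ m, b (.gam a d m) * sigmaCJ x u c m e + ∑ m, b (.gam e d m) * sigmaCJ x u c a m

/-- `φ_{[c]}`. -/
def phiCJ (c : Fin 2) : 𝕜 := b (.dphi c) - b (.dw c) * t + x .phc * u (.phic c)

/-- `∂_a φ_{[c]}`. -/
def dphiCJ (a c : Fin 2) : 𝕜 := b (.ddphi a c) - b (.ddw a c) * t + x .phc * w a (.phic c)

/-- `∂_a λ`. -/
def lamJ (a : Fin 2) : 𝕜 := b (.dlam a) - b (.dv a) * t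

/-- `∂_a ∂_c λ`. -/
def dlamJ (a c : Fin 2) : 𝕜 := b (.ddlam a c) - b (.ddv a c) * t

/-- `σ^{am} δk_m^c`. -/
def sigKJ (a c : Fin 2) : 𝕜 := ∑ m, sigmaJ b x u a m * u (.k m c)

/-- `∂_d (σ^{am} δk_m^c)`. -/
def dsigKJ (d a c : Fin 2) : 𝕜 :=
  ∑ m, (dsigmaJ b x w d a m * u (.k m c) + sigmaJ b x u a m * w d (.k m c))

/-- `∇̃_c (σ^{am} δk_m^e)`. -/
def covKJ (c a e : Fin 2) : 𝕜 :=
  dsigKJ b x u w c a e + ∑ d, b (.gam a c d) * sigKJ b x u d e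
    + ∑ d, b (.gam e c d) * sigKJ b x u a d

/-- `Γ^c_{ad}(σ)`. -/
def gammaSJ (c a d : Fin 2) : 𝕜 :=
  b (.gam c a d) + diffCG (sigmaJ b x u) (inv2 (sigmaJ b x u)) (sigmaCJ x u) c a d

/-- `Γ^c_{ae}(γ)`. -/
def gammaGJ (c a e : Fin 2) : 𝕜 :=
  gammaSJ b x u c a e
    + (1 / 2) * ((1 : Matrix (Fin 2) (Fin 2) 𝕜) c e * lamJ b t a
      + (1 : Matrix (Fin 2) (Fin 2) 𝕜) c a * lamJ b t e
      - ∑ d, sigmaJ b x u c d * inv2 (sigmaJ b x u) a e * lamJ b t d)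

/-- `R(σ)`. -/
def curvJ : 𝕜 :=
  scalarCurvG (fun a c => b (.ric a c)) (sigmaJ b x u) (inv2 (sigmaJ b x u)) (sigmaCJ x u)
    (dSigmaCJ b x u w)

/-- `Δ_σ λ`. -/
def laplaceJ : 𝕜 :=
  ∑ a, ∑ c, sigmaJ b x u a c * (dlamJ b t a c - ∑ d, gammaSJ b x u d a c * lamJ b t d)

/-- The symmetric tensor `X_{ma}` with `F_a^b = e^λ̃ (½ δ_a^b (R - Δ λ) - σ^{bm} X_{ma})`. -/
def hessJ (m a : Fin 2) : 𝕜 :=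
  lamJ b t m * lamJ b t a + dlamJ b t m a - ∑ d, gammaGJ b x t u d a m * lamJ b t d
    + 2 * (phiCJ b x t u m * phiCJ b x t u a)

/-- The source `F_a^c`. -/
def sourceKJ (a c : Fin 2) : 𝕜 :=
  b .elam * ((1 / 2) * (1 : Matrix (Fin 2) (Fin 2) 𝕜) a c * (curvJ b x u w - laplaceJ b x t u)
    - ∑ m, sigmaJ b x u c m * hessJ b x t u m a)

/-- The source `F`. -/
def sourcePJ : 𝕜 :=
  b .elam * ∑ a, ∑ c, sigmaJ b x u a c *
    (dphiCJ b x t w a c - ∑ d, gammaSJ b x u d a c * phiCJ b x t u d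
      + phiCJ b x t u c * lamJ b t a)

/-- `δk_m^m`. -/
def trJ : 𝕜 := ∑ m, u (.k m m)

/-- The right-hand sides of the system. -/
def rhsJ : Idx → 𝕜
  | .sig a c => 2 * x .sk * sigKJ b x u a c
  | .phi => x .phip * u .p
  | .k a c => x .k * trJ u * u (.k a c) + x .kv * sourceKJ b x t u w a c
  | .p => -x .pk * b .w * trJ u + x .k * u .p * trJ u + x .pv * sourcePJ b x t u w
  | .sigc c a d => 2 * x .sck * covKJ b x u w c d a
  | .phic c => x .phicp * w c .p

end Jets

/-! ### Independent components -/

/-- Labels of the independent components of `U`: the symmetric tensors in their three components,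
and `δk` through its trace, the difference of its diagonal entries and the entry `δk_0^1`. The
entry `δk_1^0` is determined by the symmetry of `σ^{am} δk_m^b`. In these variables the singular
part of the system is diagonal. -/
inductive RIdx
  | sig (n : Fin 3)
  | phi
  | tr
  | df
  | kx
  | p
  | sigc (c : Fin 2) (n : Fin 3)
  | phic (c : Fin 2)
  deriving Fintype

/-- The label of the unordered pair `{a, c}`. -/
def symIdx (a c : Fin 2) : Fin 3 := ⟨a + c, by omega⟩

/-- The smaller element of the pair with a given label. -/
def fstIdx : Fin 3 → Fin 2 := ![0, 0, 1]

/-- The larger element of the pair with a given label. -/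
def sndIdx : Fin 3 → Fin 2 := ![0, 1, 1]

section Reduced

variable {𝕜 : Type} [Field 𝕜] (b : BIdx → 𝕜) (x : EIdx → 𝕜) (t : 𝕜) (r : RIdx → 𝕜)
  (dr : Fin 2 → RIdx → 𝕜)

/-- `σ^{ac}` from the independent components. -/
def sigmaR (a c : Fin 2) : 𝕜 := b (.sU a c) + x .s * r (.sig (symIdx a c))

/-- `∂_d σ^{ac}` from the independent components. -/
def dsigmaR (d a c : Fin 2) : 𝕜 := b (.dsU d a c) + x .s * dr d (.sig (symIdx a c))

/-- The dependent component `δk_1^0`. -/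
def kDep : 𝕜 :=
  (sigmaR b x r 0 0 * r .kx - sigmaR b x r 0 1 * r .df) * (sigmaR b x r 1 1)⁻¹

/-- `∂_d δk_1^0`. -/
def dkDep (d : Fin 2) : 𝕜 :=
  (dsigmaR b x dr d 0 0 * r .kx + sigmaR b x r 0 0 * dr d .kx - dsigmaR b x dr d 0 1 * r .df
    - sigmaR b x r 0 1 * dr d .df - kDep b x r * dsigmaR b x dr d 1 1) * (sigmaR b x r 1 1)⁻¹

/-- All the components of `U` from the independent ones. -/
def full : Idx → 𝕜
  | .sig a c => r (.sig (symIdx a c))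
  | .phi => r .phi
  | .k a c => !![(r .tr + r .df) / 2, r .kx; kDep b x r, (r .tr - r .df) / 2] a c
  | .p => r .p
  | .sigc c a d => r (.sigc c (symIdx a d))
  | .phic c => r (.phic c)

/-- The first derivatives of all the components of `U` from those of the independent ones. -/
def fullD (d : Fin 2) : Idx → 𝕜
  | .sig a c => dr d (.sig (symIdx a c))
  | .phi => dr d .phi
  | .k a c => !![(dr d .tr + dr d .df) / 2, dr d .kx; dkDep b x r dr d,
      (dr d .tr - dr d .df) / 2] a c
  | .p => dr d .p
  | .sigc c a e => dr d (.sigc c (symIdx a e))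
  | .phic c => dr d (.phic c)

/-- The independent components of `U`. -/
def reduce (u : Idx → 𝕜) : RIdx → 𝕜
  | .sig n => u (.sig (fstIdx n) (sndIdx n))
  | .phi => u .phi
  | .tr => u (.k 0 0) + u (.k 1 1)
  | .df => u (.k 0 0) - u (.k 1 1)
  | .kx => u (.k 0 1)
  | .p => u .p
  | .sigc c n => u (.sigc c (fstIdx n) (sndIdx n))
  | .phic c => u (.phic c)

/-- The right-hand sides of the system for the independent components. -/
def rhsR : RIdx → 𝕜 := reduce (rhsJ b x t (full b x r) (fullD b x r dr))

end Reduced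

section Map

variable {𝕜 𝕜' : Type} [Field 𝕜] [Field 𝕜'] (f : 𝕜 →+* 𝕜')
  (b : BIdx → 𝕜) (x : EIdx → 𝕜) (t : 𝕜) (u : Idx → 𝕜) (w : Fin 2 → Idx → 𝕜) (r : RIdx → 𝕜)
  (dr : Fin 2 → RIdx → 𝕜)

theorem map_inv2 (S : Fin 2 → Fin 2 → 𝕜) (a c : Fin 2) :
    f (inv2 S a c) = inv2 (fun i j => f (S i j)) a c := by
  fin_cases a <;> fin_cases c <;> simp [inv2]

theorem map_one_apply (a c : Fin 2) :
    f ((1 : Matrix (Fin 2) (Fin 2) 𝕜) a c) = (1 : Matrix (Fin 2) (Fin 2) 𝕜') a c := by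
  fin_cases a <;> fin_cases c <;> simp

theorem map_full (i : Idx) :
    f (full b x r i) = full (fun i => f (b i)) (fun i => f (x i)) (fun i => f (r i)) i := by
  cases i with
  | k a c => fin_cases a <;> fin_cases c <;> simp [full, kDep, sigmaR, map_ofNat f 2]
  | _ => simp [full]

theorem map_fullD (d : Fin 2) (i : Idx) :
    f (fullD b x r dr d i) = fullD (fun i => f (b i)) (fun i => f (x i)) (fun i => f (r i))
      (fun c i => f (dr c i)) d i := by
  cases i with
  | k a c => fin_cases a <;> fin_cases c <;> simp [fullD, dkDep, kDep, sigmaR, dsigmaR, map_ofNat f 2]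
  | _ => simp [fullD]

theorem map_dLowG (B : Fin 2 → Fin 2 → 𝕜) (P : Fin 2 → Fin 2 → Fin 2 → 𝕜) (a c d : Fin 2) :
    f (dLowG B P a c d) = dLowG (fun i j => f (B i j)) (fun i j k => f (P i j k)) a c d := by
  simp [dLowG]

theorem map_ddLowG (B : Fin 2 → Fin 2 → 𝕜) (P : Fin 2 → Fin 2 → Fin 2 → 𝕜)
    (Q : Fin 2 → Fin 2 → Fin 2 → Fin 2 → 𝕜) (g a c d : Fin 2) :
    f (ddLowG B P Q g a c d) = ddLowG (fun i j => f (B i j)) (fun i j k => f (P i j k))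
      (fun i j k l => f (Q i j k l)) g a c d := by
  simp only [ddLowG, map_neg, map_sum, map_add, map_mul, map_dLowG]

theorem map_diffCG (S B : Fin 2 → Fin 2 → 𝕜) (P : Fin 2 → Fin 2 → Fin 2 → 𝕜) (a c d : Fin 2) :
    f (diffCG S B P a c d) = diffCG (fun i j => f (S i j)) (fun i j => f (B i j))
      (fun i j k => f (P i j k)) a c d := by
  simp only [diffCG, map_sum, map_add, map_sub, map_mul, map_dLowG, map_div₀, map_one, map_ofNat]

theorem map_dDiffCG (S B : Fin 2 → Fin 2 → 𝕜) (P : Fin 2 → Fin 2 → Fin 2 → 𝕜)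
    (Q : Fin 2 → Fin 2 → Fin 2 → Fin 2 → 𝕜) (g a c d : Fin 2) :
    f (dDiffCG S B P Q g a c d) = dDiffCG (fun i j => f (S i j)) (fun i j => f (B i j))
      (fun i j k => f (P i j k)) (fun i j k l => f (Q i j k l)) g a c d := by
  simp only [dDiffCG, map_sum, map_add, map_sub, map_mul, map_dLowG, map_ddLowG, map_div₀, map_one,
    map_ofNat]

theorem map_scalarCurvG (Rb S B : Fin 2 → Fin 2 → 𝕜) (P : Fin 2 → Fin 2 → Fin 2 → 𝕜)
    (Q : Fin 2 → Fin 2 → Fin 2 → Fin 2 → 𝕜) :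
    f (scalarCurvG Rb S B P Q) = scalarCurvG (fun i j => f (Rb i j)) (fun i j => f (S i j))
      (fun i j => f (B i j)) (fun i j k => f (P i j k)) (fun i j k l => f (Q i j k l)) := by
  simp only [scalarCurvG, map_sum, map_add, map_sub, map_mul, map_diffCG, map_dDiffCG]

theorem map_rhsJ (i : Idx) :
    f (rhsJ b x t u w i) = rhsJ (fun i => f (b i)) (fun i => f (x i)) (f t) (fun i => f (u i))
      (fun c i => f (w c i)) i := by
  cases i <;>
  simp only [rhsJ, sigKJ, covKJ, dsigKJ, sourceKJ, sourcePJ, curvJ, laplaceJ, hessJ, gammaGJ,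
    gammaSJ, phiCJ, dphiCJ, lamJ, dlamJ, dSigmaCJ, sigmaCJ, sigmaJ, dsigmaJ, trJ, map_sum, map_add,
    map_sub, map_mul, map_neg, map_scalarCurvG, map_diffCG, map_inv2, map_div₀, map_one, map_ofNat,
    map_one_apply]
  all_goals rfl

theorem map_rhsR (i : RIdx) :
    f (rhsR b x t r dr i) = rhsR (fun i => f (b i)) (fun i => f (x i)) (f t) (fun i => f (r i))
      (fun c i => f (dr c i)) i := by
  cases i <;>
  simp only [rhsR, reduce, map_add, map_sub, map_rhsJ, map_full, map_fullD]

end Map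

/-! ### Bounds for the right-hand sides -/

section Tame

/-- The space of arguments of the right-hand sides: time, position, unknowns, derivatives. -/
abbrev JetSpace : Type :=
  ℂ × (Fin 2 → ℂ) × (RIdx → ℂ) × ((Fin 2 → ℂ) →L[ℂ] (RIdx → ℂ))

/-- A holomorphic function of subexponential growth in time, and of growth of degree `n` in the
derivatives. -/
structure Tame (Ω : Set JetSpace) (n : ℕ) (g : JetSpace → ℂ) : Prop where
  diff : DifferentiableOn ℂ g Ω
  bound : ∀ η > 0, ∃ C, 0 ≤ C ∧ ∀ q ∈ Ω,
    ‖g q‖ ≤ C * Real.exp (η * q.1.re) * (1 + ‖q.2.2.2‖) ^ n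

/-- A holomorphic function that decays in time like `e^{-δ t}`, of growth of degree `n` in the
derivatives. -/
structure Small (Ω : Set JetSpace) (δ : ℝ) (n : ℕ) (g : JetSpace → ℂ) : Prop where
  diff : DifferentiableOn ℂ g Ω
  bound : ∃ C, 0 ≤ C ∧ ∀ q ∈ Ω, ‖g q‖ ≤ C * Real.exp (-δ * q.1.re) * (1 + ‖q.2.2.2‖) ^ n

variable {Ω : Set JetSpace} {m n : ℕ} {δ : ℝ} {f g : JetSpace → ℂ}

theorem Tame.of_bound (hΩ : ∀ q ∈ Ω, 0 ≤ q.1.re) (hd : DifferentiableOn ℂ g Ω) {C : ℝ}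
    (hC : ∀ q ∈ Ω, ‖g q‖ ≤ C) : Tame Ω 0 g := by
  refine ⟨hd, fun η hη => ⟨|C|, abs_nonneg _, fun q hq => ?_⟩⟩
  have h1 : 1 ≤ Real.exp (η * q.1.re) := Real.one_le_exp (mul_nonneg hη.le (hΩ q hq))
  rw [pow_zero, mul_one]
  exact (hC q hq).trans ((le_abs_self C).trans (le_mul_of_one_le_right (abs_nonneg _) h1))

theorem Tame.mono (h : Tame Ω m g) (hmn : m ≤ n) : Tame Ω n g := by
  refine ⟨h.diff, fun η hη => ?_⟩
  obtain ⟨C, hC, hb⟩ := h.bound η hη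
  refine ⟨C, hC, fun q hq => (hb q hq).trans ?_⟩
  gcongr
  linarith [norm_nonneg q.2.2.2]

theorem Tame.neg (h : Tame Ω n g) : Tame Ω n fun q => -g q :=
  ⟨h.diff.neg, fun η hη => by simpa only [norm_neg] using h.bound η hη⟩

theorem Tame.add (hf : Tame Ω n f) (hg : Tame Ω n g) : Tame Ω n fun q => f q + g q := by
  refine ⟨hf.diff.add hg.diff, fun η hη => ?_⟩
  obtain ⟨C, hC, hb⟩ := hf.bound η hη
  obtain ⟨D, hD, hb'⟩ := hg.bound η hη
  refine ⟨C + D, by positivity, fun q hq => (norm_add_le _ _).trans ?_⟩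
  linarith [hb q hq, hb' q hq]

theorem Tame.sub (hf : Tame Ω n f) (hg : Tame Ω n g) : Tame Ω n fun q => f q - g q := by
  simpa only [sub_eq_add_neg] using hf.add hg.neg

theorem Tame.mul (hf : Tame Ω m f) (hg : Tame Ω n g) : Tame Ω (m + n) fun q => f q * g q := by
  refine ⟨hf.diff.mul hg.diff, fun η hη => ?_⟩
  obtain ⟨C, hC, hb⟩ := hf.bound (η / 2) (half_pos hη)
  obtain ⟨D, hD, hb'⟩ := hg.bound (η / 2) (half_pos hη)
  refine ⟨C * D, by positivity, fun q hq => ?_⟩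
  rw [norm_mul]
  refine (mul_le_mul (hb q hq) (hb' q hq) (norm_nonneg _) (by positivity)).trans (le_of_eq ?_)
  have : Real.exp (η * q.1.re) = Real.exp (η / 2 * q.1.re) * Real.exp (η / 2 * q.1.re) := by
    rw [← Real.exp_add]; ring_nf
  rw [this, pow_add]; ring

theorem Tame.sum {F : Fin 2 → JetSpace → ℂ} (h : ∀ i, Tame Ω n (F i)) :
    Tame Ω n fun q => ∑ i, F i q := by
  simpa only [Fin.sum_univ_two] using (h 0).add (h 1)

theorem Tame.smul (c : ℂ) (h : Tame Ω n g) : Tame Ω n fun q => c * g q := by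
  refine ⟨h.diff.const_mul c, fun η hη => ?_⟩
  obtain ⟨C, hC, hb⟩ := h.bound η hη
  refine ⟨‖c‖ * C, by positivity, fun q hq => ?_⟩
  rw [norm_mul, mul_assoc, mul_assoc, ← mul_assoc C]
  exact mul_le_mul_of_nonneg_left (hb q hq) (norm_nonneg _)

theorem Small.tame (h : Small Ω δ n g) (hδ : 0 ≤ δ) (hΩ : ∀ q ∈ Ω, 0 ≤ q.1.re) : Tame Ω n g := by
  obtain ⟨C, hC, hb⟩ := h.bound
  refine ⟨h.diff, fun η hη => ⟨C, hC, fun q hq => (hb q hq).trans ?_⟩⟩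
  have : -δ * q.1.re ≤ η * q.1.re := by nlinarith [hΩ q hq]
  gcongr

theorem Small.congr_fun (h : Small Ω δ n f) (hfg : ∀ q, g q = f q) : Small Ω δ n g := by
  rwa [show g = f from funext hfg]

theorem Small.neg (h : Small Ω δ n g) : Small Ω δ n fun q => -g q :=
  ⟨h.diff.neg, by simpa only [norm_neg] using h.bound⟩

theorem Small.add (hf : Small Ω δ n f) (hg : Small Ω δ n g) : Small Ω δ n fun q => f q + g q := by
  obtain ⟨C, hC, hb⟩ := hf.bound
  obtain ⟨D, hD, hb'⟩ := hg.bound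
  refine ⟨hf.diff.add hg.diff, C + D, by positivity, fun q hq => (norm_add_le _ _).trans ?_⟩
  linarith [hb q hq, hb' q hq]

theorem Small.sub (hf : Small Ω δ n f) (hg : Small Ω δ n g) : Small Ω δ n fun q => f q - g q := by
  simpa only [sub_eq_add_neg] using hf.add hg.neg

theorem Small.mul_tame (hδ : 0 < δ) (hf : Small Ω (2 * δ) 0 f) (hg : Tame Ω n g) :
    Small Ω δ n fun q => f q * g q := by
  obtain ⟨C, hC, hb⟩ := hf.bound
  obtain ⟨D, hD, hb'⟩ := hg.bound δ hδ
  refine ⟨hf.diff.mul hg.diff, C * D, by positivity, fun q hq => ?_⟩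
  rw [norm_mul]
  refine (mul_le_mul (hb q hq) (hb' q hq) (norm_nonneg _) (by positivity)).trans (le_of_eq ?_)
  have : Real.exp (-δ * q.1.re) = Real.exp (-(2 * δ) * q.1.re) * Real.exp (δ * q.1.re) := by
    rw [← Real.exp_add]; ring_nf
  rw [this]; ring

variable {S B Rb : JetSpace → Fin 2 → Fin 2 → ℂ} {P : JetSpace → Fin 2 → Fin 2 → Fin 2 → ℂ}
  {Q : JetSpace → Fin 2 → Fin 2 → Fin 2 → Fin 2 → ℂ}

theorem tame_inv2 (hS : ∀ i j, Tame Ω 0 fun q => S q i j)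
    (hdet : Tame Ω 0 fun q => (S q 0 0 * S q 1 1 - S q 0 1 * S q 1 0)⁻¹) (i j : Fin 2) :
    Tame Ω 0 fun q => inv2 (S q) i j := by
  have key : Tame Ω 0 fun q => !![S q 1 1, -S q 0 1; -S q 1 0, S q 0 0] i j := by
    fin_cases i <;> fin_cases j
    · exact hS 1 1
    · exact (hS 0 1).neg
    · exact (hS 1 0).neg
    · exact hS 0 0
  exact hdet.mul key

theorem tame_dLowG (hB : ∀ i j, Tame Ω 0 fun q => B q i j)
    (hP : ∀ i j k, Tame Ω 0 fun q => P q i j k) (a c d : Fin 2) :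
    Tame Ω 0 fun q => dLowG (B q) (P q) a c d :=
  (Tame.sum fun m => Tame.sum fun n => ((hB c m).mul (hB d n)).mul (hP a m n)).neg

theorem tame_ddLowG (hB : ∀ i j, Tame Ω 0 fun q => B q i j)
    (hP : ∀ i j k, Tame Ω 0 fun q => P q i j k) (hQ : ∀ i j k l, Tame Ω 1 fun q => Q q i j k l)
    (g a c d : Fin 2) : Tame Ω 1 fun q => ddLowG (B q) (P q) (Q q) g a c d :=
  (Tame.sum fun m => Tame.sum fun n =>
    ((((tame_dLowG hB hP g c m).mul (hB d n)).mul (hP a m n)).add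
      (((hB c m).mul (tame_dLowG hB hP g d n)).mul (hP a m n))).mono zero_le_one |>.add
        (((hB c m).mul (hB d n)).mul (hQ g a m n))).neg

theorem tame_diffCG (hS : ∀ i j, Tame Ω 0 fun q => S q i j) (hB : ∀ i j, Tame Ω 0 fun q => B q i j)
    (hP : ∀ i j k, Tame Ω 0 fun q => P q i j k) (a c d : Fin 2) :
    Tame Ω 0 fun q => diffCG (S q) (B q) (P q) a c d :=
  Tame.sum fun _ => ((hS _ _).smul _).mul
    (((tame_dLowG hB hP _ _ _).add (tame_dLowG hB hP _ _ _)).sub (tame_dLowG hB hP _ _ _))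

theorem tame_dDiffCG (hS : ∀ i j, Tame Ω 0 fun q => S q i j)
    (hB : ∀ i j, Tame Ω 0 fun q => B q i j)
    (hP : ∀ i j k, Tame Ω 0 fun q => P q i j k) (hQ : ∀ i j k l, Tame Ω 1 fun q => Q q i j k l)
    (g a c d : Fin 2) : Tame Ω 1 fun q => dDiffCG (S q) (B q) (P q) (Q q) g a c d :=
  Tame.sum fun _ => ((((hP _ _ _).smul _).mul
    (((tame_dLowG hB hP _ _ _).add (tame_dLowG hB hP _ _ _)).sub
      (tame_dLowG hB hP _ _ _))).mono zero_le_one).add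
    (((hS _ _).smul _).mul (((tame_ddLowG hB hP hQ _ _ _ _).add
      (tame_ddLowG hB hP hQ _ _ _ _)).sub (tame_ddLowG hB hP hQ _ _ _ _)))

theorem tame_scalarCurvG (hR : ∀ i j, Tame Ω 0 fun q => Rb q i j)
    (hS : ∀ i j, Tame Ω 0 fun q => S q i j) (hB : ∀ i j, Tame Ω 0 fun q => B q i j)
    (hP : ∀ i j k, Tame Ω 0 fun q => P q i j k) (hQ : ∀ i j k l, Tame Ω 1 fun q => Q q i j k l) :
    Tame Ω 1 fun q => scalarCurvG (Rb q) (S q) (B q) (P q) (Q q) :=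
  Tame.sum fun a => Tame.sum fun c => (hS a c).mul
    ((((((hR a c).mono zero_le_one).add (Tame.sum fun _ => tame_dDiffCG hS hB hP hQ _ _ _ _)).sub
      (Tame.sum fun _ => tame_dDiffCG hS hB hP hQ _ _ _ _)).add
      ((Tame.sum fun _ => Tame.sum fun _ =>
        (tame_diffCG hS hB hP _ _ _).mul (tame_diffCG hS hB hP _ _ _)).mono zero_le_one)).sub
      ((Tame.sum fun _ => Tame.sum fun _ =>
        (tame_diffCG hS hB hP _ _ _).mul (tame_diffCG hS hB hP _ _ _)).mono zero_le_one))

/-- Growth bounds for all the arguments of the right-hand sides, and nondegeneracy of `σ^{ab}`. -/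
structure TameJet (Ω : Set JetSpace) (b : JetSpace → BIdx → ℂ) (x : JetSpace → EIdx → ℂ)
    (u : JetSpace → Idx → ℂ) (w : JetSpace → Fin 2 → Idx → ℂ) : Prop where
  time : Tame Ω 0 fun q => q.1
  bg : ∀ i, Tame Ω 0 fun q => b q i
  ex : ∀ i, Tame Ω 0 fun q => x q i
  val : ∀ i, Tame Ω 0 fun q => u q i
  der : ∀ d i, Tame Ω 1 fun q => w q d i
  det : Tame Ω 0 fun q => (sigmaJ (b q) (x q) (u q) 0 0 * sigmaJ (b q) (x q) (u q) 1 1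
    - sigmaJ (b q) (x q) (u q) 0 1 * sigmaJ (b q) (x q) (u q) 1 0)⁻¹

variable {b : JetSpace → BIdx → ℂ} {x : JetSpace → EIdx → ℂ}
    {u : JetSpace → Idx → ℂ} {w : JetSpace → Fin 2 → Idx → ℂ}

namespace TameJet

variable (h : TameJet Ω b x u w)
include h

theorem sigma (a c : Fin 2) : Tame Ω 0 fun q => sigmaJ (b q) (x q) (u q) a c :=
  (h.bg _).add ((h.ex _).mul (h.val _))

theorem inv (a c : Fin 2) : Tame Ω 0 fun q => inv2 (sigmaJ (b q) (x q) (u q)) a c :=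
  tame_inv2 (S := fun q => sigmaJ (b q) (x q) (u q)) h.sigma h.det a c

theorem dsigma (d a c : Fin 2) : Tame Ω 1 fun q => dsigmaJ (b q) (x q) (w q) d a c :=
  ((h.bg _).mono zero_le_one).add ((h.ex _).mul (h.der _ _))

theorem sigmaC (c a d : Fin 2) : Tame Ω 0 fun q => sigmaCJ (x q) (u q) c a d :=
  (h.ex _).mul (h.val _)

theorem dSigmaC (d c a e : Fin 2) : Tame Ω 1 fun q => dSigmaCJ (b q) (x q) (u q) (w q) d c a e :=
  ((((h.ex _).mul (h.der _ _)).sub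
    ((Tame.sum fun _ => (h.bg _).mul (h.sigmaC _ _ _)).mono zero_le_one)).add
    ((Tame.sum fun _ => (h.bg _).mul (h.sigmaC _ _ _)).mono zero_le_one)).add
    ((Tame.sum fun _ => (h.bg _).mul (h.sigmaC _ _ _)).mono zero_le_one)

theorem phiC (c : Fin 2) : Tame Ω 0 fun q => phiCJ (b q) (x q) q.1 (u q) c :=
  ((h.bg _).sub ((h.bg _).mul h.time)).add ((h.ex _).mul (h.val _))

theorem dphi (a c : Fin 2) : Tame Ω 1 fun q => dphiCJ (b q) (x q) q.1 (w q) a c :=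
  (((h.bg _).sub ((h.bg _).mul h.time)).mono zero_le_one).add ((h.ex _).mul (h.der _ _))

theorem lam (a : Fin 2) : Tame Ω 0 fun q => lamJ (b q) q.1 a :=
  (h.bg _).sub ((h.bg _).mul h.time)

theorem dlam (a c : Fin 2) : Tame Ω 0 fun q => dlamJ (b q) q.1 a c :=
  (h.bg _).sub ((h.bg _).mul h.time)

theorem sigK (a c : Fin 2) : Tame Ω 0 fun q => sigKJ (b q) (x q) (u q) a c :=
  Tame.sum fun _ => (h.sigma _ _).mul (h.val _)

theorem dsigK (d a c : Fin 2) : Tame Ω 1 fun q => dsigKJ (b q) (x q) (u q) (w q) d a c :=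
  Tame.sum fun _ => ((h.dsigma _ _ _).mul (h.val _)).add ((h.sigma _ _).mul (h.der _ _))

theorem covK (c a e : Fin 2) : Tame Ω 1 fun q => covKJ (b q) (x q) (u q) (w q) c a e :=
  ((h.dsigK _ _ _).add ((Tame.sum fun _ => (h.bg _).mul (h.sigK _ _)).mono zero_le_one)).add
    ((Tame.sum fun _ => (h.bg _).mul (h.sigK _ _)).mono zero_le_one)

theorem gammaS (c a d : Fin 2) : Tame Ω 0 fun q => gammaSJ (b q) (x q) (u q) c a d :=
  (h.bg _).add (tame_diffCG (S := fun q => sigmaJ (b q) (x q) (u q)) h.sigma h.inv h.sigmaC _ _ _)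

theorem gammaG (c a d : Fin 2) : Tame Ω 0 fun q => gammaGJ (b q) (x q) q.1 (u q) c a d :=
  (h.gammaS _ _ _).add (((((h.lam _).smul _).add ((h.lam _).smul _)).sub
    (Tame.sum fun _ => ((h.sigma _ _).mul (h.inv _ _)).mul (h.lam _))).smul _)

theorem curv : Tame Ω 1 fun q => curvJ (b q) (x q) (u q) (w q) :=
  tame_scalarCurvG (Rb := fun q a c => b q (.ric a c)) (S := fun q => sigmaJ (b q) (x q) (u q))
    (fun _ _ => h.bg _) h.sigma h.inv h.sigmaC h.dSigmaC

theorem laplace : Tame Ω 0 fun q => laplaceJ (b q) (x q) q.1 (u q) :=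
  Tame.sum fun _ => Tame.sum fun _ => (h.sigma _ _).mul
    ((h.dlam _ _).sub (Tame.sum fun _ => (h.gammaS _ _ _).mul (h.lam _)))

theorem hess (a c : Fin 2) : Tame Ω 0 fun q => hessJ (b q) (x q) q.1 (u q) a c :=
  ((((h.lam _).mul (h.lam _)).add (h.dlam _ _)).sub
    (Tame.sum fun _ => (h.gammaG _ _ _).mul (h.lam _))).add
    (((h.phiC _).mul (h.phiC _)).smul _)

theorem sourceK (a c : Fin 2) : Tame Ω 1 fun q => sourceKJ (b q) (x q) q.1 (u q) (w q) a c :=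
  (h.bg _).mul (((h.curv.sub (h.laplace.mono zero_le_one)).smul _).sub
    ((Tame.sum fun _ => (h.sigma _ _).mul (h.hess _ _)).mono zero_le_one))

theorem sourceP : Tame Ω 1 fun q => sourcePJ (b q) (x q) q.1 (u q) (w q) :=
  (h.bg _).mul (Tame.sum fun _ => Tame.sum fun _ => (h.sigma _ _).mul
    (((h.dphi _ _).sub ((Tame.sum fun _ => (h.gammaS _ _ _).mul (h.phiC _)).mono
      zero_le_one)).add (((h.phiC _).mul (h.lam _)).mono zero_le_one)))

theorem tr : Tame Ω 0 fun q => trJ (u q) := Tame.sum fun _ => h.val _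

theorem small_rhs (hδ : 0 < δ) (hx : ∀ i, Small Ω (2 * δ) 0 fun q => x q i) (i : Idx) :
    Small Ω δ 1 fun q => rhsJ (b q) (x q) q.1 (u q) (w q) i := by
  have key : ∀ i {g : JetSpace → ℂ}, Tame Ω 1 g → Small Ω δ 1 fun q => x q i * g q :=
    fun i g hg => (hx i).mul_tame hδ hg
  have key0 : ∀ i {g : JetSpace → ℂ}, Tame Ω 0 g → Small Ω δ 1 fun q => x q i * g q :=
    fun i g hg => (hx i).mul_tame hδ (hg.mono zero_le_one)
  cases i with
  | sig a c =>
    refine (key0 .sk ((h.sigK a c).smul 2)).congr_fun fun q => ?_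
    simp only [rhsJ]; ring
  | phi => exact key0 .phip (h.val _)
  | k a c =>
    refine ((key0 .k (h.tr.mul (h.val (.k a c)))).add (key .kv (h.sourceK a c))).congr_fun
      fun q => ?_
    simp only [rhsJ]; ring
  | p =>
    refine (((key0 .pk ((h.bg .w).mul h.tr)).neg.add (key0 .k ((h.val .p).mul h.tr))).add
      (key .pv h.sourceP)).congr_fun fun q => ?_
    simp only [rhsJ]; ring
  | sigc c a d =>
    refine (key .sck ((h.covK c d a).smul 2)).congr_fun fun q => ?_
    simp only [rhsJ]; ring
  | phic c => exact key .phicp (h.der _ _)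

end TameJet

end Tame

/-! ### The system is Fuchsian -/

section Concrete

/-- The constant part of the rates of the exponential factors. -/
def expoC (ε : Exponents) : EIdx → ℝ
  | .s => -ε.sig
  | .sc => -ε.sigc
  | .phc => -ε.phic
  | .k => -ε.k
  | .sk => ε.sig - ε.k
  | .sck => ε.sigc - ε.k
  | .kv => ε.k
  | .pk => ε.p - ε.k
  | .pv => ε.p
  | .phip => ε.phi - ε.p
  | .phicp => ε.phic - ε.p

/-- The coefficient of `-ṽ` in the rates of the exponential factors. -/
def expoV : EIdx → ℝ
  | .kv => 1
  | .pv => 1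
  | _ => 0

/-- The exponential factors at complex arguments. -/
noncomputable def expC (ε : Exponents) (v t : ℂ) (i : EIdx) : ℂ :=
  Complex.exp (((expoC ε i : ℝ) - (expoV i : ℝ) * v) * t)

/-- The exponential factors. -/
noncomputable def expR (ε : Exponents) (v t : ℝ) (i : EIdx) : ℝ :=
  Real.exp ((expoC ε i - expoV i * v) * t)

theorem expC_ofReal (ε : Exponents) (v t : ℝ) (i : EIdx) :
    expC ε v t i = (expR ε v t i : ℂ) := by
  simp [expC, expR]

/-- The diagonal singular part of the system for the independent components. -/
def muR {𝕜 : Type} [Field 𝕜] (c : ℝ → 𝕜) (ε : Exponents) (v : 𝕜) : RIdx → 𝕜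
  | .sig _ => c ε.sig
  | .phi => c ε.phi
  | .tr => c ε.k + v
  | .df => c ε.k
  | .kx => c ε.k
  | .p => c ε.p
  | .sigc _ _ => c ε.sigc
  | .phic _ => c ε.phic

/-- The right-hand side of the system for the independent components, at complex arguments. -/
noncomputable def fuchsRhs (b : BIdx → (Fin 2 → ℂ) → ℂ) (ε : Exponents) (t : ℂ) (z : Fin 2 → ℂ)
    (u : RIdx → ℂ) (w : (Fin 2 → ℂ) →L[ℂ] (RIdx → ℂ)) : RIdx → ℂ :=
  rhsR (fun i => b i z) (expC ε (b .v z) t) t u (fun d j => w (Pi.single d 1) j)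

theorem expo_neg {ε : Exponents} (hε : ε.Positive) {v : ℝ} (hv : ε.k < v)
    (hk : max (max ε.sig ε.sigc) ε.p < ε.k) (hp : max ε.phi ε.phic < ε.p) (i : EIdx) :
    expoC ε i - expoV i * v < 0 := by
  obtain ⟨h1, h2, h3, h4, h5, h6⟩ := hε
  rw [max_lt_iff, max_lt_iff] at hk
  rw [max_lt_iff] at hp
  obtain ⟨⟨_, _⟩, _⟩ := hk
  obtain ⟨_, _⟩ := hp
  cases i <;> simp only [expoC, expoV] <;> linarith

theorem norm_single_le (d : Fin 2) : ‖(Pi.single d 1 : Fin 2 → ℂ)‖ ≤ 1 := by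
  refine (pi_norm_le_iff_of_nonneg zero_le_one).2 fun i => ?_
  by_cases h : i = d
  · subst h; simp
  · simp [Pi.single_eq_of_ne h]

/-- The determinant and a diagonal entry of `S` have real part above `κ`. -/
def IsNondeg (κ : ℝ) (S : Fin 2 → Fin 2 → ℂ) : Prop :=
  κ < (S 0 0 * S 1 1 - S 0 1 * S 1 0).re ∧ κ < (S 1 1).re

/-- Nondegeneracy is stable under small perturbations. -/
theorem isNondeg_eventually {Z : Type*} [TopologicalSpace Z] {z₀ : Z} {sU : Fin 2 → Fin 2 → Z → ℂ}
    (hc : ∀ a c, ContinuousAt (sU a c) z₀)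
    (hdet : 0 < (sU 0 0 z₀ * sU 1 1 z₀ - sU 0 1 z₀ * sU 1 0 z₀).re) (hS : 0 < (sU 1 1 z₀).re) :
    ∃ ρ > 0, ∃ κ > 0, ∀ᶠ z in 𝓝 z₀, ∀ s : Fin 2 → Fin 2 → ℂ, (∀ a c, ‖s a c‖ < ρ) →
      IsNondeg κ fun a c => sU a c z + s a c := by
  set F : Z × (Fin 2 → Fin 2 → ℂ) → ℝ := fun p =>
    ((sU 0 0 p.1 + p.2 0 0) * (sU 1 1 p.1 + p.2 1 1)
      - (sU 0 1 p.1 + p.2 0 1) * (sU 1 0 p.1 + p.2 1 0)).re with hF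
  set G : Z × (Fin 2 → Fin 2 → ℂ) → ℝ := fun p => (sU 1 1 p.1 + p.2 1 1).re with hG
  have hs : ∀ a c, ContinuousAt (fun p : Z × (Fin 2 → Fin 2 → ℂ) => sU a c p.1 + p.2 a c)
      (z₀, 0) := by
    intro a c
    refine ContinuousAt.add ?_ (by fun_prop)
    exact ContinuousAt.comp (f := Prod.fst) (hc a c) continuousAt_fst
  have hFc : ContinuousAt F (z₀, 0) := Complex.continuous_re.continuousAt.comp
    (((hs 0 0).mul (hs 1 1)).sub ((hs 0 1).mul (hs 1 0)))
  have hGc : ContinuousAt G (z₀, 0) := Complex.continuous_re.continuousAt.comp (hs 1 1)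
  have hF0 : 0 < F (z₀, 0) := by simpa [hF] using hdet
  have hG0 : 0 < G (z₀, 0) := by simpa [hG] using hS
  obtain ⟨κ, hκ, hκF, hκG⟩ : ∃ κ > 0, κ < F (z₀, 0) ∧ κ < G (z₀, 0) :=
    ⟨min (F (z₀, 0)) (G (z₀, 0)) / 2, by positivity,
      by linarith [min_le_left (F (z₀, 0)) (G (z₀, 0))],
      by linarith [min_le_right (F (z₀, 0)) (G (z₀, 0))]⟩
  have h := (hFc.eventually (lt_mem_nhds hκF)).and (hGc.eventually (lt_mem_nhds hκG))
  rw [nhds_prod_eq, eventually_prod_iff] at h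
  obtain ⟨pa, ha, pb, hb, h⟩ := h
  obtain ⟨ρ, hρ, hρb⟩ := Metric.eventually_nhds_iff.1 hb
  refine ⟨ρ, hρ, κ, hκ, ha.mono fun z hz s hs' => ?_⟩
  refine h hz (hρb ?_)
  rw [dist_zero_right]
  exact (pi_norm_lt_iff hρ).2 fun a => (pi_norm_lt_iff hρ).2 fun c => hs' a c

/-- In the independent components the system has the abstract form on a small complex ball, for
solutions of arbitrary size; there `σ^{ab}` stays uniformly nondegenerate for large times. -/
theorem exists_isFuchsian {b : BIdx → (Fin 2 → ℂ) → ℂ} {y₀ : Plane} {r₀ : ℝ} (hr₀ : 0 < r₀)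
    (hb : ∀ i, DifferentiableOn ℂ (b i) (ball (toC y₀) r₀)) {ε : Exponents} (hε : ε.Positive)
    {v₀ : ℝ} (hv : b .v (toC y₀) = v₀) (hkv : ε.k < v₀)
    (hk : max (max ε.sig ε.sigc) ε.p < ε.k) (hp : max ε.phi ε.phic < ε.p)
    (hdet : 0 < (b (.sU 0 0) (toC y₀) * b (.sU 1 1) (toC y₀)
      - b (.sU 0 1) (toC y₀) * b (.sU 1 0) (toC y₀)).re)
    (hS : 0 < (b (.sU 1 1) (toC y₀)).re) :
    ∃ R > 0, R ≤ r₀ ∧ ∃ δ > 0, ∃ κ > 0, ∀ K > 0, ∃ t₁ L, 0 ≤ t₁ ∧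
      IsFuchsian (fun z => muR (fun c => (c : ℂ)) ε (b .v z)) (fuchsRhs b ε) (toC y₀) R t₁ K δ L ∧
      ∀ t ∈ strip t₁, ∀ z ∈ ball (toC y₀) R, ∀ u : RIdx → ℂ, ‖u‖ < K →
        IsNondeg κ (sigmaR (fun i => b i z) (expC ε (b .v z) t) u) := by
  have hneg := expo_neg hε hkv hk hp
  have hc : ∀ i, ContinuousAt (b i) (toC y₀) := fun i =>
    ((hb i).differentiableAt (isOpen_ball.mem_nhds (mem_ball_self hr₀))).continuousAt
  obtain ⟨δ, hδ, hδi⟩ : ∃ δ > 0, ∀ i, expoC ε i - expoV i * v₀ < -(2 * δ) := by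
    have h : ∀ᶠ δ in 𝓝[>] (0 : ℝ), ∀ i, expoC ε i - expoV i * v₀ < -(2 * δ) := by
      refine eventually_all.2 fun i => nhdsWithin_le_nhds ?_
      have : ContinuousAt (fun δ : ℝ => -(2 * δ)) 0 := by fun_prop
      exact this.eventually (lt_mem_nhds (by simpa using hneg i))
    obtain ⟨δ, h1, h2⟩ := (h.and self_mem_nhdsWithin).exists
    exact ⟨δ, h2, h1⟩
  obtain ⟨ρ, hρ, κ, hκ, hdetev⟩ := isNondeg_eventually (sU := fun a c => b (.sU a c))
    (fun a c => hc _) hdet hS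
  have hrec : ContinuousAt (fun z => (b .v z).re) (toC y₀) :=
    Complex.continuous_re.continuousAt.comp (hc .v)
  have himc : ContinuousAt (fun z => |(b .v z).im|) (toC y₀) :=
    (Complex.continuous_im.continuousAt.comp (hc .v)).abs
  have hev : ∀ᶠ z in 𝓝 (toC y₀), (∀ i, ‖b i z‖ < ‖b i (toC y₀)‖ + 1) ∧
      (∀ i, expoC ε i - expoV i * (b .v z).re < -(2 * δ)) ∧ |(b .v z).im| < 1 ∧
      0 < ε.k + (b .v z).re ∧ z ∈ ball (toC y₀) r₀ := by
    refine (eventually_all.2 fun i => ?_).and ((eventually_all.2 fun i => ?_).and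
      (Eventually.and ?_ (Eventually.and ?_ (ball_mem_nhds _ hr₀))))
    · exact (hc i).norm.eventually (gt_mem_nhds (lt_add_one _))
    · have : ContinuousAt (fun z => expoC ε i - expoV i * (b .v z).re) (toC y₀) :=
        continuousAt_const.sub (continuousAt_const.mul hrec)
      refine this.eventually (gt_mem_nhds ?_)
      show expoC ε i - expoV i * (b .v (toC y₀)).re < _
      rw [hv, Complex.ofReal_re]; exact hδi i
    · refine himc.eventually (gt_mem_nhds ?_)
      show |(b .v (toC y₀)).im| < 1
      rw [hv, Complex.ofReal_im]; simp
    · refine (continuousAt_const.add hrec).eventually (lt_mem_nhds ?_)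
      show 0 < ε.k + (b .v (toC y₀)).re
      rw [hv, Complex.ofReal_re]
      linarith [hε.2.1]
  obtain ⟨R₀, hR₀, hR₀b⟩ := Metric.eventually_nhds_iff_ball.1 (hev.and hdetev)
  have hRpos : 0 < min (min R₀ 1) r₀ := by positivity
  refine ⟨min (min R₀ 1) r₀, hRpos, min_le_right _ _, δ, hδ, κ, hκ, fun K hK => ?_⟩
  set R := min (min R₀ 1) r₀ with hR
  have hRR₀ : ball (toC y₀) R ⊆ ball (toC y₀) R₀ :=
    ball_subset_ball ((min_le_left _ _).trans (min_le_left _ _))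
  have hRr₀ : ball (toC y₀) R ⊆ ball (toC y₀) r₀ := ball_subset_ball (min_le_right _ _)
  -- After `t₁` the perturbation `e^{-ε_σ t} δσ` is below the threshold `ρ`.
  obtain ⟨t₁, ht₁, ht₁ρ⟩ : ∃ t₁ : ℝ, 0 ≤ t₁ ∧ Real.exp (-ε.sig * t₁) * K < ρ := by
    have h1 : Tendsto (fun t : ℝ => Real.exp (-ε.sig * t) * K) atTop (𝓝 (0 * K)) := by
      refine (Real.tendsto_exp_atBot.comp ?_).mul_const K
      exact tendsto_id.const_mul_atTop_of_neg (neg_lt_zero.2 hε.1)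
    rw [zero_mul] at h1
    obtain ⟨t₁, h2, h3⟩ := ((h1.eventually (gt_mem_nhds hρ)).and (eventually_ge_atTop 0)).exists
    exact ⟨t₁, h3, h2⟩
  have hnondeg : ∀ t ∈ strip t₁, ∀ z ∈ ball (toC y₀) R, ∀ u : RIdx → ℂ, ‖u‖ < K →
        IsNondeg κ (sigmaR (fun i => b i z) (expC ε (b .v z) t) u) := by
    intro t ht z hz u hu
    refine (hR₀b z (hRR₀ hz)).2 (fun a c => expC ε (b .v z) t .s * u (.sig (symIdx a c)))
      fun a c => ?_
    have h1 : ‖expC ε (b .v z) t .s‖ ≤ Real.exp (-ε.sig * t₁) := by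
      rw [expC, Complex.norm_exp]
      simp only [expoC, expoV]
      refine Real.exp_le_exp.2 ?_
      simp only [Complex.ofReal_zero, zero_mul, sub_zero, Complex.re_ofReal_mul]
      nlinarith [ht.1, hε.1]
    rw [norm_mul]
    refine lt_of_le_of_lt ?_ ht₁ρ
    exact mul_le_mul h1 ((norm_le_pi_norm u _).trans hu.le) (norm_nonneg _) (Real.exp_pos _).le
  set Ω : Set JetSpace := strip t₁ ×ˢ ball (toC y₀) R ×ˢ ball 0 K ×ˢ univ with hΩ
  have hΩ0 : ∀ q ∈ Ω, 0 ≤ q.1.re := fun q hq => ht₁.trans hq.1.1.le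
  have hbd : ∀ i, DifferentiableOn ℂ (fun q : JetSpace => b i q.2.1) Ω := fun i =>
    (hb i).comp (by fun_prop) fun q hq => hRr₀ hq.2.1
  have hbg : ∀ i, Tame Ω 0 fun q => b i q.2.1 := fun i =>
    Tame.of_bound hΩ0 (hbd i) fun q hq => ((hR₀b _ (hRR₀ hq.2.1)).1.1 i).le
  -- `Re (ṽ t)` is `Re ṽ Re t` up to `Im ṽ Im t`, which is bounded.
  have hx : ∀ i, Small Ω (2 * δ) 0 fun q => expC ε (b .v q.2.1) q.1 i := by
    intro i
    refine ⟨DifferentiableOn.cexp (((differentiableOn_const _).sub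
      ((hbd .v).const_mul _)).mul (by fun_prop)), Real.exp 1, (Real.exp_pos _).le, fun q hq => ?_⟩
    obtain ⟨⟨h1, h2, h3, h4, h5⟩, -⟩ := hR₀b _ (hRR₀ hq.2.1)
    rw [pow_zero, mul_one, expC, Complex.norm_exp, ← Real.exp_add]
    refine Real.exp_le_exp.2 ?_
    have hre : ((((expoC ε i : ℝ) : ℂ) - ((expoV i : ℝ) : ℂ) * b .v q.2.1) * q.1).re
        = (expoC ε i - expoV i * (b .v q.2.1).re) * q.1.re
          + expoV i * ((b .v q.2.1).im * q.1.im) := by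
      simp; ring
    rw [hre]
    have h6 : (expoC ε i - expoV i * (b .v q.2.1).re) * q.1.re ≤ -(2 * δ) * q.1.re :=
      mul_le_mul_of_nonneg_right (h2 i).le (hΩ0 q hq)
    have h7 : (b .v q.2.1).im * q.1.im ≤ 1 := by
      refine (le_abs_self _).trans ?_
      rw [abs_mul]
      exact mul_le_one₀ h3.le (abs_nonneg _) hq.1.2.le
    have h8 : expoV i * ((b .v q.2.1).im * q.1.im) ≤ 1 := by
      cases i <;> simp only [expoV, zero_mul, one_mul, zero_le_one, h7]
    linarith
  have hex : ∀ i, Tame Ω 0 fun q => expC ε (b .v q.2.1) q.1 i := fun i =>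
    (hx i).tame (by positivity) hΩ0
  have hr : ∀ j, Tame Ω 0 fun q => q.2.2.1 j := fun j => by
    refine Tame.of_bound hΩ0 (by fun_prop) (C := K) fun q hq => ?_
    have := hq.2.2.1
    rw [mem_ball_zero_iff] at this
    exact (norm_le_pi_norm _ j).trans this.le
  have hdr : ∀ d j, Tame Ω 1 fun q => q.2.2.2 (Pi.single d 1) j := fun d j => by
    refine ⟨?_, fun η hη => ⟨1, zero_le_one, fun q hq => ?_⟩⟩
    · have h1 : Differentiable ℂ fun q : JetSpace => q.2.2.2 (Pi.single d 1) := by fun_prop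
      exact (differentiable_pi.1 h1 j).differentiableOn
    · rw [one_mul, pow_one]
      have h1 : 1 ≤ Real.exp (η * q.1.re) := Real.one_le_exp (mul_nonneg hη.le (hΩ0 q hq))
      have h2 : ‖q.2.2.2 (Pi.single d 1) j‖ ≤ ‖q.2.2.2‖ :=
        (norm_le_pi_norm _ j).trans ((q.2.2.2.le_opNorm _).trans
          (mul_le_of_le_one_right (norm_nonneg _) (norm_single_le d)))
      nlinarith [norm_nonneg q.2.2.2]
  -- Polynomial growth in `t` is beaten by every exponential.
  have htime : Tame Ω 0 fun q => q.1 := by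
    refine ⟨by fun_prop, fun η hη => ⟨1 + 1 / η, by positivity, fun q hq => ?_⟩⟩
    rw [pow_zero, mul_one]
    have h0 := hΩ0 q hq
    have h1 : ‖q.1‖ ≤ q.1.re + 1 := by
      refine (Complex.norm_le_abs_re_add_abs_im _).trans ?_
      rw [abs_of_nonneg h0]
      linarith [hq.1.2]
    have h2 := Real.add_one_le_exp (η * q.1.re)
    have h3 : 1 ≤ Real.exp (η * q.1.re) := Real.one_le_exp (mul_nonneg hη.le h0)
    have h4 : q.1.re ≤ 1 / η * Real.exp (η * q.1.re) := by
      rw [div_mul_eq_mul_div, one_mul, le_div_iff₀ hη]; linarith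
    linarith
  have hinv : ∀ {g : JetSpace → ℂ}, Tame Ω 0 g → (∀ q ∈ Ω, κ < (g q).re) →
      Tame Ω 0 fun q => (g q)⁻¹ := by
    intro g hg hlow
    have h1 : ∀ q ∈ Ω, κ ≤ ‖g q‖ := fun q hq =>
      (hlow q hq).le.trans ((le_abs_self _).trans (Complex.abs_re_le_norm _))
    refine Tame.of_bound hΩ0 (hg.diff.inv fun q hq h0 => ?_) (C := κ⁻¹) fun q hq => ?_
    · have := h1 q hq
      rw [h0, norm_zero] at this; linarith
    · rw [norm_inv]
      exact inv_anti₀ hκ (h1 q hq)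
  have hsR : ∀ a c, Tame Ω 0 fun q => sigmaR (fun i => b i q.2.1) (expC ε (b .v q.2.1) q.1)
      q.2.2.1 a c := fun a c => (hbg _).add ((hex _).mul (hr _))
  have hdsR : ∀ d a c, Tame Ω 1 fun q => dsigmaR (fun i => b i q.2.1) (expC ε (b .v q.2.1) q.1)
      (fun d j => q.2.2.2 (Pi.single d 1) j) d a c := fun d a c =>
    ((hbg _).mono zero_le_one).add ((hex _).mul (hdr _ _))
  have hSinv := hinv (hsR 1 1) fun q hq =>
    (hnondeg q.1 hq.1 q.2.1 hq.2.1 q.2.2.1 (by simpa using hq.2.2.1)).2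
  have hdetinv := hinv (((hsR 0 0).mul (hsR 1 1)).sub ((hsR 0 1).mul (hsR 1 0))) fun q hq =>
    (hnondeg q.1 hq.1 q.2.1 hq.2.1 q.2.2.1 (by simpa using hq.2.2.1)).1
  have hkd : Tame Ω 0 fun q => kDep (fun i => b i q.2.1) (expC ε (b .v q.2.1) q.1) q.2.2.1 :=
    (((hsR 0 0).mul (hr _)).sub ((hsR 0 1).mul (hr _))).mul hSinv
  have hdkd : ∀ d, Tame Ω 1 fun q => dkDep (fun i => b i q.2.1) (expC ε (b .v q.2.1) q.1) q.2.2.1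
      (fun d j => q.2.2.2 (Pi.single d 1) j) d := fun d =>
    ((((((hdsR d 0 0).mul (hr _)).add ((hsR 0 0).mul (hdr _ _))).sub
      ((hdsR d 0 1).mul (hr _))).sub ((hsR 0 1).mul (hdr _ _))).sub
      (hkd.mul (hdsR d 1 1))).mul hSinv
  have hhalf : ∀ {n : ℕ} {g : JetSpace → ℂ}, Tame Ω n g → Tame Ω n fun q => g q / 2 := by
    intro n g hg
    simpa only [div_eq_inv_mul] using hg.smul 2⁻¹
  have hfull : ∀ i, Tame Ω 0 fun q => full (fun i => b i q.2.1) (expC ε (b .v q.2.1) q.1)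
      q.2.2.1 i := by
    intro i
    cases i with
    | k a c =>
      fin_cases a <;> fin_cases c
      · exact hhalf ((hr _).add (hr _))
      · exact hr _
      · exact hkd
      · exact hhalf ((hr _).sub (hr _))
    | _ => exact hr _
  have hfullD : ∀ d i, Tame Ω 1 fun q => fullD (fun i => b i q.2.1) (expC ε (b .v q.2.1) q.1)
      q.2.2.1 (fun d j => q.2.2.2 (Pi.single d 1) j) d i := by
    intro d i
    cases i with
    | k a c =>
      fin_cases a <;> fin_cases c
      · exact hhalf ((hdr _ _).add (hdr _ _))
      · exact hdr _ _
      · exact hdkd d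
      · exact hhalf ((hdr _ _).sub (hdr _ _))
    | _ => exact hdr _ _
  have hjet : TameJet Ω (fun q i => b i q.2.1) (fun q => expC ε (b .v q.2.1) q.1)
      (fun q => full (fun i => b i q.2.1) (expC ε (b .v q.2.1) q.1) q.2.2.1)
      (fun q => fullD (fun i => b i q.2.1) (expC ε (b .v q.2.1) q.1) q.2.2.1
        (fun d j => q.2.2.2 (Pi.single d 1) j)) :=
    ⟨htime, hbg, hex, hfull, hfullD, hdetinv⟩
  have hsm := hjet.small_rhs hδ hx
  have hred : ∀ j, Small Ω δ 1 fun q => fuchsRhs b ε q.1 q.2.1 q.2.2.1 q.2.2.2 j := by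
    intro j
    cases j with
    | tr => exact (hsm (.k 0 0)).add (hsm (.k 1 1))
    | df => exact (hsm (.k 0 0)).sub (hsm (.k 1 1))
    | sig n => exact hsm (.sig (fstIdx n) (sndIdx n))
    | phi => exact hsm .phi
    | kx => exact hsm (.k 0 1)
    | p => exact hsm .p
    | sigc c n => exact hsm (.sigc c (fstIdx n) (sndIdx n))
    | phic c => exact hsm (.phic c)
  choose C hC hCb using fun j => (hred j).bound
  refine ⟨t₁, ∑ j, C j, ht₁, ⟨hRpos, (min_le_left _ _).trans (min_le_right _ _), hK, hδ,
    Finset.sum_nonneg fun j _ => hC j, ?_, ?_, ?_, ?_⟩, hnondeg⟩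
  · refine differentiableOn_pi.2 fun j => ?_
    cases j with
    | tr => exact (differentiableOn_const _).add ((hb .v).mono hRr₀)
    | _ => exact differentiableOn_const _
  · intro z hz j
    obtain ⟨h1, h2, h3, h4, h5, h6⟩ := hε
    have := (hR₀b _ (hRR₀ hz)).1.2.2.2.1
    cases j <;> simpa [muR]
  · exact differentiableOn_pi.2 fun j => (hred j).diff
  · intro t ht z hz u hu w
    have hLn : 0 ≤ ∑ j, C j := Finset.sum_nonneg fun j _ => hC j
    refine (pi_norm_le_iff_of_nonneg (by positivity)).2 fun j => ?_
    have h1 := hCb j (t, z, u, w) ⟨ht, hz, by simpa using hu, mem_univ _⟩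
    rw [pow_one] at h1
    refine h1.trans ?_
    have h2 : C j ≤ ∑ j, C j := Finset.single_le_sum (fun j _ => hC j) (Finset.mem_univ j)
    gcongr

end Concrete

/-! ### Partial derivatives in the plane -/

section PartialDerivatives

variable {f g : Plane → ℝ} {y : Plane} {a c : Fin 2}

theorem pd_add (hf : DifferentiableAt ℝ f y) (hg : DifferentiableAt ℝ g y) :
    pd a (fun z => f z + g z) y = pd a f y + pd a g y := by
  simp only [pd, fderiv_fun_add hf hg, add_apply]

theorem pd_sub (hf : DifferentiableAt ℝ f y) (hg : DifferentiableAt ℝ g y) :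
    pd a (fun z => f z - g z) y = pd a f y - pd a g y := by
  simp only [pd, fderiv_fun_sub hf hg, sub_apply]

theorem pd_mul (hf : DifferentiableAt ℝ f y) (hg : DifferentiableAt ℝ g y) :
    pd a (fun z => f z * g z) y = pd a f y * g y + f y * pd a g y := by
  simp only [pd, fderiv_fun_mul hf hg, add_apply,
    smul_apply, smul_eq_mul]
  ring

theorem pd_const_mul (c : ℝ) (hf : DifferentiableAt ℝ f y) :
    pd a (fun z => c * f z) y = c * pd a f y := by
  simp only [pd, fderiv_const_mul hf, smul_apply, smul_eq_mul]

theorem pd_mul_const (c : ℝ) (hf : DifferentiableAt ℝ f y) :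
    pd a (fun z => f z * c) y = pd a f y * c := by
  simp only [mul_comm _ c, pd_const_mul c hf]

theorem pd_sum {f : Fin 2 → Plane → ℝ} (hf : ∀ i, DifferentiableAt ℝ (f i) y) :
    pd a (fun z => ∑ i, f i z) y = ∑ i, pd a (f i) y := by
  simp only [Fin.sum_univ_two, pd_add (hf 0) (hf 1)]

theorem pd_congr (h : f =ᶠ[𝓝 y] g) : pd a f y = pd a g y := by
  simp only [pd, h.fderiv_eq]

theorem analyticAt_pd (hf : AnalyticAt ℝ f y) : AnalyticAt ℝ (pd a f) y :=
  ((ContinuousLinearMap.apply ℝ ℝ (EuclideanSpace.single a (1 : ℝ) : Plane)).analyticAt _).comp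
    hf.fderiv

theorem pd_comm (hf : AnalyticAt ℝ f y) : pd a (pd c f) y = pd c (pd a f) y := by
  have h1 : ∀ v w : Plane, fderiv ℝ (fun z => fderiv ℝ f z v) y w = fderiv ℝ (fderiv ℝ f) y w v := by
    intro v w
    have := (ContinuousLinearMap.apply ℝ ℝ v).hasFDerivAt.comp y
      hf.fderiv.differentiableAt.hasFDerivAt
    exact congrArg (fun L => L w) this.fderiv
  have h2 := (hf.contDiffAt (n := 2)).isSymmSndFDerivAt (by simp)
  show fderiv ℝ (fun z => fderiv ℝ f z _) y _ = fderiv ℝ (fun z => fderiv ℝ f z _) y _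
  rw [h1, h1]
  exact h2 _ _

end PartialDerivatives

theorem inv_eq_inv2 (S : Matrix (Fin 2) (Fin 2) ℝ) (a c : Fin 2) : S⁻¹ a c = inv2 S a c := by
  rw [Matrix.inv_def, Ring.inverse_eq_inv', Matrix.det_fin_two, Matrix.adjugate_fin_two]
  rfl

theorem dLow_eq (S : Matrix (Fin 2) (Fin 2) ℝ) (P : Fin 2 → Fin 2 → Fin 2 → ℝ) :
    dLow S P = dLowG (inv2 S) P := by
  ext a b d
  simp only [dLow, dLowG, inv_eq_inv2]

theorem ddLow_eq (S : Matrix (Fin 2) (Fin 2) ℝ) (P : Fin 2 → Fin 2 → Fin 2 → ℝ)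
    (Q : Fin 2 → Fin 2 → Fin 2 → Fin 2 → ℝ) : ddLow S P Q = ddLowG (inv2 S) P Q := by
  ext g a b d
  simp only [ddLow, ddLowG, inv_eq_inv2, dLow_eq]

theorem diffC_eq (S : Matrix (Fin 2) (Fin 2) ℝ) (P : Fin 2 → Fin 2 → Fin 2 → ℝ) :
    diffC S P = diffCG S (inv2 S) P := by
  ext c a b
  simp only [diffC, diffCG, dLow_eq]

theorem dDiffC_eq (S : Matrix (Fin 2) (Fin 2) ℝ) (P : Fin 2 → Fin 2 → Fin 2 → ℝ)
    (Q : Fin 2 → Fin 2 → Fin 2 → Fin 2 → ℝ) : dDiffC S P Q = dDiffCG S (inv2 S) P Q := by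
  ext g c a b
  simp only [dDiffC, dDiffCG, dLow_eq, ddLow_eq]

theorem scalarCurv_eq (Rb : Fin 2 → Fin 2 → ℝ) (S : Matrix (Fin 2) (Fin 2) ℝ)
    (P : Fin 2 → Fin 2 → Fin 2 → ℝ) (Q : Fin 2 → Fin 2 → Fin 2 → Fin 2 → ℝ) :
    scalarCurv Rb S P Q = scalarCurvG Rb S (inv2 S) P Q := by
  simp only [scalarCurv, scalarCurvG, diffC_eq, dDiffC_eq]

section Expressions

variable {M : Type*} [TopologicalSpace M] [ChartedSpace Plane M] [IsManifold 𝓘(ℝ, Plane) ω M]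

/-- The background quantities in a chart. -/
noncomputable def bgR (A : AsymptoticData M) (e : OpenPartialHomeomorph M Plane) (y : Plane) :
    BIdx → ℝ
  | .sU a b => A.sigUp e y a b
  | .dsU c a b => pd c (fun z => A.sigUp e z a b) y
  | .gam c a b => christoffel (A.sigLow e) c a b y
  | .ric a b => ricci (A.sigLow e) a b y
  | .dphi a => pd a (fun z => A.phi (e.symm z)) y
  | .ddphi a b => pd a (pd b (fun z => A.phi (e.symm z))) y
  | .dlam a => pd a (fun z => A.lam (e.symm z)) y
  | .ddlam a b => pd a (pd b (fun z => A.lam (e.symm z))) y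
  | .dv a => pd a (fun z => A.v (e.symm z)) y
  | .ddv a b => pd a (pd b (fun z => A.v (e.symm z))) y
  | .dw a => pd a (fun z => A.w (e.symm z)) y
  | .ddw a b => pd a (pd b (fun z => A.w (e.symm z))) y
  | .elam => Real.exp (A.lam (e.symm y))
  | .v => A.v (e.symm y)
  | .w => A.w (e.symm y)

/-- The singular linear part of the system. -/
noncomputable def linJ (ε : Exponents) (v : ℝ) (u : Idx → ℝ) : Idx → ℝ
  | .sig a b => ε.sig * u (.sig a b)
  | .phi => ε.phi * u .phi
  | .k a b => ε.k * u (.k a b) + (1 / 2) * v * (1 : Matrix (Fin 2) (Fin 2) ℝ) a b * trJ u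
  | .p => ε.p * u .p
  | .sigc c a b => ε.sigc * u (.sigc c a b)
  | .phic c => ε.phic * u (.phic c)

/-- The background data are analytic in the chart `e` at the point with coordinates `y`. -/
structure AsymptoticData.AnalyticIn (A : AsymptoticData M) (e : OpenPartialHomeomorph M Plane)
    (y : Plane) : Prop where
  low : ∀ a b, AnalyticAt ℝ (fun z => A.sigLow e z a b) y
  up : ∀ a b, AnalyticAt ℝ (fun z => A.sigUp e z a b) y
  phi : AnalyticAt ℝ (fun z => A.phi (e.symm z)) y
  lam : AnalyticAt ℝ (fun z => A.lam (e.symm z)) y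
  v : AnalyticAt ℝ (fun z => A.v (e.symm z)) y
  w : AnalyticAt ℝ (fun z => A.w (e.symm z)) y

variable {A : AsymptoticData M} {ε : Exponents} {U : Fields M}
  {e : OpenPartialHomeomorph M Plane} {t : ℝ} {y : Plane}

/-- `∂_d` of a function in the plane of the form `f - g t`. -/
theorem pd_sub_mul_const {f g : Plane → ℝ} {a : Fin 2} {t : ℝ} (hf : AnalyticAt ℝ f y)
    (hg : AnalyticAt ℝ g y) :
    pd a (fun z => f z - g z * t) y = pd a f y - pd a g y * t := by
  rw [pd_sub hf.differentiableAt (hg.differentiableAt.mul_const t),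
    pd_mul_const t hg.differentiableAt]

theorem pd_pd_sub_mul_const {f g : Plane → ℝ} {a c : Fin 2} {t : ℝ} (hf : AnalyticAt ℝ f y)
    (hg : AnalyticAt ℝ g y) :
    pd a (pd c (fun z => f z - g z * t)) y = pd a (pd c f) y - pd a (pd c g) y * t := by
  rw [← pd_sub_mul_const (analyticAt_pd hf) (analyticAt_pd hg)]
  refine pd_congr ?_
  filter_upwards [hf.eventually_analyticAt, hg.eventually_analyticAt] with z h1 h2
  exact pd_sub_mul_const h1 h2

local notation "bb" => bgR A e y
local notation "xx" => expR ε (A.v (e.symm y)) t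
local notation "uu" => U.comp e t y
local notation "ww" => U.dx e t y

theorem expR_s {v : ℝ} : expR ε v t .s = Real.exp (-ε.sig * t) := by simp [expR, expoC, expoV]
theorem expR_sc {v : ℝ} : expR ε v t .sc = Real.exp (-ε.sigc * t) := by simp [expR, expoC, expoV]
theorem expR_phc {v : ℝ} : expR ε v t .phc = Real.exp (-ε.phic * t) := by simp [expR, expoC, expoV]

theorem sigma_eq : (sigma A ε U e t y : Fin 2 → Fin 2 → ℝ) = sigmaJ bb xx uu := by
  ext a c
  simp only [sigmaJ, expR_s]; rfl

theorem sigmaC_eq : sigmaC ε U e t y = sigmaCJ xx uu := by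
  ext c a d
  simp only [sigmaCJ, expR_sc]; rfl

theorem sigK_eq : sigK A ε U e t y = sigKJ bb xx uu := by
  ext a c
  simp only [sigKJ, ← sigma_eq]; rfl

theorem gammaSigma_eq : gammaSigma A ε U e t y = gammaSJ bb xx uu := by
  ext c a d
  simp only [gammaSigma, gammaSJ, diffC_eq, sigmaC_eq (A := A)]
  rw [sigma_eq]; rfl

theorem AsymptoticData.AnalyticIn.pd_lamAt (hA : A.AnalyticIn e y) (a : Fin 2) :
    pd a (A.lamAt e t) y = lamJ bb t a :=
  pd_sub_mul_const hA.lam hA.v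

theorem AsymptoticData.AnalyticIn.pd_pd_lamAt (hA : A.AnalyticIn e y) (a c : Fin 2) :
    pd a (pd c (A.lamAt e t)) y = dlamJ bb t a c :=
  pd_pd_sub_mul_const hA.lam hA.v

theorem AsymptoticData.AnalyticIn.phiC_eq (hA : A.AnalyticIn e y) (c : Fin 2) :
    phiC A ε U e t c y = phiCJ bb xx t uu c := by
  have : pd c (A.phiAt e t) y = _ := pd_sub_mul_const hA.phi hA.w
  simp only [phiC, phiCJ, expR_phc, this]; rfl

theorem AsymptoticData.AnalyticIn.gammaGamma_eq (hA : A.AnalyticIn e y) (c a d : Fin 2) :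
    gammaGamma A ε U e t y c a d = gammaGJ bb xx t uu c a d := by
  have h : ∀ a d, (sigma A ε U e t y)⁻¹ a d = inv2 (sigmaJ bb xx uu) a d := fun a d => by
    rw [← sigma_eq]; exact inv_eq_inv2 _ _ _
  simp only [gammaGamma, gammaGJ, gammaSigma_eq, hA.pd_lamAt, h]
  simp only [← sigma_eq]

theorem AsymptoticData.AnalyticIn.laplaceLam_eq (hA : A.AnalyticIn e y) :
    laplaceLam A ε U e t y = laplaceJ bb xx t uu := by
  simp only [laplaceLam, laplaceJ, gammaSigma_eq, hA.pd_lamAt, hA.pd_pd_lamAt]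
  simp only [← sigma_eq]

section Derivatives

variable (hU : ∀ i, DifferentiableAt ℝ (fun z => U.comp e t z i) y)
include hU

theorem dSigmaC_eq : dSigmaC A ε U e t y = dSigmaCJ bb xx uu ww := by
  ext d c a f
  have : pd d (fun z => sigmaC ε U e t z c a f) y
      = xx .sc * ww d (.sigc c a f) := by
    rw [expR_sc]
    exact pd_const_mul _ (hU _)
  simp only [dSigmaC, covMixed, dSigmaCJ, this]
  simp only [sigmaC_eq (A := A)]; rfl

theorem curvSigma_eq : curvSigma A ε U e t y = curvJ bb xx uu ww := by
  rw [curvSigma, curvJ, scalarCurv_eq, sigmaC_eq (A := A), dSigmaC_eq hU]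
  rw [sigma_eq]; rfl

theorem AsymptoticData.AnalyticIn.pd_phiC (hA : A.AnalyticIn e y) (a c : Fin 2) :
    pd a (phiC A ε U e t c) y = dphiCJ bb xx t ww a c := by
  have h1 : AnalyticAt ℝ (fun z => A.phi (e.symm z) - A.w (e.symm z) * t) y :=
    hA.phi.sub (hA.w.mul analyticAt_const)
  have h2 : pd a (phiC A ε U e t c) y = pd a (pd c (A.phiAt e t)) y
      + pd a (fun z => Real.exp (-ε.phic * t) * U.comp e t z (.phic c)) y :=
    pd_add (analyticAt_pd h1).differentiableAt ((hU _).const_mul _)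
  have h3 : pd a (pd c (A.phiAt e t)) y = _ := pd_pd_sub_mul_const hA.phi hA.w
  rw [h2, h3, pd_const_mul _ (hU _), dphiCJ, expR_phc]; rfl

theorem AsymptoticData.AnalyticIn.covUp_sigK (hA : A.AnalyticIn e y) (c a d : Fin 2) :
    covUp (A.sigLow e) (sigK A ε U e t) c a d y = covKJ bb xx uu ww c a d := by
  have h : pd c (fun z => sigK A ε U e t z a d) y = dsigKJ bb xx uu ww c a d := by
    have h1 : ∀ m, DifferentiableAt ℝ (fun z => sigma A ε U e t z a m) y := fun m =>
      (hA.up a m).differentiableAt.add ((hU _).const_mul _)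
    have h2 : ∀ m, pd c (fun z => sigma A ε U e t z a m) y = dsigmaJ bb xx ww c a m := by
      intro m
      have h3 : pd c (fun z => sigma A ε U e t z a m) y = pd c (fun z => A.sigUp e z a m) y
          + pd c (fun z => Real.exp (-ε.sig * t) * U.comp e t z (.sig a m)) y :=
        pd_add (hA.up a m).differentiableAt ((hU _).const_mul _)
      rw [h3, pd_const_mul _ (hU _), dsigmaJ, expR_s]; rfl
    have h4 : pd c (fun z => sigK A ε U e t z a d) y
        = ∑ m, pd c (fun z => sigma A ε U e t z a m * U.comp e t z (.k m d)) y :=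
      pd_sum (f := fun m z => sigma A ε U e t z a m * U.comp e t z (.k m d))
        fun m => (h1 m).mul (hU _)
    rw [h4, dsigKJ]
    refine Finset.sum_congr rfl fun m _ => ?_
    rw [pd_mul (h1 m) (hU _), h2, ← sigma_eq]; rfl
  simp only [covUp, covKJ, h]
  simp only [sigK_eq]; rfl

theorem AsymptoticData.AnalyticIn.sourceK_eq (hA : A.AnalyticIn e y) (a c : Fin 2) :
    sourceK A ε U e t y a c = sourceKJ bb xx t uu ww a c := by
  have h : hessTerm A ε U e t y a c + phiTerm A ε U e t y a c
      = ∑ m, sigmaJ bb xx uu c m * hessJ bb xx t uu m a := by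
    simp only [hessTerm, phiTerm, hA.pd_lamAt, hA.pd_pd_lamAt, hA.gammaGamma_eq, hA.phiC_eq, hessJ,
      ← sigma_eq, Finset.mul_sum, ← Finset.sum_add_distrib]
    refine Finset.sum_congr rfl fun m _ => ?_
    ring
  rw [sourceK, sourceKJ, ricciTerm, curvSigma_eq hU, hA.laplaceLam_eq, ← h, sub_sub]; rfl

theorem AsymptoticData.AnalyticIn.sourceP_eq (hA : A.AnalyticIn e y) :
    sourceP A ε U e t y = sourcePJ bb xx t uu ww := by
  simp only [sourceP, sourcePJ, hA.pd_phiC hU, gammaSigma_eq, hA.phiC_eq, hA.pd_lamAt]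
  simp only [← sigma_eq]; rfl

/-- The system at a point involves only the values and the first derivatives of the unknowns
there. -/
theorem AsymptoticData.AnalyticIn.systemAt_iff (hA : A.AnalyticIn e y) :
    SystemAt A ε U e t y ↔
      ∀ i, U.dt e t y i = linJ ε (A.v (e.symm y)) uu i + rhsJ bb xx t uu ww i := by
  have htr : U.trk e t y = trJ uu := rfl
  have e1 : xx .sk = Real.exp ((ε.sig - ε.k) * t) := by simp [expR, expoC, expoV]
  have e2 : xx .sck = Real.exp ((ε.sigc - ε.k) * t) := by simp [expR, expoC, expoV]
  have e3 : xx .k = Real.exp (-ε.k * t) := by simp [expR, expoC, expoV]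
  have e4 : xx .kv = Real.exp ((ε.k - A.v (e.symm y)) * t) := by simp [expR, expoC, expoV]
  have e5 : xx .pk = Real.exp ((ε.p - ε.k) * t) := by simp [expR, expoC, expoV]
  have e6 : xx .pv = Real.exp ((ε.p - A.v (e.symm y)) * t) := by simp [expR, expoC, expoV]
  have e7 : xx .phip = Real.exp ((ε.phi - ε.p) * t) := by simp [expR, expoC, expoV]
  have e8 : xx .phicp = Real.exp ((ε.phic - ε.p) * t) := by simp [expR, expoC, expoV]
  have hw : bb .w = A.w (e.symm y) := rfl
  constructor
  · intro h i
    cases i with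
    | sig a c => simp only [linJ, rhsJ, ← sigK_eq, e1]; linarith [h.sig a c]
    | phi => simp only [linJ, rhsJ, e7]; linarith [h.phi]
    | k a c =>
      simp only [linJ, rhsJ, ← hA.sourceK_eq hU, e3, e4, ← htr]; linarith [h.k a c]
    | p => simp only [linJ, rhsJ, ← hA.sourceP_eq hU, e5, e3, e6, ← htr, hw]; linarith [h.p]
    | sigc c a d => simp only [linJ, rhsJ, ← hA.covUp_sigK hU, e2]; linarith [h.sigc c a d]
    | phic c => simp only [linJ, rhsJ, e8]; linarith [h.phic c]
  · intro h
    refine ⟨fun a c => ?_, fun c a d => ?_, fun a c => ?_, ?_, ?_, fun c => ?_⟩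
    · rw [h]; simp only [linJ, rhsJ, ← sigK_eq, e1]; ring
    · rw [h]; simp only [linJ, rhsJ, ← hA.covUp_sigK hU, e2]; ring
    · rw [h]; simp only [linJ, rhsJ, ← hA.sourceK_eq hU, e3, e4, ← htr]; ring
    · rw [h]; simp only [linJ, rhsJ, ← hA.sourceP_eq hU, e5, e3, e6, ← htr, hw]; ring
    · rw [h]; simp only [linJ, rhsJ, e7]; ring
    · rw [h]; simp only [linJ, rhsJ, e8]; ring

end Derivatives

end Expressions

/-! ### Symmetries, and recovery of the dependent component -/

section Symmetry

/-- The symmetries of the background quantities that enter the system. -/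
structure BgSymm (b : BIdx → ℝ) : Prop where
  sU : b (.sU 1 0) = b (.sU 0 1)
  dsU : ∀ d, b (.dsU d 1 0) = b (.dsU d 0 1)
  gam : ∀ c, b (.gam c 1 0) = b (.gam c 0 1)
  ddlam : b (.ddlam 1 0) = b (.ddlam 0 1)
  ddv : b (.ddv 1 0) = b (.ddv 0 1)

variable {b : BIdx → ℝ} {x : EIdx → ℝ} {t : ℝ} {r : RIdx → ℝ} {dr : Fin 2 → RIdx → ℝ}
  {u : Idx → ℝ} {w : Fin 2 → Idx → ℝ}

theorem inv2_symm {S : Fin 2 → Fin 2 → ℝ} (hS : S 1 0 = S 0 1) : inv2 S 1 0 = inv2 S 0 1 := by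
  simp [inv2, hS]

theorem diffCG_symm {S B : Fin 2 → Fin 2 → ℝ} {P : Fin 2 → Fin 2 → Fin 2 → ℝ}
    (hB : B 1 0 = B 0 1) (hP : ∀ c, P c 1 0 = P c 0 1) (c : Fin 2) :
    diffCG S B P c 1 0 = diffCG S B P c 0 1 := by
  simp only [diffCG, dLowG, Fin.sum_univ_two, hB, hP]
  ring

theorem hessJ_symm (hb : BgSymm b) (hu : u (.sig 1 0) = u (.sig 0 1))
    (huc : ∀ c, u (.sigc c 1 0) = u (.sigc c 0 1)) :
    hessJ b x t u 1 0 = hessJ b x t u 0 1 := by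
  have hS : sigmaJ b x u 1 0 = sigmaJ b x u 0 1 := by simp only [sigmaJ, hb.sU, hu]
  have hB := inv2_symm hS
  have hG : ∀ c, gammaSJ b x u c 1 0 = gammaSJ b x u c 0 1 := fun c => by
    simp only [gammaSJ, hb.gam]
    rw [diffCG_symm hB]
    intro c; simp only [sigmaCJ, huc]
  have hGG : ∀ c, gammaGJ b x t u c 1 0 = gammaGJ b x t u c 0 1 := fun c => by
    simp only [gammaGJ, hG, hB]; ring
  simp only [hessJ, hGG, dlamJ, hb.ddlam, hb.ddv]; ring

theorem sourceKJ_symm (hb : BgSymm b) (hu : u (.sig 1 0) = u (.sig 0 1))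
    (huc : ∀ c, u (.sigc c 1 0) = u (.sigc c 0 1)) :
    sigmaJ b x u 0 0 * sourceKJ b x t u w 0 1 + sigmaJ b x u 0 1 * sourceKJ b x t u w 1 1
      = sigmaJ b x u 0 1 * sourceKJ b x t u w 0 0
        + sigmaJ b x u 1 1 * sourceKJ b x t u w 1 0 := by
  have hS : sigmaJ b x u 1 0 = sigmaJ b x u 0 1 := by simp only [sigmaJ, hb.sU, hu]
  simp only [sourceKJ, Fin.sum_univ_two, hS, hessJ_symm hb hu huc, Matrix.one_apply_eq,
    Matrix.one_apply_ne zero_ne_one, Matrix.one_apply_ne one_ne_zero]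
  ring

theorem sigmaR_symm (hb : BgSymm b) : sigmaR b x r 1 0 = sigmaR b x r 0 1 := by
  simp only [sigmaR, hb.sU]; rfl

theorem dsigmaR_symm (hb : BgSymm b) (d : Fin 2) :
    dsigmaR b x dr d 1 0 = dsigmaR b x dr d 0 1 := by
  simp only [dsigmaR, hb.dsU]; rfl

theorem sigmaJ_full : sigmaJ b x (full b x r) = sigmaR b x r := rfl

theorem dsigmaJ_fullD : dsigmaJ b x (fullD b x r dr) = dsigmaR b x dr := rfl

theorem full_k00 : full b x r (.k 0 0) = (r .tr + r .df) / 2 := rfl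
theorem full_k01 : full b x r (.k 0 1) = r .kx := rfl
theorem full_k10 : full b x r (.k 1 0) = kDep b x r := rfl
theorem full_k11 : full b x r (.k 1 1) = (r .tr - r .df) / 2 := rfl
theorem fullD_k00 (d : Fin 2) : fullD b x r dr d (.k 0 0) = (dr d .tr + dr d .df) / 2 := rfl
theorem fullD_k01 (d : Fin 2) : fullD b x r dr d (.k 0 1) = dr d .kx := rfl
theorem fullD_k10 (d : Fin 2) : fullD b x r dr d (.k 1 0) = dkDep b x r dr d := rfl
theorem fullD_k11 (d : Fin 2) : fullD b x r dr d (.k 1 1) = (dr d .tr - dr d .df) / 2 := rfl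

theorem mul_kDep (hS : sigmaR b x r 1 1 ≠ 0) :
    sigmaR b x r 1 1 * kDep b x r = sigmaR b x r 0 0 * r .kx - sigmaR b x r 0 1 * r .df := by
  rw [kDep]; field_simp

theorem mul_dkDep (hS : sigmaR b x r 1 1 ≠ 0) (d : Fin 2) :
    sigmaR b x r 1 1 * dkDep b x r dr d = dsigmaR b x dr d 0 0 * r .kx
      + sigmaR b x r 0 0 * dr d .kx - dsigmaR b x dr d 0 1 * r .df
      - sigmaR b x r 0 1 * dr d .df - kDep b x r * dsigmaR b x dr d 1 1 := by
  rw [dkDep]; field_simp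

theorem sigKJ_symm (hb : BgSymm b) (hS : sigmaR b x r 1 1 ≠ 0) :
    sigKJ b x (full b x r) 1 0 = sigKJ b x (full b x r) 0 1 := by
  simp only [sigKJ, Fin.sum_univ_two, sigmaJ_full, full_k00, full_k01, full_k10, full_k11,
    sigmaR_symm hb, mul_kDep hS]
  ring

theorem dsigKJ_symm (hb : BgSymm b) (hS : sigmaR b x r 1 1 ≠ 0) (d : Fin 2) :
    dsigKJ b x (full b x r) (fullD b x r dr) d 1 0
      = dsigKJ b x (full b x r) (fullD b x r dr) d 0 1 := by
  have h := mul_dkDep (b := b) (x := x) (dr := dr) hS d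
  simp only [dsigKJ, Fin.sum_univ_two, sigmaJ_full, dsigmaJ_fullD, full_k00, full_k01, full_k10,
    full_k11, fullD_k00, fullD_k01, fullD_k10, fullD_k11, sigmaR_symm hb, dsigmaR_symm hb]
  linear_combination h

theorem covKJ_symm (hb : BgSymm b) (hS : sigmaR b x r 1 1 ≠ 0) (c : Fin 2) :
    covKJ b x (full b x r) (fullD b x r dr) c 1 0
      = covKJ b x (full b x r) (fullD b x r dr) c 0 1 := by
  simp only [covKJ, dsigKJ_symm hb hS, Fin.sum_univ_two, sigKJ_symm hb hS]
  ring

/-- The equation for the dependent component is a consequence of the others: the antisymmetric part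
of `σ^{am} δk_m^b` is preserved. -/
theorem kDep_equation (hb : BgSymm b) (hS : sigmaR b x r 1 1 ≠ 0) {εk : ℝ} {S' : Fin 2 → Fin 2 → ℝ}
    (hS' : ∀ a c, S' a c = 2 * x .k * sigKJ b x (full b x r) a c) {kx' df' : ℝ}
    (hkx : kx' = εk * r .kx + rhsR b x t r dr .kx)
    (hdf : df' = εk * r .df + rhsR b x t r dr .df) :
    (S' 0 0 * r .kx + sigmaR b x r 0 0 * kx' - S' 0 1 * r .df - sigmaR b x r 0 1 * df'
      - kDep b x r * S' 1 1) * (sigmaR b x r 1 1)⁻¹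
    = εk * kDep b x r + rhsJ b x t (full b x r) (fullD b x r dr) (.k 1 0) := by
  have h1 := mul_kDep (b := b) (x := x) hS
  have h2 := sourceKJ_symm (b := b) (x := x) (t := t) (u := full b x r) (w := fullD b x r dr) hb rfl
    fun c => rfl
  have hx : rhsR b x t r dr .kx = rhsJ b x t (full b x r) (fullD b x r dr) (.k 0 1) := rfl
  have hd : rhsR b x t r dr .df = rhsJ b x t (full b x r) (fullD b x r dr) (.k 0 0)
    - rhsJ b x t (full b x r) (fullD b x r dr) (.k 1 1) := rfl
  rw [← div_eq_mul_inv, div_eq_iff hS, hkx, hdf, hx, hd]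
  simp only [hS', rhsJ, trJ, sigKJ, Fin.sum_univ_two, sigmaJ_full, sigmaR_symm hb, full_k00,
    full_k01, full_k10, full_k11] at h2 ⊢
  linear_combination x .kv * h2
    - (εk + x .k * ((r .tr + r .df) / 2 + (r .tr - r .df) / 2) + x .k * (r .tr - r .df)) * h1

theorem full_reduce (hu : u (.sig 1 0) = u (.sig 0 1)) (huc : ∀ c, u (.sigc c 1 0) = u (.sigc c 0 1))
    (hb : BgSymm b) (hS : sigmaJ b x u 1 1 ≠ 0) (hk : sigKJ b x u 1 0 = sigKJ b x u 0 1) :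
    full b x (reduce u) = u := by
  have hsR : ∀ a c, sigmaR b x (reduce u) a c = sigmaJ b x u a c := by
    intro a c
    simp only [sigmaR, sigmaJ, reduce]
    fin_cases a <;> fin_cases c
    · rfl
    · rfl
    · exact congrArg _ (congrArg _ hu.symm)
    · rfl
  ext i
  cases i with
  | sig a c =>
    fin_cases a <;> fin_cases c
    exacts [rfl, rfl, hu.symm, rfl]
  | sigc c a d =>
    fin_cases a <;> fin_cases d
    exacts [rfl, rfl, (huc c).symm, rfl]
  | k a c =>
    have h00 : full b x (reduce u) (.k 0 0) = u (.k 0 0) := by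
      rw [full_k00]; simp only [reduce]; ring
    have h11 : full b x (reduce u) (.k 1 1) = u (.k 1 1) := by
      rw [full_k11]; simp only [reduce]; ring
    have h10 : full b x (reduce u) (.k 1 0) = u (.k 1 0) := by
      have hS1 : sigmaJ b x u 1 0 = sigmaJ b x u 0 1 := by simp only [sigmaJ, hb.sU, hu]
      rw [full_k10]
      refine mul_left_cancel₀ (show sigmaR b x (reduce u) 1 1 ≠ 0 by rw [hsR]; exact hS) ?_
      rw [mul_kDep (by rw [hsR]; exact hS), hsR, hsR, hsR]
      simp only [reduce]
      simp only [sigKJ, Fin.sum_univ_two, hS1] at hk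
      linear_combination -hk
    fin_cases a <;> fin_cases c
    exacts [h00, rfl, h10, h11]
  | _ => rfl

theorem reduce_linJ {ε : Exponents} {v : ℝ} (j : RIdx) :
    reduce (linJ ε v u) j = muR (fun c => c) ε v j * reduce u j := by
  cases j <;> simp [reduce, linJ, muR, trJ] <;> ring

/-- The values of all the time derivatives from those of the independent components. -/
theorem linJ_add_rhsJ_full (hb : BgSymm b) (hS : sigmaR b x r 1 1 ≠ 0) {ε : Exponents} {v : ℝ}
    {ρ : RIdx → ℝ} (hρ : ∀ j, ρ j = muR (fun c => c) ε v j * r j + rhsR b x t r dr j) :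
    (∀ a c, ρ (.sig (symIdx a c)) = linJ ε v (full b x r) (.sig a c)
      + rhsJ b x t (full b x r) (fullD b x r dr) (.sig a c)) ∧
    (ρ .phi = linJ ε v (full b x r) .phi + rhsJ b x t (full b x r) (fullD b x r dr) .phi) ∧
    ((ρ .tr + ρ .df) / 2 = linJ ε v (full b x r) (.k 0 0)
      + rhsJ b x t (full b x r) (fullD b x r dr) (.k 0 0)) ∧
    (ρ .kx = linJ ε v (full b x r) (.k 0 1)
      + rhsJ b x t (full b x r) (fullD b x r dr) (.k 0 1)) ∧
    ((ρ .tr - ρ .df) / 2 = linJ ε v (full b x r) (.k 1 1)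
      + rhsJ b x t (full b x r) (fullD b x r dr) (.k 1 1)) ∧
    (ρ .p = linJ ε v (full b x r) .p + rhsJ b x t (full b x r) (fullD b x r dr) .p) ∧
    (∀ c a d, ρ (.sigc c (symIdx a d)) = linJ ε v (full b x r) (.sigc c a d)
      + rhsJ b x t (full b x r) (fullD b x r dr) (.sigc c a d)) ∧
    (∀ c, ρ (.phic c) = linJ ε v (full b x r) (.phic c)
      + rhsJ b x t (full b x r) (fullD b x r dr) (.phic c)) := by
  have hsig : ∀ a c, rhsJ b x t (full b x r) (fullD b x r dr)
      (.sig (fstIdx (symIdx a c)) (sndIdx (symIdx a c)))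
      = rhsJ b x t (full b x r) (fullD b x r dr) (.sig a c) := by
    intro a c
    fin_cases a <;> fin_cases c
    · rfl
    · rfl
    · exact congrArg (fun s => 2 * x .sk * s) (sigKJ_symm hb hS).symm
    · rfl
  have hsigc : ∀ c a d, rhsJ b x t (full b x r) (fullD b x r dr)
      (.sigc c (fstIdx (symIdx a d)) (sndIdx (symIdx a d)))
      = rhsJ b x t (full b x r) (fullD b x r dr) (.sigc c a d) := by
    intro c a d
    fin_cases a <;> fin_cases d
    · rfl
    · rfl
    · exact congrArg (fun s => 2 * x .sck * s) (covKJ_symm hb hS c)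
    · rfl
  refine ⟨fun a c => ?_, ?_, ?_, ?_, ?_, ?_, fun c a d => ?_, fun c => ?_⟩
  · rw [hρ, ← hsig]; rfl
  · rw [hρ]; rfl
  · rw [hρ, hρ]
    simp only [rhsR, reduce, linJ, muR, trJ, Fin.sum_univ_two, full_k00, full_k11,
      Matrix.one_apply_eq]
    ring
  · rw [hρ]
    simp only [rhsR, reduce, linJ, muR, full_k01, Matrix.one_apply_ne zero_ne_one]
    ring
  · rw [hρ, hρ]
    simp only [rhsR, reduce, linJ, muR, trJ, Fin.sum_univ_two, full_k00, full_k11,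
      Matrix.one_apply_eq]
    ring
  · rw [hρ]; rfl
  · rw [hρ, ← hsigc]; rfl
  · rw [hρ]; rfl

end Symmetry

/-! ### Frames, components and changes of chart -/

section Charts

variable {M : Type*} [TopologicalSpace M] [ChartedSpace Plane M]

/-- The coordinate vectors as elements of the model space. -/
noncomputable def frameV (e : OpenPartialHomeomorph M Plane) (y : Plane) (a : Fin 2) : Plane :=
  frame e y a

/-- The coordinate covectors as linear forms on the model space. -/
noncomputable def coframeV (e : OpenPartialHomeomorph M Plane) (y : Plane) (a : Fin 2) :
    Plane →ₗ[ℝ] ℝ := coframe e y a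

/-- `δσ^{ab}` as a bilinear form on the dual of the model space. -/
noncomputable def Fields.sigV (U : Fields M) (t : ℝ) (x : M) :
    (Plane →ₗ[ℝ] ℝ) →ₗ[ℝ] (Plane →ₗ[ℝ] ℝ) →ₗ[ℝ] ℝ := U.sig t x

/-- `δk_a^b` as an endomorphism of the model space. -/
noncomputable def Fields.kV (U : Fields M) (t : ℝ) (x : M) : Plane →ₗ[ℝ] Plane := U.k t x

/-- `δσ^{ab}_{[c]}` as a multilinear form on the model space. -/
noncomputable def Fields.sigcV (U : Fields M) (t : ℝ) (x : M) :
    Plane →ₗ[ℝ] (Plane →ₗ[ℝ] ℝ) →ₗ[ℝ] (Plane →ₗ[ℝ] ℝ) →ₗ[ℝ] ℝ := U.sigc t x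

/-- `δφ_{[c]}` as a linear form on the model space. -/
noncomputable def Fields.phicV (U : Fields M) (t : ℝ) (x : M) : Plane →ₗ[ℝ] ℝ := U.phic t x

theorem comp_sig (U : Fields M) (e : OpenPartialHomeomorph M Plane) (t : ℝ) (y : Plane)
    (a b : Fin 2) :
    U.comp e t y (.sig a b) = U.sigV t (e.symm y) (coframeV e y a) (coframeV e y b) := rfl

theorem comp_k (U : Fields M) (e : OpenPartialHomeomorph M Plane) (t : ℝ) (y : Plane)
    (a b : Fin 2) :
    U.comp e t y (.k a b) = coframeV e y b (U.kV t (e.symm y) (frameV e y a)) := rfl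

theorem comp_sigc (U : Fields M) (e : OpenPartialHomeomorph M Plane) (t : ℝ) (y : Plane)
    (c a b : Fin 2) : U.comp e t y (.sigc c a b)
      = U.sigcV t (e.symm y) (frameV e y c) (coframeV e y a) (coframeV e y b) := rfl

theorem comp_phic (U : Fields M) (e : OpenPartialHomeomorph M Plane) (t : ℝ) (y : Plane)
    (c : Fin 2) : U.comp e t y (.phic c) = U.phicV t (e.symm y) (frameV e y c) := rfl

/-- The change of coordinates from the chart `e` to the chart `e'`. -/
def transit (e e' : OpenPartialHomeomorph M Plane) (y : Plane) : Plane := e' (e.symm y)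

/-- The Jacobian matrix of a change of coordinates. -/
noncomputable def jac (e e' : OpenPartialHomeomorph M Plane) (y : Plane) (i a : Fin 2) : ℝ :=
  pd a (fun z => transit e e' z i) y

/-- The derivative of the inverse of a chart, as an endomorphism of the model space. -/
noncomputable def dSymm (e : OpenPartialHomeomorph M Plane) (y : Plane) : Plane →L[ℝ] Plane :=
  mfderiv 𝓘(ℝ, Plane) 𝓘(ℝ, Plane) e.symm y

/-- The derivative of a chart at a point of the surface, as an endomorphism of the model space. -/
noncomputable def dChart (e : OpenPartialHomeomorph M Plane) (x : M) : Plane →L[ℝ] Plane :=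
  mfderiv 𝓘(ℝ, Plane) 𝓘(ℝ, Plane) e x

theorem frameV_eq (e : OpenPartialHomeomorph M Plane) (y : Plane) (a : Fin 2) :
    frameV e y a = dSymm e y (EuclideanSpace.single a 1) := rfl

theorem coframeV_apply (e : OpenPartialHomeomorph M Plane) (y : Plane) (a : Fin 2) (v : Plane) :
    coframeV e y a v = dChart e (e.symm y) v a := rfl

theorem plane_eq_sum (v : Plane) : v = ∑ a, v a • EuclideanSpace.single a (1 : ℝ) := by
  ext i; fin_cases i <;> simp

/-- The points common to two charts, in the coordinates of the first. -/
def overlap (e e' : OpenPartialHomeomorph M Plane) : Set Plane :=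
  e.target ∩ e.symm ⁻¹' e'.source

theorem isOpen_overlap (e e' : OpenPartialHomeomorph M Plane) : IsOpen (overlap e e') :=
  e.isOpen_inter_preimage_symm e'.open_source

variable {e e' : OpenPartialHomeomorph M Plane} {y : Plane}

theorem symm_transit (hy : y ∈ overlap e e') : e'.symm (transit e e' y) = e.symm y :=
  e'.left_inv hy.2

theorem transit_mem (hy : y ∈ overlap e e') : transit e e' y ∈ overlap e' e :=
  ⟨e'.map_source hy.2, by rw [mem_preimage, symm_transit hy]; exact e.map_target hy.1⟩

theorem transit_transit (hy : y ∈ overlap e e') : transit e' e (transit e e' y) = y := by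
  rw [transit, symm_transit hy, e.right_inv hy.1]

variable [IsManifold 𝓘(ℝ, Plane) ω M]

instance : IsManifold 𝓘(ℝ, Plane) 1 M := IsManifold.of_le (n := ω) le_top

theorem contMDiffAt_symm (he : e ∈ atlas Plane M) (hy : y ∈ e.target) :
    ContMDiffAt 𝓘(ℝ, Plane) 𝓘(ℝ, Plane) ω e.symm y :=
  (contMDiffOn_symm_of_mem_maximalAtlas (IsManifold.subset_maximalAtlas he)).contMDiffAt
    (e.open_target.mem_nhds hy)

theorem analyticAt_transit (he : e ∈ atlas Plane M) (he' : e' ∈ atlas Plane M)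
    (hy : y ∈ overlap e e') : AnalyticAt ℝ (transit e e') y := by
  have h1 := contMDiffAt_symm he hy.1
  have h2 : ContMDiffAt 𝓘(ℝ, Plane) 𝓘(ℝ, Plane) ω e' (e.symm y) :=
    (contMDiffOn_of_mem_maximalAtlas (IsManifold.subset_maximalAtlas he')).contMDiffAt
      (e'.open_source.mem_nhds hy.2)
  exact (contMDiffAt_iff_contDiffAt.1 (h2.comp y h1)).analyticAt

theorem analyticAt_transit_apply (he : e ∈ atlas Plane M) (he' : e' ∈ atlas Plane M)
    (hy : y ∈ overlap e e') (i : Fin 2) : AnalyticAt ℝ (fun z => transit e e' z i) y :=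
  ((EuclideanSpace.proj i : Plane →L[ℝ] ℝ).analyticAt _).comp (analyticAt_transit he he' hy)

theorem analyticAt_jac (he : e ∈ atlas Plane M) (he' : e' ∈ atlas Plane M)
    (hy : y ∈ overlap e e') (i a : Fin 2) : AnalyticAt ℝ (fun z => jac e e' z i a) y :=
  analyticAt_pd (analyticAt_transit_apply he he' hy i)

theorem fderiv_transit_apply (he : e ∈ atlas Plane M) (he' : e' ∈ atlas Plane M)
    (hy : y ∈ overlap e e') (i a : Fin 2) :
    fderiv ℝ (transit e e') y (EuclideanSpace.single a 1) i = jac e e' y i a := by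
  have h := ((EuclideanSpace.proj i : Plane →L[ℝ] ℝ).hasFDerivAt.comp y
    (analyticAt_transit he he' hy).differentiableAt.hasFDerivAt).fderiv
  exact (congrArg (fun L => L (EuclideanSpace.single a 1)) h).symm

theorem dChart_comp_dSymm (he : e ∈ atlas Plane M) (hy : y ∈ e.target) (v : Plane) :
    dChart e (e.symm y) (dSymm e y v) = v := by
  have h := (mdifferentiable_of_mem_atlas (I := 𝓘(ℝ, Plane)) he).comp_symm_deriv hy
  exact congrArg (fun L : Plane →L[ℝ] Plane => L v) h

theorem dSymm_comp_dChart (he : e ∈ atlas Plane M) (hy : y ∈ e.target) (v : Plane) :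
    dSymm e y (dChart e (e.symm y) v) = v := by
  have h := (mdifferentiable_of_mem_atlas (I := 𝓘(ℝ, Plane)) he).symm_comp_deriv
    (e.map_target hy)
  have h2 := congrArg (fun L : Plane →L[ℝ] Plane => L v) h
  have h3 : dSymm e (e (e.symm y)) (dChart e (e.symm y) v) = v := h2
  rwa [e.right_inv hy] at h3

theorem coframeV_frameV (he : e ∈ atlas Plane M) (hy : y ∈ e.target) (a b : Fin 2) :
    coframeV e y a (frameV e y b) = (1 : Matrix (Fin 2) (Fin 2) ℝ) a b := by
  rw [coframeV_apply, frameV_eq, dChart_comp_dSymm he hy]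
  simp [Matrix.one_apply]

theorem sum_coframeV_smul_frameV (he : e ∈ atlas Plane M) (hy : y ∈ e.target) (v : Plane) :
    ∑ a, coframeV e y a v • frameV e y a = v := by
  simp only [coframeV_apply, frameV_eq, ← map_smul, ← map_sum]
  rw [← plane_eq_sum, dSymm_comp_dChart he hy]

theorem sum_frameV_smul_coframeV (he : e ∈ atlas Plane M) (hy : y ∈ e.target) (θ : Plane →ₗ[ℝ] ℝ) :
    ∑ a, θ (frameV e y a) • coframeV e y a = θ := by
  ext v
  conv_rhs => rw [← sum_coframeV_smul_frameV he hy v, map_sum]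
  simp [mul_comm]

theorem dSymm_transit (he : e ∈ atlas Plane M) (he' : e' ∈ atlas Plane M)
    (hy : y ∈ overlap e e') (v : Plane) :
    dSymm e y v = dSymm e' (transit e e' y) (fderiv ℝ (transit e e') y v) := by
  have hev : e.symm =ᶠ[𝓝 y] e'.symm ∘ transit e e' := by
    filter_upwards [(isOpen_overlap e e').mem_nhds hy] with z hz using (symm_transit hz).symm
  have h1 : mfderiv 𝓘(ℝ, Plane) 𝓘(ℝ, Plane) e.symm y
      = (mfderiv 𝓘(ℝ, Plane) 𝓘(ℝ, Plane) (e'.symm ∘ transit e e') y :) := hev.mfderiv_eq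
  have h2 := mfderiv_comp (I := 𝓘(ℝ, Plane)) (I' := 𝓘(ℝ, Plane)) (I'' := 𝓘(ℝ, Plane)) y
    (f := transit e e') (g := e'.symm)
    (mdifferentiableAt_atlas_symm he' (transit_mem hy).1)
    (analyticAt_transit he he' hy).differentiableAt.mdifferentiableAt
  rw [mfderiv_eq_fderiv] at h2
  have h3 : dSymm e y = (dSymm e' (transit e e' y)).comp (fderiv ℝ (transit e e') y) := h1.trans h2
  rw [h3]; rfl

theorem dChart_transit (he : e ∈ atlas Plane M) (he' : e' ∈ atlas Plane M)
    (hy : y ∈ overlap e e') (v : Plane) :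
    dChart e (e.symm y) v
      = fderiv ℝ (transit e' e) (transit e e' y) (dChart e' (e'.symm (transit e e' y)) v) := by
  have hinv : fderiv ℝ (transit e' e) (transit e e' y) (fderiv ℝ (transit e e') y
      (dChart e (e.symm y) v)) = dChart e (e.symm y) v := by
    have h := (analyticAt_transit he' he (transit_mem hy)).differentiableAt.hasFDerivAt.comp y
      (analyticAt_transit he he' hy).differentiableAt.hasFDerivAt
    have hid : (transit e' e) ∘ (transit e e') =ᶠ[𝓝 y] id := by
      filter_upwards [(isOpen_overlap e e').mem_nhds hy] with z hz using transit_transit hz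
    have h2 := (h.congr_of_eventuallyEq hid.symm).unique (hasFDerivAt_id y)
    exact congrArg (fun L : Plane →L[ℝ] Plane => L (dChart e (e.symm y) v)) h2
  rw [← hinv]
  congr 1
  have h1 := dSymm_comp_dChart he hy.1 v
  rw [dSymm_transit he he' hy] at h1
  conv_rhs => rw [← h1]
  rw [dChart_comp_dSymm he' (transit_mem hy).1]

theorem frameV_transit (he : e ∈ atlas Plane M) (he' : e' ∈ atlas Plane M)
    (hy : y ∈ overlap e e') (a : Fin 2) :
    frameV e y a = ∑ i, jac e e' y i a • frameV e' (transit e e' y) i := by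
  rw [frameV_eq, dSymm_transit he he' hy,
    plane_eq_sum (fderiv ℝ (transit e e') y (EuclideanSpace.single a 1)), map_sum]
  refine Finset.sum_congr rfl fun i _ => ?_
  rw [map_smul, fderiv_transit_apply he he' hy]; rfl

theorem coframeV_transit (he : e ∈ atlas Plane M) (he' : e' ∈ atlas Plane M)
    (hy : y ∈ overlap e e') (a : Fin 2) :
    coframeV e y a = ∑ i, jac e' e (transit e e' y) a i • coframeV e' (transit e e' y) i := by
  ext v
  rw [coframeV_apply, dChart_transit he he' hy,
    plane_eq_sum (dChart e' (e'.symm (transit e e' y)) v), map_sum]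
  simp only [map_smul, LinearMap.sum_apply, LinearMap.smul_apply, coframeV_apply, smul_eq_mul,
    WithLp.ofLp_sum, WithLp.ofLp_smul, Finset.sum_apply, Pi.smul_apply,
    fderiv_transit_apply he' he (transit_mem hy)]
  simp only [mul_comm]

theorem jac_mul_jac (he : e ∈ atlas Plane M) (he' : e' ∈ atlas Plane M)
    (hy : y ∈ overlap e e') (a b : Fin 2) :
    ∑ i, jac e' e (transit e e' y) a i * jac e e' y i b = (1 : Matrix (Fin 2) (Fin 2) ℝ) a b := by
  rw [← coframeV_frameV he hy.1, coframeV_transit he he' hy, frameV_transit he he' hy]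
  simp [Fin.sum_univ_two, coframeV_frameV he' (transit_mem hy).1]

/-- How the components of `U` change with the chart. -/
theorem comp_transit (he : e ∈ atlas Plane M) (he' : e' ∈ atlas Plane M)
    (hy : y ∈ overlap e e') (U : Fields M) (t : ℝ) :
    (∀ a b, U.comp e t y (.sig a b) = ∑ i, ∑ j, jac e' e (transit e e' y) a i
      * jac e' e (transit e e' y) b j * U.comp e' t (transit e e' y) (.sig i j)) ∧
    (U.comp e t y .phi = U.comp e' t (transit e e' y) .phi) ∧
    (∀ a b, U.comp e t y (.k a b) = ∑ i, ∑ j, jac e e' y i a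
      * jac e' e (transit e e' y) b j * U.comp e' t (transit e e' y) (.k i j)) ∧
    (U.comp e t y .p = U.comp e' t (transit e e' y) .p) ∧
    (∀ c a b, U.comp e t y (.sigc c a b) = ∑ l, ∑ i, ∑ j, jac e e' y l c
      * jac e' e (transit e e' y) a i * jac e' e (transit e e' y) b j
      * U.comp e' t (transit e e' y) (.sigc l i j)) ∧
    (∀ c, U.comp e t y (.phic c) = ∑ i, jac e e' y i c
      * U.comp e' t (transit e e' y) (.phic i)) := by
  have hx := symm_transit hy
  refine ⟨fun a b => ?_, ?_, fun a b => ?_, ?_, fun c a b => ?_, fun c => ?_⟩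
  · simp only [comp_sig, coframeV_transit he he' hy, hx, Fin.sum_univ_two, map_add, map_smul,
      LinearMap.add_apply, LinearMap.smul_apply, smul_eq_mul]
    ring
  · show U.phi t _ = U.phi t _
    rw [hx]
  · simp only [comp_k, coframeV_transit he he' hy, frameV_transit he he' hy, hx, Fin.sum_univ_two,
      map_add, map_smul, LinearMap.add_apply, LinearMap.smul_apply, smul_eq_mul]
    ring
  · show U.p t _ = U.p t _
    rw [hx]
  · simp only [comp_sigc, coframeV_transit he he' hy, frameV_transit he he' hy, hx,
      Fin.sum_univ_two, map_add, map_smul, LinearMap.add_apply, LinearMap.smul_apply, smul_eq_mul]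
    ring
  · simp only [comp_phic, frameV_transit he he' hy, hx, Fin.sum_univ_two, map_add, map_smul,
      smul_eq_mul]

/-- The components in a chart determine the fields. -/
theorem agreeAt_of_comp_eq (he : e ∈ atlas Plane M) (hy : y ∈ e.target) {U U' : Fields M} {t : ℝ}
    (h : ∀ i, U.comp e t y i = U'.comp e t y i) : U.AgreeAt U' t (e.symm y) := by
  have hf := sum_coframeV_smul_frameV he hy
  have hc := sum_frameV_smul_coframeV he hy
  refine ⟨?_, h .phi, ?_, h .p, ?_, ?_⟩
  · show U.sigV t (e.symm y) = U'.sigV t (e.symm y)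
    refine LinearMap.ext fun α => LinearMap.ext fun β => ?_
    rw [← hc α, ← hc β]
    simp only [map_sum, map_smul, LinearMap.sum_apply, LinearMap.smul_apply, ← comp_sig, h]
  · show U.kV t (e.symm y) = U'.kV t (e.symm y)
    refine LinearMap.ext fun v => ?_
    rw [← hf (U.kV t (e.symm y) v), ← hf (U'.kV t (e.symm y) v)]
    refine Finset.sum_congr rfl fun a _ => ?_
    rw [← hf v]
    simp only [map_sum, map_smul, ← comp_k, h]
  · show U.sigcV t (e.symm y) = U'.sigcV t (e.symm y)
    refine LinearMap.ext fun v => LinearMap.ext fun α => LinearMap.ext fun β => ?_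
    rw [← hc α, ← hc β, ← hf v]
    simp only [map_sum, map_smul, LinearMap.sum_apply, LinearMap.smul_apply, ← comp_sigc, h]
  · show U.phicV t (e.symm y) = U'.phicV t (e.symm y)
    refine LinearMap.ext fun v => ?_
    rw [← hf v]
    simp only [map_sum, map_smul, ← comp_phic, h]

end Charts

open Filter Topology Metric Set MeasureTheory Bundle

/-! ### The background metric in a chart -/

section Metric

variable {M : Type*} [TopologicalSpace M] [ChartedSpace Plane M] [IsManifold 𝓘(ℝ, Plane) ω M]
  {e e' : OpenPartialHomeomorph M Plane} {y : Plane}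

theorem contMDiffAt_frame (he : e ∈ atlas Plane M) (hy : y ∈ e.target) (a : Fin 2) :
    ContMDiffAt 𝓘(ℝ, Plane) 𝓘(ℝ, Plane).tangent ω
      (fun z => (⟨e.symm z, frame e z a⟩ : TangentBundle 𝓘(ℝ, Plane) M)) y := by
  have h1 := (contMDiffOn_symm_of_mem_maximalAtlas (I := 𝓘(ℝ, Plane)) (n := ω)
    (IsManifold.subset_maximalAtlas he)).contMDiffOn_tangentMapWithin (m := ω) (by simp)
    e.open_target.uniqueMDiffOn
  have h2 : ContMDiffAt 𝓘(ℝ, Plane) 𝓘(ℝ, Plane).tangent ω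
      (fun z : Plane => (⟨z, EuclideanSpace.single a (1 : ℝ)⟩ :
        TangentBundle 𝓘(ℝ, Plane) Plane)) y := by
    have := contMDiffWithinAt_vectorSpace_iff_contDiffWithinAt (𝕜 := ℝ) (n := ω)
      (V := fun _ : Plane => (EuclideanSpace.single a (1 : ℝ) : Plane)) (s := univ) (x := y)
    exact (this.2 contDiffWithinAt_const).contMDiffAt univ_mem
  have h3 := (h1 ⟨y, EuclideanSpace.single a (1 : ℝ)⟩ hy).comp_of_eq
    (x := y) (s := e.target)
    (f := fun z : Plane => (⟨z, EuclideanSpace.single a (1 : ℝ)⟩ :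
        TangentBundle 𝓘(ℝ, Plane) Plane)) h2.contMDiffWithinAt (fun z hz => hz) rfl
  refine (h3.contMDiffAt (e.open_target.mem_nhds hy)).congr_of_eventuallyEq ?_
  filter_upwards [e.open_target.mem_nhds hy] with z hz
  simp only [Function.comp, tangentMapWithin]
  rw [mfderivWithin_of_isOpen e.open_target hz]; rfl

theorem analyticAt_sigLow (A : AsymptoticData M) (he : e ∈ atlas Plane M) (hy : y ∈ e.target)
    (a b : Fin 2) : AnalyticAt ℝ (fun z => A.sigLow e z a b) y := by
  have h : ContMDiffAt 𝓘(ℝ, Plane) (𝓘(ℝ, Plane).prod 𝓘(ℝ)) ω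
      (fun z => TotalSpace.mk' ℝ (E := Bundle.Trivial M ℝ) (e.symm z)
        (A.metric.inner (e.symm z) (frame e z a) (frame e z b))) y := by
    apply ContMDiffWithinAt.clm_bundle_apply₂ (F₁ := Plane) (F₂ := Plane)
    · exact ContMDiffAt.comp_contMDiffWithinAt y A.metric.contMDiff.contMDiffAt
        (contMDiffAt_symm he hy)
    · exact contMDiffAt_frame he hy a
    · exact contMDiffAt_frame he hy b
  simp only [contMDiffAt_totalSpace] at h
  exact (contMDiffAt_iff_contDiffAt.1 h.2).analyticAt

/-- The background metric as a bilinear form on the model space. -/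
noncomputable def AsymptoticData.metricV (A : AsymptoticData M) (x : M) :
    Plane →L[ℝ] Plane →L[ℝ] ℝ := A.metric.inner x

theorem sigLow_eq (A : AsymptoticData M) (e : OpenPartialHomeomorph M Plane) (y : Plane)
    (a b : Fin 2) :
    A.sigLow e y a b = A.metricV (e.symm y) (frameV e y a) (frameV e y b) := rfl

theorem sigLow_symm (A : AsymptoticData M) (e : OpenPartialHomeomorph M Plane) (y : Plane)
    (a b : Fin 2) : A.sigLow e y a b = A.sigLow e y b a := A.metric.symm _ _ _

theorem sigLow_transit (A : AsymptoticData M) (he : e ∈ atlas Plane M) (he' : e' ∈ atlas Plane M)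
    (hy : y ∈ overlap e e') (a b : Fin 2) :
    A.sigLow e y a b = ∑ i, ∑ j, jac e e' y i a * jac e e' y j b
      * A.sigLow e' (transit e e' y) i j := by
  simp only [sigLow_eq, frameV_transit he he' hy, symm_transit hy, Fin.sum_univ_two, map_add,
    map_smul, add_apply, smul_apply, smul_eq_mul]
  ring

theorem sigLow_posDef (A : AsymptoticData M) (he : e ∈ atlas Plane M) (hy : y ∈ e.target) :
    (A.sigLow e y).PosDef := by
  refine Matrix.PosDef.of_dotProduct_mulVec_pos ?_ fun {v} hv => ?_
  · ext a b; exact sigLow_symm A e y b a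
  · have h1 : star v ⬝ᵥ (A.sigLow e y).mulVec v
        = A.metricV (e.symm y) (∑ a, v a • frameV e y a) (∑ a, v a • frameV e y a) := by
      simp only [dotProduct, Matrix.mulVec, sigLow_eq, Fin.sum_univ_two, map_add, map_smul,
        add_apply, smul_apply, smul_eq_mul, Pi.star_apply, star_trivial]
      ring
    rw [h1]
    refine A.metric.pos _ _ fun h0 => hv ?_
    have h3 : ∀ b, v 0 * (1 : Matrix (Fin 2) (Fin 2) ℝ) b 0
        + v 1 * (1 : Matrix (Fin 2) (Fin 2) ℝ) b 1 = 0 := by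
      intro b
      have h2 := congrArg (fun w : Plane => coframeV e y b w) h0
      have h3 : coframeV e y b (∑ a, v a • frameV e y a) = 0 := h2.trans (map_zero _)
      rwa [Fin.sum_univ_two, map_add, map_smul, map_smul, coframeV_frameV he hy,
        coframeV_frameV he hy] at h3
    have h4 : v 0 = 0 := by simpa using h3 0
    have h5 : v 1 = 0 := by simpa using h3 1
    ext b; fin_cases b <;> assumption

theorem sigUp_posDef (A : AsymptoticData M) (he : e ∈ atlas Plane M) (hy : y ∈ e.target) :
    (A.sigUp e y).PosDef := (sigLow_posDef A he hy).inv

theorem analyticAt_sigUp (A : AsymptoticData M) (he : e ∈ atlas Plane M) (hy : y ∈ e.target)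
    (a b : Fin 2) : AnalyticAt ℝ (fun z => A.sigUp e z a b) y := by
  have h := fun a b => analyticAt_sigLow A he hy a b
  have hdet : A.sigLow e y 0 0 * A.sigLow e y 1 1 - A.sigLow e y 0 1 * A.sigLow e y 1 0 ≠ 0 := by
    rw [← Matrix.det_fin_two]; exact (sigLow_posDef A he hy).det_pos.ne'
  have hinv := (((h 0 0).mul (h 1 1)).sub ((h 0 1).mul (h 1 0))).inv hdet
  have heq : (fun z => A.sigUp e z a b) = fun z => inv2 (A.sigLow e z) a b := by
    ext z; exact inv_eq_inv2 _ _ _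
  rw [heq]
  have key : AnalyticAt ℝ (fun z => (!![A.sigLow e z 1 1, -A.sigLow e z 0 1;
      -A.sigLow e z 1 0, A.sigLow e z 0 0] : Matrix (Fin 2) (Fin 2) ℝ) a b) y := by
    fin_cases a <;> fin_cases b
    · exact h 1 1
    · exact (h 0 1).neg
    · exact (h 1 0).neg
    · exact h 0 0
  exact hinv.mul key

theorem analyticAt_comp_symm {f : M → ℝ} (hf : ContMDiff 𝓘(ℝ, Plane) 𝓘(ℝ, ℝ) ω f)
    (he : e ∈ atlas Plane M) (hy : y ∈ e.target) : AnalyticAt ℝ (fun z => f (e.symm z)) y :=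
  (contMDiffAt_iff_contDiffAt.1 (hf.contMDiffAt.comp y (contMDiffAt_symm he hy))).analyticAt

theorem analyticIn_chart (A : AsymptoticData M) (he : e ∈ atlas Plane M) (hy : y ∈ e.target) :
    A.AnalyticIn e y :=
  ⟨analyticAt_sigLow A he hy, analyticAt_sigUp A he hy, analyticAt_comp_symm A.phi_analytic he hy,
    analyticAt_comp_symm A.lam_analytic he hy, analyticAt_comp_symm A.v_analytic he hy,
    analyticAt_comp_symm A.w_analytic he hy⟩

theorem analyticAt_sum {F : Fin 2 → Plane → ℝ} (h : ∀ i, AnalyticAt ℝ (F i) y) :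
    AnalyticAt ℝ (fun z => ∑ i, F i z) y := by
  simp only [Fin.sum_univ_two]
  exact (h 0).add (h 1)

theorem AsymptoticData.AnalyticIn.christoffel {A : AsymptoticData M} (h : A.AnalyticIn e y)
    (c a b : Fin 2) : AnalyticAt ℝ (christoffel (A.sigLow e) c a b) y :=
  analyticAt_sum fun d => (analyticAt_const.mul (h.up c d)).mul
    (((analyticAt_pd (h.low b d)).add (analyticAt_pd (h.low a d))).sub (analyticAt_pd (h.low a b)))

theorem AsymptoticData.AnalyticIn.ricci {A : AsymptoticData M} (h : A.AnalyticIn e y)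
    (a b : Fin 2) : AnalyticAt ℝ (ricci (A.sigLow e) a b) y :=
  (((analyticAt_sum fun c => analyticAt_pd (h.christoffel c a b)).sub
    (analyticAt_sum fun c => analyticAt_pd (h.christoffel c a c))).add
    (analyticAt_sum fun c => analyticAt_sum fun d =>
      (h.christoffel c c d).mul (h.christoffel d a b))).sub
    (analyticAt_sum fun c => analyticAt_sum fun d =>
      (h.christoffel c b d).mul (h.christoffel d a c))

theorem AsymptoticData.AnalyticIn.bgR {A : AsymptoticData M} (h : A.AnalyticIn e y) (i : BIdx) :
    AnalyticAt ℝ (fun z => bgR A e z i) y := by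
  cases i with
  | sU a b => exact h.up a b
  | dsU c a b => exact analyticAt_pd (h.up a b)
  | gam c a b => exact h.christoffel c a b
  | ric a b => exact h.ricci a b
  | dphi a => exact analyticAt_pd h.phi
  | ddphi a b => exact analyticAt_pd (analyticAt_pd h.phi)
  | dlam a => exact analyticAt_pd h.lam
  | ddlam a b => exact analyticAt_pd (analyticAt_pd h.lam)
  | dv a => exact analyticAt_pd h.v
  | ddv a b => exact analyticAt_pd (analyticAt_pd h.v)
  | dw a => exact analyticAt_pd h.w
  | ddw a b => exact analyticAt_pd (analyticAt_pd h.w)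
  | elam => exact h.lam.rexp
  | v => exact h.v
  | w => exact h.w

theorem sigUp_symm (A : AsymptoticData M) (e : OpenPartialHomeomorph M Plane) (y : Plane) :
    A.sigUp e y 1 0 = A.sigUp e y 0 1 := by
  simp only [AsymptoticData.sigUp, inv_eq_inv2]
  exact inv2_symm (sigLow_symm A e y 1 0)

theorem christoffel_symm (A : AsymptoticData M) (e : OpenPartialHomeomorph M Plane) (y : Plane)
    (c a b : Fin 2) :
    christoffel (A.sigLow e) c a b y = christoffel (A.sigLow e) c b a y := by
  simp only [christoffel]
  refine Finset.sum_congr rfl fun d _ => ?_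
  have : (fun z => A.sigLow e z a b) = fun z => A.sigLow e z b a :=
    funext fun z => sigLow_symm A e z a b
  rw [this]; ring

theorem bgSymm_bgR {A : AsymptoticData M} (h : A.AnalyticIn e y) : BgSymm (bgR A e y) := by
  refine ⟨sigUp_symm A e y, fun d => ?_, fun c => christoffel_symm A e y c 1 0, pd_comm h.lam,
    pd_comm h.v⟩
  show pd d _ y = pd d _ y
  rw [show (fun z => A.sigUp e z 1 0) = fun z => A.sigUp e z 0 1 from
    funext fun z => sigUp_symm A e z]

end Metric

/-! ### Fields with given components -/

section OfComp

variable {M : Type*} [TopologicalSpace M] [ChartedSpace Plane M]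

/-- The contravariant tensor with components `c` in the frame `f`. -/
noncomputable def contraOf (f : Fin 2 → Plane) (c : Fin 2 → Fin 2 → ℝ) :
    (Plane →ₗ[ℝ] ℝ) →ₗ[ℝ] (Plane →ₗ[ℝ] ℝ) →ₗ[ℝ] ℝ :=
  LinearMap.mk₂ ℝ (fun α β => ∑ a, ∑ b, c a b * α (f a) * β (f b))
    (fun α α' β => by simp only [Fin.sum_univ_two, LinearMap.add_apply]; ring)
    (fun r α β => by simp only [Fin.sum_univ_two, LinearMap.smul_apply, smul_eq_mul]; ring)
    (fun α β β' => by simp only [Fin.sum_univ_two, LinearMap.add_apply]; ring)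
    (fun r α β => by simp only [Fin.sum_univ_two, LinearMap.smul_apply, smul_eq_mul]; ring)

theorem contraOf_apply (f : Fin 2 → Plane) (c : Fin 2 → Fin 2 → ℝ) (α β : Plane →ₗ[ℝ] ℝ) :
    contraOf f c α β = ∑ a, ∑ b, c a b * α (f a) * β (f b) := rfl

/-- The fields with given components in the chart `e`. -/
noncomputable def Fields.ofComp (e : OpenPartialHomeomorph M Plane) (c : ℝ → Plane → Idx → ℝ) :
    Fields M where
  sig t x := contraOf (frameV e (e x)) fun a b => c t (e x) (.sig a b)
  phi t x := c t (e x) .phi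
  k t x := (∑ a, ∑ b, c t (e x) (.k a b) • (coframeV e (e x) a).smulRight (frameV e (e x) b) :
    Plane →ₗ[ℝ] Plane)
  p t x := c t (e x) .p
  sigc t x := (∑ d, (coframeV e (e x) d).smulRight
    (contraOf (frameV e (e x)) fun a b => c t (e x) (.sigc d a b)) :
    Plane →ₗ[ℝ] (Plane →ₗ[ℝ] ℝ) →ₗ[ℝ] (Plane →ₗ[ℝ] ℝ) →ₗ[ℝ] ℝ)
  phic t x := (∑ d, c t (e x) (.phic d) • coframeV e (e x) d : Plane →ₗ[ℝ] ℝ)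

theorem comp_ofComp [IsManifold 𝓘(ℝ, Plane) ω M] {e : OpenPartialHomeomorph M Plane}
    (he : e ∈ atlas Plane M) {y : Plane} (hy : y ∈ e.target) (c : ℝ → Plane → Idx → ℝ) (t : ℝ)
    (i : Idx) : (Fields.ofComp e c).comp e t y i = c t y i := by
  have hr := e.right_inv hy
  have hd := coframeV_frameV he hy
  have h2 : ∀ f : Fin 2 → ℝ, ∀ a, ∑ b, f b * (1 : Matrix (Fin 2) (Fin 2) ℝ) a b = f a := by
    intro f a
    revert a
    rw [Fin.forall_fin_two]
    constructor <;> simp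
  have h3 : ∀ f : Fin 2 → ℝ, ∀ a, ∑ b, f b * (1 : Matrix (Fin 2) (Fin 2) ℝ) b a = f a := by
    intro f a
    revert a
    rw [Fin.forall_fin_two]
    constructor <;> simp
  have hcon : ∀ (g : Fin 2 → Fin 2 → ℝ) a b, contraOf (frameV e y) g (coframeV e y a)
      (coframeV e y b) = g a b := by
    intro g a b
    simp only [contraOf_apply, hd, h2]
  cases i with
  | sig a b =>
    rw [comp_sig]
    show contraOf (frameV e (e (e.symm y))) (fun a b => c t (e (e.symm y)) (.sig a b)) _ _ = _
    rw [hr, hcon]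
  | phi =>
    show c t (e (e.symm y)) .phi = _
    rw [hr]
  | k a b =>
    rw [comp_k]
    show coframeV e y b ((∑ a, ∑ b, c t (e (e.symm y)) (.k a b) •
      (coframeV e (e (e.symm y)) a).smulRight (frameV e (e (e.symm y)) b)) (frameV e y a)) = _
    rw [hr]
    simp only [LinearMap.sum_apply, LinearMap.smul_apply, LinearMap.smulRight_apply, map_sum,
      map_smul, hd, smul_eq_mul]
    revert a b
    simp only [Fin.forall_fin_two]
    simp
  | p =>
    show c t (e (e.symm y)) .p = _
    rw [hr]
  | sigc d a b =>
    rw [comp_sigc]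
    show (∑ d, (coframeV e (e (e.symm y)) d).smulRight (contraOf (frameV e (e (e.symm y)))
      fun a b => c t (e (e.symm y)) (.sigc d a b))) (frameV e y d) (coframeV e y a)
      (coframeV e y b) = _
    rw [hr]
    simp only [LinearMap.sum_apply, LinearMap.smulRight_apply, LinearMap.smul_apply, hd,
      smul_eq_mul, hcon]
    simp only [mul_comm _ (c t y _), h3]
  | phic d =>
    rw [comp_phic]
    show (∑ d, c t (e (e.symm y)) (.phic d) • coframeV e (e (e.symm y)) d) (frameV e y d) = _
    rw [hr]
    simp only [LinearMap.sum_apply, LinearMap.smul_apply, hd, smul_eq_mul, h3]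

end OfComp

/-! ### Holomorphic extensions of time-dependent functions -/

section Extensions

/-- The functions `g t` extend, for all large times, holomorphically to a common complex
neighborhood of `y₀`, with a common bound. -/
def HolBounded (g : ℝ → Plane → ℝ) (y₀ : Plane) : Prop :=
  ∃ r > 0, ∃ (t₀ C : ℝ) (V : ℝ → (Fin 2 → ℂ) → ℂ), ∀ t, t₀ < t →
    DifferentiableOn ℂ (V t) (ball (toC y₀) r) ∧ (∀ z ∈ ball (toC y₀) r, ‖V t z‖ ≤ C) ∧
    ∀ y, toC y ∈ ball (toC y₀) r → V t (toC y) = g t y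

/-- The functions `g t` extend, for all large times, holomorphically to a common complex
neighborhood of `y₀`, on which they tend to zero uniformly. -/
def HolZero (g : ℝ → Plane → ℝ) (y₀ : Plane) : Prop :=
  ∃ r > 0, ∃ (t₀ : ℝ) (V : ℝ → (Fin 2 → ℂ) → ℂ), (∀ t, t₀ < t →
    DifferentiableOn ℂ (V t) (ball (toC y₀) r) ∧
    ∀ y, toC y ∈ ball (toC y₀) r → V t (toC y) = g t y) ∧
    TendstoUniformlyOn V (fun _ => 0) atTop (ball (toC y₀) r)

theorem rePart_toC (y : Plane) : rePart (toC y) = y := by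
  ext a; simp [rePart, toC]

theorem exists_ball_toC_subset {s : Set Plane} {y₀ : Plane} (hs : s ∈ 𝓝 y₀) :
    ∃ ρ > 0, ∀ y, toC y ∈ ball (toC y₀) ρ → y ∈ s := by
  have hc : Continuous rePart :=
    (PiLp.continuous_toLp 2 _).comp (continuous_pi fun a =>
      Complex.continuous_re.comp (continuous_apply a))
  have h : rePart ⁻¹' s ∈ 𝓝 (toC y₀) := hc.continuousAt (by rwa [rePart_toC])
  obtain ⟨ρ, hρ, hρs⟩ := Metric.mem_nhds_iff.1 h
  refine ⟨ρ, hρ, fun y hy => ?_⟩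
  have := hρs hy
  rwa [mem_preimage, rePart_toC] at this

end Extensions

/-! ### The holomorphic form of the system near a point -/

section Model

variable {M : Type*} [TopologicalSpace M] [ChartedSpace Plane M] [IsManifold 𝓘(ℝ, Plane) ω M]

/-- The functions `b` are holomorphic extensions of the background quantities in the chart `e` to a
polydisc about `y₀` on which the system for the independent components has the abstract form, for
solutions of arbitrary size, and `σ^{ab}` is uniformly nondegenerate. -/
structure LocalModel (A : AsymptoticData M) (ε : Exponents) (e : OpenPartialHomeomorph M Plane)
    (y₀ : Plane) (b : BIdx → (Fin 2 → ℂ) → ℂ) (R δ κ : ℝ) : Prop where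
  R_pos : 0 < R
  δ_pos : 0 < δ
  κ_pos : 0 < κ
  target : ∀ y, toC y ∈ ball (toC y₀) R → y ∈ e.target
  diff : ∀ i, DifferentiableOn ℂ (b i) (ball (toC y₀) R)
  ext : ∀ i y, toC y ∈ ball (toC y₀) R → b i (toC y) = (bgR A e y i : ℂ)
  fuchsian : ∀ K > 0, ∃ t₁ L, 0 ≤ t₁ ∧
    IsFuchsian (fun z => muR (fun c => (c : ℂ)) ε (b .v z)) (fuchsRhs b ε) (toC y₀) R t₁ K δ L ∧
    IsRealSystem (LinearMap.range (toCL : Plane →ₗ[ℝ] (Fin 2 → ℂ)))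
      (fun z => muR (fun c => (c : ℂ)) ε (b .v z)) (fuchsRhs b ε) t₁ R (toC y₀) ∧
    ∀ t ∈ strip t₁, ∀ z ∈ ball (toC y₀) R, ∀ u : RIdx → ℂ, ‖u‖ < K →
      IsNondeg κ (sigmaR (fun i => b i z) (expC ε (b .v z) t) u)

theorem toC_single (d : Fin 2) : toC (EuclideanSpace.single d (1 : ℝ)) = Pi.single d (1 : ℂ) := by
  ext a
  by_cases h : a = d
  · subst h; simp [toC]
  · simp [toC, h]

/-- At real arguments the right-hand side is real. -/
theorem fuchsRhs_ofReal {b : BIdx → (Fin 2 → ℂ) → ℂ} {ε : Exponents} {z : Fin 2 → ℂ}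
    {β : BIdx → ℝ} (hβ : ∀ i, b i z = (β i : ℂ)) (t : ℝ) {u : RIdx → ℂ} {r : RIdx → ℝ}
    (hu : ∀ j, u j = (r j : ℂ)) {w : (Fin 2 → ℂ) →L[ℂ] (RIdx → ℂ)} {dr : Fin 2 → RIdx → ℝ}
    (hw : ∀ d j, w (Pi.single d 1) j = (dr d j : ℂ)) (j : RIdx) :
    fuchsRhs b ε t z u w j = ((rhsR β (expR ε (β .v) t) t r dr j : ℝ) : ℂ) := by
  have h := map_rhsR Complex.ofRealHom β (expR ε (β .v) t) t r dr j
  simp only [Complex.ofRealHom_eq_coe] at h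
  rw [h, fuchsRhs]
  congr 1
  · exact funext hβ
  · funext i; rw [hβ, expC_ofReal]
  · exact funext hu
  · funext d j; exact hw d j

theorem muR_ofReal (ε : Exponents) (v : ℝ) (j : RIdx) :
    muR (fun c => (c : ℂ)) ε (v : ℂ) j = (muR (fun c => c) ε v j : ℝ) := by
  cases j <;> simp [muR]

theorem exists_localModel (A : AsymptoticData M) {ε : Exponents} (hε : ε.Positive)
    (hv : ∀ x, ε.k < A.v x) (hk : max (max ε.sig ε.sigc) ε.p < ε.k)
    (hp : max ε.phi ε.phic < ε.p) {e : OpenPartialHomeomorph M Plane} (he : e ∈ atlas Plane M)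
    {y₀ : Plane} (hy : y₀ ∈ e.target) : ∃ b R δ κ, LocalModel A ε e y₀ b R δ κ := by
  obtain ⟨r₁, hr₁, b, hb, hbe⟩ := exists_hol_extension_family (analyticIn_chart A he hy).bgR
  obtain ⟨r₂, hr₂, hr₂t⟩ := exists_ball_toC_subset (e.open_target.mem_nhds hy)
  have hmem : ∀ {r}, 0 < r → toC y₀ ∈ ball (toC y₀) r := fun h => mem_ball_self h
  have hpd := sigUp_posDef A he hy
  have hb0 : ∀ a c, b (.sU a c) (toC y₀) = (A.sigUp e y₀ a c : ℂ) := fun a c => hbe _ _ (hmem hr₁)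
  obtain ⟨R, hR, hR₀, δ, hδ, κ, hκ, h⟩ := exists_isFuchsian (b := b) (y₀ := y₀)
    (r₀ := min r₁ r₂) (lt_min hr₁ hr₂)
    (fun i => (hb i).mono (ball_subset_ball (min_le_left _ _))) hε (v₀ := A.v (e.symm y₀))
    (hbe .v _ (hmem hr₁)) (hv _) hk hp
    (by
      simp only [hb0]
      have := hpd.det_pos
      rw [Matrix.det_fin_two] at this
      exact_mod_cast this)
    (by
      rw [hb0, Complex.ofReal_re]
      exact hpd.diag_pos)
  have hbe' : ∀ i y, toC y ∈ ball (toC y₀) R → b i (toC y) = (bgR A e y i : ℂ) := fun i y hy =>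
    hbe i y (ball_subset_ball (hR₀.trans (min_le_left _ _)) hy)
  refine ⟨b, R, δ, κ, hR, hδ, hκ, fun y hy =>
    hr₂t y (ball_subset_ball (hR₀.trans (min_le_right _ _)) hy),
    fun i => (hb i).mono (ball_subset_ball (hR₀.trans (min_le_left _ _))), hbe', fun K hK => ?_⟩
  obtain ⟨t₁, L, ht₁, hF, hS⟩ := h K hK
  refine ⟨t₁, L, ht₁, hF, ⟨?_, ?_⟩, hS⟩
  · rintro z ⟨y, rfl⟩ hz i
    have h1 : b .v (toC y) = (bgR A e y .v : ℂ) := hbe' _ _ hz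
    show (muR (fun c => (c : ℂ)) ε (b .v (toC y)) i).im = 0
    rw [h1, muR_ofReal, Complex.ofReal_im]
  · rintro t - z ⟨y, rfl⟩ hz u hu w hw i
    have h1 := fuchsRhs_ofReal (ε := ε) (w := w) (u := u) (r := fun j => (u j).re)
      (dr := fun d j => (w (Pi.single d 1) j).re) (fun i => hbe' i y hz) t
      (fun j => Complex.ext (by simp) (by simp [hu j])) (fun d j => Complex.ext (by simp)
        (by rw [Complex.ofReal_im]; exact hw _ ⟨EuclideanSpace.single d 1, toC_single d⟩ j)) i
    show (fuchsRhs b ε t (toC y) u w i).im = 0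
    rw [h1, Complex.ofReal_im]

end Model

/-! ### Calculus of the dependent component -/

section Full

theorem analyticAt_sigmaR {𝕜 : Type} [NontriviallyNormedField 𝕜] {E : Type*}
    [NormedAddCommGroup E] [NormedSpace 𝕜 E] {b : E → BIdx → 𝕜} {x : E → EIdx → 𝕜}
    {r : E → RIdx → 𝕜} {p : E} (hb : ∀ i, AnalyticAt 𝕜 (fun q => b q i) p)
    (hx : ∀ i, AnalyticAt 𝕜 (fun q => x q i) p) (hr : ∀ i, AnalyticAt 𝕜 (fun q => r q i) p)
    (a c : Fin 2) : AnalyticAt 𝕜 (fun q => sigmaR (b q) (x q) (r q) a c) p :=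
  (hb _).add ((hx _).mul (hr _))

theorem analyticAt_full {𝕜 : Type} [NontriviallyNormedField 𝕜] {E : Type*}
    [NormedAddCommGroup E] [NormedSpace 𝕜 E] {b : E → BIdx → 𝕜} {x : E → EIdx → 𝕜}
    {r : E → RIdx → 𝕜} {p : E} (hb : ∀ i, AnalyticAt 𝕜 (fun q => b q i) p)
    (hx : ∀ i, AnalyticAt 𝕜 (fun q => x q i) p) (hr : ∀ i, AnalyticAt 𝕜 (fun q => r q i) p)
    (hS : sigmaR (b p) (x p) (r p) 1 1 ≠ 0) (i : Idx) :
    AnalyticAt 𝕜 (fun q => full (b q) (x q) (r q) i) p := by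
  have hs := analyticAt_sigmaR hb hx hr
  have hd : ∀ s : 𝕜, AnalyticAt 𝕜 (fun _ : E => s) p := fun s => analyticAt_const
  cases i with
  | sig a c => exact hr _
  | phi => exact hr _
  | k a c =>
    revert a c
    simp only [Fin.forall_fin_two]
    refine ⟨⟨?_, hr .kx⟩, ?_, ?_⟩
    · simp only [show ∀ q, full (b q) (x q) (r q) (.k 0 0) = (r q .tr + r q .df) * 2⁻¹ from
        fun q => div_eq_mul_inv _ _]
      exact ((hr _).add (hr _)).mul (hd _)
    · exact (((hs 0 0).mul (hr .kx)).sub ((hs 0 1).mul (hr .df))).mul ((hs 1 1).inv hS)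
    · simp only [show ∀ q, full (b q) (x q) (r q) (.k 1 1) = (r q .tr - r q .df) * 2⁻¹ from
        fun q => div_eq_mul_inv _ _]
      exact ((hr _).sub (hr _)).mul (hd _)
  | p => exact hr _
  | sigc c a d => exact hr _
  | phic c => exact hr _

theorem hasDerivAt_kDep {b : ℝ → BIdx → ℝ} {x : ℝ → EIdx → ℝ} {r : ℝ → RIdx → ℝ} {t : ℝ}
    {S' : Fin 2 → Fin 2 → ℝ} {kx' df' : ℝ}
    (hS : ∀ a c, HasDerivAt (fun s => sigmaR (b s) (x s) (r s) a c) (S' a c) t)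
    (hkx : HasDerivAt (fun s => r s .kx) kx' t) (hdf : HasDerivAt (fun s => r s .df) df' t)
    (hne : sigmaR (b t) (x t) (r t) 1 1 ≠ 0) :
    HasDerivAt (fun s => kDep (b s) (x s) (r s))
      ((S' 0 0 * r t .kx + sigmaR (b t) (x t) (r t) 0 0 * kx' - S' 0 1 * r t .df
        - sigmaR (b t) (x t) (r t) 0 1 * df' - kDep (b t) (x t) (r t) * S' 1 1)
        * (sigmaR (b t) (x t) (r t) 1 1)⁻¹) t := by
  have h := (((hS 0 0).mul hkx).sub ((hS 0 1).mul hdf)).mul ((hS 1 1).inv hne)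
  refine h.congr_deriv ?_
  simp only [kDep, Pi.mul_apply, Pi.sub_apply, Pi.inv_apply]
  field_simp
  ring

theorem hasDerivAt_line {f : Plane → ℝ} {y : Plane} (hf : DifferentiableAt ℝ f y) (d : Fin 2) :
    HasDerivAt (fun s : ℝ => f (y + s • EuclideanSpace.single d (1 : ℝ))) (pd d f y) 0 := by
  have h1 : HasDerivAt (fun s : ℝ => y + s • EuclideanSpace.single d (1 : ℝ))
      (EuclideanSpace.single d (1 : ℝ)) 0 := by
    simpa using ((hasDerivAt_id (0 : ℝ)).smul_const (EuclideanSpace.single d (1 : ℝ))).const_add y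
  have h2 : HasFDerivAt f (fderiv ℝ f y) (y + (0 : ℝ) • EuclideanSpace.single d (1 : ℝ)) := by
    simpa using hf.hasFDerivAt
  exact h2.comp_hasDerivAt (0 : ℝ) h1

/-- The derivatives of all components are those given by `fullD`. -/
theorem pd_full {b : Plane → BIdx → ℝ} {x : Plane → EIdx → ℝ} {r : Plane → RIdx → ℝ} {y : Plane}
    (hb : ∀ i, AnalyticAt ℝ (fun q => b q i) y) (hx : ∀ i, AnalyticAt ℝ (fun q => x q i) y)
    (hr : ∀ i, AnalyticAt ℝ (fun q => r q i) y) (hS : sigmaR (b y) (x y) (r y) 1 1 ≠ 0)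
    {dr : Fin 2 → RIdx → ℝ} (hdr : ∀ d j, pd d (fun q => r q j) y = dr d j)
    (hdS : ∀ d a c, pd d (fun q => sigmaR (b q) (x q) (r q) a c) y = dsigmaR (b y) (x y) dr d a c)
    (d : Fin 2) (i : Idx) :
    pd d (fun q => full (b q) (x q) (r q) i) y = fullD (b y) (x y) (r y) dr d i := by
  have hrd := fun i => (hr i).differentiableAt
  cases i with
  | sig a c => exact hdr _ _
  | phi => exact hdr _ _
  | k a c =>
    revert a c
    simp only [Fin.forall_fin_two]
    refine ⟨⟨?_, hdr _ _⟩, ?_, ?_⟩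
    · simp only [full_k00, fullD_k00, div_eq_mul_inv]
      rw [pd_mul_const (f := fun q => r q .tr + r q .df) _ ((hrd _).add (hrd _)),
        pd_add (hrd _) (hrd _), hdr, hdr]
    · have h1 := hasDerivAt_line (analyticAt_full hb hx hr hS (.k 1 0)).differentiableAt d
      have h2 := hasDerivAt_kDep (t := 0)
        (b := fun s => b (y + s • EuclideanSpace.single d (1 : ℝ)))
        (x := fun s => x (y + s • EuclideanSpace.single d (1 : ℝ)))
        (r := fun s => r (y + s • EuclideanSpace.single d (1 : ℝ)))
        (fun a c => hasDerivAt_line (analyticAt_sigmaR hb hx hr a c).differentiableAt d)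
        (hasDerivAt_line (hrd _) d) (hasDerivAt_line (hrd _) d) (by simpa using hS)
      rw [h1.unique h2, fullD_k10, dkDep]
      simp only [zero_smul, add_zero, hdS, hdr]
    · simp only [full_k11, fullD_k11, div_eq_mul_inv]
      rw [pd_mul_const (f := fun q => r q .tr - r q .df) _ ((hrd _).sub (hrd _)),
        pd_sub (hrd _) (hrd _), hdr, hdr]
  | p => exact hdr _ _
  | sigc c a d => exact hdr _ _
  | phic c => exact hdr _ _

end Full

/-! ### Local solutions -/

section LocalExistence

variable {M : Type*} [TopologicalSpace M] [ChartedSpace Plane M] [IsManifold 𝓘(ℝ, Plane) ω M]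

/-- `U` is an analytic solution in the chart `e`, on the coordinate domain `W` and for `t > t₀`. -/
structure IsSolOn (A : AsymptoticData M) (ε : Exponents) (U : Fields M)
    (e : OpenPartialHomeomorph M Plane) (W : Set Plane) (t₀ : ℝ) : Prop where
  analytic : ∀ i : Idx, AnalyticOnNhd ℝ (fun q : ℝ × Plane => U.comp e q.1 q.2 i) (Ioi t₀ ×ˢ W)
  admissible : ∀ y ∈ W, ∀ t, t₀ < t → AdmissibleAt A ε U e t y
  system : ∀ y ∈ W, ∀ t, t₀ < t → SystemAt A ε U e t y

theorem symIdx_comm (a c : Fin 2) : symIdx a c = symIdx c a := by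
  simp [symIdx, add_comm]

theorem posDef_of_det {S : Matrix (Fin 2) (Fin 2) ℝ} (hs : S 1 0 = S 0 1) (h1 : 0 < S 1 1)
    (hd : 0 < S 0 0 * S 1 1 - S 0 1 * S 1 0) : S.PosDef := by
  refine Matrix.PosDef.of_dotProduct_mulVec_pos ?_ fun {v} hv => ?_
  · ext a b
    revert a b
    simp [Fin.forall_fin_two, hs]
  · have hq : S 1 1 * (star v ⬝ᵥ S.mulVec v)
        = (S 0 1 * v 0 + S 1 1 * v 1) ^ 2 + (S 0 0 * S 1 1 - S 0 1 * S 1 0) * v 0 ^ 2 := by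
      simp only [dotProduct, Matrix.mulVec, Fin.sum_univ_two, Pi.star_apply, star_trivial, hs]
      ring
    refine pos_of_mul_pos_right (a := S 1 1) ?_ h1.le
    rw [hq]
    by_cases h0 : v 0 = 0
    · have hv1 : v 1 ≠ 0 := fun h => hv (by ext i; revert i; simp [Fin.forall_fin_two, h0, h])
      rw [h0]; simp only [mul_zero, zero_add]
      positivity
    · positivity

theorem admissibleAt_of_full {A : AsymptoticData M} {ε : Exponents} {U : Fields M}
    {e : OpenPartialHomeomorph M Plane} {t : ℝ} {y : Plane} (hA : A.AnalyticIn e y) {r : RIdx → ℝ}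
    (hU : U.comp e t y = full (bgR A e y) (expR ε (A.v (e.symm y)) t) r)
    (h1 : 0 < sigmaR (bgR A e y) (expR ε (A.v (e.symm y)) t) r 1 1)
    (hd : 0 < sigmaR (bgR A e y) (expR ε (A.v (e.symm y)) t) r 0 0
        * sigmaR (bgR A e y) (expR ε (A.v (e.symm y)) t) r 1 1
      - sigmaR (bgR A e y) (expR ε (A.v (e.symm y)) t) r 0 1
        * sigmaR (bgR A e y) (expR ε (A.v (e.symm y)) t) r 1 0) :
    AdmissibleAt A ε U e t y := by
  have hb := bgSymm_bgR hA
  have hs : (sigma A ε U e t y : Fin 2 → Fin 2 → ℝ)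
      = sigmaR (bgR A e y) (expR ε (A.v (e.symm y)) t) r := by rw [sigma_eq, hU]; rfl
  refine ⟨posDef_of_det ?_ ?_ ?_, fun c a b => ?_, fun a b => ?_⟩
  · rw [hs]; exact sigmaR_symm hb
  · rw [hs]; exact h1
  · rw [hs]; exact hd
  · rw [hU]; simp only [full, symIdx_comm]
  · have h := sigKJ_symm (r := r) hb h1.ne'
    rw [sigK_eq, hU]
    revert a b
    simp only [Fin.forall_fin_two]
    exact ⟨⟨trivial, h.symm⟩, h, trivial⟩

theorem analyticAt_expR (ε : Exponents) {E : Type*} [NormedAddCommGroup E] [NormedSpace ℝ E]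
    {v t : E → ℝ} {p : E} (hv : AnalyticAt ℝ v p) (ht : AnalyticAt ℝ t p) (i : EIdx) :
    AnalyticAt ℝ (fun q => expR ε (v q) (t q) i) p :=
  ((analyticAt_const.sub (analyticAt_const.mul hv)).mul ht).rexp

theorem hasDerivAt_expR (ε : Exponents) (v t : ℝ) (i : EIdx) :
    HasDerivAt (fun s => expR ε v s i) ((expoC ε i - expoV i * v) * expR ε v t i) t := by
  have h := ((hasDerivAt_id t).const_mul (expoC ε i - expoV i * v)).exp
  refine h.congr_deriv ?_
  simp only [expR, id, mul_one]
  ring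

theorem expR_sk (ε : Exponents) (v t : ℝ) : expR ε v t .s * expR ε v t .sk = expR ε v t .k := by
  simp only [expR, ← Real.exp_add, expoC, expoV]
  congr 1; ring

/-- From a solution `ρ` of the system for the independent components to a solution of the full
system. -/
theorem systemAt_of_full {A : AsymptoticData M} {ε : Exponents} {U : Fields M}
    {e : OpenPartialHomeomorph M Plane} {t : ℝ} {y : Plane} (hA : ∀ᶠ z in 𝓝 y, A.AnalyticIn e z)
    {ρ : ℝ → Plane → RIdx → ℝ} (hρ : ∀ j, AnalyticAt ℝ (fun z => ρ t z j) y)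
    (hU : ∀ᶠ z in 𝓝 y, ∀ s,
      U.comp e s z = full (bgR A e z) (expR ε (A.v (e.symm z)) s) (ρ s z))
    (hne : sigmaR (bgR A e y) (expR ε (A.v (e.symm y)) t) (ρ t y) 1 1 ≠ 0)
    (hode : ∀ j, HasDerivAt (fun s => ρ s y j) (muR (fun c => c) ε (A.v (e.symm y)) j * ρ t y j
      + rhsR (bgR A e y) (expR ε (A.v (e.symm y)) t) t (ρ t y)
        (fun d j => pd d (fun z => ρ t z j) y) j) t) :
    SystemAt A ε U e t y := by
  have hA0 := hA.self_of_nhds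
  have hU0 := hU.self_of_nhds
  have hb := bgSymm_bgR hA0
  set b := bgR A e y with hbdef
  set x := expR ε (A.v (e.symm y)) t with hx
  set dr : Fin 2 → RIdx → ℝ := fun d j => pd d (fun z => ρ t z j) y with hdr
  have hxa : ∀ i, AnalyticAt ℝ (fun z => expR ε (A.v (e.symm z)) t i) y := fun i =>
    analyticAt_expR ε hA0.v analyticAt_const i
  have hfa := analyticAt_full (p := y) hA0.bgR hxa hρ hne
  have hUt : ∀ i, (fun z => U.comp e t z i)
      =ᶠ[𝓝 y] fun z => full (bgR A e z) (expR ε (A.v (e.symm z)) t) (ρ t z) i := fun i =>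
    hU.mono fun z hz => congrFun (hz t) i
  have hUd : ∀ i, DifferentiableAt ℝ (fun z => U.comp e t z i) y := fun i =>
    ((hfa i).congr (hUt i).symm).differentiableAt
  have hxs : ∀ z, expR ε (A.v (e.symm z)) t .s = x .s := fun z => by
    simp only [hx, expR_s]
  have hdS : ∀ d a c, pd d (fun z => sigmaR (bgR A e z) (expR ε (A.v (e.symm z)) t) (ρ t z) a c) y
      = dsigmaR b x dr d a c := by
    intro d a c
    simp only [sigmaR, hxs]
    rw [pd_add (hA0.bgR _).differentiableAt ((hρ _).differentiableAt.const_mul _),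
      pd_const_mul _ (hρ _).differentiableAt]
    rfl
  have hdx : U.dx e t y = fullD b x (ρ t y) dr := by
    ext d i
    rw [Fields.dx, pd_congr (hUt i)]
    exact pd_full hA0.bgR hxa hρ hne (fun _ _ => rfl) hdS d i
  rw [hA0.systemAt_iff hUd]
  have hmain := linJ_add_rhsJ_full (x := x) (t := t) (r := ρ t y) (dr := dr) hb hne
    (ε := ε) (v := A.v (e.symm y)) (ρ := fun j => deriv (fun s => ρ s y j) t)
    fun j => (hode j).deriv
  obtain ⟨m1, m2, m3, m4, m5, m6, m7, m8⟩ := hmain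
  have hd : ∀ j, HasDerivAt (fun s => ρ s y j) (deriv (fun s => ρ s y j) t) t := fun j =>
    (hode j).differentiableAt.hasDerivAt
  have hdt : ∀ i D, HasDerivAt (fun s => full b (expR ε (A.v (e.symm y)) s) (ρ s y) i) D t →
      U.dt e t y i = D := by
    intro i D h
    have : (fun s => U.comp e s y i) = fun s => full b (expR ε (A.v (e.symm y)) s) (ρ s y) i := by
      funext s; rw [hU0]
    rw [Fields.dt, this, h.deriv]
  intro i
  rw [hU0, hdx]
  cases i with
  | sig a c => rw [← m1]; exact hdt _ _ (hd _)
  | phi => rw [← m2]; exact hdt _ _ (hd _)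
  | p => rw [← m6]; exact hdt _ _ (hd _)
  | sigc c a d => rw [← m7]; exact hdt _ _ (hd _)
  | phic c => rw [← m8]; exact hdt _ _ (hd _)
  | k a c =>
    revert a c
    simp only [Fin.forall_fin_two]
    refine ⟨⟨?_, ?_⟩, ?_, ?_⟩
    · rw [← m3]; exact hdt _ _ (((hd .tr).add (hd .df)).div_const 2)
    · rw [← m4]; exact hdt _ _ (hd _)
    · have hS' : ∀ a c, HasDerivAt (fun s => sigmaR b (expR ε (A.v (e.symm y)) s) (ρ s y) a c)
          (2 * x .k * sigKJ b x (full b x (ρ t y)) a c) t := by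
        intro a c
        have h1 := ((hasDerivAt_expR ε (A.v (e.symm y)) t .s).mul (hd (.sig (symIdx a c)))).const_add
          (b (.sU a c))
        refine h1.congr_deriv ?_
        have h2 := m1 a c
        simp only [linJ, rhsJ, full] at h2
        have h3 : x .s * x .sk = x .k := expR_sk _ _ _
        rw [h2, ← hx, ← h3]
        simp only [expoC, expoV]
        ring
      have h := hdt (.k 1 0) _ (hasDerivAt_kDep (b := fun _ => b) hS' (hd .kx) (hd .df) hne)
      rw [h, kDep_equation hb hne (S' := fun a c => 2 * x .k * sigKJ b x (full b x (ρ t y)) a c)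
        (fun _ _ => rfl) (εk := ε.k) (t := t) (dr := dr) (hode .kx).deriv (hode .df).deriv]
      simp only [linJ, full_k10, Matrix.one_apply_ne (one_ne_zero (α := Fin 2)), mul_zero, zero_mul,
        add_zero]
      rfl
    · rw [← m5]; exact hdt _ _ (((hd .tr).sub (hd .df)).div_const 2)

end LocalExistence

section LocalExistence

variable {M : Type*} [TopologicalSpace M] [ChartedSpace Plane M] [IsManifold 𝓘(ℝ, Plane) ω M]

/-- All components are controlled by the independent ones where `σ^{11}` is bounded below. -/
theorem norm_full_le {b : BIdx → ℂ} {x : EIdx → ℂ} {r : RIdx → ℂ} {κ B : ℝ} (hκ : 0 < κ)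
    (hS : κ < (sigmaR b x r 1 1).re) (hB : ∀ a c, ‖b (.sU a c)‖ ≤ B) (hx : ‖x .s‖ ≤ 1)
    (hr : ‖r‖ ≤ 1) (i : Idx) : ‖full b x r i‖ ≤ (1 + 2 * (B + 1) / κ) * ‖r‖ := by
  have hB0 : 0 ≤ B := (norm_nonneg _).trans (hB 0 0)
  have hj : ∀ j, ‖r j‖ ≤ ‖r‖ := norm_le_pi_norm r
  have h0 := norm_nonneg r
  have hC : ‖r‖ ≤ (1 + 2 * (B + 1) / κ) * ‖r‖ := by
    have : 0 ≤ 2 * (B + 1) / κ * ‖r‖ := by positivity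
    linarith
  have hs : ∀ a c, ‖sigmaR b x r a c‖ ≤ B + 1 := by
    intro a c
    refine (norm_add_le _ _).trans (add_le_add (hB a c) ?_)
    rw [norm_mul]
    exact mul_le_one₀ hx (norm_nonneg _) ((hj _).trans hr)
  have h2 : ‖(2 : ℂ)‖ = 2 := by simp
  cases i with
  | sig a c => exact (hj _).trans hC
  | phi => exact (hj _).trans hC
  | k a c =>
    revert a c
    simp only [Fin.forall_fin_two]
    refine ⟨⟨?_, (hj _).trans hC⟩, ?_, ?_⟩
    · refine le_trans ?_ hC
      rw [full, show (!![(r .tr + r .df) / 2, r .kx; kDep b x r, (r .tr - r .df) / 2] :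
        Matrix (Fin 2) (Fin 2) ℂ) 0 0 = (r .tr + r .df) / 2 from rfl, norm_div, h2,
        div_le_iff₀ two_pos]
      linarith [norm_add_le (r .tr) (r .df), hj .tr, hj .df]
    · show ‖(sigmaR b x r 0 0 * r .kx - sigmaR b x r 0 1 * r .df) * (sigmaR b x r 1 1)⁻¹‖ ≤ _
      have h3 : κ ≤ ‖sigmaR b x r 1 1‖ := hS.le.trans (Complex.re_le_norm _)
      have h4 : ‖(sigmaR b x r 1 1)⁻¹‖ ≤ κ⁻¹ := by
        rw [norm_inv]; exact inv_anti₀ hκ h3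
      have h5 : ‖sigmaR b x r 0 0 * r .kx - sigmaR b x r 0 1 * r .df‖ ≤ 2 * (B + 1) * ‖r‖ := by
        refine (norm_sub_le _ _).trans ?_
        rw [norm_mul, norm_mul]
        have := mul_le_mul (hs 0 0) (hj .kx) (norm_nonneg _) (by linarith)
        have := mul_le_mul (hs 0 1) (hj .df) (norm_nonneg _) (by linarith)
        linarith
      rw [norm_mul]
      refine (mul_le_mul h5 h4 (norm_nonneg _) (by positivity)).trans ?_
      rw [add_mul, one_mul, div_eq_mul_inv]
      linarith
    · refine le_trans ?_ hC
      rw [full, show (!![(r .tr + r .df) / 2, r .kx; kDep b x r, (r .tr - r .df) / 2] :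
        Matrix (Fin 2) (Fin 2) ℂ) 1 1 = (r .tr - r .df) / 2 from rfl, norm_div, h2,
        div_le_iff₀ two_pos]
      linarith [norm_sub_le (r .tr) (r .df), hj .tr, hj .df]
  | p => exact (hj _).trans hC
  | sigc c a d => exact (hj _).trans hC
  | phic c => exact (hj _).trans hC

theorem analyticAt_expC (ε : Exponents) {E : Type*} [NormedAddCommGroup E] [NormedSpace ℂ E]
    {v t : E → ℂ} {p : E} (hv : AnalyticAt ℂ v p) (ht : AnalyticAt ℂ t p) (i : EIdx) :
    AnalyticAt ℂ (fun q => expC ε (v q) (t q) i) p :=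
  ((analyticAt_const.sub (analyticAt_const.mul hv)).mul ht).cexp

/-- The complex derivative of a holomorphic extension restricts to the real partial derivatives. -/
theorem fderiv_single_of_ofReal {ι : Type} [Fintype ι] {u : (Fin 2 → ℂ) → ι → ℂ}
    {ρ : Plane → ι → ℝ} {y : Plane} (hu : DifferentiableAt ℂ u (toC y))
    (h : ∀ᶠ z in 𝓝 y, ∀ j, u (toC z) j = (ρ z j : ℂ)) (d : Fin 2) (j : ι) :
    fderiv ℂ u (toC y) (Pi.single d 1) j = (pd d (fun z => ρ z j) y : ℂ) := by
  have h1 : HasFDerivAt (fun z => u (toC z)) ((fderiv ℂ u (toC y)).restrictScalars ℝ ∘L toCL) y :=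
    (hu.hasFDerivAt.restrictScalars ℝ).comp y toCL.hasFDerivAt
  have h2 : HasFDerivAt (fun z => u (toC z) j) (ContinuousLinearMap.proj (R := ℝ) j ∘L
      ((fderiv ℂ u (toC y)).restrictScalars ℝ ∘L toCL)) y :=
    (ContinuousLinearMap.proj (R := ℝ) (φ := fun _ : ι => ℂ) j).hasFDerivAt.comp y h1
  have h3 : HasFDerivAt (fun z => ρ z j) (Complex.reCLM ∘L (ContinuousLinearMap.proj (R := ℝ) j ∘L
      ((fderiv ℂ u (toC y)).restrictScalars ℝ ∘L toCL))) y := by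
    refine (Complex.reCLM.hasFDerivAt.comp y h2).congr_of_eventuallyEq ?_
    filter_upwards [h] with z hz
    simp [hz]
  have h4 : HasFDerivAt (fun z => u (toC z) j)
      (Complex.ofRealCLM ∘L (fderiv ℝ (fun z => ρ z j) y)) y := by
    refine (Complex.ofRealCLM.hasFDerivAt.comp y
      h3.differentiableAt.hasFDerivAt).congr_of_eventuallyEq ?_
    filter_upwards [h] with z hz
    simp [hz]
  have h5 := congrArg (fun L => L (EuclideanSpace.single d (1 : ℝ))) (h2.unique h4)
  have h6 : toCL (EuclideanSpace.single d (1 : ℝ)) = Pi.single d (1 : ℂ) := toC_single d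
  simpa [pd, h6] using h5

theorem exists_isSolOn (A : AsymptoticData M) {ε : Exponents} (hε : ε.Positive)
    (hv : ∀ x, ε.k < A.v x) (hk : max (max ε.sig ε.sigc) ε.p < ε.k)
    (hp : max ε.phi ε.phic < ε.p) {e : OpenPartialHomeomorph M Plane} (he : e ∈ atlas Plane M)
    {y₀ : Plane} (hy : y₀ ∈ e.target) :
    ∃ (U : Fields M) (W : Set Plane) (t₀ : ℝ), IsOpen W ∧ y₀ ∈ W ∧ W ⊆ e.target ∧
      IsSolOn A ε U e W t₀ ∧ ∀ y₁ ∈ W, ∀ i, HolZero (fun t y => U.comp e t y i) y₁ := by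
  obtain ⟨b, R, δ, κ, hm⟩ := exists_localModel A hε hv hk hp he hy
  obtain ⟨t₁, L, ht₁, hF, hreal, hS⟩ := hm.fuchsian 1 one_pos
  obtain ⟨T, r, C, u, hT, hr, hrR, hud, hub, hode, hur⟩ := hF.exists_solution hreal
  have hκ := hm.κ_pos
  have hδ := hm.δ_pos
  have hbR : ball (toC y₀) r ⊆ ball (toC y₀) R := ball_subset_ball hrR
  have hstrip : ∀ {t : ℝ}, T < t → (t : ℂ) ∈ strip T := fun ht => ofReal_mem_strip ht
  have hstrip1 : ∀ {t : ℝ}, T < t → (t : ℂ) ∈ strip t₁ := fun ht =>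
    ofReal_mem_strip (hT.trans_lt ht)
  set W : Set Plane := toC ⁻¹' ball (toC y₀) r with hW
  have hWo : IsOpen W := isOpen_ball.preimage continuous_toC
  have hWt : W ⊆ e.target := fun y hy => hm.target y (hbR hy)
  set ρ : ℝ → Plane → RIdx → ℝ := fun t y j => (u (t, toC y) j).re with hρ
  have huρ : ∀ t : ℝ, T < t → ∀ y ∈ W, ∀ j, u (t, toC y) j = (ρ t y j : ℂ) := fun t ht y hy j =>
    Complex.ext (by simp [hρ]) (by
      rw [Complex.ofReal_im]; exact hur t ht _ hy ⟨y, rfl⟩ j)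
  have hua : AnalyticOnNhd ℂ u (strip T ×ˢ ball (toC y₀) r) :=
    analyticOnNhd_of_differentiableOn ((isOpen_strip T).prod isOpen_ball) hud
  have hρa : ∀ t : ℝ, T < t → ∀ y ∈ W, ∀ j,
      AnalyticAt ℝ (fun q : ℝ × Plane => ρ q.1 q.2 j) (t, y) := by
    intro t ht y hy j
    have h1 : AnalyticAt ℝ u ((t : ℂ), toC y) :=
      (hua ((t : ℂ), toC y) ⟨hstrip ht, hy⟩).restrictScalars
    have h2 : AnalyticAt ℝ (fun q : ℝ × Plane => ((q.1 : ℂ), toC q.2)) (t, y) :=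
      (Complex.ofRealCLM.prodMap toCL).analyticAt _
    have h3 : AnalyticAt ℝ (fun q : ℝ × Plane => u ((q.1 : ℂ), toC q.2)) (t, y) :=
      AnalyticAt.comp (f := fun q : ℝ × Plane => ((q.1 : ℂ), toC q.2)) h1 h2
    exact ((Complex.reCLM ∘L ContinuousLinearMap.proj (R := ℝ) (φ := fun _ : RIdx => ℂ)
      j).analyticAt _).comp h3
  have hbe : ∀ y ∈ W, ∀ i, b i (toC y) = (bgR A e y i : ℂ) := fun y hy i => hm.ext i y (hbR hy)
  have hK : ∀ t : ℝ, T < t → ∀ z ∈ ball (toC y₀) r, ‖u (t, z)‖ < 1 := fun t ht z hz =>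
    ((hub t (hstrip ht) z hz).1).trans_lt (by norm_num)
  have hSR : ∀ t : ℝ, T < t → ∀ y ∈ W, ∀ a c,
      sigmaR (fun i => b i (toC y)) (expC ε (b .v (toC y)) t) (u (t, toC y)) a c
        = (sigmaR (bgR A e y) (expR ε (A.v (e.symm y)) t) (ρ t y) a c : ℝ) := by
    intro t ht y hy a c
    simp only [sigmaR, hbe y hy, huρ t ht y hy, expC_ofReal, bgR]
    push_cast; rfl
  -- The complex nondegeneracy gives positive definiteness at real points.
  have hpos : ∀ t : ℝ, T < t → ∀ y ∈ W,
      0 < sigmaR (bgR A e y) (expR ε (A.v (e.symm y)) t) (ρ t y) 0 0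
        * sigmaR (bgR A e y) (expR ε (A.v (e.symm y)) t) (ρ t y) 1 1
        - sigmaR (bgR A e y) (expR ε (A.v (e.symm y)) t) (ρ t y) 0 1
        * sigmaR (bgR A e y) (expR ε (A.v (e.symm y)) t) (ρ t y) 1 0 ∧
      0 < sigmaR (bgR A e y) (expR ε (A.v (e.symm y)) t) (ρ t y) 1 1 := by
    intro t ht y hy
    obtain ⟨h1, h2⟩ := hS t (hstrip1 ht) _ (hbR hy) _ (hK t ht _ hy)
    simp only [hSR t ht y hy] at h1 h2
    norm_cast at h1 h2
    exact ⟨hκ.trans h1, hκ.trans h2⟩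
  have hA : ∀ y ∈ W, A.AnalyticIn e y := fun y hy => analyticIn_chart A he (hWt hy)
  set U : Fields M := Fields.ofComp e fun t y =>
    full (bgR A e y) (expR ε (A.v (e.symm y)) t) (ρ t y) with hU
  have hUc : ∀ y ∈ W, ∀ t, U.comp e t y = full (bgR A e y) (expR ε (A.v (e.symm y)) t) (ρ t y) :=
    fun y hy t => funext fun i => comp_ofComp he (hWt hy) _ t i
  refine ⟨U, W, T, hWo, mem_ball_self hr, hWt, ⟨fun i => ?_, fun y hy t ht => ?_,
    fun y hy t ht => ?_⟩, fun y₁ hy₁ i => ?_⟩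
  · rintro ⟨t, y⟩ ⟨ht, hy⟩
    have hsnd : AnalyticAt ℝ (fun q : ℝ × Plane => q.2) (t, y) := analyticAt_snd
    have hb : ∀ i, AnalyticAt ℝ (fun q : ℝ × Plane => bgR A e q.2 i) (t, y) := fun i =>
      AnalyticAt.comp (f := fun q : ℝ × Plane => q.2) (g := fun z => bgR A e z i)
        ((hA y hy).bgR i) hsnd
    have hx : ∀ i, AnalyticAt ℝ (fun q : ℝ × Plane => expR ε (A.v (e.symm q.2)) q.1 i) (t, y) :=
      fun i => analyticAt_expR ε (hb .v) analyticAt_fst i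
    refine (analyticAt_full hb hx (hρa t ht y hy) (hpos t ht y hy).2.ne' i).congr ?_
    have : ∀ᶠ q : ℝ × Plane in 𝓝 (t, y), q.2 ∈ W :=
      continuousAt_snd.eventually (hWo.mem_nhds hy)
    filter_upwards [this] with q hq
    rw [hUc _ hq]
  · exact admissibleAt_of_full (hA y hy) (hUc y hy t) (hpos t ht y hy).2 (hpos t ht y hy).1
  · have hWn : ∀ᶠ z in 𝓝 y, z ∈ W := hWo.mem_nhds hy
    refine systemAt_of_full (ρ := ρ) (hWn.mono hA) (fun j => ?_) (hWn.mono hUc)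
      (hpos t ht y hy).2.ne' fun j => ?_
    · exact AnalyticAt.comp (f := fun z : Plane => (t, z)) (g := fun q : ℝ × Plane => ρ q.1 q.2 j)
        (hρa t ht y hy j)
        (analyticAt_const.prod analyticAt_id)
    · have h1 := Complex.reCLM.hasFDerivAt.comp_hasDerivAt t (hode t ht _ hy j)
      have hv' : b .v (toC y) = (A.v (e.symm y) : ℂ) := hbe y hy .v
      have hdz : DifferentiableAt ℂ (fun z => u ((t : ℂ), z)) (toC y) :=
        (hud.comp ((differentiableOn_const _).prodMk differentiableOn_id)
          fun z hz => ⟨hstrip ht, hz⟩).differentiableAt (isOpen_ball.mem_nhds hy)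
      have h2 := fderiv_single_of_ofReal hdz (ρ := ρ t) (hWn.mono fun z hz => huρ t ht z hz)
      have h3 := fuchsRhs_ofReal (ε := ε) (hbe y hy) t (huρ t ht y hy) h2 j
      rw [h3, hv', muR_ofReal, huρ t ht y hy] at h1
      refine h1.congr_deriv ?_
      rw [← Complex.ofReal_mul, ← Complex.ofReal_add]
      rfl
  · obtain ⟨r', hr', hr'W⟩ : ∃ r' > 0, ball (toC y₁) r' ⊆ ball (toC y₀) r :=
      Metric.isOpen_iff.1 isOpen_ball _ hy₁
    have hbc : ∀ i, ContinuousAt (b i) (toC y₁) := fun i =>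
      ((hm.diff i).differentiableAt (isOpen_ball.mem_nhds (hbR hy₁))).continuousAt
    obtain ⟨B, hB⟩ : ∃ B, ∀ᶠ z in 𝓝 (toC y₁), ∀ a c, ‖b (.sU a c) z‖ ≤ B := by
      have h1 : ∀ a c, ∀ᶠ z in 𝓝 (toC y₁), ‖b (.sU a c) z‖ < ‖b (.sU a c) (toC y₁)‖ + 1 := fun a c =>
        (hbc _).norm.eventually (gt_mem_nhds (by linarith))
      refine ⟨∑ a, ∑ c, (‖b (.sU a c) (toC y₁)‖ + 1), ?_⟩
      filter_upwards [eventually_all.2 fun a => eventually_all.2 (h1 a)] with z hz a c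
      refine (hz a c).le.trans ?_
      refine le_trans ?_ (Finset.single_le_sum (fun a _ => Finset.sum_nonneg fun c _ => by positivity)
        (Finset.mem_univ a))
      exact Finset.single_le_sum (f := fun c => ‖b (.sU a c) (toC y₁)‖ + 1)
        (fun c _ => by positivity) (Finset.mem_univ c)
    obtain ⟨s, hs, hsB⟩ := Metric.mem_nhds_iff.1 hB
    set ρ' := min r' s with hρ'
    have hsub : ball (toC y₁) ρ' ⊆ ball (toC y₀) r :=
      (ball_subset_ball (min_le_left _ _)).trans hr'W
    have hT0 : 0 ≤ T := ht₁.trans hT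
    refine ⟨ρ', lt_min hr' hs, T, fun t z => full (fun i => b i z) (expC ε (b .v z) t) (u (t, z)) i,
      fun t ht => ⟨?_, ?_⟩, ?_⟩
    · intro z hz
      have hz' := hsub hz
      have hba : ∀ i, AnalyticAt ℂ (b i) z := fun i =>
        analyticOnNhd_of_differentiableOn isOpen_ball (hm.diff i) _ (hbR hz')
      have hne : sigmaR (fun i => b i z) (expC ε (b .v z) t) (u (t, z)) 1 1 ≠ 0 := by
        intro h0
        have := (hS t (hstrip1 ht) z (hbR hz') _ (hK t ht z hz')).2
        rw [h0, Complex.zero_re] at this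
        linarith
      have huz : ∀ j, AnalyticAt ℂ (fun z => u ((t : ℂ), z) j) z := fun j =>
        ((ContinuousLinearMap.proj (R := ℂ) (φ := fun _ : RIdx => ℂ) j).analyticAt _).comp
          (AnalyticAt.comp (f := fun z => ((t : ℂ), z)) (hua _ ⟨hstrip ht, hz'⟩)
            (analyticAt_const.prod analyticAt_id))
      exact (analyticAt_full hba (analyticAt_expC ε (hba .v) analyticAt_const) huz hne
        i).differentiableAt.differentiableWithinAt
    · intro y hy
      have hyW : y ∈ W := hsub hy
      have h := map_full Complex.ofRealHom (bgR A e y) (expR ε (A.v (e.symm y)) t) (ρ t y) i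
      simp only [Complex.ofRealHom_eq_coe] at h
      have hv' : b .v (toC y) = (A.v (e.symm y) : ℂ) := hbe y hyW .v
      show full _ _ _ i = ((U.comp e t y i : ℝ) : ℂ)
      rw [hUc y hyW t, h]
      congr 1
      · exact funext (hbe y hyW)
      · funext i; rw [hv', expC_ofReal]
      · exact funext (huρ t ht y hyW)
    -- The dependent component decays as well, since `σ^{11}` is bounded away from `0`.
    · have hlim : Tendsto (fun t : ℝ => (1 + 2 * (B + 1) / κ) * (C * Real.exp (-δ * t))) atTop
          (𝓝 0) := by
        have h1 : Tendsto (fun t : ℝ => Real.exp (-δ * t)) atTop (𝓝 0) := by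
          refine Real.tendsto_exp_atBot.comp ?_
          exact tendsto_id.const_mul_atTop_of_neg (by linarith)
        simpa using (h1.const_mul C).const_mul (1 + 2 * (B + 1) / κ)
      rw [Metric.tendstoUniformlyOn_iff]
      intro η hη
      filter_upwards [hlim.eventually (gt_mem_nhds hη), eventually_gt_atTop T] with t ht1 ht2 z hz
      rw [dist_zero_left]
      have hz' := hsub hz
      have hx : ‖expC ε (b .v z) t .s‖ ≤ 1 := by
        rw [expC, Complex.norm_exp, Real.exp_le_one_iff]
        have : (((expoC ε .s : ℝ) - (expoV .s : ℝ) * b .v z) * (t : ℂ)).re = -ε.sig * t := by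
          simp [expoC, expoV]
        rw [this]
        have := hε.1
        nlinarith
      refine lt_of_le_of_lt ?_ ht1
      refine (norm_full_le hκ (hS t (hstrip1 ht2) z (hbR hz') _ (hK t ht2 z hz')).2
        (hsB (ball_subset_ball (min_le_right _ _) hz)) hx (hK t ht2 z hz').le i).trans ?_
      have hBn : 0 ≤ B := (norm_nonneg _).trans (hsB (ball_subset_ball (min_le_right _ _) hz) 0 0)
      have := (hub t (hstrip ht2) z hz').2
      rw [Complex.ofReal_re] at this
      gcongr

end LocalExistence

/-! ### Uniqueness of bounded local solutions -/

section LocalUniqueness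

instance : Finite Idx := by
  let f : (Fin 2 × Fin 2) ⊕ Unit ⊕ (Fin 2 × Fin 2) ⊕ Unit ⊕ (Fin 2 × Fin 2 × Fin 2) ⊕ Fin 2 → Idx :=
    Sum.elim (fun q => .sig q.1 q.2) <| Sum.elim (fun _ => .phi) <|
      Sum.elim (fun q => .k q.1 q.2) <| Sum.elim (fun _ => .p) <|
      Sum.elim (fun q => .sigc q.1 q.2.1 q.2.2) fun c => .phic c
  refine Finite.of_surjective f fun i => ?_
  cases i with
  | sig a b => exact ⟨.inl (a, b), rfl⟩
  | phi => exact ⟨.inr (.inl ()), rfl⟩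
  | k a b => exact ⟨.inr (.inr (.inl (a, b))), rfl⟩
  | p => exact ⟨.inr (.inr (.inr (.inl ()))), rfl⟩
  | sigc c a b => exact ⟨.inr (.inr (.inr (.inr (.inl (c, a, b))))), rfl⟩
  | phic c => exact ⟨.inr (.inr (.inr (.inr (.inr c)))), rfl⟩

/-- Finitely many bounded functions have extensions with a common domain and a common bound. -/
theorem exists_common_extension {ι : Type*} [Finite ι] {g : ι → ℝ → Plane → ℝ} {y₀ : Plane}
    (h : ∀ i, HolBounded (g i) y₀) :
    ∃ r > 0, ∃ (t₀ C : ℝ) (V : ι → ℝ → (Fin 2 → ℂ) → ℂ), ∀ t, t₀ < t → ∀ i,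
      DifferentiableOn ℂ (V i t) (ball (toC y₀) r) ∧ (∀ z ∈ ball (toC y₀) r, ‖V i t z‖ ≤ C) ∧
      ∀ y, toC y ∈ ball (toC y₀) r → V i t (toC y) = g i t y := by
  choose r hr t₀ C V hV using h
  obtain ⟨s, hs, hsr⟩ := exists_pos_forall_le hr
  obtain ⟨T, hT⟩ := (Set.finite_range t₀).bddAbove
  obtain ⟨B, hB⟩ := (Set.finite_range C).bddAbove
  refine ⟨s, hs, T, B, V, fun t ht i => ?_⟩
  obtain ⟨h1, h2, h3⟩ := hV i t ((hT ⟨i, rfl⟩).trans_lt ht)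
  exact ⟨h1.mono (ball_subset_ball (hsr i)),
    fun z hz => (h2 z (ball_subset_ball (hsr i) hz)).trans (hB ⟨i, rfl⟩),
    fun y hy => h3 y (ball_subset_ball (hsr i) hy)⟩

theorem reduce_add {𝕜 : Type} [Field 𝕜] (u v : Idx → 𝕜) (j : RIdx) :
    reduce (fun i => u i + v i) j = reduce u j + reduce v j := by
  cases j <;> simp only [reduce] <;> ring

theorem map_reduce {𝕜 𝕜' : Type} [Field 𝕜] [Field 𝕜'] (f : 𝕜 →+* 𝕜') (u : Idx → 𝕜) (j : RIdx) :
    f (reduce u j) = reduce (fun i => f (u i)) j := by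
  cases j <;> simp only [reduce, map_add, map_sub]

theorem norm_reduce_le {u : Idx → ℂ} {C : ℝ} (hC : 0 ≤ C) (h : ∀ i, ‖u i‖ ≤ C) :
    ‖reduce u‖ ≤ 2 * C := by
  refine (pi_norm_le_iff_of_nonneg (by positivity)).2 fun j => ?_
  cases j with
  | tr => exact (norm_add_le _ _).trans (by linarith [h (.k 0 0), h (.k 1 1)])
  | df => exact (norm_sub_le _ _).trans (by linarith [h (.k 0 0), h (.k 1 1)])
  | _ => exact (h _).trans (by linarith)

theorem analyticAt_reduce {𝕜 : Type} [NontriviallyNormedField 𝕜] {E : Type*}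
    [NormedAddCommGroup E] [NormedSpace 𝕜 E] {u : E → Idx → 𝕜} {p : E}
    (h : ∀ i, AnalyticAt 𝕜 (fun q => u q i) p) (j : RIdx) :
    AnalyticAt 𝕜 (fun q => reduce (u q) j) p := by
  cases j with
  | tr => exact (h _).add (h _)
  | df => exact (h _).sub (h _)
  | _ => exact h _

theorem differentiableOn_reduce {V : (Fin 2 → ℂ) → Idx → ℂ} {s : Set (Fin 2 → ℂ)}
    (h : ∀ i, DifferentiableOn ℂ (fun z => V z i) s) :
    DifferentiableOn ℂ (fun z => reduce (V z)) s := by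
  refine differentiableOn_pi.2 fun j => ?_
  cases j with
  | tr => exact (h _).add (h _)
  | df => exact (h _).sub (h _)
  | _ => exact h _

theorem hasDerivAt_reduce {u : ℝ → Idx → ℝ} {u' : Idx → ℝ} {t : ℝ}
    (h : ∀ i, HasDerivAt (fun s => u s i) (u' i) t) (j : RIdx) :
    HasDerivAt (fun s => reduce (u s) j) (reduce u' j) t := by
  cases j with
  | tr => exact (h _).add (h _)
  | df => exact (h _).sub (h _)
  | _ => exact h _

variable {M : Type*} [TopologicalSpace M] [ChartedSpace Plane M] [IsManifold 𝓘(ℝ, Plane) ω M]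
  {A : AsymptoticData M} {ε : Exponents} {e : OpenPartialHomeomorph M Plane} {W : Set Plane}
  {t₀ : ℝ} {U U' : Fields M}

theorem AdmissibleAt.sigmaJ_pos {t : ℝ} {y : Plane} (h : AdmissibleAt A ε U e t y) :
    0 < sigmaJ (bgR A e y) (expR ε (A.v (e.symm y)) t) (U.comp e t y) 1 1 := by
  rw [← sigma_eq]; exact h.posDef.diag_pos

/-- An admissible field is determined by its independent components. -/
theorem AdmissibleAt.full_reduce {t : ℝ} {y : Plane} (h : AdmissibleAt A ε U e t y)
    (hA : A.AnalyticIn e y) :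
    full (bgR A e y) (expR ε (A.v (e.symm y)) t) (reduce (U.comp e t y)) = U.comp e t y := by
  refine AVTD.full_reduce ?_ (fun c => h.symm_sigc c 1 0) (bgSymm_bgR hA) h.sigmaJ_pos.ne' ?_
  · have h1 : sigma A ε U e t y 1 0 = sigma A ε U e t y 0 1 := by
      simpa using h.posDef.isHermitian.apply 0 1
    simp only [sigma, Matrix.of_apply, sigUp_symm] at h1
    exact mul_left_cancel₀ (Real.exp_ne_zero _) (add_left_cancel h1)
  · rw [← sigK_eq]; exact h.symm_k 1 0

theorem AdmissibleAt.sigmaR_reduce {t : ℝ} {y : Plane} (h : AdmissibleAt A ε U e t y)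
    (hA : A.AnalyticIn e y) :
    sigmaR (bgR A e y) (expR ε (A.v (e.symm y)) t) (reduce (U.comp e t y))
      = sigmaJ (bgR A e y) (expR ε (A.v (e.symm y)) t) (U.comp e t y) := by
  rw [← sigmaJ_full, h.full_reduce hA]

theorem IsSolOn.analyticAt_space (h : IsSolOn A ε U e W t₀) {t : ℝ} (ht : t₀ < t) {y : Plane}
    (hy : y ∈ W) (i : Idx) : AnalyticAt ℝ (fun z => U.comp e t z i) y :=
  AnalyticAt.comp (f := fun z : Plane => (t, z)) (g := fun q : ℝ × Plane => U.comp e q.1 q.2 i)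
    (h.analytic i (t, y) ⟨ht, hy⟩) (analyticAt_const.prod analyticAt_id)

theorem IsSolOn.analyticAt_time (h : IsSolOn A ε U e W t₀) {t : ℝ} (ht : t₀ < t) {y : Plane}
    (hy : y ∈ W) (i : Idx) : AnalyticAt ℝ (fun s => U.comp e s y i) t :=
  AnalyticAt.comp (f := fun s : ℝ => (s, y)) (g := fun q : ℝ × Plane => U.comp e q.1 q.2 i)
    (h.analytic i (t, y) ⟨ht, hy⟩) (analyticAt_id.prod analyticAt_const)

/-- The independent components of a solution satisfy the reduced system. -/
theorem IsSolOn.hasDerivAt_reduce (h : IsSolOn A ε U e W t₀) (hW : IsOpen W)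
    (hA : ∀ y ∈ W, A.AnalyticIn e y) {t : ℝ} (ht : t₀ < t) {y : Plane} (hy : y ∈ W) (j : RIdx) :
    HasDerivAt (fun s => reduce (U.comp e s y) j)
      (muR (fun c => c) ε (A.v (e.symm y)) j * reduce (U.comp e t y) j
        + rhsR (bgR A e y) (expR ε (A.v (e.symm y)) t) t (reduce (U.comp e t y))
          (fun d j => pd d (fun z => reduce (U.comp e t z) j) y) j) t := by
  have hyA := hA y hy
  have hadm := h.admissible y hy t ht
  have hs := fun i => h.analyticAt_space ht hy i
  set b := bgR A e y with hb
  set x := expR ε (A.v (e.symm y)) t with hx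
  set dr : Fin 2 → RIdx → ℝ := fun d j => pd d (fun z => reduce (U.comp e t z) j) y with hdr
  have hne : sigmaR b x (reduce (U.comp e t y)) 1 1 ≠ 0 := by
    rw [hadm.sigmaR_reduce hyA]; exact hadm.sigmaJ_pos.ne'
  have hra := analyticAt_reduce hs
  have hdS : ∀ d a c, pd d (fun z => sigmaR (bgR A e z) (expR ε (A.v (e.symm z)) t)
      (reduce (U.comp e t z)) a c) y = dsigmaR b x dr d a c := by
    intro d a c
    have hxs : ∀ z, expR ε (A.v (e.symm z)) t .s = x .s := fun z => by simp only [hx, expR_s]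
    simp only [sigmaR, hxs]
    rw [pd_add (hyA.bgR _).differentiableAt ((hra _).differentiableAt.const_mul _),
      pd_const_mul _ (hra _).differentiableAt]
    rfl
  have hdx : U.dx e t y = fullD b x (reduce (U.comp e t y)) dr := by
    ext d i
    rw [← pd_full hyA.bgR (fun i => analyticAt_expR ε hyA.v analyticAt_const i) hra hne
      (fun _ _ => rfl) hdS d i]
    refine pd_congr ?_
    filter_upwards [hW.mem_nhds hy] with z hz
    rw [(h.admissible z hz t ht).full_reduce (hA z hz)]
  have hsys := (hyA.systemAt_iff fun i => (hs i).differentiableAt).1 (h.system y hy t ht)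
  have hdt : ∀ i, HasDerivAt (fun s => U.comp e s y i) (U.dt e t y i) t := fun i =>
    (h.analyticAt_time ht hy i).differentiableAt.hasDerivAt
  refine (AVTD.hasDerivAt_reduce hdt j).congr_deriv ?_
  rw [show U.dt e t y = fun i => linJ ε (A.v (e.symm y)) (U.comp e t y) i
      + rhsJ b x t (U.comp e t y) (U.dx e t y) i from funext hsys, reduce_add]
  rw [reduce_linJ, rhsR, hadm.full_reduce hyA, hdx]

/-- The independent components of bounded holomorphic extensions of a solution form a bounded
solution of the complex system. -/
theorem IsSolOn.isBoundedSolution (h : IsSolOn A ε U e W t₀) (hW : IsOpen W)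
    (hA : ∀ y ∈ W, A.AnalyticIn e y) {y₀ : Plane} {b : BIdx → (Fin 2 → ℂ) → ℂ} {R δ κ : ℝ}
    (hm : LocalModel A ε e y₀ b R δ κ) {t₁ K L : ℝ}
    (hF : IsFuchsian (fun z => muR (fun c => (c : ℂ)) ε (b .v z)) (fuchsRhs b ε) (toC y₀) R t₁ K δ
      L) {r T C : ℝ} (hr : 0 < r) (hrR : r ≤ R)
    (hrW : ∀ y, toC y ∈ ball (toC y₀) r → y ∈ W) (hT : t₁ ≤ T) (hT0 : t₀ ≤ T) (hC : 0 ≤ C)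
    (hCK : 2 * C ≤ K / 2) {V : Idx → ℝ → (Fin 2 → ℂ) → ℂ}
    (hV : ∀ t, T < t → ∀ i, DifferentiableOn ℂ (V i t) (ball (toC y₀) r) ∧
      (∀ z ∈ ball (toC y₀) r, ‖V i t z‖ ≤ C) ∧
      ∀ y, toC y ∈ ball (toC y₀) r → V i t (toC y) = U.comp e t y i) :
    IsBoundedSolution (fun z => muR (fun c => (c : ℂ)) ε (b .v z)) (fuchsRhs b ε) (toC y₀) (r / 32)
      T (K / 2) fun t z => reduce fun i => V i t z := by
  have hVr : ∀ t, T < t → ∀ y, toC y ∈ ball (toC y₀) r → ∀ j,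
      reduce (fun i => V i t (toC y)) j = ((reduce (U.comp e t y) j : ℝ) : ℂ) := by
    intro t ht y hy j
    have := map_reduce Complex.ofRealHom (U.comp e t y) j
    simp only [Complex.ofRealHom_eq_coe] at this
    rw [this]
    congr 1
    exact funext fun i => (hV t ht i).2.2 y hy
  have hVd : ∀ t, T < t → DifferentiableOn ℂ (fun z => reduce fun i => V i t z)
      (ball (toC y₀) r) := fun t ht =>
    differentiableOn_reduce (V := fun z i => V i t z) fun i => (hV t ht i).1
  refine hF.isBoundedSolution_of_real hr hrR hT (V := fun t z => reduce fun i => V i t z)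
    (g := fun q j => ((reduce (U.comp e q.1 q.2) j : ℝ) : ℂ)) hVd
    (fun t ht z hz => (norm_reduce_le hC fun i => (hV t ht i).2.1 z hz).trans hCK) ?_
    (fun t ht y hy => funext (hVr t ht y hy)) fun t ht y hy j => ?_
  · rintro ⟨t, y⟩ ⟨ht, hy⟩
    refine analyticAt_pi_iff.2 fun j => ?_
    exact (Complex.ofRealCLM.analyticAt _).comp
      (analyticAt_reduce (fun i => h.analytic i (t, y) ⟨hT0.trans_lt ht, hrW y hy⟩) j)
  · have hyR : toC y ∈ ball (toC y₀) R := ball_subset_ball hrR hy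
    have hnear : ∀ᶠ z in 𝓝 y, toC z ∈ ball (toC y₀) r :=
      continuous_toC.continuousAt.eventually (isOpen_ball.mem_nhds hy)
    have h1 := (h.hasDerivAt_reduce hW hA (hT0.trans_lt ht) (hrW y hy) j).ofReal_comp
    have h2 : HasDerivAt (fun s => reduce (fun i => V i s (toC y)) j) _ t :=
      h1.congr_of_eventuallyEq (by
        filter_upwards [eventually_gt_nhds ht] with s hs
        exact hVr s hs y hy j)
    refine h2.congr_deriv ?_
    have h3 := fderiv_single_of_ofReal ((hVd t ht).differentiableAt (isOpen_ball.mem_nhds hy))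
      (ρ := fun y => reduce (U.comp e t y)) (hnear.mono fun z hz => hVr t ht z hz)
    have hv' : b .v (toC y) = (A.v (e.symm y) : ℂ) := hm.ext .v y hyR
    have h4 := fuchsRhs_ofReal (ε := ε) (fun i => hm.ext i y hyR) t (hVr t ht y hy) h3 j
    rw [h4, hv', muR_ofReal, hVr t ht y hy]
    push_cast
    rfl

/-- Two bounded local solutions coincide: near `y₀` for large times, hence at `y₀` for all times by
analyticity. -/
theorem IsSolOn.comp_eq (hU : IsSolOn A ε U e W t₀) (hU' : IsSolOn A ε U' e W t₀)
    (hε : ε.Positive) (hv : ∀ x, ε.k < A.v x) (hk : max (max ε.sig ε.sigc) ε.p < ε.k)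
    (hp : max ε.phi ε.phic < ε.p) (he : e ∈ atlas Plane M) (hW : IsOpen W) (hWe : W ⊆ e.target)
    {y₀ : Plane} (hy : y₀ ∈ W) (hb : ∀ i, HolBounded (fun t y => U.comp e t y i) y₀)
    (hb' : ∀ i, HolBounded (fun t y => U'.comp e t y i) y₀) {t : ℝ} (ht : t₀ < t) :
    U.comp e t y₀ = U'.comp e t y₀ := by
  obtain ⟨b, R, δ, κ, hm⟩ := exists_localModel A hε hv hk hp he (hWe hy)
  have hA : ∀ y ∈ W, A.AnalyticIn e y := fun y hy => analyticIn_chart A he (hWe hy)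
  obtain ⟨r₁, hr₁, T₁, C₁, V, hV⟩ := exists_common_extension hb
  obtain ⟨r₂, hr₂, T₂, C₂, V', hV'⟩ := exists_common_extension hb'
  obtain ⟨r₃, hr₃, hr₃W⟩ := exists_ball_toC_subset (hW.mem_nhds hy)
  set C := max 0 (max C₁ C₂) with hC
  have hC0 : 0 ≤ C := le_max_left _ _
  obtain ⟨t₁, L, ht₁, hF, -, -⟩ := hm.fuchsian (4 * C + 1) (by positivity)
  have hR := hm.R_pos
  obtain ⟨r, hr, h1, h2, h3, h4⟩ : ∃ r > 0, r ≤ R ∧ r ≤ r₁ ∧ r ≤ r₂ ∧ r ≤ r₃ :=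
    ⟨min (min R r₁) (min r₂ r₃), by positivity, by simp, by simp, by simp, by simp⟩
  obtain ⟨T, k1, k2, k3, k4⟩ : ∃ T, t₁ ≤ T ∧ t₀ ≤ T ∧ T₁ ≤ T ∧ T₂ ≤ T :=
    ⟨max (max t₁ t₀) (max T₁ T₂), by simp, by simp, by simp, by simp⟩
  have hrW : ∀ y, toC y ∈ ball (toC y₀) r → y ∈ W := fun y hy => hr₃W y (ball_subset_ball h4 hy)
  have e1 : ∀ t, T < t → ∀ i, DifferentiableOn ℂ (V i t) (ball (toC y₀) r) ∧
      (∀ z ∈ ball (toC y₀) r, ‖V i t z‖ ≤ C) ∧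
      ∀ y, toC y ∈ ball (toC y₀) r → V i t (toC y) = U.comp e t y i := by
    intro t ht i
    obtain ⟨a1, a2, a3⟩ := hV t (k3.trans_lt ht) i
    exact ⟨a1.mono (ball_subset_ball h2), fun z hz => (a2 z (ball_subset_ball h2 hz)).trans
      ((le_max_left _ _).trans (le_max_right _ _)), fun y hy => a3 y (ball_subset_ball h2 hy)⟩
  have e2 : ∀ t, T < t → ∀ i, DifferentiableOn ℂ (V' i t) (ball (toC y₀) r) ∧
      (∀ z ∈ ball (toC y₀) r, ‖V' i t z‖ ≤ C) ∧
      ∀ y, toC y ∈ ball (toC y₀) r → V' i t (toC y) = U'.comp e t y i := by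
    intro t ht i
    obtain ⟨a1, a2, a3⟩ := hV' t (k4.trans_lt ht) i
    exact ⟨a1.mono (ball_subset_ball h3), fun z hz => (a2 z (ball_subset_ball h3 hz)).trans
      ((le_max_right _ _).trans (le_max_right _ _)), fun y hy => a3 y (ball_subset_ball h3 hy)⟩
  have hCK : 2 * C ≤ (4 * C + 1) / 2 := by linarith
  have s1 := hU.isBoundedSolution hW hA hm hF hr h1 hrW k1 k2 hC0 hCK e1
  have s2 := hU'.isBoundedSolution hW hA hm hF hr h1 hrW k1 k2 hC0 hCK e2
  obtain ⟨T', r', hr', heq⟩ := hF.eq_of_isBoundedSolution (by positivity) (by linarith) k1 s1 s2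
  have hlarge : ∀ t, max T T' < t → U.comp e t y₀ = U'.comp e t y₀ := by
    intro t ht
    have hTt : T < t := (le_max_left _ _).trans_lt ht
    have hred : reduce (U.comp e t y₀) = reduce (U'.comp e t y₀) := by
      have h5 := heq t ((le_max_right _ _).trans_lt ht) (toC y₀) (mem_ball_self hr')
      have h6 : (fun i => V i t (toC y₀)) = fun i => Complex.ofRealHom (U.comp e t y₀ i) :=
        funext fun i => (e1 t hTt i).2.2 y₀ (mem_ball_self hr)
      have h7 : (fun i => V' i t (toC y₀)) = fun i => Complex.ofRealHom (U'.comp e t y₀ i) :=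
        funext fun i => (e2 t hTt i).2.2 y₀ (mem_ball_self hr)
      funext j
      have h8 := congrFun h5 j
      simp only [h6, h7, ← map_reduce] at h8
      exact Complex.ofReal_injective h8
    rw [← (hU.admissible y₀ hy t (k2.trans_lt hTt)).full_reduce (hA y₀ hy),
      ← (hU'.admissible y₀ hy t (k2.trans_lt hTt)).full_reduce (hA y₀ hy), hred]
  funext i
  have hmem : max T T' + 1 ∈ Ioi t₀ :=
    mem_Ioi.2 ((k2.trans (le_max_left _ _)).trans_lt (lt_add_one _))
  refine AnalyticOnNhd.eqOn_of_preconnected_of_eventuallyEq (𝕜 := ℝ) (U := Ioi t₀)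
    (f := fun s => U.comp e s y₀ i) (g := fun s => U'.comp e s y₀ i)
    (fun s hs => hU.analyticAt_time hs hy i) (fun s hs => hU'.analyticAt_time hs hy i)
    isPreconnected_Ioi hmem ?_ ht
  filter_upwards [eventually_gt_nhds (lt_add_one (max T T'))] with s hs
  rw [hlarge s hs]

end LocalUniqueness

/-! ### Tensor algebra under a change of basis -/

section Tensors

variable {J K : Fin 2 → Fin 2 → ℝ}

/-- The arrays `X` and `X'` are the components of one covector in two bases. Here and below the
index `i` of the Jacobian `J i a` belongs to the primed basis. The relations are arranged so that
only `J`, but not its inverse, occurs. -/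
def IsCov1 (J : Fin 2 → Fin 2 → ℝ) (X X' : Fin 2 → ℝ) : Prop := ∀ a, X a = ∑ i, J i a * X' i

/-- Components of one covariant tensor of rank two. -/
def IsCov2 (J : Fin 2 → Fin 2 → ℝ) (X X' : Fin 2 → Fin 2 → ℝ) : Prop :=
  ∀ a b, X a b = ∑ i, ∑ j, J i a * J j b * X' i j

/-- Components of one covariant tensor of rank three. -/
def IsCov3 (J : Fin 2 → Fin 2 → ℝ) (X X' : Fin 2 → Fin 2 → Fin 2 → ℝ) : Prop :=
  ∀ a b c, X a b c = ∑ i, ∑ j, ∑ k, J i a * J j b * J k c * X' i j k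

/-- Components of one covariant tensor of rank four. -/
def IsCov4 (J : Fin 2 → Fin 2 → ℝ) (X X' : Fin 2 → Fin 2 → Fin 2 → Fin 2 → ℝ) : Prop :=
  ∀ a b c d, X a b c d = ∑ i, ∑ j, ∑ k, ∑ l, J i a * J j b * J k c * J l d * X' i j k l

/-- Components of one contravariant tensor of rank two. -/
def IsContra2 (J : Fin 2 → Fin 2 → ℝ) (X X' : Fin 2 → Fin 2 → ℝ) : Prop :=
  ∀ i j, X' i j = ∑ a, ∑ b, J i a * J j b * X a b

/-- Components of one tensor `F_a^b`. -/
def IsMixed11 (J : Fin 2 → Fin 2 → ℝ) (F F' : Fin 2 → Fin 2 → ℝ) : Prop :=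
  ∀ a i, ∑ b, J i b * F a b = ∑ k, J k a * F' k i

/-- Components of one tensor `P_c^{ab}`. -/
def IsMixed12 (J : Fin 2 → Fin 2 → ℝ) (P P' : Fin 2 → Fin 2 → Fin 2 → ℝ) : Prop :=
  ∀ c i j, ∑ a, ∑ b, J i a * J j b * P c a b = ∑ k, J k c * P' k i j

/-- Components of one tensor `Q_{dc}^{ab}`. -/
def IsMixed22 (J : Fin 2 → Fin 2 → ℝ) (Q Q' : Fin 2 → Fin 2 → Fin 2 → Fin 2 → ℝ) : Prop :=
  ∀ d c i j, ∑ a, ∑ b, J i a * J j b * Q d c a b = ∑ l, ∑ k, J l d * J k c * Q' l k i j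

/-- Components of one tensor `C^c_{ab}`. -/
def IsMixed21 (J : Fin 2 → Fin 2 → ℝ) (C C' : Fin 2 → Fin 2 → Fin 2 → ℝ) : Prop :=
  ∀ i a b, ∑ c, J i c * C c a b = ∑ k, ∑ l, J k a * J l b * C' i k l

/-- Components `D g c a b` of one tensor `D_g^c_{ab}`. -/
def IsMixed31 (J : Fin 2 → Fin 2 → ℝ) (D D' : Fin 2 → Fin 2 → Fin 2 → Fin 2 → ℝ) : Prop :=
  ∀ i g a b, ∑ c, J i c * D g c a b = ∑ n, ∑ k, ∑ l, J n g * J k a * J l b * D' n i k l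

/-- Components of one connection; `H` is the array of second derivatives of the change of
coordinates. -/
def IsConn (J : Fin 2 → Fin 2 → ℝ) (H Γ Γ' : Fin 2 → Fin 2 → Fin 2 → ℝ) : Prop :=
  ∀ i a b, ∑ c, J i c * Γ c a b = ∑ k, ∑ l, J k a * J l b * Γ' i k l + H i a b

theorem contract1 {X X' Y Y' : Fin 2 → ℝ} (hX : IsCov1 J X X') (hY : ∀ i, Y' i = ∑ a, J i a * Y a) :
    ∑ a, X a * Y a = ∑ i, X' i * Y' i := by
  simp only [hX _, hY, Fin.sum_univ_two]; ring

theorem contract2 {X X' Y Y' : Fin 2 → ℝ} {T T' : Fin 2 → Fin 2 → ℝ} (hX : IsCov1 J X X')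
    (hY : IsCov1 J Y Y') (hT : ∀ i j, ∑ a, ∑ b, J i a * J j b * T a b = T' i j) :
    ∑ a, ∑ b, X a * Y b * T a b = ∑ i, ∑ j, X' i * Y' j * T' i j := by
  simp only [hX _, hY _, ← hT, Fin.sum_univ_two]; ring

theorem contract22 {X X' T T' : Fin 2 → Fin 2 → ℝ} (hX : IsCov2 J X X')
    (hT : IsContra2 J T T') : ∑ a, ∑ b, T a b * X a b = ∑ i, ∑ j, T' i j * X' i j := by
  simp only [hX _, hT _, Fin.sum_univ_two]; ring

theorem eq_zero_of_jac (hKJ : ∀ a b, ∑ i, K a i * J i b = (1 : Matrix (Fin 2) (Fin 2) ℝ) a b)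
    {Y : Fin 2 → ℝ} (h : ∀ i, ∑ a, J i a * Y a = 0) (a : Fin 2) : Y a = 0 := by
  have h0 := h 0
  have h1 := h 1
  have k0 := hKJ a 0
  have k1 := hKJ a 1
  simp only [Fin.sum_univ_two] at h0 h1 k0 k1
  have : Y a = (1 : Matrix (Fin 2) (Fin 2) ℝ) a 0 * Y 0 + (1 : Matrix (Fin 2) (Fin 2) ℝ) a 1 * Y 1 := by
    revert a; simp [Fin.forall_fin_two]
  rw [this, ← k0, ← k1]
  linear_combination K a 0 * h0 + K a 1 * h1

theorem eq_zero_of_jac₂ (hKJ : ∀ a b, ∑ i, K a i * J i b = (1 : Matrix (Fin 2) (Fin 2) ℝ) a b)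
    {Y : Fin 2 → Fin 2 → ℝ} (h : ∀ i j, ∑ a, ∑ b, J i a * J j b * Y a b = 0) (a b : Fin 2) :
    Y a b = 0 := by
  refine eq_zero_of_jac hKJ (Y := fun b => Y a b) (fun j => ?_) b
  refine eq_zero_of_jac hKJ (Y := fun a => ∑ b, J j b * Y a b) (fun i => ?_) a
  rw [← h i j]
  simp only [Fin.sum_univ_two]; ring

/-- The trace is independent of the basis. -/
theorem trace_eq_of_mixed (hKJ : ∀ a b, ∑ i, K a i * J i b = (1 : Matrix (Fin 2) (Fin 2) ℝ) a b)
    {F F' : Fin 2 → Fin 2 → ℝ} (h : IsMixed11 J F F') : ∑ c, F c c = ∑ i, F' i i := by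
  have k00 := hKJ 0 0
  have k01 := hKJ 0 1
  have k10 := hKJ 1 0
  have k11 := hKJ 1 1
  have h00 := h 0 0
  have h01 := h 0 1
  have h10 := h 1 0
  have h11 := h 1 1
  have hd : J 0 0 * J 1 1 - J 0 1 * J 1 0 ≠ 0 := by
    intro hd
    have : (K 0 0 * K 1 1 - K 0 1 * K 1 0) * (J 0 0 * J 1 1 - J 0 1 * J 1 0) = 1 := by
      have e : (K 0 0 * J 0 0 + K 0 1 * J 1 0) * (K 1 0 * J 0 1 + K 1 1 * J 1 1)
        - (K 0 0 * J 0 1 + K 0 1 * J 1 1) * (K 1 0 * J 0 0 + K 1 1 * J 1 0) = 1 := by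
        simp only [Fin.sum_univ_two] at k00 k01 k10 k11
        rw [k00, k01, k10, k11]; simp
      linear_combination e
    rw [hd, mul_zero] at this
    exact zero_ne_one this
  simp only [Fin.sum_univ_two] at *
  refine mul_left_cancel₀ hd ?_
  linear_combination J 1 1 * h00 - J 0 1 * h01 - J 1 0 * h10 + J 0 0 * h11

variable {S S' B B' : Fin 2 → Fin 2 → ℝ} {P P' : Fin 2 → Fin 2 → Fin 2 → ℝ}
  {Q Q' : Fin 2 → Fin 2 → Fin 2 → Fin 2 → ℝ}

theorem IsCov2.row (hB : IsCov2 J B B') (b : Fin 2) :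
    IsCov1 J (B b) fun p => ∑ i, J i b * B' i p := fun m => by
  rw [hB]; simp only [Fin.sum_univ_two]; ring

theorem isCov3_dLowG (hB : IsCov2 J B B') (hP : IsMixed12 J P P') :
    IsCov3 J (dLowG B P) (dLowG B' P') := fun a b d => by
  rw [dLowG, contract2 (hB.row b) (hB.row d) (hP a)]
  simp only [dLowG, Fin.sum_univ_two]; ring

theorem IsCov3.row {D D' : Fin 2 → Fin 2 → Fin 2 → ℝ} (hD : IsCov3 J D D') (g b : Fin 2) :
    IsCov1 J (D g b) fun p => ∑ l, ∑ i, J l g * J i b * D' l i p := fun m => by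
  rw [hD]; simp only [Fin.sum_univ_two]; ring

theorem isCov4_ddLowG (hB : IsCov2 J B B') (hP : IsMixed12 J P P') (hQ : IsMixed22 J Q Q') :
    IsCov4 J (ddLowG B P Q) (ddLowG B' P' Q') := fun g a b d => by
  have hD := isCov3_dLowG hB hP
  have h1 := contract2 (hD.row g b) (hB.row d) (hP a)
  have h2 := contract2 (hB.row b) (hD.row g d) (hP a)
  have h3 := contract2 (hB.row b) (hB.row d) (hQ g a)
  simp only [ddLowG, Finset.sum_add_distrib]
  rw [h1, h2, h3]
  simp only [Fin.sum_univ_two]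
  ring

/-- The combination of derivatives in the formula for the Christoffel symbols. -/
theorem IsCov3.christoffel {D D' : Fin 2 → Fin 2 → Fin 2 → ℝ} (hD : IsCov3 J D D') :
    IsCov3 J (fun a b d => D a b d + D b a d - D d a b) fun a b d => D' a b d + D' b a d - D' d a b :=
  fun a b d => by
    simp only [hD _ _ _, Fin.sum_univ_two]; ring

theorem IsCov4.christoffel {D D' : Fin 2 → Fin 2 → Fin 2 → Fin 2 → ℝ} (hD : IsCov4 J D D') :
    IsCov4 J (fun g a b d => D g a b d + D g b a d - D g d a b)
      fun g a b d => D' g a b d + D' g b a d - D' g d a b :=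
  fun g a b d => by
    simp only [hD _ _ _ _, Fin.sum_univ_two]; ring

/-- Raising an index. -/
theorem IsContra2.raise3 (hS : IsContra2 J S S') {E E' : Fin 2 → Fin 2 → Fin 2 → ℝ}
    (hE : IsCov3 J E E') : IsMixed21 J (fun c a b => ∑ d, (1 / 2) * S c d * E a b d)
      fun c a b => ∑ d, (1 / 2) * S' c d * E' a b d := fun i a b => by
  simp only [hE _ _ _, hS _ _, Fin.sum_univ_two]; ring

theorem isMixed21_diffCG (hS : IsContra2 J S S') (hB : IsCov2 J B B') (hP : IsMixed12 J P P') :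
    IsMixed21 J (diffCG S B P) (diffCG S' B' P') :=
  hS.raise3 (isCov3_dLowG hB hP).christoffel

theorem isMixed31_dDiffCG (hS : IsContra2 J S S') (hB : IsCov2 J B B') (hP : IsMixed12 J P P')
    (hQ : IsMixed22 J Q Q') : IsMixed31 J (dDiffCG S B P Q) (dDiffCG S' B' P' Q') := by
  intro i g a b
  have hE := (isCov3_dLowG hB hP).christoffel
  have hF := (isCov4_ddLowG hB hP hQ).christoffel
  have h1 : ∑ c, J i c * ∑ d, (1 / 2) * P g c d * (dLowG B P a b d + dLowG B P b a d - dLowG B P d a b)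
      = ∑ n, ∑ k, ∑ l, J n g * J k a * J l b * ∑ m, (1 / 2) * P' n i m
        * (dLowG B' P' k l m + dLowG B' P' l k m - dLowG B' P' m k l) := by
    have hp := fun m => hP g i m
    have e := fun d => hE a b d
    simp only at e
    simp only [e]
    simp only [Fin.sum_univ_two] at hp ⊢
    set E' := fun a b d => dLowG B' P' a b d + dLowG B' P' b a d - dLowG B' P' d a b with hE'
    have p0 := hp 0
    have p1 := hp 1
    linear_combination (1 / 2) * (J 0 a * J 0 b * E' 0 0 0 + J 0 a * J 1 b * E' 0 1 0
      + J 1 a * J 0 b * E' 1 0 0 + J 1 a * J 1 b * E' 1 1 0) * p0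
      + (1 / 2) * (J 0 a * J 0 b * E' 0 0 1 + J 0 a * J 1 b * E' 0 1 1
      + J 1 a * J 0 b * E' 1 0 1 + J 1 a * J 1 b * E' 1 1 1) * p1
  have h2 : ∑ c, J i c * ∑ d, (1 / 2) * S c d *
        (ddLowG B P Q g a b d + ddLowG B P Q g b a d - ddLowG B P Q g d a b)
      = ∑ n, ∑ k, ∑ l, J n g * J k a * J l b * ∑ m, (1 / 2) * S' i m
        * (ddLowG B' P' Q' n k l m + ddLowG B' P' Q' n l k m - ddLowG B' P' Q' n m k l) := by
    have e := fun d => hF g a b d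
    simp only at e
    simp only [e, hS _ _, Fin.sum_univ_two]
    ring
  simp only [dDiffCG, Finset.sum_add_distrib, mul_add] at h1 h2 ⊢
  rw [h1, h2]

theorem isCov2_trace31 (hKJ : ∀ a b, ∑ i, K a i * J i b = (1 : Matrix (Fin 2) (Fin 2) ℝ) a b)
    {D D' : Fin 2 → Fin 2 → Fin 2 → Fin 2 → ℝ} (hD : IsMixed31 J D D') :
    IsCov2 J (fun a b => ∑ c, D c c a b) fun a b => ∑ c, D' c c a b := fun a b => by
  have := trace_eq_of_mixed hKJ (F := fun g c => D g c a b)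
    (F' := fun n i => ∑ k, ∑ l, J k a * J l b * D' n i k l) fun g i => by
      rw [hD]; simp only [Fin.sum_univ_two]; ring
  simp only [this, Fin.sum_univ_two]; ring

theorem isCov2_trace31' (hKJ : ∀ a b, ∑ i, K a i * J i b = (1 : Matrix (Fin 2) (Fin 2) ℝ) a b)
    {D D' : Fin 2 → Fin 2 → Fin 2 → Fin 2 → ℝ} (hD : IsMixed31 J D D') :
    IsCov2 J (fun a b => ∑ c, D b c a c) fun a b => ∑ c, D' b c a c := fun a b => by
  have := trace_eq_of_mixed hKJ (F := fun g c => D b c a g)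
    (F' := fun l i => ∑ k, ∑ n, J k a * J n b * D' n i k l) fun g i => by
      rw [hD]; simp only [Fin.sum_univ_two]; ring
  simp only [this, Fin.sum_univ_two]; ring

variable {C C' : Fin 2 → Fin 2 → Fin 2 → ℝ}

theorem isCov1_trace21 (hKJ : ∀ a b, ∑ i, K a i * J i b = (1 : Matrix (Fin 2) (Fin 2) ℝ) a b)
    (hC : IsMixed21 J C C') : IsCov1 J (fun d => ∑ c, C c c d) fun d => ∑ c, C' c c d := fun d => by
  have := trace_eq_of_mixed hKJ (F := fun g c => C c g d)
    (F' := fun l i => ∑ k, J k d * C' i l k) fun g i => by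
      rw [hC]; simp only [Fin.sum_univ_two]; ring
  simp only [this, Fin.sum_univ_two]; ring

theorem isCov2_quad₁ (hKJ : ∀ a b, ∑ i, K a i * J i b = (1 : Matrix (Fin 2) (Fin 2) ℝ) a b)
    (hC : IsMixed21 J C C') : IsCov2 J (fun a b => ∑ c, ∑ d, C c c d * C d a b)
      fun a b => ∑ c, ∑ d, C' c c d * C' d a b := fun a b => by
  have h := contract1 (isCov1_trace21 hKJ hC) (Y := fun d => C d a b)
    (Y' := fun i => ∑ k, ∑ l, J k a * J l b * C' i k l) fun i => (hC i a b).symm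
  simp only [Fin.sum_univ_two] at h ⊢
  linear_combination h

theorem isCov2_quad₂ (hKJ : ∀ a b, ∑ i, K a i * J i b = (1 : Matrix (Fin 2) (Fin 2) ℝ) a b)
    (hC : IsMixed21 J C C') : IsCov2 J (fun a b => ∑ c, ∑ d, C c b d * C d a c)
      fun a b => ∑ c, ∑ d, C' c b d * C' d a c := fun a b => by
  have h := trace_eq_of_mixed hKJ (F := fun g c => ∑ d, C c b d * C d a g)
    (F' := fun l i => ∑ m, (∑ n, J n b * C' i n m) * ∑ k, J k a * C' m k l) fun g i => by
      have h1 := fun d => hC i b d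
      have h2 := fun m => hC m a g
      simp only [Fin.sum_univ_two] at h1 h2 ⊢
      linear_combination C 0 a g * h1 0 + C 1 a g * h1 1
        + (J 0 b * C' i 0 0 + J 1 b * C' i 1 0) * h2 0 + (J 0 b * C' i 0 1 + J 1 b * C' i 1 1) * h2 1
  refine h.trans ?_
  simp only [Fin.sum_univ_two]; ring

theorem IsCov2.add {X X' Y Y' : Fin 2 → Fin 2 → ℝ} (hX : IsCov2 J X X') (hY : IsCov2 J Y Y') :
    IsCov2 J (fun a b => X a b + Y a b) fun a b => X' a b + Y' a b := fun a b => by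
  simp only [hX a b, hY a b, Fin.sum_univ_two]; ring

theorem IsCov2.sub {X X' Y Y' : Fin 2 → Fin 2 → ℝ} (hX : IsCov2 J X X') (hY : IsCov2 J Y Y') :
    IsCov2 J (fun a b => X a b - Y a b) fun a b => X' a b - Y' a b := fun a b => by
  simp only [hX a b, hY a b, Fin.sum_univ_two]; ring

/-- The scalar curvature is independent of the basis. -/
theorem scalarCurvG_eq (hKJ : ∀ a b, ∑ i, K a i * J i b = (1 : Matrix (Fin 2) (Fin 2) ℝ) a b)
    {Rb Rb' : Fin 2 → Fin 2 → ℝ} (hR : IsCov2 J Rb Rb') (hS : IsContra2 J S S')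
    (hB : IsCov2 J B B') (hP : IsMixed12 J P P') (hQ : IsMixed22 J Q Q') :
    scalarCurvG Rb S B P Q = scalarCurvG Rb' S' B' P' Q' := by
  have hC := isMixed21_diffCG hS hB hP
  have hD := isMixed31_dDiffCG hS hB hP hQ
  exact contract22 ((((hR.add (isCov2_trace31 hKJ hD)).sub (isCov2_trace31' hKJ hD)).add
    (isCov2_quad₁ hKJ hC)).sub (isCov2_quad₂ hKJ hC)) hS

end Tensors

/-! ### Covariant derivatives and curvature under a change of coordinates -/

section Coordinates

variable {M : Type*} [TopologicalSpace M] [ChartedSpace Plane M] [IsManifold 𝓘(ℝ, Plane) ω M]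
  {e e' : OpenPartialHomeomorph M Plane} {y : Plane}

theorem pd_comp_transit (he : e ∈ atlas Plane M) (he' : e' ∈ atlas Plane M)
    (hy : y ∈ overlap e e') {f : Plane → ℝ} (hf : DifferentiableAt ℝ f (transit e e' y)) (a : Fin 2) :
    pd a (fun z => f (transit e e' z)) y = ∑ i, jac e e' y i a * pd i f (transit e e' y) := by
  have h1 := hf.hasFDerivAt.comp y (analyticAt_transit he he' hy).differentiableAt.hasFDerivAt
  have h2 : pd a (fun z => f (transit e e' z)) y = fderiv ℝ f (transit e e' y)
      (fderiv ℝ (transit e e') y (EuclideanSpace.single a 1)) := by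
    rw [pd, show (fun z => f (transit e e' z)) = f ∘ transit e e' from rfl, h1.fderiv]; rfl
  rw [h2, plane_eq_sum (fderiv ℝ (transit e e') y (EuclideanSpace.single a 1)), map_sum]
  simp only [map_smul, smul_eq_mul, fderiv_transit_apply he he' hy, pd]

/-- The second derivatives of a change of coordinates. -/
noncomputable def hes (e e' : OpenPartialHomeomorph M Plane) (y : Plane) (i a b : Fin 2) : ℝ :=
  pd b (fun z => jac e e' z i a) y

theorem hes_symm (he : e ∈ atlas Plane M) (he' : e' ∈ atlas Plane M) (hy : y ∈ overlap e e')
    (i a b : Fin 2) : hes e e' y i a b = hes e e' y i b a :=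
  pd_comm (analyticAt_transit_apply he he' hy i)

theorem eventually_overlap (hy : y ∈ overlap e e') : ∀ᶠ z in 𝓝 y, z ∈ overlap e e' :=
  (isOpen_overlap e e').mem_nhds hy

theorem pd_hes_symm (he : e ∈ atlas Plane M) (he' : e' ∈ atlas Plane M) (hy : y ∈ overlap e e')
    (i a b c : Fin 2) :
    pd c (fun z => hes e e' z i a b) y = pd b (fun z => hes e e' z i a c) y :=
  pd_comm (analyticAt_jac he he' hy i a)

theorem differentiableAt_comp_transit (he : e ∈ atlas Plane M) (he' : e' ∈ atlas Plane M)
    (hy : y ∈ overlap e e') {f : Plane → ℝ} (hf : DifferentiableAt ℝ f (transit e e' y)) :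
    DifferentiableAt ℝ (fun z => f (transit e e' z)) y :=
  hf.comp y (analyticAt_transit he he' hy).differentiableAt

theorem isCov1_pd (he : e ∈ atlas Plane M) (he' : e' ∈ atlas Plane M) (hy : y ∈ overlap e e')
    {f f' : Plane → ℝ} (hf : ∀ z ∈ overlap e e', f z = f' (transit e e' z))
    (hf' : DifferentiableAt ℝ f' (transit e e' y)) :
    IsCov1 (jac e e' y) (fun a => pd a f y) fun i => pd i f' (transit e e' y) := fun a => by
  show pd a f y = _
  rw [pd_congr ((eventually_overlap hy).mono hf), pd_comp_transit he he' hy hf']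

/-- The second derivatives of a function. -/
theorem pd_pd_transit (he : e ∈ atlas Plane M) (he' : e' ∈ atlas Plane M) (hy : y ∈ overlap e e')
    {f f' : Plane → ℝ} (hf : ∀ z ∈ overlap e e', f z = f' (transit e e' z))
    (hf' : AnalyticOnNhd ℝ f' (overlap e' e)) (a b : Fin 2) :
    pd a (pd b f) y = ∑ i, ∑ j, jac e e' y i a * jac e e' y j b * pd i (pd j f') (transit e e' y)
      + ∑ i, hes e e' y i a b * pd i f' (transit e e' y) := by
  have h1 : (fun z => pd b f z) =ᶠ[𝓝 y]
      fun z => ∑ i, jac e e' z i b * pd i f' (transit e e' z) := by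
    filter_upwards [eventually_overlap hy] with z hz
    exact isCov1_pd he he' hz hf (hf' _ (transit_mem hz)).differentiableAt b
  have hd : ∀ i, DifferentiableAt ℝ (fun z => pd i f' z) (transit e e' y) := fun i =>
    (analyticAt_pd (hf' _ (transit_mem hy))).differentiableAt
  have hJ : ∀ i, DifferentiableAt ℝ (fun z => jac e e' z i b) y := fun i =>
    (analyticAt_jac he he' hy i b).differentiableAt
  have h2 : pd a (pd b f) y = _ := pd_congr h1
  rw [h2, pd_sum (f := fun i z => jac e e' z i b * pd i f' (transit e e' z))
    fun i => (hJ i).mul (differentiableAt_comp_transit he he' hy (hd i))]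
  have h3 : ∀ i, pd a (fun z => jac e e' z i b * pd i f' (transit e e' z)) y
      = hes e e' y i a b * pd i f' (transit e e' y) + jac e e' y i b
        * ∑ j, jac e e' y j a * pd j (pd i f') (transit e e' y) := by
    intro i
    rw [pd_mul (hJ i) (differentiableAt_comp_transit he he' hy (hd i)),
      pd_comp_transit he he' hy (hd i), hes_symm he he' hy i a b]
    rfl
  simp only [h3, Fin.sum_univ_two]
  ring

theorem jac_jac (he : e ∈ atlas Plane M) (he' : e' ∈ atlas Plane M) (hy : y ∈ overlap e e')
    (a b : Fin 2) :
    ∑ i, jac e e' y a i * jac e' e (transit e e' y) i b = (1 : Matrix (Fin 2) (Fin 2) ℝ) a b := by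
  have h := jac_mul_jac he' he (transit_mem hy) a b
  rwa [transit_transit hy] at h

variable {g g' : Plane → Matrix (Fin 2) (Fin 2) ℝ}

theorem isContra2_inv {J K : Matrix (Fin 2) (Fin 2) ℝ} (hKJ : K * J = 1)
    {G G' : Matrix (Fin 2) (Fin 2) ℝ} (h : IsCov2 J G G') :
    IsContra2 J (G⁻¹ : Matrix (Fin 2) (Fin 2) ℝ) (G'⁻¹ : Matrix (Fin 2) (Fin 2) ℝ) := by
  have hJK : J * K = 1 := mul_eq_one_comm.1 hKJ
  have hG : G = J.transpose * G' * J := by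
    ext a b
    rw [h]
    simp only [Matrix.mul_apply, Matrix.transpose_apply, Fin.sum_univ_two]; ring
  have hJ : J⁻¹ = K := Matrix.inv_eq_right_inv hJK
  have hK : K⁻¹ = J := Matrix.inv_eq_right_inv hKJ
  have hG' : G'⁻¹ = J * G⁻¹ * J.transpose := by
    rw [hG, Matrix.mul_inv_rev, Matrix.mul_inv_rev, ← Matrix.transpose_nonsing_inv, hJ,
      ← Matrix.mul_assoc, ← Matrix.mul_assoc, hJK, Matrix.one_mul, Matrix.mul_assoc,
      ← Matrix.transpose_mul, hJK, Matrix.transpose_one, Matrix.mul_one]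
  intro i j
  rw [hG']
  simp only [Matrix.mul_apply, Matrix.transpose_apply, Fin.sum_univ_two]; ring

theorem isCov2_inv {J K : Matrix (Fin 2) (Fin 2) ℝ} (hKJ : K * J = 1)
    {S S' : Matrix (Fin 2) (Fin 2) ℝ} (h : IsContra2 J S S') :
    IsCov2 J (S⁻¹ : Matrix (Fin 2) (Fin 2) ℝ) (S'⁻¹ : Matrix (Fin 2) (Fin 2) ℝ) := by
  have hJK : J * K = 1 := mul_eq_one_comm.1 hKJ
  have hS : S' = J * S * J.transpose := by
    ext a b
    rw [h]
    simp only [Matrix.mul_apply, Matrix.transpose_apply, Fin.sum_univ_two]; ring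
  have hJ : J⁻¹ = K := Matrix.inv_eq_right_inv hJK
  have hS' : S⁻¹ = J.transpose * S'⁻¹ * J := by
    rw [hS, Matrix.mul_inv_rev, Matrix.mul_inv_rev, ← Matrix.transpose_nonsing_inv, hJ,
      ← Matrix.mul_assoc, ← Matrix.mul_assoc, ← Matrix.transpose_mul, hKJ, Matrix.transpose_one,
      Matrix.one_mul, Matrix.mul_assoc, hKJ, Matrix.mul_one]
  intro i j
  rw [hS']
  simp only [Matrix.mul_apply, Matrix.transpose_apply, Fin.sum_univ_two]; ring

theorem jac_mul_jac_matrix (he : e ∈ atlas Plane M) (he' : e' ∈ atlas Plane M)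
    (hy : y ∈ overlap e e') :
    (Matrix.of (jac e' e (transit e e' y)) * Matrix.of (jac e e' y) : Matrix (Fin 2) (Fin 2) ℝ)
      = 1 := by
  ext a b
  rw [Matrix.mul_apply]
  exact jac_mul_jac he he' hy a b

/-- A Riemannian metric, in the coordinates of both charts. -/
structure IsMetricPair (e e' : OpenPartialHomeomorph M Plane)
    (g g' : Plane → Matrix (Fin 2) (Fin 2) ℝ) : Prop where
  cov : ∀ z ∈ overlap e e', IsCov2 (jac e e' z) (g z) (g' (transit e e' z))
  analytic : ∀ z ∈ overlap e' e, ∀ a b, AnalyticAt ℝ (fun z => g' z a b) z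
  analytic_conn : ∀ z ∈ overlap e e', ∀ c a b, AnalyticAt ℝ (fun z => christoffel g c a b z) z
  analytic_conn' : ∀ z ∈ overlap e' e, ∀ c a b, AnalyticAt ℝ (fun z => christoffel g' c a b z) z
  symm : ∀ z a b, g' z a b = g' z b a
  inv_mul : ∀ z ∈ overlap e' e, (g' z)⁻¹ * g' z = 1

theorem christoffel_symm_of_symm (hs : ∀ z a b, g z a b = g z b a) (c a b : Fin 2) :
    christoffel g c a b y = christoffel g c b a y := by
  simp only [christoffel]
  refine Finset.sum_congr rfl fun d _ => ?_
  have : (fun z => g z a b) = fun z => g z b a := funext fun z => hs z a b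
  rw [this]; ring

/-- The transformation law of the Christoffel symbols. -/
theorem IsMetricPair.isConn (h : IsMetricPair e e' g g') (he : e ∈ atlas Plane M)
    (he' : e' ∈ atlas Plane M) (hy : y ∈ overlap e e') :
    IsConn (jac e e' y) (hes e e' y) (fun c a b => christoffel g c a b y)
      fun c a b => christoffel g' c a b (transit e e' y) := by
  have hy' := transit_mem hy
  have hd : ∀ a b, DifferentiableAt ℝ (fun z => g' z a b) (transit e e' y) := fun a b =>
    (h.analytic _ hy' a b).differentiableAt
  have hdt := fun a b => differentiableAt_comp_transit he he' hy (hd a b)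
  have hJ : ∀ i a, DifferentiableAt ℝ (fun z => jac e e' z i a) y := fun i a =>
    (analyticAt_jac he he' hy i a).differentiableAt
  have hpd : ∀ c a b, pd c (fun z => g z a b) y = ∑ i, ∑ j,
      (hes e e' y i a c * jac e e' y j b * g' (transit e e' y) i j
        + jac e e' y i a * hes e e' y j b c * g' (transit e e' y) i j
        + jac e e' y i a * jac e e' y j b
          * ∑ k, jac e e' y k c * pd k (fun z => g' z i j) (transit e e' y)) := by
    intro c a b
    have h1 : pd c (fun z => g z a b) y = pd c (fun z => ∑ i, ∑ j, jac e e' z i a * jac e e' z j b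
        * g' (transit e e' z) i j) y :=
      pd_congr ((eventually_overlap hy).mono fun z hz => h.cov z hz a b)
    rw [h1, pd_sum (f := fun i z => ∑ j, jac e e' z i a * jac e e' z j b
        * g' (transit e e' z) i j) fun i => by
      simp only [Fin.sum_univ_two]
      exact (((hJ _ _).mul (hJ _ _)).mul (hdt _ _)).add (((hJ _ _).mul (hJ _ _)).mul (hdt _ _))]
    refine Finset.sum_congr rfl fun i _ => ?_
    rw [pd_sum (f := fun j z => jac e e' z i a * jac e e' z j b * g' (transit e e' z) i j)
      fun j => ((hJ _ _).mul (hJ _ _)).mul (hdt _ _)]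
    refine Finset.sum_congr rfl fun j _ => ?_
    rw [pd_mul (f := fun z => jac e e' z i a * jac e e' z j b) ((hJ _ _).mul (hJ _ _)) (hdt _ _),
      pd_mul (hJ _ _) (hJ _ _), pd_comp_transit he he' hy (hd i j)]
    simp only [hes]
    ring
  have hcon := isContra2_inv (jac_mul_jac_matrix he he' hy) (h.cov y hy)
  have hinv := fun i j => congrFun (congrFun (h.inv_mul _ hy') i) j
  have hs := fun a b => h.symm (transit e e' y) a b
  have hsp : ∀ k, pd k (fun z => g' z 1 0) (transit e e' y)
      = pd k (fun z => g' z 0 1) (transit e e' y) := fun k => by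
    rw [show (fun z => g' z 1 0) = fun z => g' z 0 1 from funext fun z => h.symm z 1 0]
  intro i a b
  -- The Christoffel symbols with the index lowered.
  have hlow : ∀ d, pd a (fun z => g z b d) y + pd b (fun z => g z a d) y
      - pd d (fun z => g z a b) y = ∑ m, jac e e' y m d * (∑ k, ∑ l, jac e e' y k a
        * jac e e' y l b * (pd k (fun z => g' z l m) (transit e e' y)
          + pd l (fun z => g' z k m) (transit e e' y) - pd m (fun z => g' z k l) (transit e e' y))
        + 2 * ∑ j, g' (transit e e' y) m j * hes e e' y j a b) := by
    intro d
    rw [hpd, hpd, hpd]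
    have s1 := fun i => hes_symm he he' hy i b a
    have s2 := fun i => hes_symm he he' hy i d a
    have s3 := fun i => hes_symm he he' hy i d b
    have s4 := hs 1 0
    simp only [Fin.sum_univ_two, s1, s2, s3, s4, hsp]
    ring
  have hcon' : ∀ m, ∑ c, ∑ d, jac e e' y i c * jac e e' y m d * (g y)⁻¹ c d
      = (g' (transit e e' y))⁻¹ i m := fun m => (hcon i m).symm
  set X : Fin 2 → ℝ := fun m => ∑ k, ∑ l, jac e e' y k a
        * jac e e' y l b * (pd k (fun z => g' z l m) (transit e e' y)
          + pd l (fun z => g' z k m) (transit e e' y) - pd m (fun z => g' z k l) (transit e e' y))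
    with hX
  have h1 : ∑ c, jac e e' y i c * christoffel g c a b y
      = ∑ m, (1 / 2) * (g' (transit e e' y))⁻¹ i m * (X m
        + 2 * ∑ j, g' (transit e e' y) m j * hes e e' y j a b) := by
    simp only [hX, christoffel, hlow, ← hcon', Fin.sum_univ_two]
    ring
  have h2 : ∑ k, ∑ l, jac e e' y k a * jac e e' y l b * christoffel g' i k l (transit e e' y)
      = ∑ m, (1 / 2) * (g' (transit e e' y))⁻¹ i m * X m := by
    simp only [hX, christoffel, Fin.sum_univ_two]
    ring
  have h3 : ∑ m, (g' (transit e e' y))⁻¹ i m * ∑ j, g' (transit e e' y) m j * hes e e' y j a b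
      = hes e e' y i a b := by
    have e0 := hinv i 0
    have e1 := hinv i 1
    simp only [Matrix.mul_apply, Fin.sum_univ_two] at e0 e1 ⊢
    have : hes e e' y i a b = (1 : Matrix (Fin 2) (Fin 2) ℝ) i 0 * hes e e' y 0 a b
        + (1 : Matrix (Fin 2) (Fin 2) ℝ) i 1 * hes e e' y 1 a b := by
      revert i; simp [Fin.forall_fin_two]
    rw [this, ← e0, ← e1]
    ring
  show ∑ c, jac e e' y i c * christoffel g c a b y = _
  rw [h1, h2]
  simp only [Fin.sum_univ_two] at h3 ⊢
  linear_combination h3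

end Coordinates

section Curvature

variable {M : Type*} [TopologicalSpace M] [ChartedSpace Plane M] [IsManifold 𝓘(ℝ, Plane) ω M]
  {e e' : OpenPartialHomeomorph M Plane} {y : Plane} {g g' : Plane → Matrix (Fin 2) (Fin 2) ℝ}

/-- The Riemann tensor `R^e_{acb}`, indexed as the summands of the Ricci curvature. -/
noncomputable def riem (g : Plane → Matrix (Fin 2) (Fin 2) ℝ) (y : Plane) (c e a b : Fin 2) : ℝ :=
  pd c (christoffel g e a b) y - pd b (christoffel g e a c) y
    + ∑ d, christoffel g e c d y * christoffel g d a b y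
    - ∑ d, christoffel g e b d y * christoffel g d a c y

theorem ricci_eq_sum_riem (a b : Fin 2) : ricci g a b y = ∑ c, riem g y c c a b := by
  simp only [ricci, riem, Finset.sum_sub_distrib, Finset.sum_add_distrib]

/-- The derivative of the transformation law of the Christoffel symbols. -/
theorem IsMetricPair.pd_isConn (h : IsMetricPair e e' g g') (he : e ∈ atlas Plane M)
    (he' : e' ∈ atlas Plane M) (hy : y ∈ overlap e e') (i a b c : Fin 2) :
    ∑ f, (hes e e' y i f c * christoffel g f a b y + jac e e' y i f * pd c (christoffel g f a b) y)
      = ∑ k, ∑ l, (hes e e' y k a c * jac e e' y l b * christoffel g' i k l (transit e e' y)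
        + jac e e' y k a * hes e e' y l b c * christoffel g' i k l (transit e e' y)
        + jac e e' y k a * jac e e' y l b
          * ∑ n, jac e e' y n c * pd n (christoffel g' i k l) (transit e e' y))
        + pd c (fun z => hes e e' z i a b) y := by
  have hy' := transit_mem hy
  have hd : ∀ i k l, DifferentiableAt ℝ (christoffel g' i k l) (transit e e' y) := fun i k l =>
    (h.analytic_conn' _ hy' i k l).differentiableAt
  have hdt := fun i k l => differentiableAt_comp_transit he he' hy (hd i k l)
  have hJ : ∀ i a, DifferentiableAt ℝ (fun z => jac e e' z i a) y := fun i a =>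
    (analyticAt_jac he he' hy i a).differentiableAt
  have hH : DifferentiableAt ℝ (fun z => hes e e' z i a b) y :=
    (analyticAt_pd (analyticAt_jac he he' hy i a)).differentiableAt
  have hΓ : ∀ f, DifferentiableAt ℝ (christoffel g f a b) y := fun f =>
    (h.analytic_conn _ hy f a b).differentiableAt
  have hlaw : pd c (fun z => ∑ f, jac e e' z i f * christoffel g f a b z) y
      = pd c (fun z => (∑ k, ∑ l, jac e e' z k a * jac e e' z l b
        * christoffel g' i k l (transit e e' z)) + hes e e' z i a b) y :=
    pd_congr ((eventually_overlap hy).mono fun z hz => h.isConn he he' hz i a b)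
  have hterm : ∀ k l, DifferentiableAt ℝ (fun z => jac e e' z k a * jac e e' z l b
      * christoffel g' i k l (transit e e' z)) y := fun k l =>
    ((hJ _ _).mul (hJ _ _)).mul (hdt _ _ _)
  have hsum : ∀ k, DifferentiableAt ℝ (fun z => ∑ l, jac e e' z k a * jac e e' z l b
      * christoffel g' i k l (transit e e' z)) y := fun k => by
    simp only [Fin.sum_univ_two]; exact (hterm _ _).add (hterm _ _)
  rw [pd_sum (f := fun f z => jac e e' z i f * christoffel g f a b z)
      fun f => (hJ _ _).mul (hΓ _),
    pd_add (f := fun z => ∑ k, ∑ l, jac e e' z k a * jac e e' z l b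
        * christoffel g' i k l (transit e e' z)) (by
      simp only [Fin.sum_univ_two] at hsum ⊢; exact (hsum 0).add (hsum 1)) hH,
    pd_sum (f := fun k z => ∑ l, jac e e' z k a * jac e e' z l b
        * christoffel g' i k l (transit e e' z)) hsum] at hlaw
  have h1 : ∀ f, pd c (fun z => jac e e' z i f * christoffel g f a b z) y
      = hes e e' y i f c * christoffel g f a b y
        + jac e e' y i f * pd c (christoffel g f a b) y := fun f => pd_mul (hJ _ _) (hΓ _)
  have h2 : ∀ k, pd c (fun z => ∑ l, jac e e' z k a * jac e e' z l b
        * christoffel g' i k l (transit e e' z)) y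
      = ∑ l, (hes e e' y k a c * jac e e' y l b * christoffel g' i k l (transit e e' y)
        + jac e e' y k a * hes e e' y l b c * christoffel g' i k l (transit e e' y)
        + jac e e' y k a * jac e e' y l b
          * ∑ n, jac e e' y n c * pd n (christoffel g' i k l) (transit e e' y)) := by
    intro k
    rw [pd_sum (f := fun l z => jac e e' z k a * jac e e' z l b
        * christoffel g' i k l (transit e e' z)) (hterm k)]
    refine Finset.sum_congr rfl fun l _ => ?_
    rw [pd_mul (f := fun z => jac e e' z k a * jac e e' z l b) ((hJ _ _).mul (hJ _ _)) (hdt _ _ _),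
      pd_mul (hJ _ _) (hJ _ _), pd_comp_transit he he' hy (hd i k l)]
    simp only [hes]
    ring
  simpa only [h1, h2] using hlaw

theorem IsMetricPair.isMixed31_riem (h : IsMetricPair e e' g g') (hs : ∀ z a b, g z a b = g z b a)
    (he : e ∈ atlas Plane M) (he' : e' ∈ atlas Plane M) (hy : y ∈ overlap e e') :
    IsMixed31 (jac e e' y) (riem g y) (riem g' (transit e e' y)) := by
  intro i c a b
  have h1 := h.pd_isConn he he' hy i a b c
  have h2 := h.pd_isConn he he' hy i a c b
  have hH := pd_hes_symm he he' hy i a b c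
  have s1 : ∀ k a b, hes e e' y k a b = hes e e' y k b a := hes_symm he he' hy
  have s2 : ∀ k a b, christoffel g k a b y = christoffel g k b a y := fun k a b =>
    christoffel_symm_of_symm hs k a b
  have s3 : ∀ k, christoffel g' k 1 0 (transit e e' y) = christoffel g' k 0 1 (transit e e' y) :=
    fun k => christoffel_symm_of_symm h.symm k 1 0
  have hc : ∀ i a b, ∑ c, jac e e' y i c * christoffel g c a b y = ∑ k, ∑ l, jac e e' y k a
      * jac e e' y l b * christoffel g' i k l (transit e e' y) + hes e e' y i a b :=
    h.isConn he he' hy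
  have t1 := hc i c 0
  have t2 := hc i c 1
  have t3 := hc i b 0
  have t4 := hc i b 1
  have t5 := hc 0 a b
  have t6 := hc 1 a b
  have t7 := hc 0 a c
  have t8 := hc 1 a c
  rw [hH] at h1
  simp only [riem, Fin.sum_univ_two, s1 _ 0 c, s1 _ 1 c, s1 _ 0 b, s1 _ 1 b, s1 _ b c] at *
  simp only [s3] at *
  generalize christoffel g' = Γ' at *
  generalize pd b (fun z => hes e e' z i a c) y = X at *
  linear_combination h1 - h2 + christoffel g 0 a b y * t1 + christoffel g 1 a b y * t2
    - christoffel g 0 a c y * t3 - christoffel g 1 a c y * t4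
    + (jac e e' y 0 c * Γ' i 0 0 (transit e e' y) + jac e e' y 1 c * Γ' i 0 1 (transit e e' y)) * t5
    + (jac e e' y 0 c * Γ' i 0 1 (transit e e' y) + jac e e' y 1 c * Γ' i 1 1 (transit e e' y)) * t6
    - (jac e e' y 0 b * Γ' i 0 0 (transit e e' y) + jac e e' y 1 b * Γ' i 0 1 (transit e e' y)) * t7
    - (jac e e' y 0 b * Γ' i 0 1 (transit e e' y) + jac e e' y 1 b * Γ' i 1 1 (transit e e' y)) * t8

theorem IsMetricPair.isCov2_ricci (h : IsMetricPair e e' g g') (hs : ∀ z a b, g z a b = g z b a)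
    (he : e ∈ atlas Plane M) (he' : e' ∈ atlas Plane M) (hy : y ∈ overlap e e') :
    IsCov2 (jac e e' y) (fun a b => ricci g a b y) fun a b => ricci g' a b (transit e e' y) := by
  simp only [ricci_eq_sum_riem]
  exact isCov2_trace31 (jac_mul_jac he he' hy) (h.isMixed31_riem hs he he' hy)

theorem IsMetricPair.isMixed12_covUp (h : IsMetricPair e e' g g') (he : e ∈ atlas Plane M)
    (he' : e' ∈ atlas Plane M) (hy : y ∈ overlap e e') {S S' : Plane → Fin 2 → Fin 2 → ℝ}
    (hS : ∀ᶠ z in 𝓝 y, IsContra2 (jac e e' z) (S z) (S' (transit e e' z)))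
    (hd : ∀ a b, DifferentiableAt ℝ (fun z => S z a b) y)
    (hd' : ∀ a b, DifferentiableAt ℝ (fun z => S' z a b) (transit e e' y)) :
    IsMixed12 (jac e e' y) (fun c a b => covUp g S c a b y)
      fun c a b => covUp g' S' c a b (transit e e' y) := by
  intro c i j
  have hJ : ∀ i a, DifferentiableAt ℝ (fun z => jac e e' z i a) y := fun i a =>
    (analyticAt_jac he he' hy i a).differentiableAt
  have hterm : ∀ a b, DifferentiableAt ℝ (fun z => jac e e' z i a * jac e e' z j b * S z a b) y :=
    fun a b => ((hJ _ _).mul (hJ _ _)).mul (hd _ _)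
  have h1 : ∑ k, jac e e' y k c * pd k (fun z => S' z i j) (transit e e' y)
      = ∑ a, ∑ b, (hes e e' y i a c * jac e e' y j b * S y a b
        + jac e e' y i a * hes e e' y j b c * S y a b
        + jac e e' y i a * jac e e' y j b * pd c (fun z => S z a b) y) := by
    rw [← pd_comp_transit he he' hy (hd' i j), pd_congr (hS.mono fun z hz => hz i j),
      pd_sum (f := fun a z => ∑ b, jac e e' z i a * jac e e' z j b * S z a b) fun a => by
        simp only [Fin.sum_univ_two]; exact (hterm _ _).add (hterm _ _)]
    refine Finset.sum_congr rfl fun a _ => ?_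
    rw [pd_sum (f := fun b z => jac e e' z i a * jac e e' z j b * S z a b) (hterm a)]
    refine Finset.sum_congr rfl fun b _ => ?_
    rw [pd_mul (f := fun z => jac e e' z i a * jac e e' z j b) ((hJ _ _).mul (hJ _ _)) (hd _ _),
      pd_mul (hJ _ _) (hJ _ _)]
    simp only [hes]
    ring
  have hc : ∀ i a b, ∑ c, jac e e' y i c * christoffel g c a b y = ∑ k, ∑ l, jac e e' y k a
      * jac e e' y l b * christoffel g' i k l (transit e e' y) + hes e e' y i a b :=
    h.isConn he he' hy
  have h2 : ∀ a b, S' (transit e e' y) a b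
      = ∑ d, ∑ f, jac e e' y a d * jac e e' y b f * S y d f := hS.self_of_nhds
  have s1 := fun k a => hes_symm he he' hy k a c
  have t1 := hc i c 0
  have t2 := hc i c 1
  have t3 := hc j c 0
  have t4 := hc j c 1
  simp only [covUp, h2, s1, Fin.sum_univ_two] at *
  linear_combination -h1 + (jac e e' y j 0 * S y 0 0 + jac e e' y j 1 * S y 0 1) * t1
    + (jac e e' y j 0 * S y 1 0 + jac e e' y j 1 * S y 1 1) * t2
    + (jac e e' y i 0 * S y 0 0 + jac e e' y i 1 * S y 1 0) * t3
    + (jac e e' y i 0 * S y 0 1 + jac e e' y i 1 * S y 1 1) * t4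

/-- Tensoriality of the covariant derivative: the second derivatives of the transition map cancel
against the inhomogeneous terms of the Christoffel symbols. -/
theorem IsMetricPair.isMixed22_covMixed (h : IsMetricPair e e' g g') (he : e ∈ atlas Plane M)
    (he' : e' ∈ atlas Plane M) (hy : y ∈ overlap e e') {P P' : Plane → Fin 2 → Fin 2 → Fin 2 → ℝ}
    (hP : ∀ᶠ z in 𝓝 y, IsMixed12 (jac e e' z) (P z) (P' (transit e e' z)))
    (hd : ∀ c a b, DifferentiableAt ℝ (fun z => P z c a b) y)
    (hd' : ∀ c a b, DifferentiableAt ℝ (fun z => P' z c a b) (transit e e' y)) :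
    IsMixed22 (jac e e' y) (fun d c a b => covMixed g P d c a b y)
      fun d c a b => covMixed g' P' d c a b (transit e e' y) := by
  intro d c i j
  have hJ : ∀ i a, DifferentiableAt ℝ (fun z => jac e e' z i a) y := fun i a =>
    (analyticAt_jac he he' hy i a).differentiableAt
  have hterm : ∀ a b, DifferentiableAt ℝ (fun z => jac e e' z i a * jac e e' z j b * P z c a b) y :=
    fun a b => ((hJ _ _).mul (hJ _ _)).mul (hd _ _ _)
  have hdt := fun c a b => differentiableAt_comp_transit he he' hy (hd' c a b)
  have h1 : ∑ k, (hes e e' y k c d * P' (transit e e' y) k i j + jac e e' y k c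
        * ∑ l, jac e e' y l d * pd l (fun z => P' z k i j) (transit e e' y))
      = ∑ a, ∑ b, (hes e e' y i a d * jac e e' y j b * P y c a b
        + jac e e' y i a * hes e e' y j b d * P y c a b
        + jac e e' y i a * jac e e' y j b * pd d (fun z => P z c a b) y) := by
    have e1 : ∀ k, hes e e' y k c d * P' (transit e e' y) k i j + jac e e' y k c
        * ∑ l, jac e e' y l d * pd l (fun z => P' z k i j) (transit e e' y)
        = pd d (fun z => jac e e' z k c * P' (transit e e' z) k i j) y := by
      intro k
      rw [pd_mul (hJ _ _) (hdt _ _ _), ← pd_comp_transit he he' hy (hd' k i j)]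
      rfl
    simp only [e1]
    rw [← pd_sum (f := fun k z => jac e e' z k c * P' (transit e e' z) k i j)
        fun k => (hJ _ _).mul (hdt _ _ _), pd_congr (hP.mono fun z hz => (hz c i j).symm),
      pd_sum (f := fun a z => ∑ b, jac e e' z i a * jac e e' z j b * P z c a b) fun a => by
        simp only [Fin.sum_univ_two]; exact (hterm _ _).add (hterm _ _)]
    refine Finset.sum_congr rfl fun a _ => ?_
    rw [pd_sum (f := fun b z => jac e e' z i a * jac e e' z j b * P z c a b) (hterm a)]
    refine Finset.sum_congr rfl fun b _ => ?_
    rw [pd_mul (f := fun z => jac e e' z i a * jac e e' z j b) ((hJ _ _).mul (hJ _ _)) (hd _ _ _),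
      pd_mul (hJ _ _) (hJ _ _)]
    simp only [hes]
    ring
  have hc : ∀ i a b, ∑ c, jac e e' y i c * christoffel g c a b y = ∑ k, ∑ l, jac e e' y k a
      * jac e e' y l b * christoffel g' i k l (transit e e' y) + hes e e' y i a b :=
    h.isConn he he' hy
  have h2 : ∀ c i j, ∑ a, ∑ b, jac e e' y i a * jac e e' y j b * P y c a b
      = ∑ k, jac e e' y k c * P' (transit e e' y) k i j := hP.self_of_nhds
  have s1 := fun k a => hes_symm he he' hy k a d
  -- Contraction of the connection coefficients with the upper indices.
  have u1 : ∑ a, ∑ b, jac e e' y i a * jac e e' y j b * ∑ m, christoffel g a d m y * P y c m b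
      = ∑ l, ∑ k, jac e e' y l d * jac e e' y k c
          * ∑ m, christoffel g' i l m (transit e e' y) * P' (transit e e' y) k m j
        + ∑ m, ∑ b, hes e e' y i d m * jac e e' y j b * P y c m b := by
    have t1 := hc i d 0
    have t2 := hc i d 1
    have t3 := h2 c 0 j
    have t4 := h2 c 1 j
    simp only [Fin.sum_univ_two] at *
    linear_combination (jac e e' y j 0 * P y c 0 0 + jac e e' y j 1 * P y c 0 1) * t1
      + (jac e e' y j 0 * P y c 1 0 + jac e e' y j 1 * P y c 1 1) * t2
      + (jac e e' y 0 d * christoffel g' i 0 0 (transit e e' y)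
        + jac e e' y 1 d * christoffel g' i 1 0 (transit e e' y)) * t3
      + (jac e e' y 0 d * christoffel g' i 0 1 (transit e e' y)
        + jac e e' y 1 d * christoffel g' i 1 1 (transit e e' y)) * t4
  have u2 : ∑ a, ∑ b, jac e e' y i a * jac e e' y j b * ∑ m, christoffel g b d m y * P y c a m
      = ∑ l, ∑ k, jac e e' y l d * jac e e' y k c
          * ∑ m, christoffel g' j l m (transit e e' y) * P' (transit e e' y) k i m
        + ∑ m, ∑ a, hes e e' y j d m * jac e e' y i a * P y c a m := by
    have t1 := hc j d 0
    have t2 := hc j d 1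
    have t3 := h2 c i 0
    have t4 := h2 c i 1
    simp only [Fin.sum_univ_two] at *
    linear_combination (jac e e' y i 0 * P y c 0 0 + jac e e' y i 1 * P y c 1 0) * t1
      + (jac e e' y i 0 * P y c 0 1 + jac e e' y i 1 * P y c 1 1) * t2
      + (jac e e' y 0 d * christoffel g' j 0 0 (transit e e' y)
        + jac e e' y 1 d * christoffel g' j 1 0 (transit e e' y)) * t3
      + (jac e e' y 0 d * christoffel g' j 0 1 (transit e e' y)
        + jac e e' y 1 d * christoffel g' j 1 1 (transit e e' y)) * t4
  have u3 : ∑ a, ∑ b, jac e e' y i a * jac e e' y j b * ∑ m, christoffel g m d c y * P y m a b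
      = ∑ l, ∑ k, jac e e' y l d * jac e e' y k c
          * ∑ m, christoffel g' m l k (transit e e' y) * P' (transit e e' y) m i j
        + ∑ m, hes e e' y m d c * P' (transit e e' y) m i j := by
    have t1 := hc 0 d c
    have t2 := hc 1 d c
    have t3 := h2 0 i j
    have t4 := h2 1 i j
    simp only [Fin.sum_univ_two] at *
    linear_combination P' (transit e e' y) 0 i j * t1 + P' (transit e e' y) 1 i j * t2
      + christoffel g 0 d c y * t3 + christoffel g 1 d c y * t4
  simp only [covMixed, s1, Fin.sum_univ_two] at *
  linear_combination -h1 + u1 + u2 - u3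

end Curvature

/-! ### The system under a change of coordinates -/

section Algebra

variable {J K : Fin 2 → Fin 2 → ℝ}

theorem sum_mul_one (f : Fin 2 → ℝ) (b : Fin 2) :
    ∑ c, f c * (1 : Matrix (Fin 2) (Fin 2) ℝ) c b = f b := by
  revert b; simp [Fin.forall_fin_two]

theorem sum_mul_one' (f : Fin 2 → ℝ) (b : Fin 2) :
    ∑ c, f c * (1 : Matrix (Fin 2) (Fin 2) ℝ) b c = f b := by
  revert b; simp [Fin.forall_fin_two]

theorem IsContra2.raise2 {S S' Z Z' : Fin 2 → Fin 2 → ℝ} (hS : IsContra2 J S S')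
    (hZ : IsCov2 J Z Z') :
    IsMixed11 J (fun a b => ∑ m, S b m * Z a m) fun a b => ∑ m, S' b m * Z' a m := fun a i => by
  simp only [hZ _ _, hS _ _, Fin.sum_univ_two]; ring

theorem IsContra2.mul_mixed {S S' F F' : Fin 2 → Fin 2 → ℝ} (hS : IsContra2 J S S')
    (hF : IsMixed11 J F F') :
    IsContra2 J (fun a b => ∑ m, S a m * F m b) fun a b => ∑ m, S' a m * F' m b := fun i j => by
  have h0 := hF 0 j
  have h1 := hF 1 j
  simp only [hS _ _, Fin.sum_univ_two] at *
  linear_combination -(J i 0 * S 0 0 + J i 1 * S 1 0) * h0 - (J i 0 * S 0 1 + J i 1 * S 1 1) * h1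

theorem IsCov1.mul {X X' Y Y' : Fin 2 → ℝ} (hX : IsCov1 J X X') (hY : IsCov1 J Y Y') :
    IsCov2 J (fun a b => X a * Y b) fun a b => X' a * Y' b := fun a b => by
  simp only [hX _, hY _, Fin.sum_univ_two]; ring

theorem IsCov2.swap {X X' : Fin 2 → Fin 2 → ℝ} (hX : IsCov2 J X X') :
    IsCov2 J (fun a b => X b a) fun a b => X' b a := fun a b => by
  simp only [hX _ _, Fin.sum_univ_two]; ring

/-- The covariant derivative of a covector. -/
theorem IsConn.isCov2_cov {H Γ Γ' : Fin 2 → Fin 2 → Fin 2 → ℝ} (hΓ : IsConn J H Γ Γ')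
    {X X' : Fin 2 → ℝ} (hX : IsCov1 J X X') {Y Y' : Fin 2 → Fin 2 → ℝ}
    (hY : ∀ a b, Y a b = ∑ i, ∑ j, J i a * J j b * Y' i j + ∑ i, H i a b * X' i) :
    IsCov2 J (fun a b => Y a b - ∑ c, Γ c a b * X c) fun a b => Y' a b - ∑ c, Γ' c a b * X' c :=
  fun a b => by
    have h0 := hΓ 0 a b
    have h1 := hΓ 1 a b
    simp only [hX _, hY, Fin.sum_univ_two] at *
    linear_combination -X' 0 * h0 - X' 1 * h1

theorem IsConn.add_mixed {H Γ Γ' C C' : Fin 2 → Fin 2 → Fin 2 → ℝ} (hΓ : IsConn J H Γ Γ')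
    (hC : IsMixed21 J C C') :
    IsConn J H (fun c a b => Γ c a b + C c a b) fun c a b => Γ' c a b + C' c a b := fun i a b => by
  have h1 := hΓ i a b
  have h2 := hC i a b
  simp only [Fin.sum_univ_two] at *
  linear_combination h1 + h2

/-- The difference of the Christoffel symbols of two conformal metrics. -/
theorem isMixed21_conformal {S S' B B' : Fin 2 → Fin 2 → ℝ} (hS : IsContra2 J S S')
    (hB : IsCov2 J B B') {X X' : Fin 2 → ℝ} (hX : IsCov1 J X X') :
    IsMixed21 J (fun c a b => (1 / 2) * ((1 : Matrix (Fin 2) (Fin 2) ℝ) c b * X a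
        + (1 : Matrix (Fin 2) (Fin 2) ℝ) c a * X b - ∑ d, S c d * B a b * X d))
      fun c a b => (1 / 2) * ((1 : Matrix (Fin 2) (Fin 2) ℝ) c b * X' a
        + (1 : Matrix (Fin 2) (Fin 2) ℝ) c a * X' b - ∑ d, S' c d * B' a b * X' d) := by
  intro i a b
  have h1 : ∀ b, J i 0 * (1 : Matrix (Fin 2) (Fin 2) ℝ) 0 b
      + J i 1 * (1 : Matrix (Fin 2) (Fin 2) ℝ) 1 b = J i b := fun b => by
    simpa [Fin.sum_univ_two] using sum_mul_one (fun c => J i c) b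
  have h2 : ∀ b, J 0 b * (1 : Matrix (Fin 2) (Fin 2) ℝ) i 0
      + J 1 b * (1 : Matrix (Fin 2) (Fin 2) ℝ) i 1 = J i b := fun b => by
    simpa [Fin.sum_univ_two] using sum_mul_one' (fun c => J c b) i
  have e1 := h1 a
  have e2 := h1 b
  have e3 := h2 a
  have e4 := h2 b
  simp only [hX _, hB _ _, hS _ _, Fin.sum_univ_two] at *
  linear_combination (1 / 2) * (J 0 a * X' 0 + J 1 a * X' 1) * (e2 - e4)
    + (1 / 2) * (J 0 b * X' 0 + J 1 b * X' 1) * (e1 - e3)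

theorem isMixed11_one (s : ℝ) :
    IsMixed11 J (fun a b => (1 / 2) * (1 : Matrix (Fin 2) (Fin 2) ℝ) a b * s)
      fun a b => (1 / 2) * (1 : Matrix (Fin 2) (Fin 2) ℝ) a b * s := by
  intro a i
  have h1 := sum_mul_one' (fun c => J i c) a
  have h2 := sum_mul_one (fun c => J c a) i
  simp only [Fin.sum_univ_two] at *
  linear_combination (1 / 2) * s * (h1 - h2)

end Algebra

section Covariance

variable {M : Type*} [TopologicalSpace M] [ChartedSpace Plane M] [IsManifold 𝓘(ℝ, Plane) ω M]
  {A : AsymptoticData M} {ε : Exponents} {U : Fields M}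
  {e e' : OpenPartialHomeomorph M Plane} {t : ℝ} {y : Plane}

theorem isMetricPair_sigLow (A : AsymptoticData M) (he : e ∈ atlas Plane M)
    (he' : e' ∈ atlas Plane M) : IsMetricPair e e' (A.sigLow e) (A.sigLow e') where
  cov _ hz := sigLow_transit A he he' hz
  analytic _ hz := analyticAt_sigLow A he' hz.1
  analytic_conn _ hz := (analyticIn_chart A he hz.1).christoffel
  analytic_conn' _ hz := (analyticIn_chart A he' hz.1).christoffel
  symm := sigLow_symm A e'
  inv_mul _ hz := Matrix.nonsing_inv_mul _
    (isUnit_iff_ne_zero.2 (sigLow_posDef A he' hz.1).det_pos.ne')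

section Pointwise

variable (he : e ∈ atlas Plane M) (he' : e' ∈ atlas Plane M) (hy : y ∈ overlap e e')
include he he' hy

theorem isContra2_comp_sig (U : Fields M) (t : ℝ) :
    IsContra2 (jac e e' y) (fun a b => U.comp e t y (.sig a b))
      fun i j => U.comp e' t (transit e e' y) (.sig i j) := by
  have h := (comp_transit he' he (transit_mem hy) U t).1
  rwa [transit_transit hy] at h

theorem isMixed11_comp_k (U : Fields M) (t : ℝ) :
    IsMixed11 (jac e e' y) (fun a b => U.comp e t y (.k a b))
      fun i j => U.comp e' t (transit e e' y) (.k i j) := by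
  intro a i
  have h := (comp_transit he he' hy U t).2.2.1
  have hJ := jac_jac he he' hy i
  have h0 := hJ 0
  have h1 := hJ 1
  have k := sum_mul_one' (fun j => ∑ k, jac e e' y k a * U.comp e' t (transit e e' y) (.k k j)) i
  simp only [h, Fin.sum_univ_two] at *
  linear_combination k
    + (jac e e' y 0 a * U.comp e' t (transit e e' y) (.k 0 0)
      + jac e e' y 1 a * U.comp e' t (transit e e' y) (.k 1 0)) * h0
    + (jac e e' y 0 a * U.comp e' t (transit e e' y) (.k 0 1)
      + jac e e' y 1 a * U.comp e' t (transit e e' y) (.k 1 1)) * h1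

theorem isMixed12_comp_sigc (U : Fields M) (t : ℝ) :
    IsMixed12 (jac e e' y) (fun c a b => U.comp e t y (.sigc c a b))
      fun c i j => U.comp e' t (transit e e' y) (.sigc c i j) := by
  intro c i j
  have h := (comp_transit he he' hy U t).2.2.2.2.1 c
  have k : ∀ f : Fin 2 → Fin 2 → ℝ, ∑ a, ∑ b, jac e e' y i a * jac e e' y j b
      * (∑ m, ∑ n, jac e' e (transit e e' y) a m * jac e' e (transit e e' y) b n * f m n)
      = f i j := by
    intro f
    have e1 : ∀ m, jac e e' y i 0 * jac e' e (transit e e' y) 0 m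
        + jac e e' y i 1 * jac e' e (transit e e' y) 1 m = (1 : Matrix (Fin 2) (Fin 2) ℝ) i m := by
      simpa only [Fin.sum_univ_two] using jac_jac he he' hy i
    have e2 : ∀ m, jac e e' y j 0 * jac e' e (transit e e' y) 0 m
        + jac e e' y j 1 * jac e' e (transit e e' y) 1 m = (1 : Matrix (Fin 2) (Fin 2) ℝ) j m := by
      simpa only [Fin.sum_univ_two] using jac_jac he he' hy j
    have e3 : f i j = ∑ m, ∑ n, (1 : Matrix (Fin 2) (Fin 2) ℝ) i m
        * (1 : Matrix (Fin 2) (Fin 2) ℝ) j n * f m n := by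
      revert i j
      simp [Fin.forall_fin_two]
    rw [e3]
    simp only [← e1, ← e2, Fin.sum_univ_two]
    ring
  have k' := k fun m n => ∑ l, jac e e' y l c * U.comp e' t (transit e e' y) (.sigc l m n)
  simp only
  rw [← k']
  simp only [h, Fin.sum_univ_two]
  ring

theorem isCov1_comp_phic (U : Fields M) (t : ℝ) :
    IsCov1 (jac e e' y) (fun c => U.comp e t y (.phic c))
      fun c => U.comp e' t (transit e e' y) (.phic c) :=
  (comp_transit he he' hy U t).2.2.2.2.2

theorem comp_phi_transit (U : Fields M) (t : ℝ) :
    U.comp e t y .phi = U.comp e' t (transit e e' y) .phi :=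
  (comp_transit he he' hy U t).2.1

theorem comp_p_transit (U : Fields M) (t : ℝ) :
    U.comp e t y .p = U.comp e' t (transit e e' y) .p :=
  (comp_transit he he' hy U t).2.2.2.1

theorem isContra2_sigUp (A : AsymptoticData M) :
    IsContra2 (jac e e' y) (A.sigUp e y) (A.sigUp e' (transit e e' y)) :=
  isContra2_inv (jac_mul_jac_matrix he he' hy) ((isMetricPair_sigLow A he he').cov y hy)

theorem isContra2_sigma : IsContra2 (jac e e' y) (sigma A ε U e t y)
    (sigma A ε U e' t (transit e e' y)) := by
  intro i j
  have h1 := isContra2_sigUp he he' hy A i j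
  have h2 := isContra2_comp_sig he he' hy U t i j
  simp only [sigma, Matrix.of_apply, Fin.sum_univ_two] at *
  linear_combination h1 + Real.exp (-ε.sig * t) * h2

theorem isMixed12_sigmaC : IsMixed12 (jac e e' y) (sigmaC ε U e t y)
    (sigmaC ε U e' t (transit e e' y)) := by
  intro c i j
  have h := isMixed12_comp_sigc he he' hy U t c i j
  simp only [sigmaC, Fin.sum_univ_two] at *
  linear_combination Real.exp (-ε.sigc * t) * h

theorem isContra2_sigK : IsContra2 (jac e e' y) (sigK A ε U e t y)
    (sigK A ε U e' t (transit e e' y)) :=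
  (isContra2_sigma he he' hy).mul_mixed (isMixed11_comp_k he he' hy U t)

theorem trk_transit : U.trk e t y = U.trk e' t (transit e e' y) :=
  trace_eq_of_mixed (jac_mul_jac he he' hy) (isMixed11_comp_k he he' hy U t)

theorem isCov2_sigma_inv : IsCov2 (jac e e' y)
    ((sigma A ε U e t y)⁻¹ : Matrix (Fin 2) (Fin 2) ℝ)
    ((sigma A ε U e' t (transit e e' y))⁻¹ : Matrix (Fin 2) (Fin 2) ℝ) :=
  isCov2_inv (jac_mul_jac_matrix he he' hy) (isContra2_sigma he he' hy)

theorem isConn_gammaSigma : IsConn (jac e e' y) (hes e e' y) (gammaSigma A ε U e t y)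
    (gammaSigma A ε U e' t (transit e e' y)) :=
  ((isMetricPair_sigLow A he he').isConn he he' hy).add_mixed
    (isMixed21_diffCG (isContra2_sigma he he' hy) (isCov2_sigma_inv he he' hy)
      (isMixed12_sigmaC he he' hy))

theorem lamAt_transit : A.lamAt e t y = A.lamAt e' t (transit e e' y) := by
  simp only [AsymptoticData.lamAt, symm_transit hy]

theorem phiAt_transit : A.phiAt e t y = A.phiAt e' t (transit e e' y) := by
  simp only [AsymptoticData.phiAt, symm_transit hy]

theorem analyticAt_lamAt : AnalyticAt ℝ (A.lamAt e t) y :=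
  have h := analyticIn_chart A he hy.1
  h.lam.sub (h.v.mul analyticAt_const)

theorem analyticAt_phiAt : AnalyticAt ℝ (A.phiAt e t) y :=
  have h := analyticIn_chart A he hy.1
  h.phi.sub (h.w.mul analyticAt_const)

theorem isCov1_pd_lamAt : IsCov1 (jac e e' y) (fun a => pd a (A.lamAt e t) y)
    fun a => pd a (A.lamAt e' t) (transit e e' y) :=
  isCov1_pd he he' hy (fun _ hz => lamAt_transit he he' hz)
    (analyticAt_lamAt he' he (transit_mem hy)).differentiableAt

theorem isCov1_phiC : IsCov1 (jac e e' y) (fun c => phiC A ε U e t c y)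
    fun c => phiC A ε U e' t c (transit e e' y) := by
  intro c
  have h1 := isCov1_pd he he' hy (fun _ hz => phiAt_transit (A := A) (t := t) he he' hz)
    (analyticAt_phiAt he' he (transit_mem hy)).differentiableAt c
  have h2 := isCov1_comp_phic he he' hy U t c
  simp only [phiC, Fin.sum_univ_two] at *
  linear_combination h1 + Real.exp (-ε.phic * t) * h2

theorem isConn_gammaGamma : IsConn (jac e e' y) (hes e e' y) (gammaGamma A ε U e t y)
    (gammaGamma A ε U e' t (transit e e' y)) :=
  (isConn_gammaSigma he he' hy).add_mixed (isMixed21_conformal (isContra2_sigma he he' hy)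
    (isCov2_sigma_inv he he' hy) (isCov1_pd_lamAt he he' hy))

theorem pd_pd_lamAt_transit (a b : Fin 2) : pd a (pd b (A.lamAt e t)) y
    = ∑ i, ∑ j, jac e e' y i a * jac e e' y j b * pd i (pd j (A.lamAt e' t)) (transit e e' y)
      + ∑ i, hes e e' y i a b * pd i (A.lamAt e' t) (transit e e' y) :=
  pd_pd_transit he he' hy (fun _ hz => lamAt_transit he he' hz)
    (fun _ hz => analyticAt_lamAt he' he hz) a b

theorem laplaceLam_transit :
    laplaceLam A ε U e t y = laplaceLam A ε U e' t (transit e e' y) :=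
  contract22 ((isConn_gammaSigma he he' hy).isCov2_cov (isCov1_pd_lamAt he he' hy)
    (pd_pd_lamAt_transit he he' hy)) (isContra2_sigma he he' hy)

theorem isMixed11_hessTerm : IsMixed11 (jac e e' y) (hessTerm A ε U e t y)
    (hessTerm A ε U e' t (transit e e' y)) := by
  have hX := isCov1_pd_lamAt (A := A) (t := t) he he' hy
  have hZ := (isConn_gammaGamma (A := A) (ε := ε) (U := U) (t := t) he he' hy).isCov2_cov hX
    (Y := fun a m => pd m (pd a (A.lamAt e t)) y)
    (Y' := fun a m => pd m (pd a (A.lamAt e' t)) (transit e e' y)) fun a m => by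
      have s1 := fun i => hes_symm he he' hy i m a
      simp only [pd_pd_lamAt_transit he he' hy, s1, Fin.sum_univ_two]
      ring
  have h := (isContra2_sigma (A := A) (ε := ε) (U := U) (t := t) he he' hy).raise2
    ((hX.mul hX).swap.add hZ)
  intro a i
  have := h a i
  simp only [hessTerm, add_sub_assoc]
  exact this

theorem isMixed11_phiTerm : IsMixed11 (jac e e' y) (phiTerm A ε U e t y)
    (phiTerm A ε U e' t (transit e e' y)) := by
  have hX := isCov1_phiC (A := A) (ε := ε) (U := U) (t := t) he he' hy
  have h := (isContra2_sigma (A := A) (ε := ε) (U := U) (t := t) he he' hy).raise2 (hX.mul hX).swap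
  intro a i
  have := h a i
  simp only [phiTerm, Fin.sum_univ_two] at *
  linear_combination 2 * this

end Pointwise

end Covariance

section Covariance

variable {M : Type*} [TopologicalSpace M] [ChartedSpace Plane M] [IsManifold 𝓘(ℝ, Plane) ω M]
  {A : AsymptoticData M} {ε : Exponents} {U : Fields M}
  {e e' : OpenPartialHomeomorph M Plane} {t : ℝ} {y : Plane}

theorem hasDerivAt_sum {f : Fin 2 → ℝ → ℝ} {f' : Fin 2 → ℝ} (c : Fin 2 → ℝ)
    (h : ∀ a, HasDerivAt (f a) (f' a) t) :
    HasDerivAt (fun s => ∑ a, c a * f a s) (∑ a, c a * f' a) t := by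
  simp only [Fin.sum_univ_two]
  exact ((h 0).const_mul _).add ((h 1).const_mul _)

theorem hasDerivAt_sum₂ {f : Fin 2 → Fin 2 → ℝ → ℝ} {f' : Fin 2 → Fin 2 → ℝ}
    (c : Fin 2 → Fin 2 → ℝ) (h : ∀ a b, HasDerivAt (f a b) (f' a b) t) :
    HasDerivAt (fun s => ∑ a, ∑ b, c a b * f a b s) (∑ a, ∑ b, c a b * f' a b) t := by
  simp only [Fin.sum_univ_two]
  exact (((h 0 0).const_mul _).add ((h 0 1).const_mul _)).add
    (((h 1 0).const_mul _).add ((h 1 1).const_mul _))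

variable (he : e ∈ atlas Plane M) (he' : e' ∈ atlas Plane M) (hy : y ∈ overlap e e')

section Space

variable (hd : ∀ i, DifferentiableAt ℝ (fun z => U.comp e t z i) y)
  (hd' : ∀ i, DifferentiableAt ℝ (fun z => U.comp e' t z i) (transit e e' y))
include he he' hy hd hd'

theorem isMixed22_dSigmaC : IsMixed22 (jac e e' y) (dSigmaC A ε U e t y)
    (dSigmaC A ε U e' t (transit e e' y)) :=
  (isMetricPair_sigLow A he he').isMixed22_covMixed he he' hy
    ((eventually_overlap hy).mono fun _ hz => isMixed12_sigmaC he he' hz)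
    (fun _ _ _ => (hd _).const_mul _) fun _ _ _ => (hd' _).const_mul _

theorem curvSigma_transit : curvSigma A ε U e t y = curvSigma A ε U e' t (transit e e' y) :=
  scalarCurvG_eq (jac_mul_jac he he' hy)
    ((isMetricPair_sigLow A he he').isCov2_ricci (sigLow_symm A e) he he' hy)
    (isContra2_sigma (A := A) (ε := ε) (U := U) (t := t) he he' hy) (isCov2_sigma_inv he he' hy) (isMixed12_sigmaC he he' hy)
    (isMixed22_dSigmaC he he' hy hd hd')

theorem isMixed11_sourceK : IsMixed11 (jac e e' y) (sourceK A ε U e t y)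
    (sourceK A ε U e' t (transit e e' y)) := by
  intro a i
  have h1 := isMixed11_one (J := jac e e' y)
    (curvSigma A ε U e t y - laplaceLam A ε U e t y) a i
  have h2 := isMixed11_hessTerm (A := A) (ε := ε) (U := U) (t := t) he he' hy a i
  have h3 := isMixed11_phiTerm (A := A) (ε := ε) (U := U) (t := t) he he' hy a i
  have h4 := curvSigma_transit (A := A) (ε := ε) he he' hy hd hd'
  have h5 := laplaceLam_transit (A := A) (ε := ε) (U := U) (t := t) he he' hy
  simp only [sourceK, ricciTerm, symm_transit hy, ← h4, ← h5, Fin.sum_univ_two] at *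
  linear_combination Real.exp (A.lam (e.symm y)) * (h1 - h2 - h3)

theorem pd_phiC_transit (a b : Fin 2) : pd a (phiC A ε U e t b) y
    = ∑ i, ∑ j, jac e e' y i a * jac e e' y j b * pd i (phiC A ε U e' t j) (transit e e' y)
      + ∑ i, hes e e' y i a b * phiC A ε U e' t i (transit e e' y) := by
  have hdφ : ∀ j, DifferentiableAt ℝ (phiC A ε U e' t j) (transit e e' y) := fun j =>
    (analyticAt_pd (analyticAt_phiAt he' he (transit_mem hy))).differentiableAt.add
      ((hd' _).const_mul _)
  have hdt := fun j => differentiableAt_comp_transit he he' hy (hdφ j)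
  have hJ : ∀ i a, DifferentiableAt ℝ (fun z => jac e e' z i a) y := fun i a =>
    (analyticAt_jac he he' hy i a).differentiableAt
  rw [pd_congr ((eventually_overlap hy).mono fun z hz => isCov1_phiC he he' hz b),
    pd_sum (f := fun j z => jac e e' z j b * phiC A ε U e' t j (transit e e' z))
      fun j => (hJ _ _).mul (hdt _)]
  have h : ∀ j, pd a (fun z => jac e e' z j b * phiC A ε U e' t j (transit e e' z)) y
      = hes e e' y j a b * phiC A ε U e' t j (transit e e' y) + jac e e' y j b
        * ∑ i, jac e e' y i a * pd i (phiC A ε U e' t j) (transit e e' y) := by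
    intro j
    rw [pd_mul (hJ _ _) (hdt _), pd_comp_transit he he' hy (hdφ j), hes_symm he he' hy j a b]
    rfl
  simp only [h, Fin.sum_univ_two]
  ring

theorem sourceP_transit : sourceP A ε U e t y = sourceP A ε U e' t (transit e e' y) := by
  have hX := isCov1_phiC (A := A) (ε := ε) (U := U) (t := t) he he' hy
  have h := contract22 (((isConn_gammaSigma (A := A) (ε := ε) (U := U) (t := t) he he' hy).isCov2_cov hX
    (pd_phiC_transit he he' hy hd hd')).add
    ((isCov1_pd_lamAt (A := A) (t := t) he he' hy).mul hX)) (isContra2_sigma (A := A) (ε := ε) (U := U) (t := t) he he' hy)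
  simp only [sourceP, symm_transit hy]
  congr 1
  simpa only [mul_comm (phiC A ε U _ t _ _)] using h

theorem isMixed12_covUp_sigK : IsMixed12 (jac e e' y)
    (fun c a b => covUp (A.sigLow e) (sigK A ε U e t) c a b y)
    fun c a b => covUp (A.sigLow e') (sigK A ε U e' t) c a b (transit e e' y) := by
  have key : ∀ {e : OpenPartialHomeomorph M Plane} {y : Plane}, e ∈ atlas Plane M → y ∈ e.target →
      (∀ i, DifferentiableAt ℝ (fun z => U.comp e t z i) y) →
      ∀ a b, DifferentiableAt ℝ (fun z => sigK A ε U e t z a b) y := by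
    intro e y he hy hd a b
    have h := analyticIn_chart A he hy
    simp only [sigK, sigma, Matrix.of_apply, Fin.sum_univ_two]
    exact (((h.up _ _).differentiableAt.add ((hd _).const_mul _)).mul (hd _)).add
      (((h.up _ _).differentiableAt.add ((hd _).const_mul _)).mul (hd _))
  exact (isMetricPair_sigLow A he he').isMixed12_covUp he he' hy
    ((eventually_overlap hy).mono fun _ hz => isContra2_sigK he he' hz) (key he hy.1 hd)
    (key he' (transit_mem hy).1 hd')

end Space

include he he' hy in
/-- The system has the same meaning in all charts. -/
theorem SystemAt.transit (h : SystemAt A ε U e' t (transit e e' y))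
    (hd : ∀ i, DifferentiableAt ℝ (fun z => U.comp e t z i) y)
    (hd' : ∀ i, DifferentiableAt ℝ (fun z => U.comp e' t z i) (AVTD.transit e e' y))
    (ht : ∀ i, DifferentiableAt ℝ (fun s => U.comp e s y i) t)
    (ht' : ∀ i, DifferentiableAt ℝ (fun s => U.comp e' s (AVTD.transit e e' y) i) t) :
    SystemAt A ε U e t y := by
  have hKJ := jac_mul_jac he he' hy
  have hdt : ∀ i, HasDerivAt (fun s => U.comp e s y i) (U.dt e t y i) t := fun i =>
    (ht i).hasDerivAt
  have hdt' : ∀ i, HasDerivAt (fun s => U.comp e' s (AVTD.transit e e' y) i)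
      (U.dt e' t (AVTD.transit e e' y) i) t := fun i => (ht' i).hasDerivAt
  have htr := trk_transit he he' hy (U := U) (t := t)
  have hx := symm_transit hy
  have dsig : IsContra2 (jac e e' y) (fun a b => U.dt e t y (.sig a b))
      fun i j => U.dt e' t (AVTD.transit e e' y) (.sig i j) := fun i j =>
    (hdt' _).unique ((hasDerivAt_sum₂ (fun a b => jac e e' y i a * jac e e' y j b)
      fun a b => hdt (.sig a b)).congr_of_eventuallyEq
      (Eventually.of_forall fun s => isContra2_comp_sig he he' hy U s i j))
  have dk : IsMixed11 (jac e e' y) (fun a b => U.dt e t y (.k a b))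
      fun i j => U.dt e' t (AVTD.transit e e' y) (.k i j) := fun a i =>
    (hasDerivAt_sum _ fun b => hdt (.k a b)).unique
      ((hasDerivAt_sum (fun k => jac e e' y k a) fun k => hdt' (.k k i)).congr_of_eventuallyEq
        (Eventually.of_forall fun s => isMixed11_comp_k he he' hy U s a i))
  have dsigc : IsMixed12 (jac e e' y) (fun c a b => U.dt e t y (.sigc c a b))
      fun c i j => U.dt e' t (AVTD.transit e e' y) (.sigc c i j) := fun c i j =>
    (hasDerivAt_sum₂ (fun a b => jac e e' y i a * jac e e' y j b)
      fun a b => hdt (.sigc c a b)).unique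
      ((hasDerivAt_sum (fun k => jac e e' y k c) fun k => hdt' (.sigc k i j)).congr_of_eventuallyEq
        (Eventually.of_forall fun s => isMixed12_comp_sigc he he' hy U s c i j))
  have dphic : IsCov1 (jac e e' y) (fun c => U.dt e t y (.phic c))
      fun c => U.dt e' t (AVTD.transit e e' y) (.phic c) := fun c =>
    (hdt _).unique ((hasDerivAt_sum (fun k => jac e e' y k c)
      fun k => hdt' (.phic k)).congr_of_eventuallyEq
      (Eventually.of_forall fun s => isCov1_comp_phic he he' hy U s c))
  have dp : U.dt e t y .p = U.dt e' t (AVTD.transit e e' y) .p :=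
    congrArg (fun f => deriv f t) (funext fun s => comp_p_transit he he' hy U s)
  have dphi : U.dt e t y .phi = U.dt e' t (AVTD.transit e e' y) .phi :=
    congrArg (fun f => deriv f t) (funext fun s => comp_phi_transit he he' hy U s)
  refine ⟨fun a b => ?_, fun c a b => ?_, fun a b => ?_, ?_, ?_, fun c => ?_⟩
  · refine sub_eq_zero.1 (eq_zero_of_jac₂ hKJ (Y := fun a b =>
      U.dt e t y (.sig a b) - ε.sig * U.comp e t y (.sig a b)
        - 2 * Real.exp ((ε.sig - ε.k) * t) * sigK A ε U e t y a b) (fun i j => ?_) a b)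
    have h1 := dsig i j
    have h2 := isContra2_comp_sig he he' hy U t i j
    have h3 := isContra2_sigK (A := A) (ε := ε) he he' hy (U := U) (t := t) i j
    have h4 := h.sig i j
    simp only [Fin.sum_univ_two] at *
    linear_combination h4 - h1 + ε.sig * h2 + 2 * Real.exp ((ε.sig - ε.k) * t) * h3
  · refine sub_eq_zero.1 (eq_zero_of_jac₂ hKJ (Y := fun a b =>
      U.dt e t y (.sigc c a b) - ε.sigc * U.comp e t y (.sigc c a b)
        - 2 * Real.exp ((ε.sigc - ε.k) * t) * covUp (A.sigLow e) (sigK A ε U e t) c b a y)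
        (fun i j => ?_) a b)
    have h1 := dsigc c i j
    have h2 := isMixed12_comp_sigc he he' hy U t c i j
    have h3 := isMixed12_covUp_sigK (A := A) (ε := ε) he he' hy hd hd' c j i
    have h4 := fun k => h.sigc k i j
    have h40 := h4 0
    have h41 := h4 1
    simp only [Fin.sum_univ_two] at *
    linear_combination h1 - ε.sigc * h2 - 2 * Real.exp ((ε.sigc - ε.k) * t) * h3
      + jac e e' y 0 c * h40 + jac e e' y 1 c * h41
  · refine sub_eq_zero.1 (eq_zero_of_jac hKJ (Y := fun b => U.dt e t y (.k a b)
        - ε.k * U.comp e t y (.k a b)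
        - (1 / 2) * A.v (e.symm y) * (1 : Matrix (Fin 2) (Fin 2) ℝ) a b * U.trk e t y
        - (Real.exp (-ε.k * t) * U.trk e t y * U.comp e t y (.k a b)
          + Real.exp ((ε.k - A.v (e.symm y)) * t) * sourceK A ε U e t y a b)) (fun i => ?_) b)
    have h1 := dk a i
    have h2 := isMixed11_comp_k he he' hy U t a i
    have h3 := isMixed11_sourceK (A := A) (ε := ε) he he' hy hd hd' a i
    have h5 := isMixed11_one (J := jac e e' y) (A.v (e.symm y) * U.trk e t y) a i
    have h40 := h.k 0 i
    have h41 := h.k 1 i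
    rw [hx, ← htr] at h40 h41
    simp only [Fin.sum_univ_two] at *
    linear_combination h1 - (ε.k + Real.exp (-ε.k * t) * U.trk e t y) * h2
      - Real.exp ((ε.k - A.v (e.symm y)) * t) * h3 - h5 + jac e e' y 0 a * h40 + jac e e' y 1 a * h41
  · have h4 := h.p
    rw [hx, ← htr, ← dp, ← comp_p_transit he he' hy U t, ← sourceP_transit he he' hy hd hd'] at h4
    exact h4
  · have h4 := h.phi
    rw [← dphi, ← comp_p_transit he he' hy U t, ← comp_phi_transit he he' hy U t] at h4
    exact h4
  · have h1 := dphic c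
    have h2 := isCov1_comp_phic he he' hy U t c
    have h3 : U.dx e t y c .p = ∑ k, jac e e' y k c * U.dx e' t (AVTD.transit e e' y) k .p :=
      isCov1_pd he he' hy (fun z hz => comp_p_transit he he' hz U t) (hd' .p) c
    have h40 := h.phic 0
    have h41 := h.phic 1
    simp only [Fin.sum_univ_two] at *
    linear_combination h1 - ε.phic * h2 - Real.exp ((ε.phic - ε.p) * t) * h3
      + jac e e' y 0 c * h40 + jac e e' y 1 c * h41

include he he' hy in
/-- The algebraic constraints do not depend on the chart. -/
theorem AdmissibleAt.transit (h : AdmissibleAt A ε U e' t (transit e e' y)) :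
    AdmissibleAt A ε U e t y := by
  have hKJ := jac_mul_jac he he' hy
  refine ⟨?_, fun c a b => ?_, fun a b => ?_⟩
  · have hM := jac_mul_jac_matrix he he' hy
    set J : Matrix (Fin 2) (Fin 2) ℝ := Matrix.of (jac e e' y) with hJ
    set K : Matrix (Fin 2) (Fin 2) ℝ := Matrix.of (jac e' e (AVTD.transit e e' y)) with hK
    have h1 : sigma A ε U e' t (AVTD.transit e e' y) = J * sigma A ε U e t y * J.transpose := by
      ext i j
      rw [isContra2_sigma he he' hy i j]
      simp only [hJ, Matrix.mul_apply, Matrix.transpose_apply, Matrix.of_apply, Fin.sum_univ_two]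
      ring
    have h2 : sigma A ε U e t y = K * sigma A ε U e' t (AVTD.transit e e' y) * K.conjTranspose := by
      rw [h1, Matrix.conjTranspose_eq_transpose_of_trivial, Matrix.mul_assoc, Matrix.mul_assoc,
        ← Matrix.transpose_mul, hM, Matrix.transpose_one, Matrix.mul_one, ← Matrix.mul_assoc, hM,
        Matrix.one_mul]
    rw [h2]
    refine h.posDef.mul_mul_conjTranspose_same ?_
    intro v w hvw
    have hM' : K * J = 1 := hM
    have h3 := congrArg (fun u => Matrix.vecMul u J) hvw
    simpa only [Matrix.vecMul_vecMul, hM', Matrix.vecMul_one] using h3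
  · refine sub_eq_zero.1 (eq_zero_of_jac₂ hKJ (Y := fun a b =>
      U.comp e t y (.sigc c a b) - U.comp e t y (.sigc c b a)) (fun i j => ?_) a b)
    have h1 := isMixed12_comp_sigc he he' hy U t c i j
    have h2 := isMixed12_comp_sigc he he' hy U t c j i
    have h3 := fun c => h.symm_sigc c i j
    simp only [h3, Fin.sum_univ_two] at *
    linear_combination h1 - h2
  · refine sub_eq_zero.1 (eq_zero_of_jac₂ hKJ (Y := fun a b =>
      sigK A ε U e t y a b - sigK A ε U e t y b a) (fun i j => ?_) a b)
    have h1 := isContra2_sigK (A := A) (ε := ε) he he' hy (U := U) (t := t) i j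
    have h2 := isContra2_sigK (A := A) (ε := ε) he he' hy (U := U) (t := t) j i
    have h3 := h.symm_k i j
    simp only [h3, Fin.sum_univ_two] at *
    linear_combination h2 - h1

end Covariance

/-! ### Local solutions in different charts -/

section HolBoundedClosure

variable {f g : ℝ → Plane → ℝ} {y₀ : Plane}

theorem HolBounded.congr (hf : HolBounded f y₀) {T : ℝ} {s : Set Plane} (hs : s ∈ 𝓝 y₀)
    (h : ∀ t, T < t → ∀ y ∈ s, f t y = g t y) : HolBounded g y₀ := by
  obtain ⟨r, hr, t₀, C, V, hV⟩ := hf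
  obtain ⟨ρ, hρ, hρs⟩ := exists_ball_toC_subset hs
  refine ⟨min r ρ, lt_min hr hρ, max t₀ T, C, V, fun t ht => ?_⟩
  obtain ⟨h1, h2, h3⟩ := hV t ((le_max_left _ _).trans_lt ht)
  have hsub := ball_subset_ball (x := toC y₀) (min_le_left r ρ)
  refine ⟨h1.mono hsub, fun z hz => h2 z (hsub hz), fun y hy => ?_⟩
  rw [h3 y (hsub hy),
    h t ((le_max_right _ _).trans_lt ht) y (hρs y (ball_subset_ball (min_le_right _ _) hy))]

theorem HolBounded.add (hf : HolBounded f y₀) (hg : HolBounded g y₀) :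
    HolBounded (fun t y => f t y + g t y) y₀ := by
  obtain ⟨r, hr, t₀, C, V, hV⟩ := exists_common_extension (g := fun b : Bool => cond b f g)
    (Bool.forall_bool.2 ⟨hg, hf⟩)
  refine ⟨r, hr, t₀, C + C, fun t z => V true t z + V false t z, fun t ht => ?_⟩
  obtain ⟨h1, h2, h3⟩ := hV t ht true
  obtain ⟨k1, k2, k3⟩ := hV t ht false
  refine ⟨h1.add k1, fun z hz => (norm_add_le _ _).trans (add_le_add (h2 z hz) (k2 z hz)),
    fun y hy => ?_⟩
  beta_reduce
  rw [h3 y hy, k3 y hy]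
  push_cast
  rfl

theorem HolBounded.analytic_mul {c : Plane → ℝ} (hc : AnalyticAt ℝ c y₀) (hf : HolBounded f y₀) :
    HolBounded (fun t y => c y * f t y) y₀ := by
  obtain ⟨r₁, hr₁, F, hF, hFc⟩ := exists_hol_extension hc
  obtain ⟨r₂, hr₂, hB⟩ := Metric.mem_nhds_iff.1
    ((hF.differentiableAt (ball_mem_nhds _ hr₁)).continuousAt.norm.eventually_lt
      continuousAt_const (lt_add_one _))
  obtain ⟨r, hr, t₀, C, V, hV⟩ := hf
  set ρ := min r (min r₁ r₂)
  have hs0 : ball (toC y₀) ρ ⊆ ball (toC y₀) r := ball_subset_ball (min_le_left _ _)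
  have hs1 : ball (toC y₀) ρ ⊆ ball (toC y₀) r₁ :=
    ball_subset_ball ((min_le_right _ _).trans (min_le_left _ _))
  have hs2 : ball (toC y₀) ρ ⊆ ball (toC y₀) r₂ :=
    ball_subset_ball ((min_le_right _ _).trans (min_le_right _ _))
  refine ⟨ρ, lt_min hr (lt_min hr₁ hr₂), t₀, (‖F (toC y₀)‖ + 1) * C, fun t z => F z * V t z,
    fun t ht => ?_⟩
  obtain ⟨h1, h2, h3⟩ := hV t ht
  refine ⟨(hF.mono hs1).mul (h1.mono hs0), fun z hz => ?_, fun y hy => ?_⟩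
  · rw [norm_mul]
    exact mul_le_mul (le_of_lt (hB (hs2 hz))) (h2 z (hs0 hz)) (norm_nonneg _) (by positivity)
  · beta_reduce
    rw [hFc y (hs1 hy), h3 y (hs0 hy)]
    push_cast
    rfl

theorem HolZero.holBounded (hf : HolZero f y₀) : HolBounded f y₀ := by
  obtain ⟨r, hr, t₀, V, hV, hlim⟩ := hf
  obtain ⟨t₁, ht₁⟩ := eventually_atTop.1 (Metric.tendstoUniformlyOn_iff.1 hlim 1 one_pos)
  refine ⟨r, hr, max t₀ t₁, 1, V, fun t ht => ?_⟩
  obtain ⟨h1, h2⟩ := hV t ((le_max_left _ _).trans_lt ht)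
  refine ⟨h1, fun z hz => ?_, h2⟩
  have := ht₁ t ((le_max_right _ _).trans ht.le) z hz
  rw [dist_zero_left] at this
  exact this.le

end HolBoundedClosure

section LocalSolutions

variable {M : Type*} [TopologicalSpace M] [ChartedSpace Plane M] [IsManifold 𝓘(ℝ, Plane) ω M]
  {A : AsymptoticData M} {ε : Exponents} {e e' : OpenPartialHomeomorph M Plane} {y : Plane}
  {U U' : Fields M} {t₀ t₀' t : ℝ}

theorem HolBounded.comp_transit (he : e ∈ atlas Plane M) (he' : e' ∈ atlas Plane M)
    (hy : y ∈ overlap e e') {f : ℝ → Plane → ℝ} (hf : HolBounded f (transit e e' y)) :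
    HolBounded (fun t z => f t (transit e e' z)) y := by
  obtain ⟨r, hr, F, hF, hFe⟩ := exists_hol_extension_family fun i =>
    analyticAt_transit_apply he he' hy i
  obtain ⟨r', hr', t₀, C, V, hV⟩ := hf
  have hΦ : ∀ z, toC z ∈ ball (toC y) r → (fun i => F i (toC z)) = toC (transit e e' z) :=
    fun z hz => funext fun i => hFe i z hz
  have hd : DifferentiableOn ℂ (fun z i => F i z) (ball (toC y) r) := differentiableOn_pi.2 hF
  have hc : ContinuousAt (fun z i => F i z) (toC y) :=
    (hd.differentiableAt (ball_mem_nhds _ hr)).continuousAt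
  obtain ⟨s, hs, hsub⟩ := Metric.mem_nhds_iff.1 (hc.preimage_mem_nhds (t := ball _ r')
    (by rw [hΦ y (mem_ball_self hr)]; exact ball_mem_nhds _ hr'))
  have hs1 : ball (toC y) (min r s) ⊆ ball (toC y) r := ball_subset_ball (min_le_left _ _)
  have hs2 : ball (toC y) (min r s) ⊆ ball (toC y) s := ball_subset_ball (min_le_right _ _)
  refine ⟨min r s, lt_min hr hs, t₀, C, fun t z => V t fun i => F i z, fun t ht => ?_⟩
  obtain ⟨h1, h2, h3⟩ := hV t ht
  refine ⟨h1.comp (hd.mono hs1) fun z hz => hsub (hs2 hz), fun z hz => h2 _ (hsub (hs2 hz)),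
    fun z hz => ?_⟩
  have hz' := hsub (hs2 hz)
  rw [mem_preimage, hΦ z (hs1 hz)] at hz'
  beta_reduce
  rw [hΦ z (hs1 hz), h3 _ hz']

/-- The components in one chart are combinations, with analytic coefficients, of the components in
another one: a property stable under such combinations passes from one chart to another. -/
theorem comp_transit_induction (he : e ∈ atlas Plane M) (he' : e' ∈ atlas Plane M)
    (hy : y ∈ overlap e e') {P : (ℝ → Plane → ℝ) → Prop}
    (hadd : ∀ f g, P f → P g → P fun t z => f t z + g t z)
    (hmul : ∀ (c : Plane → ℝ) f, AnalyticAt ℝ c y → P f → P fun t z => c z * f t z)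
    (hcongr : ∀ f g, P f → (∀ t, ∀ z ∈ overlap e e', f t z = g t z) → P g)
    (h : ∀ i, P fun t z => U.comp e' t (transit e e' z) i) (i : Idx) :
    P fun t z => U.comp e t z i := by
  have hJ := analyticAt_jac he he' hy
  have hK : ∀ i a, AnalyticAt ℝ (fun z => jac e' e (transit e e' z) i a) y := fun i a =>
    (analyticAt_jac he' he (transit_mem hy) i a).comp (analyticAt_transit he he' hy)
  have hsum : ∀ f : Fin 2 → ℝ → Plane → ℝ, (∀ k, P (f k)) → P fun t z => ∑ k, f k t z := by
    intro f hf
    simp only [Fin.sum_univ_two]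
    exact hadd _ _ (hf 0) (hf 1)
  cases i with
  | sig a b =>
    refine hcongr _ _ (hsum _ fun k => hsum _ fun l =>
      hmul _ _ ((hK a k).mul (hK b l)) (h (.sig k l))) fun t z hz => ?_
    exact ((comp_transit he he' hz U t).1 a b).symm
  | phi => exact hcongr _ _ (h .phi) fun t z hz => (comp_transit he he' hz U t).2.1.symm
  | k a b =>
    refine hcongr _ _ (hsum _ fun k => hsum _ fun l =>
      hmul _ _ ((hJ k a).mul (hK b l)) (h (.k k l))) fun t z hz => ?_
    exact ((comp_transit he he' hz U t).2.2.1 a b).symm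
  | p => exact hcongr _ _ (h .p) fun t z hz => (comp_transit he he' hz U t).2.2.2.1.symm
  | sigc c a b =>
    refine hcongr _ _ (hsum _ fun m => hsum _ fun k => hsum _ fun l =>
      hmul _ _ (((hJ m c).mul (hK a k)).mul (hK b l)) (h (.sigc m k l))) fun t z hz => ?_
    exact ((comp_transit he he' hz U t).2.2.2.2.1 c a b).symm
  | phic c =>
    refine hcongr _ _ (hsum _ fun k => hmul _ _ (hJ k c) (h (.phic k))) fun t z hz => ?_
    exact ((comp_transit he he' hz U t).2.2.2.2.2 c).symm

theorem IsSolOn.transit (he : e ∈ atlas Plane M) (he' : e' ∈ atlas Plane M) {W W' : Set Plane}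
    (h : IsSolOn A ε U e' W' t₀) (hW : ∀ y ∈ W, y ∈ overlap e e' ∧ transit e e' y ∈ W') :
    IsSolOn A ε U e W t₀ := by
  have han : ∀ t, t₀ < t → ∀ y ∈ W, ∀ i,
      AnalyticAt ℝ (fun q : ℝ × Plane => U.comp e q.1 q.2 i) (t, y) := by
    intro t ht y hy
    obtain ⟨hyo, hyW⟩ := hW y hy
    refine comp_transit_induction he he' hyo
      (P := fun f => AnalyticAt ℝ (fun q : ℝ × Plane => f q.1 q.2) (t, y))
      (fun f g hf hg => hf.add hg)
      (fun c f hc hf => (AnalyticAt.comp (f := Prod.snd) hc analyticAt_snd).mul hf)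
      (fun f g hf hfg => hf.congr ?_) fun i => ?_
    · filter_upwards [continuousAt_snd.eventually ((isOpen_overlap e e').mem_nhds hyo)] with q hq
      exact hfg q.1 q.2 hq
    · exact AnalyticAt.comp (g := fun q : ℝ × Plane => U.comp e' q.1 q.2 i)
        (f := fun q : ℝ × Plane => (q.1, AVTD.transit e e' q.2)) (h.analytic i _ ⟨ht, hyW⟩)
        (analyticAt_fst.prod (AnalyticAt.comp (g := AVTD.transit e e') (f := Prod.snd)
          (analyticAt_transit he he' hyo) analyticAt_snd))
  refine ⟨fun i q hq => han _ hq.1 _ hq.2 i, fun y hy t ht =>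
    (h.admissible _ (hW y hy).2 t ht).transit he he' (hW y hy).1, fun y hy t ht => ?_⟩
  obtain ⟨hyo, hyW⟩ := hW y hy
  exact (h.system _ hyW t ht).transit he he' hyo
    (fun i => (AnalyticAt.comp (f := fun z : Plane => (t, z)) (han t ht y hy i)
      (analyticAt_const.prod analyticAt_id)).differentiableAt)
    (fun i => (h.analyticAt_space ht hyW i).differentiableAt)
    (fun i => (AnalyticAt.comp (f := fun s : ℝ => (s, y)) (han t ht y hy i)
      (analyticAt_id.prod analyticAt_const)).differentiableAt)
    fun i => (h.analyticAt_time ht hyW i).differentiableAt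

theorem IsSolOn.mono {W W' : Set Plane} (h : IsSolOn A ε U e W t₀) (hW : W' ⊆ W)
    (ht : t₀ ≤ t₀') : IsSolOn A ε U e W' t₀' :=
  ⟨fun i q hq => h.analytic i q ⟨ht.trans_lt hq.1, hW hq.2⟩,
    fun y hy t h1 => h.admissible y (hW hy) t (ht.trans_lt h1),
    fun y hy t h1 => h.system y (hW hy) t (ht.trans_lt h1)⟩

variable (A ε U) in
/-- `U` is an analytic solution on the open set `O` for `t > t₀`, in all charts, and is bounded for
large `t` near each point of `O`. -/
structure IsLocalSol (O : Set M) (t₀ : ℝ) : Prop where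
  isOpen : IsOpen O
  isSolOn : ∀ e ∈ atlas Plane M, IsSolOn A ε U e (e.target ∩ e.symm ⁻¹' O) t₀
  bounded : ∀ e ∈ atlas Plane M, ∀ y ∈ e.target, e.symm y ∈ O → ∀ i,
    HolBounded (fun t z => U.comp e t z i) y

theorem exists_isLocalSol (A : AsymptoticData M) (hε : ε.Positive) (hv : ∀ x, ε.k < A.v x)
    (hk : max (max ε.sig ε.sigc) ε.p < ε.k) (hp : max ε.phi ε.phic < ε.p) (x : M) :
    ∃ U O t₀, x ∈ O ∧ IsLocalSol A ε U O t₀ := by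
  have he' := chart_mem_atlas Plane x
  set e' := chartAt Plane x
  have hx : x ∈ e'.source := mem_chart_source Plane x
  obtain ⟨U, W, t₀, hW, hxW, hWe, hU, hz⟩ := exists_isSolOn A hε hv hk hp he' (e'.map_source hx)
  have hov : ∀ {e : OpenPartialHomeomorph M Plane} {y}, y ∈ e.target →
      e.symm y ∈ e'.source ∩ e' ⁻¹' W → y ∈ overlap e e' ∧ transit e e' y ∈ W :=
    fun hy h => ⟨⟨hy, h.1⟩, h.2⟩
  refine ⟨U, e'.source ∩ e' ⁻¹' W, t₀, ⟨hx, hxW⟩, e'.isOpen_inter_preimage hW, fun e he =>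
    hU.transit he he' fun y hy => hov hy.1 hy.2, fun e he y hy hyO => ?_⟩
  obtain ⟨h1, h2⟩ := hov hy hyO
  exact comp_transit_induction he he' h1 (P := fun f => HolBounded f y)
    (fun f g hf hg => hf.add hg) (fun c f hc hf => hf.analytic_mul hc)
    (fun f g hf hfg => hf.congr (T := 0) ((isOpen_overlap e e').mem_nhds h1) fun t _ z hz =>
      hfg t z hz)
    fun i => (hz _ h2 i).holBounded.comp_transit he he' h1

theorem IsLocalSol.comp_eq {O O' : Set M} (h : IsLocalSol A ε U O t₀)
    (h' : IsLocalSol A ε U' O' t₀') (hε : ε.Positive) (hv : ∀ x, ε.k < A.v x)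
    (hk : max (max ε.sig ε.sigc) ε.p < ε.k) (hp : max ε.phi ε.phic < ε.p)
    (he : e ∈ atlas Plane M) (hy : y ∈ e.target) (hO : e.symm y ∈ O) (hO' : e.symm y ∈ O')
    (ht : t₀ < t) (ht' : t₀' < t) : U.comp e t y = U'.comp e t y :=
  IsSolOn.comp_eq (W := e.target ∩ e.symm ⁻¹' (O ∩ O')) (t₀ := max t₀ t₀')
    ((h.isSolOn e he).mono (fun _ hz => ⟨hz.1, hz.2.1⟩) (le_max_left _ _))
    ((h'.isSolOn e he).mono (fun _ hz => ⟨hz.1, hz.2.2⟩) (le_max_right _ _)) hε hv hk hp he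
    (e.isOpen_inter_preimage_symm (h.isOpen.inter h'.isOpen)) inter_subset_left ⟨hy, hO, hO'⟩
    (h.bounded e he y hy hO) (h'.bounded e he y hy hO') (max_lt ht ht')

/-- Bounded local solutions tend to zero, since the local solutions of the existence theorem do. -/
theorem IsLocalSol.holZero {O : Set M} (h : IsLocalSol A ε U O t₀) (hε : ε.Positive)
    (hv : ∀ x, ε.k < A.v x) (hk : max (max ε.sig ε.sigc) ε.p < ε.k) (hp : max ε.phi ε.phic < ε.p)
    (he : e ∈ atlas Plane M) (hy : y ∈ e.target) (hO : e.symm y ∈ O) (i : Idx) :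
    HolZero (fun t z => U.comp e t z i) y := by
  obtain ⟨U', W, t₁, hW, hyW, hWe, hU', hz⟩ := exists_isSolOn A hε hv hk hp he hy
  obtain ⟨r, hr, t₂, V, hV, hlim⟩ := hz y hyW i
  have hW' : IsOpen (W ∩ (e.target ∩ e.symm ⁻¹' O)) :=
    hW.inter (e.isOpen_inter_preimage_symm h.isOpen)
  obtain ⟨ρ, hρ, hρW⟩ := exists_ball_toC_subset (hW'.mem_nhds ⟨hyW, hy, hO⟩)
  have hs := ball_subset_ball (x := toC y) (min_le_left r ρ)
  refine ⟨min r ρ, lt_min hr hρ, max t₂ (max t₀ t₁), V, fun t ht => ?_, hlim.mono hs⟩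
  obtain ⟨h1, h2⟩ := hV t ((le_max_left _ _).trans_lt ht)
  refine ⟨h1.mono hs, fun z hz' => ?_⟩
  have hzW := hρW z (ball_subset_ball (min_le_right _ _) hz')
  rw [h2 z (hs hz')]
  beta_reduce
  rw [IsSolOn.comp_eq (hU'.mono inter_subset_left (le_max_right t₀ t₁))
    ((h.isSolOn e he).mono inter_subset_right (le_max_left t₀ t₁)) hε hv hk hp he hW'
    (inter_subset_left.trans hWe) hzW (fun j => (hz z hzW.1 j).holBounded)
    (h.bounded e he z hzW.2.1 hzW.2.2) ((le_max_right _ _).trans_lt ht)]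

end LocalSolutions

/-! ### Gluing local solutions -/

section Gluing

variable {M : Type*} [TopologicalSpace M] [ChartedSpace Plane M] [IsManifold 𝓘(ℝ, Plane) ω M]
  {A : AsymptoticData M} {ε : Exponents} {T : M → ℝ} {U U' : Fields M}

theorem boundedAnalytic_of_holBounded
    (h : ∀ e ∈ atlas Plane M, ∀ y ∈ e.target, ∀ i, HolBounded (fun t z => U.comp e t z i) y) :
    BoundedAnalytic U := by
  intro e he y₀ hy
  obtain ⟨r, hr, t₀, C, V, hV⟩ := exists_common_extension (h e he y₀ hy)
  exact ⟨r, t₀, C, fun t z i => V i t z, hr, fun t ht i => ⟨(hV t ht i).1, fun y _ =>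
    (hV t ht i).2.2 y⟩, fun t ht i => (hV t ht i).2.1⟩

theorem tendsToZero_of_holZero
    (h : ∀ e ∈ atlas Plane M, ∀ y ∈ e.target, ∀ i, HolZero (fun t z => U.comp e t z i) y) :
    TendsToZero U := by
  intro e he y₀ hy
  choose r hr t₀ V hV hlim using h e he y₀ hy
  obtain ⟨s, hs, hsr⟩ := exists_pos_forall_le hr
  obtain ⟨B, hB⟩ := (Set.finite_range t₀).bddAbove
  refine ⟨s, B, fun t z i => V i t z, hs, fun t ht i => ?_,
    fun i => (hlim i).mono (ball_subset_ball (hsr i))⟩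
  obtain ⟨h1, h2⟩ := hV i t ((hB ⟨i, rfl⟩).trans_lt ht)
  exact ⟨h1.mono (ball_subset_ball (hsr i)), fun y _ hy' => h2 y (ball_subset_ball (hsr i) hy')⟩

theorem IsSolution.isLocalSol (h : IsSolution A ε T U) (hb : BoundedAnalytic U)
    (hT : Continuous T) (s : ℝ) : IsLocalSol A ε U {x | T x < s} s := by
  refine ⟨isOpen_lt hT continuous_const, fun e he => ⟨fun i q hq =>
    h.analytic e he i q ⟨hq.2.1, lt_trans hq.2.2 hq.1⟩, fun y hy t ht =>
    h.admissible e he y hy.1 t (lt_trans hy.2 ht), fun y hy t ht =>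
    h.system e he y hy.1 t (lt_trans hy.2 ht)⟩, fun e he y hy _ i => ?_⟩
  obtain ⟨r, t₀, C, V, hr, hV, hC⟩ := hb e he y hy
  obtain ⟨ρ, hρ, hρe⟩ := exists_ball_toC_subset (e.open_target.mem_nhds hy)
  have hs := ball_subset_ball (x := toC y) (min_le_left r ρ)
  exact ⟨min r ρ, lt_min hr hρ, t₀, C, fun t z => V t z i, fun t ht =>
    ⟨(hV t ht i).1.mono hs, fun z hz => hC t ht i z (hs hz), fun z hz =>
      (hV t ht i).2 z (hρe z (ball_subset_ball (min_le_right _ _) hz)) (hs hz)⟩⟩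

/-- A field which coincides with local solutions near each point is a solution. -/
theorem isSolution_of_local
    (h : ∀ e ∈ atlas Plane M, ∀ y ∈ e.target, ∀ t, T (e.symm y) < t → ∃ U' O t₀,
      IsLocalSol A ε U' O t₀ ∧ e.symm y ∈ O ∧ t₀ < t ∧
      ∀ᶠ q in 𝓝 (t, y), U.comp e q.1 q.2 = U'.comp e q.1 q.2) :
    IsSolution A ε T U := by
  refine ⟨?_, ?_, ?_⟩
  · rintro e he i ⟨t, y⟩ ⟨hy, ht⟩
    obtain ⟨U', O, t₀, hU', hyO, ht₀, heq⟩ := h e he y hy t ht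
    exact ((hU'.isSolOn e he).analytic i (t, y) ⟨ht₀, hy, hyO⟩).congr
      (heq.mono fun q hq => (congrFun hq i).symm)
  · intro e he y hy t ht
    obtain ⟨U', O, t₀, hU', hyO, ht₀, heq⟩ := h e he y hy t ht
    have h0 : U.comp e t y = U'.comp e t y := heq.self_of_nhds
    have hadm := (hU'.isSolOn e he).admissible y ⟨hy, hyO⟩ t ht₀
    have hs : sigma A ε U e t y = sigma A ε U' e t y := by simp only [sigma, h0]
    have hK : ∀ a b, sigK A ε U e t y a b = sigK A ε U' e t y a b := fun a b => by
      simp only [sigK, hs, h0]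
    exact ⟨hs ▸ hadm.posDef, by simpa only [h0] using hadm.symm_sigc,
      by simpa only [hK] using hadm.symm_k⟩
  · intro e he y hy t ht
    obtain ⟨U', O, t₀, hU', hyO, ht₀, heq⟩ := h e he y hy t ht
    have hsol := hU'.isSolOn e he
    have hA := analyticIn_chart A he hy
    have h0 : U.comp e t y = U'.comp e t y := heq.self_of_nhds
    have hsp : ∀ i, (fun z => U'.comp e t z i) =ᶠ[𝓝 y] fun z => U.comp e t z i := fun i =>
      ((Continuous.prodMk_right t).continuousAt.eventually heq).mono
        fun z hz => (congrFun hz i).symm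
    have htm : ∀ i, (fun s => U.comp e s y i) =ᶠ[𝓝 t] fun s => U'.comp e s y i := fun i =>
      ((Continuous.prodMk_left y).continuousAt.eventually heq).mono fun z hz => congrFun hz i
    have hd := fun i => (hsol.analyticAt_space ht₀ ⟨hy, hyO⟩ i).differentiableAt
    have hdt : U.dt e t y = U'.dt e t y := funext fun i => (htm i).deriv_eq
    have hdx : U.dx e t y = U'.dx e t y := funext fun c => funext fun i => (pd_congr (hsp i)).symm
    rw [hA.systemAt_iff fun i => (hd i).congr_of_eventuallyEq (hsp i).symm, h0, hdt, hdx]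
    exact (hA.systemAt_iff hd).1 (hsol.system y ⟨hy, hyO⟩ t ht₀)

/-- A function which dominates, at each point, the starting time of one of the local solutions
there, and which is constant on compact surfaces. -/
theorem exists_startingTime [T2Space M] [SecondCountableTopology M] {O : M → Set M} {s : M → ℝ}
    (hO : ∀ x, IsOpen (O x)) (hx : ∀ x, x ∈ O x) :
    ∃ T : M → ℝ, Continuous T ∧ (CompactSpace M → ∀ x y, T x = T y) ∧
      ∀ x, ∃ j, x ∈ O j ∧ s j ≤ T x := by
  have : LocallyCompactSpace M := ChartedSpace.locallyCompactSpace Plane M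
  by_cases hc : CompactSpace M
  · obtain ⟨F, hF⟩ := isCompact_univ.elim_finite_subcover O hO
      fun x _ => mem_iUnion.2 ⟨x, hx x⟩
    obtain ⟨B, hB⟩ := (F.finite_toSet.image s).bddAbove
    refine ⟨fun _ => B, continuous_const, fun _ _ _ => rfl, fun x => ?_⟩
    obtain ⟨j, hj, hxj⟩ := mem_iUnion₂.1 (hF (mem_univ x))
    exact ⟨j, hxj, hB ⟨j, hj, rfl⟩⟩
  · obtain ⟨T, hT⟩ := exists_continuous_forall_mem_convex_of_local_const
      (t := fun x => {r | ∃ j, x ∈ O j ∧ s j ≤ r})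
      (fun x => Set.OrdConnected.convex <| IsUpperSet.ordConnected <| by
        rintro a b hab ⟨j, h1, h2⟩
        exact ⟨j, h1, h2.trans hab⟩)
      fun x => ⟨s x, mem_of_superset ((hO x).mem_nhds (hx x)) fun z hz => ⟨x, hz, le_rfl⟩⟩
    exact ⟨T, T.continuous, fun h => absurd h hc, hT⟩

end Gluing

end AVTD

open Filter Topology Set in
theorem proposition1 {M : Type*} [TopologicalSpace M] [T2Space M] [SecondCountableTopology M]
    [ChartedSpace AVTD.Plane M] [IsManifold 𝓘(ℝ, AVTD.Plane) ω M]
    (A : AVTD.AsymptoticData M) (ε : AVTD.Exponents) (hε : ε.Positive)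
    (hv : ∀ x, ε.k < A.v x)
    (hk : max (max ε.sig ε.sigc) ε.p < ε.k)
    (hp : max ε.phi ε.phic < ε.p) :
    ∃ (T : M → ℝ) (U : AVTD.Fields M),
      Continuous T ∧ (CompactSpace M → ∀ x y, T x = T y) ∧
      AVTD.IsSolution A ε T U ∧ AVTD.BoundedAnalytic U ∧
      (∀ (T' : M → ℝ) (U' : AVTD.Fields M), Continuous T' →
        AVTD.IsSolution A ε T' U' → AVTD.BoundedAnalytic U' →
        ∀ t x, T x < t → T' x < t → U'.AgreeAt U t x) ∧
      AVTD.TendsToZero U := by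
  open AVTD in
  choose V O s hxO hV using exists_isLocalSol (M := M) A hε hv hk hp
  obtain ⟨T, hT, hTc, hTs⟩ := exists_startingTime (s := s) (fun x => (hV x).isOpen) hxO
  choose c hcO hcs using hTs
  let U : Fields M :=
    { sig := fun t x => (V (c x)).sig t x
      phi := fun t x => (V (c x)).phi t x
      k := fun t x => (V (c x)).k t x
      p := fun t x => (V (c x)).p t x
      sigc := fun t x => (V (c x)).sigc t x
      phic := fun t x => (V (c x)).phic t x }
  have hUV : ∀ (e : OpenPartialHomeomorph M Plane) t y,
      U.comp e t y = (V (c (e.symm y))).comp e t y := by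
    intro e t y
    funext i
    cases i <;> rfl
  -- By uniqueness, `U` coincides with every local solution where both are defined.
  have hU : ∀ e ∈ atlas Plane M, ∀ y ∈ e.target, ∀ j, e.symm y ∈ O j → ∀ t, T (e.symm y) < t →
      s j < t → U.comp e t y = (V j).comp e t y := by
    intro e he y hy j hj t ht hjt
    rw [hUV]
    exact (hV _).comp_eq (hV j) hε hv hk hp he hy (hcO _) hj ((hcs _).trans_lt ht) hjt
  have hcont : ∀ {e : OpenPartialHomeomorph M Plane} {y}, y ∈ e.target →
      ContinuousAt (fun z => T (e.symm z)) y := fun {e y} hy =>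
    hT.continuousAt.comp (e.continuousAt_symm hy)
  have hsol : IsSolution A ε T U := by
    refine isSolution_of_local fun e he y hy t ht => ⟨_, _, _, hV (c (e.symm y)), hcO _,
      (hcs _).trans_lt ht, ?_⟩
    have h1 : ∀ᶠ q : ℝ × Plane in 𝓝 (t, y), q.2 ∈ e.target ∩ e.symm ⁻¹' O (c (e.symm y)) :=
      continuousAt_snd.eventually ((e.isOpen_inter_preimage_symm (hV _).isOpen).mem_nhds
        ⟨hy, hcO _⟩)
    have h2 : ∀ᶠ q : ℝ × Plane in 𝓝 (t, y), T (e.symm q.2) < q.1 :=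
      (ContinuousAt.comp (f := Prod.snd) (x := (t, y)) (hcont hy)
        continuousAt_snd).eventually_lt continuousAt_fst ht
    have h3 : ∀ᶠ q : ℝ × Plane in 𝓝 (t, y), s (c (e.symm y)) < q.1 :=
      continuousAt_fst.eventually (lt_mem_nhds ((hcs _).trans_lt ht))
    filter_upwards [h1, h2, h3] with q hq1 hq2 hq3
    exact hU e he q.2 hq1.1 _ hq1.2 q.1 hq2 hq3
  have hbdd : BoundedAnalytic U := by
    refine boundedAnalytic_of_holBounded fun e he y hy i => ?_
    have h1 : ∀ᶠ z in 𝓝 y, T (e.symm z) < T (e.symm y) + 1 :=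
      (hcont hy).eventually (gt_mem_nhds (lt_add_one _))
    have h2 := (e.isOpen_inter_preimage_symm (hV (c (e.symm y))).isOpen).mem_nhds ⟨hy, hcO _⟩
    exact ((hV (c (e.symm y))).bounded e he y hy (hcO _) i).congr (inter_mem h1 h2)
      (T := T (e.symm y) + 1) fun t ht z hz => (congrFun (hU e he z hz.2.1 _ hz.2.2 t
        (lt_trans hz.1 ht) ((hcs _).trans_lt ((lt_add_one _).trans ht))) i).symm
  have hloc := hsol.isLocalSol hbdd hT
  refine ⟨T, U, hT, hTc, hsol, hbdd, fun T' U' hT' hU' hb' t x hx hx' => ?_,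
    tendsToZero_of_holZero fun e he y hy => (hloc (T (e.symm y) + 1)).holZero hε hv hk hp he hy
      (mem_ofPred.2 (lt_add_one _))⟩
  obtain ⟨r, hr, hrt⟩ := exists_between (max_lt hx hx')
  have hsrc := mem_chart_source Plane x
  have he := chart_mem_atlas Plane x
  have hx0 := (chartAt Plane x).left_inv hsrc
  rw [← hx0] at hr ⊢
  exact agreeAt_of_comp_eq he ((chartAt Plane x).map_source hsrc) fun i => congrFun
    ((hU'.isLocalSol hb' hT' r).comp_eq (hloc r) hε hv hk hp he
      ((chartAt Plane x).map_source hsrc) ((le_max_right _ _).trans_lt hr)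
      ((le_max_left _ _).trans_lt hr) hrt hrt) i
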